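/- Let $E$ be a complex vector space of dimension $n$ with a non-degenerate symmetric bilinear form $B$, put $\ell=[n/2]$, and let $\bar a=(a_1,\dots,a_t)$ be a composition (all $a_i\ge 1$) of an integer $r$ with $1\le r\le \ell$. Let $\mathfrak p=\mathfrak p_n^{+1}(\bar a)\subset\mathfrak{so}(E)\simeq\mathfrak{so}_n$ be the parabolic subalgebra stabilising a flag $0=V_0\subset V_1\subset\dots\subset V_t$ of isotropic subspaces of $E$ with $\dim V_i=a_1+\dots+a_i$, and let $P\subset SO(E)$ be the stabiliser of this flag in $SO(E)$, a connected algebraic group with Lie algebra $\mathfrak p$ and centre $Z$. For $\gamma\in\mathfrak p^*$ let $P_\gamma\subset P$ and $\mathfrak p_\gamma=\{x\in\mathfrak p:\gamma([x,\mathfrak p])=0\}$ be its stabilisers for the coadjoint actions. The form $\gamma$ is of reductive type if $P_\gamma/Z$ is a reductive subgroup of $GL(\mathfrak p)$, and of nilpotent type if $\gamma(\mathfrak p_\gamma)=0$. The Lie algebra $\mathfrak p$ is strongly quasi-reductive if it has a form of reductive type and its centre consists of semisimple elements. For a Lie algebra $\mathfrak m$, we write $M_*(\mathfrak p)=\mathfrak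 m$ if $\mathfrak p$ is strongly quasi-reductive, there is a $\gamma\in\mathfrak p^*$ of both reductive and nilpotent type (its stabiliser $P_\gamma$ is called a maximal reductive stabiliser), and $\mathfrak p_\gamma\cong\mathfrak m$ as Lie algebras for every such $\gamma$. Put $\bar a'=(a_1,\dots,a_{t-1})$ if $r$ is odd and equal to $n/2$, and $\bar a'=\bar a$ otherwise. We say that $\bar a'$ has property $(\ast)$ if no two consecutive terms of its sequence of partial sums $a_1,\ a_1+a_2,\ \dots$ are both odd. For $0\le s\le t$ put $$\mathfrak r_s(\bar a)=\bigoplus_{1\le i\le s,\ a_i\text{ even}}\mathfrak{sp}_{a_i}\ \oplus\bigoplus_{1\le i\le s,\ a_i\text{ odd}}\mathfrak{sp}_{a_i-1},$$ with the conventions $\mathfrak r_0(\bar a)=0$, $\mathfrak{sp}_0=0$, $\mathfrak{so}_0=0$ (and $\mathfrak{so}_1=0$). **Theorem.** Suppose that $\bar a'$ has property $(\ast)$. Then: 1. if $r$ is even, $M_*(\mathfrak p)=\mathfrak r_t(\bar a)\oplus\mathfrak{so}_{n-2r}$; 2. if $r$ is odd and $r<n/2$, $M_*(\mathfrak p)=\mathfrak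 r_{t-1}(\bar a)\oplus\mathfrak{sp}_{a_t-1}\oplus\mathfrak{so}_{n-2r-1}$; 3. if $r=n/2$ is odd and $a_t=1$, $M_*(\mathfrak p)=\mathfrak r_{t-1}(\bar a)\oplus\mathbb C$, where $\mathbb C$ is the one-dimensional Lie algebra; 4. if $r=n/2$ is odd and $a_t>1$ is odd, $M_*(\mathfrak p)=\mathfrak r_{t-1}(\bar a)\oplus\mathfrak{sp}_{a_t-3}$; 5. if $r=n/2$ is odd and $a_t$ is even, $M_*(\mathfrak p)=\mathfrak r_{t-2}(\bar a)\oplus\mathfrak{sp}_{a_{t-1}-1}\oplus\mathfrak{sp}_{a_t-2}$. -/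

import Mathlib

attribute [local instance 100] LieRing.ofAssociativeRing

namespace SoParabolic

section Compositions

variable {r : ℕ}

/-- The `i`-th part `a_i` of a composition `(a_1, …, a_t)`, numbered from `1`, with the
convention `a_0 = 0` (and the value `0` beyond `t`). -/
def part (a : Composition r) : ℕ → ℕ
  | 0 => 0
  | i + 1 => a.blocks.getD i 0

/-- The number of parts of the truncated composition `a'`: the last part of `a` is dropped when `r`
is odd and equal to `n / 2`, and `a' = a` otherwise. -/
def truncLength (n : ℕ) (a : Composition r) : ℕ :=
  if Odd r ∧ 2 * r = n then a.length - 1 else a.length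

/-- Parity condition on `a'`: it has no part `a_{i+1}` that is even and is preceded by an odd
partial sum `a_1 + ⋯ + a_i`; equivalently, no two consecutive partial sums of `a'` are odd. -/
def HasStar (n : ℕ) (a : Composition r) : Prop :=
  ∀ i : ℕ, i + 1 ≤ truncLength n a → ¬ (Odd (a.sizeUpTo i) ∧ Even (part a (i + 1)))

/-- `sp_m`, for `m` even: `m × m` matrices in block form. -/
abbrev spAlg (m : ℕ) := LieAlgebra.Symplectic.sp (Fin (m / 2)) ℂ

/-- `so_m`: skew-symmetric `m × m` matrices. -/
abbrev soAlg (m : ℕ) := LieAlgebra.Orthogonal.so (Fin m) ℂ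

/-- The Lie algebra `r_s(a)` (used for `s` with `a_1 + ⋯ + a_s` even): each even part `a_i` with
`i ≤ s` contributes `sp_{a_i}` and each odd one contributes `sp_{a_i - 1}`, once. -/
abbrev rAlg (a : Composition r) (s : ℕ) :=
  DirectSum (Fin s) fun i => spAlg (2 * (part a (i + 1) / 2))

end Compositions

section Coadjoint

variable {L : Type*} [LieRing L] [LieAlgebra ℂ L]

/-- The stabiliser `L_γ` of a linear form under the coadjoint action of the Lie algebra `L`. -/
def coadjointStabilizer (γ : Module.Dual ℂ L) : LieSubalgebra ℂ L where
  carrier := {x | ∀ y : L, γ ⁅x, y⁆ = 0}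
  zero_mem' := by simp
  add_mem' := by
    intro x y hx hy z
    simp [hx z, hy z]
  smul_mem' := by
    intro c x hx y
    simp [hx y]
  lie_mem' := by
    intro x y hx hy z
    simp [lie_lie, hx ⁅y, z⁆, hy ⁅x, z⁆]

/-- `γ` is of nilpotent type: it vanishes on its own stabiliser. -/
def IsNilpotentType (γ : Module.Dual ℂ L) : Prop :=
  ∀ x ∈ coadjointStabilizer γ, γ x = 0

/-- A subgroup `H` of `GL(W)` is reductive if it has no nontrivial normal subgroup consisting of
unipotent elements. For `H` Zariski closed this says that the unipotent radical of `H` is trivial: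
the Zariski closure of such a normal subgroup is a closed normal unipotent subgroup of `H`, and it
is connected because the characteristic is zero. -/
def IsReductiveSubgroup {W : Type*} [AddCommGroup W] [Module ℂ W]
    (H : Subgroup (W ≃ₗ[ℂ] W)) : Prop :=
  ∀ N : Subgroup (W ≃ₗ[ℂ] W), N ≤ H →
    (∀ h ∈ H, ∀ g ∈ N, h * g * h⁻¹ ∈ N) →
    (∀ g ∈ N, IsNilpotent ((g : Module.End ℂ W) - 1)) →
    N = ⊥

end Coadjoint

section Parabolic

variable {E : Type*} [AddCommGroup E] [Module ℂ E]

/-- A flag `0 = V_0 ⊂ V_1 ⊂ ⋯ ⊂ V_t` of isotropic subspaces with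
`dim V_i = a_1 + ⋯ + a_i`. -/
structure IsIsotropicFlag (B : LinearMap.BilinForm ℂ E) {r : ℕ} (a : Composition r)
    (V : Fin (a.length + 1) → Submodule ℂ E) : Prop where
  mono : Monotone V
  isotropic : ∀ i, ∀ v ∈ V i, ∀ w ∈ V i, B v w = 0
  finrank_eq : ∀ i, Module.finrank ℂ (V i) = a.sizeUpTo i

variable {ι : Type*} (B : LinearMap.BilinForm ℂ E) (V : ι → Submodule ℂ E)

/-- The stabiliser of the flag `V` in the Lie algebra of endomorphisms that are skew-adjoint
for `B` (that is, in `so(E, B)` when `B` is symmetric and nondegenerate). -/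
def parabolic : LieSubalgebra ℂ (Module.End ℂ E) where
  carrier := {x | x ∈ skewAdjointLieSubalgebra B ∧ ∀ i, ∀ v ∈ V i, x v ∈ V i}
  zero_mem' := ⟨zero_mem _, by simp⟩
  add_mem' := by
    rintro x y ⟨hx, hx'⟩ ⟨hy, hy'⟩
    exact ⟨add_mem hx hy, fun i v hv => add_mem (hx' i v hv) (hy' i v hv)⟩
  smul_mem' := by
    rintro c x ⟨hx, hx'⟩
    exact ⟨(skewAdjointLieSubalgebra B).smul_mem c hx,
      fun i v hv => (V i).smul_mem c (hx' i v hv)⟩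
  lie_mem' := by
    rintro x y ⟨hx, hx'⟩ ⟨hy, hy'⟩
    refine ⟨LieSubalgebra.lie_mem _ hx hy, fun i v hv => ?_⟩
    rw [LieRing.of_associative_ring_bracket]
    exact sub_mem (hx' i _ (hy' i v hv)) (hy' i _ (hx' i v hv))

/-- The parabolic subgroup: the stabiliser of the flag `V` in `SO(E, B)`. For a flag of isotropic
subspaces of a nondegenerate quadratic space it is a connected algebraic group, with Lie
algebra `parabolic B V`. -/
def parabolicGroup : Subgroup (E ≃ₗ[ℂ] E) where
  carrier := {g | (∀ v w, B (g v) (g w) = B v w) ∧ LinearMap.det (g : E →ₗ[ℂ] E) = 1 ∧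
    ∀ i v, g v ∈ V i ↔ v ∈ V i}
  one_mem' := ⟨fun _ _ => rfl, LinearMap.det_id, fun _ _ => Iff.rfl⟩
  mul_mem' := by
    rintro g h ⟨hg, hg', hg''⟩ ⟨hh, hh', hh''⟩
    refine ⟨fun v w => (hg _ _).trans (hh _ _), ?_, fun i v => (hg'' i _).trans (hh'' i _)⟩
    have : ((g * h : E ≃ₗ[ℂ] E) : E →ₗ[ℂ] E) = (g : E →ₗ[ℂ] E) ∘ₗ (h : E →ₗ[ℂ] E) := rfl
    rw [this, LinearMap.det_comp, hg', hh', one_mul]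
  inv_mem' := by
    rintro g ⟨hg, hg', hg''⟩
    have key : ∀ v, g (g⁻¹ v) = v := fun v => g.apply_symm_apply v
    refine ⟨fun v w => ?_, ?_, fun i v => ?_⟩
    · rw [← hg, key, key]
    · have h1 : (g : E →ₗ[ℂ] E) ∘ₗ ((g⁻¹ : E ≃ₗ[ℂ] E) : E →ₗ[ℂ] E) = LinearMap.id :=
        LinearMap.ext key
      have h2 := congrArg LinearMap.det h1
      rwa [LinearMap.det_comp, hg', one_mul, LinearMap.det_id] at h2
    · rw [← hg'', key]

variable {B V}

theorem conj_mem_parabolic {g : E ≃ₗ[ℂ] E} (hg : g ∈ parabolicGroup B V)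
    {x : Module.End ℂ E} (hx : x ∈ parabolic B V) : g.conj x ∈ parabolic B V := by
  obtain ⟨h1, -, h3⟩ := hg
  obtain ⟨hx1, hx2⟩ := hx
  have hx1' : ∀ v w, B (x v) w = B v (-x w) :=
    (LinearMap.mem_skewAdjointSubmodule x).1 hx1
  refine ⟨(LinearMap.mem_skewAdjointSubmodule _).2 fun v w => ?_, fun i v hv => ?_⟩
  · change B (g (x (g.symm v))) w = B v (-(g (x (g.symm w))))
    have e1 := h1 (x (g.symm v)) (g.symm w)
    have e2 := h1 (g.symm v) (-x (g.symm w))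
    rw [g.apply_symm_apply] at e1 e2
    rw [e1, hx1', ← e2, map_neg]
  · change g (x (g.symm v)) ∈ V i
    rw [h3]
    refine hx2 i _ ?_
    rw [← h3, g.apply_symm_apply]
    exact hv

variable (B V)

/-- The adjoint action `g ↦ (x ↦ g x g⁻¹)` of the parabolic subgroup on its Lie algebra. -/
def Ad : parabolicGroup B V →* (parabolic B V ≃ₗ[ℂ] parabolic B V) where
  toFun g :=
    { toFun := fun x => ⟨g.1.conj x.1, conj_mem_parabolic g.2 x.2⟩
      invFun := fun x => ⟨(g⁻¹).1.conj x.1, conj_mem_parabolic (g⁻¹).2 x.2⟩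
      map_add' := fun x y => Subtype.ext (map_add g.1.conj x.1 y.1)
      map_smul' := fun c x => Subtype.ext (map_smul g.1.conj c x.1)
      left_inv := fun x => Subtype.ext (g.1.conj.symm_apply_apply x.1)
      right_inv := fun x => Subtype.ext (g.1.conj.apply_symm_apply x.1) }
  map_one' := rfl
  map_mul' _ _ := rfl

variable {B V}

/-- The stabiliser `P_γ` of a linear form under the coadjoint action `γ ↦ γ ∘ Ad(g)⁻¹` of the
parabolic subgroup `P`. Its Lie algebra is `coadjointStabilizer γ`. -/
def groupStabilizer (γ : Module.Dual ℂ (parabolic B V)) : Subgroup (parabolicGroup B V) where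
  carrier := {g | ∀ x, γ (Ad B V g⁻¹ x) = γ x}
  one_mem' := fun x => by simp
  mul_mem' := by
    intro g h hg hh x
    rw [mul_inv_rev, map_mul]
    exact (hh _).trans (hg x)
  inv_mem' := by
    intro g hg x
    rw [inv_inv, ← hg (Ad B V g x)]
    congr 1
    change (Ad B V g⁻¹ * Ad B V g) x = x
    rw [← map_mul, inv_mul_cancel, map_one]
    rfl

/-- `γ` is of reductive type: `P_γ / Z` is a reductive subgroup of `GL(p)`. Here `Z`, the centre of
the connected group `P`, is the kernel of `Ad`, so that `P_γ / Z` is the image of `P_γ`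
under `Ad`. -/
def IsReductiveType (γ : Module.Dual ℂ (parabolic B V)) : Prop :=
  IsReductiveSubgroup ((groupStabilizer γ).map (Ad B V))

variable (B V)

/-- `p` is strongly quasi-reductive: it has a linear form of reductive type, and its centre
consists of semisimple endomorphisms of `E`. -/
def IsStronglyQuasiReductive : Prop :=
  (∃ γ : Module.Dual ℂ (parabolic B V), IsReductiveType γ) ∧
    ∀ z ∈ LieAlgebra.center ℂ (parabolic B V), (z : Module.End ℂ E).IsSemisimple

/-- `M_*(p) = M`: the Lie algebra `p` is strongly quasi-reductive, it has a maximal reductive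
stabiliser (the stabiliser of a linear form that is both of reductive and of nilpotent type), and
the Lie algebra of every maximal reductive stabiliser is isomorphic to `M`. -/
def MStarEq (M : Type*) [LieRing M] [LieAlgebra ℂ M] : Prop :=
  IsStronglyQuasiReductive B V ∧
    (∃ γ : Module.Dual ℂ (parabolic B V), IsReductiveType γ ∧ IsNilpotentType γ) ∧
    ∀ γ : Module.Dual ℂ (parabolic B V), IsReductiveType γ → IsNilpotentType γ →
      Nonempty (coadjointStabilizer γ ≃ₗ⁅ℂ⁆ M)

end Parabolic

end SoParabolic

open Module
open LinearMap (BilinForm)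
set_option autoImplicit false
namespace SoParabolic

/-! ### Skew endomorphisms, rank-two elements of the parabolic subalgebra, and stabilisers of forms
-/

section Basics

variable {E : Type*} [AddCommGroup E] [Module ℂ E] {ι : Type*}

/-! By the trace form, every linear form on the parabolic subalgebra is `tr (y ·)` for some skew
`y`, and on the rank-two elements `u ∧ v` it takes the value `2 B (y u) v`. The problem is thus
governed by the alternating form ω(u, v) = B(yu, v): the flag decides which `u ∧ v` are in the
subalgebra, hence which values of ω the stabiliser has to respect.

Reductive type is bracketed by two conditions on `y`, both formulated in the full isometry group of
the flag, without a determinant condition. Reductive type implies `OrthReductive`, and `RigidUnip`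
implies reductive type. The sign in `RigidUnip` comes from the scalar -1, which acts trivially on
the subalgebra. For uniqueness, each possible degeneracy of ω is excluded by an explicit nonzero
element of the Lie stabiliser: either one acting as zero on the graded pieces of U ⊂ U^⊥ ⊂ E for an
invariant isotropic U (`OrthReductive.eq_zero_of_lowering`), or a nilpotent one commuting with the
group stabiliser (`OrthReductive.eq_zero_of_central`). Cayley transforms carry such elements to the
group. For existence a rigid form is written down. `Target` joins the two halves, and `Realizes`
asserts them for all flags with given dimensions.

The reduction is by orthogonal decompositions E = A ⊕ A^⊥ that the stabiliser must preserve, so that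
it becomes a product (`Splits.nonempty_equiv`). For reductive `y` the radical of ω on a member V_j
is at most a line. If dim V_j is even, ω is therefore nondegenerate on V_j, and A = V_j + yV_j
splits off (`Realizes.of_even`). If V_j is the first nonzero member, of odd dimension and not
Lagrangian, the radical is a line ℂk with yk anisotropic; the hyperplane L = {v ∈ V_j : B(yv, yk) =
0} gives A = L + yL, and what remains of V_j is a line (`Realizes.of_odd`). By property (∗), an odd
partial sum of the truncated composition is preceded by an even one, so these cuts leave only the
following blocks: no flag (so_n); a Lagrangian of even dimension m (sp_m); a line in dimension n ≥ 3
(so_{n-3}); a line inside a Lagrangian of dimension m (sp_{m-2} for m even, sp_{m-3} for m odd); a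
Lagrangian of odd dimension m ≥ 3 (sp_{m-3}); a line in a plane (ℂ).

In the first two blocks nilpotent type makes a certain operator (`y` itself, or the operator
comparing B(y·, y·) with ω on the Lagrangian) nilpotent, and reductivity kills it, since it commutes
with the group stabiliser. The stabiliser is then the whole of so or sp. In the next three kinds of
block the vectors produced by the odd dimensions lie in a summand T on which the stabiliser acts by
±1. It contributes nothing, and its orthogonal complement is one of the first two blocks. In the
plane the subalgebra is abelian. -/

/-- Skew-adjointness, written out. -/
def IsSkew (B : BilinForm ℂ E) (x : End ℂ E) : Prop := ∀ v w, B (x v) w = -B v (x w)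

/-- Membership in the parabolic subalgebra, as a predicate on endomorphisms. -/
def Par (B : BilinForm ℂ E) (V : ι → Submodule ℂ E) (x : End ℂ E) : Prop :=
  IsSkew B x ∧ ∀ i, ∀ v ∈ V i, x v ∈ V i

/-- A symmetric nondegenerate form with a family of totally isotropic subspaces. -/
structure Datum (B : BilinForm ℂ E) (V : ι → Submodule ℂ E) : Prop where
  symm : ∀ v w, B v w = B w v
  nondeg : ∀ v, (∀ w, B v w = 0) → v = 0
  isotropic : ∀ i, ∀ v ∈ V i, ∀ w ∈ V i, B v w = 0

variable {B : BilinForm ℂ E} {V : ι → Submodule ℂ E}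

theorem mem_parabolic_iff {x : End ℂ E} : x ∈ parabolic B V ↔ Par B V x := by
  refine and_congr ?_ Iff.rfl
  refine (LinearMap.mem_skewAdjointSubmodule x).trans ?_
  refine forall_congr' fun v => forall_congr' fun w => ?_
  simp

theorem IsSkew.add {x z : End ℂ E} (hx : IsSkew B x) (hz : IsSkew B z) : IsSkew B (x + z) := by
  intro v w; simp [hx v w, hz v w]; ring

theorem IsSkew.sub {x z : End ℂ E} (hx : IsSkew B x) (hz : IsSkew B z) : IsSkew B (x - z) := by
  intro v w; simp [hx v w, hz v w]; ring

theorem IsSkew.smul {x : End ℂ E} (c : ℂ) (hx : IsSkew B x) : IsSkew B (c • x) := by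
  intro v w; simp [hx v w]

theorem IsSkew.zero : IsSkew B (0 : End ℂ E) := by intro v w; simp

theorem IsSkew.comm {x z : End ℂ E} (hx : IsSkew B x) (hz : IsSkew B z) :
    IsSkew B (x * z - z * x) := by
  intro v w
  simp [hx (z v) w, hz v (x w), hz (x v) w, hx v (z w)]

theorem Par.zero : Par B V 0 := ⟨IsSkew.zero, fun i v _ => by simp⟩

theorem Par.add {x z : End ℂ E} (hx : Par B V x) (hz : Par B V z) : Par B V (x + z) :=
  ⟨hx.1.add hz.1, fun i v hv => (V i).add_mem (hx.2 i v hv) (hz.2 i v hv)⟩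

theorem Par.sub {x z : End ℂ E} (hx : Par B V x) (hz : Par B V z) : Par B V (x - z) :=
  ⟨hx.1.sub hz.1, fun i v hv => (V i).sub_mem (hx.2 i v hv) (hz.2 i v hv)⟩

theorem Par.smul {x : End ℂ E} (c : ℂ) (hx : Par B V x) : Par B V (c • x) :=
  ⟨hx.1.smul c, fun i v hv => (V i).smul_mem c (hx.2 i v hv)⟩

theorem Par.comm {x z : End ℂ E} (hx : Par B V x) (hz : Par B V z) : Par B V (x * z - z * x) :=
  ⟨hx.1.comm hz.1, fun i v hv =>
    (V i).sub_mem (hx.2 i _ (hz.2 i v hv)) (hz.2 i _ (hx.2 i v hv))⟩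

variable (B V) in
/-- The stabiliser of the form `z ↦ tr (y z)` on the parabolic subalgebra. -/
def lieStab (y : End ℂ E) : LieSubalgebra ℂ (End ℂ E) where
  carrier := {x | Par B V x ∧ ∀ z, Par B V z → LinearMap.trace ℂ E (y * (x * z - z * x)) = 0}
  zero_mem' := ⟨Par.zero, by simp⟩
  add_mem' := by
    rintro x x' ⟨hx, h⟩ ⟨hx', h'⟩
    refine ⟨hx.add hx', fun z hz => ?_⟩
    have : y * ((x + x') * z - z * (x + x')) =
      y * (x * z - z * x) + y * (x' * z - z * x') := by noncomm_ring
    rw [this, map_add, h z hz, h' z hz, add_zero]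
  smul_mem' := by
    rintro c x ⟨hx, h⟩
    refine ⟨hx.smul c, fun z hz => ?_⟩
    have : y * ((c • x) * z - z * (c • x)) = c • (y * (x * z - z * x)) := by
      rw [smul_mul_assoc, mul_smul_comm, ← smul_sub, mul_smul_comm]
    rw [this, map_smul, h z hz, smul_zero]
  lie_mem' := by
    rintro x x' ⟨hx, h⟩ ⟨hx', h'⟩
    rw [LieRing.of_associative_ring_bracket]
    refine ⟨hx.comm hx', fun z hz => ?_⟩
    have : y * ((x * x' - x' * x) * z - z * (x * x' - x' * x)) =
      y * (x * (x' * z - z * x') - (x' * z - z * x') * x) -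
      y * (x' * (x * z - z * x) - (x * z - z * x) * x') := by noncomm_ring
    rw [this, map_sub, h _ (hx'.comm hz), h' _ (hx.comm hz), sub_zero]

theorem conj_apply' (g : E ≃ₗ[ℂ] E) (z : End ℂ E) (v : E) : g.conj z v = g (z (g.symm v)) := rfl

theorem symm_conj_apply' (g : E ≃ₗ[ℂ] E) (z : End ℂ E) (v : E) :
    g.symm.conj z v = g.symm (z (g v)) := rfl

/-- Isometries preserving the family of subspaces. -/
def IsFlagIsometry (B : BilinForm ℂ E) (V : ι → Submodule ℂ E) (g : E ≃ₗ[ℂ] E) : Prop :=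
  (∀ v w, B (g v) (g w) = B v w) ∧ ∀ i v, g v ∈ V i ↔ v ∈ V i

theorem IsFlagIsometry.symm {g : E ≃ₗ[ℂ] E} (hg : IsFlagIsometry B V g) :
    IsFlagIsometry B V g.symm :=
  ⟨fun v w => by rw [← hg.1, g.apply_symm_apply, g.apply_symm_apply],
    fun i v => by rw [← hg.2, g.apply_symm_apply]⟩

theorem IsFlagIsometry.mul {g h : E ≃ₗ[ℂ] E} (hg : IsFlagIsometry B V g)
    (hh : IsFlagIsometry B V h) : IsFlagIsometry B V (g * h) :=
  ⟨fun v w => (hg.1 _ _).trans (hh.1 _ _), fun i v => (hg.2 i _).trans (hh.2 i _)⟩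

theorem IsFlagIsometry.conj {g : E ≃ₗ[ℂ] E} (hg : IsFlagIsometry B V g) {z : End ℂ E}
    (hz : Par B V z) : Par B V (g.conj z) := by
  refine ⟨fun v w => ?_, fun i v hv => ?_⟩
  · rw [conj_apply', conj_apply']
    rw [← hg.symm.1 (g (z (g.symm v))), ← hg.symm.1 v, g.symm_apply_apply, g.symm_apply_apply]
    exact hz.1 _ _
  · rw [conj_apply', hg.2]
    exact hz.2 i _ ((hg.symm.2 i v).2 hv)

variable (B V) in
/-- The stabiliser of the form `z ↦ tr (y z)` in the group of isometries preserving the flag. -/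
def grpStab (y : End ℂ E) : Subgroup (E ≃ₗ[ℂ] E) where
  carrier := {g | IsFlagIsometry B V g ∧
    ∀ z, Par B V z → LinearMap.trace ℂ E (y * g.symm.conj z) = LinearMap.trace ℂ E (y * z)}
  one_mem' := ⟨⟨fun _ _ => rfl, fun _ _ => Iff.rfl⟩, fun z _ => rfl⟩
  mul_mem' := by
    rintro g h ⟨hg, hg'⟩ ⟨hh, hh'⟩
    refine ⟨hg.mul hh, fun z hz => ?_⟩
    have : (g * h).symm.conj z = h.symm.conj (g.symm.conj z) := rfl
    rw [this, hh' _ (hg.symm.conj hz), hg' z hz]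
  inv_mem' := by
    rintro g ⟨hg, hg'⟩
    refine ⟨hg.symm, fun z hz => ?_⟩
    refine (hg' _ (hg.symm.symm.conj hz)).symm.trans ?_
    congr 2
    ext v
    change g.symm (g (z (g.symm (g v)))) = z v
    simp

variable (B V) in
/-- The form `z ↦ tr (y z)` vanishes on its stabiliser. -/
def NilType (y : End ℂ E) : Prop := ∀ x ∈ lieStab B V y, LinearMap.trace ℂ E (y * x) = 0

/-- A unipotent linear automorphism. -/
def Unip (g : E ≃ₗ[ℂ] E) : Prop := IsNilpotent ((g : End ℂ E) - 1)

/-- A linear automorphism that is unipotent up to sign. -/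
def SignUnip (g : E ≃ₗ[ℂ] E) : Prop :=
  IsNilpotent ((g : End ℂ E) - 1) ∨ IsNilpotent ((g : End ℂ E) + 1)

variable (B V) in
/-- The stabiliser has no nontrivial normal unipotent subgroup. -/
def OrthReductive (y : End ℂ E) : Prop :=
  ∀ N : Subgroup (E ≃ₗ[ℂ] E), N ≤ grpStab B V y →
    (∀ h ∈ grpStab B V y, ∀ g ∈ N, h * g * h⁻¹ ∈ N) → (∀ g ∈ N, Unip g) → N = ⊥

variable (B V) in
/-- A unipotent element of the stabiliser is trivial as soon as its commutators with all unipotent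
elements are unipotent up to sign. -/
def RigidUnip (y : End ℂ E) : Prop :=
  ∀ g ∈ grpStab B V y, Unip g →
    (∀ h ∈ grpStab B V y, Unip h → SignUnip (g * h * g⁻¹ * h⁻¹)) → g = 1

variable (B) in
/-- The skew endomorphism `u ∧ v`. -/
def wedge (u v : E) : End ℂ E := (B v).smulRight u - (B u).smulRight v

@[simp] theorem wedge_apply (u v w : E) : wedge B u v w = B v w • u - B u w • v := rfl

theorem isSkew_wedge (hs : ∀ v w, B v w = B w v) (u v : E) : IsSkew B (wedge B u v) := by
  intro a b
  simp [hs a u, hs a v]; ring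

section FD
variable [FiniteDimensional ℂ E]

/-- A wedge is a difference of two rank-one maps, and skewness makes their contributions agree. This
identity turns traces against `y` into values of the alternating form B(y·, ·). -/
theorem trace_mul_wedge {y : End ℂ E} (hs : ∀ v w, B v w = B w v) (hy : IsSkew B y) (u v : E) :
    LinearMap.trace ℂ E (y * wedge B u v) = 2 * B (y u) v := by
  have : y * wedge B u v = (B v).smulRight (y u) - (B u).smulRight (y v) := by
    ext w; simp
  rw [this, map_sub, LinearMap.trace_smulRight, LinearMap.trace_smulRight, hs v, hs u, hy v u,
    hs v]
  ring

theorem conj_wedge {g : E ≃ₗ[ℂ] E} (hg : ∀ v w, B (g v) (g w) = B v w) (u v : E) :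
    g.symm.conj (wedge B (g u) (g v)) = wedge B u v := by
  ext w
  rw [symm_conj_apply']
  simp [hg]

/-- The basic invariance property of elements of the stabiliser. -/
theorem grpStab_inv (hs : ∀ v w, B v w = B w v) {y : End ℂ E} (hy : IsSkew B y)
    {g : E ≃ₗ[ℂ] E} (hg : g ∈ grpStab B V y) {u v : E} (h : Par B V (wedge B u v)) :
    B (y (g u)) (g v) = B (y u) v := by
  have h1 : Par B V (wedge B (g u) (g v)) := by
    have := hg.1.conj h
    rwa [← conj_wedge hg.1.1, show g.conj (g.symm.conj (wedge B (g u) (g v))) =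
      wedge B (g u) (g v) by ext w; simp [conj_apply']] at this
  have h2 := hg.2 _ h1
  rw [conj_wedge hg.1.1, trace_mul_wedge hs hy, trace_mul_wedge hs hy] at h2
  exact (mul_left_cancel₀ two_ne_zero h2).symm

theorem lie_wedge {z : End ℂ E} (hz : IsSkew B z) (u v : E) :
    z * wedge B u v - wedge B u v * z = wedge B (z u) v + wedge B u (z v) := by
  ext w
  simp [hz u w, hz v w]; abel

/-- The basic invariance property of elements of the infinitesimal stabiliser. -/
theorem lieStab_inv (hs : ∀ v w, B v w = B w v) {y : End ℂ E} (hy : IsSkew B y)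
    {x : End ℂ E} (hx : x ∈ lieStab B V y) {u v : E} (h : Par B V (wedge B u v)) :
    B (y (x u)) v + B (y u) (x v) = 0 := by
  have := hx.2 _ h
  rw [lie_wedge hx.1.1, mul_add, map_add, trace_mul_wedge hs hy, trace_mul_wedge hs hy] at this
  linear_combination this / 2

/-- `tr (y [u ∧ v, z])`. -/
theorem trace_lie_wedge (hs : ∀ v w, B v w = B w v) {y : End ℂ E} (hy : IsSkew B y)
    {z : End ℂ E} (hz : IsSkew B z) (u v : E) :
    LinearMap.trace ℂ E (y * (wedge B u v * z - z * wedge B u v)) =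
      2 * (B (z u) (y v) - B (y u) (z v)) := by
  have : wedge B u v * z - z * wedge B u v = -(wedge B (z u) v + wedge B u (z v)) := by
    rw [← lie_wedge hz]; abel
  rw [this, mul_neg, map_neg, mul_add, map_add, trace_mul_wedge hs hy, trace_mul_wedge hs hy,
    hy (z u) v]
  ring

end FD

/-- On a member orthogonal to `u` the wedge acts as w ↦ B(v, w)u, so it is harmless if `u` lies in
that member or if `v` is orthogonal to it. These elements are the test vectors in all invariance
arguments. -/
theorem par_wedge (hs : ∀ v w, B v w = B w v) {u v : E}
    (h : ∀ i, (∀ w ∈ V i, B u w = 0) ∧ (u ∈ V i ∨ ∀ w ∈ V i, B v w = 0)) :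
    Par B V (wedge B u v) := by
  refine ⟨isSkew_wedge hs u v, fun i w hw => ?_⟩
  rw [wedge_apply, (h i).1 w hw, zero_smul, sub_zero]
  rcases (h i).2 with h1 | h1
  · exact (V i).smul_mem _ h1
  · rw [h1 w hw, zero_smul]; exact zero_mem _

section perp
variable [FiniteDimensional ℂ E]

theorem Datum.nondegenerate (D : Datum B V) : B.Nondegenerate :=
  ⟨fun v hv => D.nondeg v hv, fun v hv => D.nondeg v fun w => by rw [D.symm]; exact hv w⟩

theorem Datum.isRefl (D : Datum B V) : B.IsRefl := fun v w h => by rw [D.symm]; exact h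

theorem Datum.perp_perp (D : Datum B V) (W : Submodule ℂ E) :
    B.orthogonal (B.orthogonal W) = W :=
  LinearMap.BilinForm.orthogonal_orthogonal D.nondegenerate D.isRefl W

theorem Datum.finrank_perp (D : Datum B V) (W : Submodule ℂ E) :
    finrank ℂ (B.orthogonal W) + finrank ℂ W = finrank ℂ E := by
  rw [LinearMap.BilinForm.finrank_orthogonal D.nondegenerate]
  have := Submodule.finrank_le W
  omega

/-- A vector orthogonal to `W^⊥` lies in `W`. -/
theorem Datum.mem_of_perp (D : Datum B V) {W : Submodule ℂ E} {v : E}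
    (h : ∀ m, (∀ w ∈ W, B w m = 0) → B m v = 0) : v ∈ W := by
  rw [← D.perp_perp W]
  exact fun m hm => h m hm

/-- Every linear form is represented by a vector. -/
theorem Datum.exists_rep (D : Datum B V) (f : E →ₗ[ℂ] ℂ) : ∃ u, ∀ w, B u w = f w := by
  refine ⟨(B.toDual D.nondegenerate).symm f, fun w => ?_⟩
  rw [← LinearMap.BilinForm.toDual_def D.nondegenerate, LinearEquiv.apply_symm_apply]

theorem exists_extend {W : Submodule ℂ E} (f : W →ₗ[ℂ] ℂ) :
    ∃ F : E →ₗ[ℂ] ℂ, ∀ w : W, F w = f w := by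
  obtain ⟨F, hF⟩ := LinearMap.exists_extend f
  exact ⟨F, fun w => by rw [← hF]; rfl⟩

theorem Datum.exists_rep_on (D : Datum B V) {W : Submodule ℂ E} (f : W →ₗ[ℂ] ℂ) :
    ∃ u, ∀ w : W, B u w = f w := by
  obtain ⟨F, hF⟩ := exists_extend f
  obtain ⟨u, hu⟩ := D.exists_rep F
  exact ⟨u, fun w => by rw [hu, hF]⟩

/-- Solving `B (y s) · = f` on a subspace `W`, for `f` vanishing on the radical. -/
theorem exists_solve (hs : ∀ v w, B v w = B w v) {y : End ℂ E} (hy : IsSkew B y)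
    (W : Submodule ℂ E) (f : E →ₗ[ℂ] ℂ)
    (hf : ∀ k ∈ W, (∀ v ∈ W, B (y k) v = 0) → f k = 0) :
    ∃ s ∈ W, ∀ v ∈ W, B (y s) v = f v := by
  let β : W →ₗ[ℂ] Dual ℂ W := (W.subtype.dualMap) ∘ₗ B ∘ₗ y ∘ₗ W.subtype
  have hβ : ∀ s v : W, β s v = B (y s) v := fun s v => rfl
  -- The range of β is the annihilator of its coannihilator, and by skewness that coannihilator is
  -- the radical, where `f` vanishes.
  have key : (f ∘ₗ W.subtype : Dual ℂ W) ∈ LinearMap.range β := by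
    rw [← Subspace.dualCoannihilator_dualAnnihilator_eq (W := LinearMap.range β),
      Submodule.mem_dualAnnihilator]
    intro v hv
    rw [Submodule.mem_dualCoannihilator] at hv
    refine hf v v.2 fun w hw => ?_
    have := hv (β ⟨w, hw⟩) ⟨_, rfl⟩
    rw [hβ] at this
    rw [hy, hs, this, neg_zero]
  obtain ⟨s, hs'⟩ := key
  refine ⟨s, s.2, fun v hv => ?_⟩
  have := LinearMap.congr_fun hs' ⟨v, hv⟩
  exact this

end perp

end Basics


/-! ### Cayley transforms: from the Lie stabiliser to the group stabiliser -/

section Cayley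

variable {E : Type*} [AddCommGroup E] [Module ℂ E] {ι : Type*}
  {B : BilinForm ℂ E} {V : ι → Submodule ℂ E}

theorem map_eq_of_injective_of_le [FiniteDimensional ℂ E] {f : End ℂ E}
    (hf : Function.Injective f) {W : Submodule ℂ E} (hW : ∀ v ∈ W, f v ∈ W) : W.map f = W := by
  refine Submodule.eq_of_le_of_finrank_eq ?_ ?_
  · rintro _ ⟨v, hv, rfl⟩; exact hW v hv
  · exact (Submodule.equivMapOfInjective f hf W).finrank_eq.symm

theorem mem_of_apply_mem [FiniteDimensional ℂ E] {f : End ℂ E}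
    (hf : Function.Injective f) {W : Submodule ℂ E} (hW : ∀ v ∈ W, f v ∈ W) {v : E}
    (hv : f v ∈ W) : v ∈ W := by
  rw [← map_eq_of_injective_of_le hf hW] at hv
  obtain ⟨w, hw, h⟩ := hv
  rwa [← hf h]

theorem units_inv_apply (a : (End ℂ E)ˣ) (v : E) : (a : End ℂ E) (((a⁻¹ : (End ℂ E)ˣ) : End ℂ E) v) = v := by
  rw [← Module.End.mul_apply, a.mul_inv, Module.End.one_apply]

theorem units_apply_inv (a : (End ℂ E)ˣ) (v : E) : ((a⁻¹ : (End ℂ E)ˣ) : End ℂ E) ((a : End ℂ E) v) = v := by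
  rw [← Module.End.mul_apply, a.inv_mul, Module.End.one_apply]

theorem units_injective (a : (End ℂ E)ˣ) : Function.Injective (a : End ℂ E) :=
  fun v w h => by rw [← units_apply_inv a v, h, units_apply_inv]

variable [FiniteDimensional ℂ E]

/-- The Cayley transform of an element of the infinitesimal stabiliser lies in the stabiliser. -/
theorem exists_cayley {y x : End ℂ E} (hx : x ∈ lieStab B V y) (h1 : IsUnit (1 - x))
    (h2 : IsUnit (1 + x)) : ∃ g ∈ grpStab B V y, ∀ v, g (v - x v) = v + x v := by
  obtain ⟨a, ha⟩ := h1
  obtain ⟨b, hb⟩ := h2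
  have hav : ∀ v, (a : End ℂ E) v = v - x v := fun v => by rw [ha]; rfl
  have hbv : ∀ v, (b : End ℂ E) v = v + x v := fun v => by rw [hb]; rfl
  have hab : (a : End ℂ E) * b = b * a := by rw [ha, hb]; noncomm_ring
  have hab' : a * b = b * a := Units.ext hab
  have aV : ∀ i, ∀ v ∈ V i, (a : End ℂ E) v ∈ V i := fun i v hv => by
    rw [hav]; exact sub_mem hv (hx.1.2 i v hv)
  have bV : ∀ i, ∀ v ∈ V i, (b : End ℂ E) v ∈ V i := fun i v hv => by
    rw [hbv]; exact add_mem hv (hx.1.2 i v hv)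
  have aV' : ∀ i v, ((a⁻¹ : (End ℂ E)ˣ) : End ℂ E) v ∈ V i ↔ v ∈ V i := fun i v =>
    ⟨fun h => by have := aV i _ h; rwa [units_inv_apply] at this, fun h =>
      mem_of_apply_mem (units_injective a) (aV i) (by rwa [units_inv_apply])⟩
  have bV' : ∀ i v, ((b⁻¹ : (End ℂ E)ˣ) : End ℂ E) v ∈ V i ↔ v ∈ V i := fun i v =>
    ⟨fun h => by have := bV i _ h; rwa [units_inv_apply] at this, fun h =>
      mem_of_apply_mem (units_injective b) (bV i) (by rwa [units_inv_apply])⟩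
  have bV2 : ∀ i v, (b : End ℂ E) v ∈ V i ↔ v ∈ V i := fun i v =>
    ⟨fun h => by rw [← bV', units_apply_inv] at h; exact h, bV i v⟩
  have adj : ∀ v w, B ((b : End ℂ E) v) w = B v ((a : End ℂ E) w) := fun v w => by
    rw [hav, hbv]; simp [hx.1.1 v w, sub_eq_add_neg]
  have adj' : ∀ v w, B ((a : End ℂ E) v) w = B v ((b : End ℂ E) w) := fun v w => by
    rw [hav, hbv]; simp [hx.1.1 v w, sub_eq_add_neg]
  have iadj : ∀ v w, B (((b⁻¹ : (End ℂ E)ˣ) : End ℂ E) v) w =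
      B v (((a⁻¹ : (End ℂ E)ˣ) : End ℂ E) w) := fun v w => by
    conv_rhs => rw [← units_inv_apply b v]
    rw [adj, units_inv_apply]
  have iadj' : ∀ v w, B (((a⁻¹ : (End ℂ E)ˣ) : End ℂ E) v) w =
      B v (((b⁻¹ : (End ℂ E)ˣ) : End ℂ E) w) := fun v w => by
    conv_rhs => rw [← units_inv_apply a v]
    rw [adj', units_inv_apply]
  let g : E ≃ₗ[ℂ] E := LinearMap.GeneralLinearGroup.toLinearEquiv (b * a⁻¹)
  have hg : ∀ v, g v = (b : End ℂ E) (((a⁻¹ : (End ℂ E)ˣ) : End ℂ E) v) := fun v => rfl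
  have hgs : ∀ v, g.symm v = (a : End ℂ E) (((b⁻¹ : (End ℂ E)ˣ) : End ℂ E) v) := fun v => by
    rw [LinearEquiv.symm_apply_eq, hg, units_apply_inv, units_inv_apply]
  refine ⟨g, ⟨⟨fun v w => ?_, fun i v => ?_⟩, fun z hz => ?_⟩, fun v => ?_⟩
  · have hc : (b * a⁻¹ : (End ℂ E)ˣ) = a⁻¹ * b := by
      rw [mul_inv_eq_iff_eq_mul, mul_assoc, ← hab', inv_mul_cancel_left]
    have hg2 : ∀ v, g v = ((a⁻¹ : (End ℂ E)ˣ) : End ℂ E) ((b : End ℂ E) v) := fun v => by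
      change ((b * a⁻¹ : (End ℂ E)ˣ) : End ℂ E) v = _
      rw [hc]; rfl
    rw [hg w, hg2, iadj', units_apply_inv, adj, units_inv_apply]
  · rw [hg, bV2, aV']
  -- Put z₁ = (1 + x)⁻¹ z (1 - x)⁻¹, which is again in the subalgebra because the two inverses are
  -- adjoint. Then z = (1 + x) z₁ (1 - x) and g⁻¹zg = (1 - x) z₁ (1 + x) differ by 2[x, z₁], on
  -- which the form vanishes.
  · let z1 : End ℂ E := (b⁻¹ : (End ℂ E)ˣ) * z * (a⁻¹ : (End ℂ E)ˣ)
    have hz1 : Par B V z1 := by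
      refine ⟨fun v w => ?_, fun i v hv => ?_⟩
      · change B (((b⁻¹ : (End ℂ E)ˣ) : End ℂ E) (z (((a⁻¹ : (End ℂ E)ˣ) : End ℂ E) v))) w =
          -B v (((b⁻¹ : (End ℂ E)ˣ) : End ℂ E) (z (((a⁻¹ : (End ℂ E)ˣ) : End ℂ E) w)))
        rw [iadj, hz.1, iadj']
      · exact (bV' i _).2 (hz.2 i _ ((aV' i v).2 hv))
    have e1 : z = (1 + x) * z1 * (1 - x) := by
      rw [← ha, ← hb]
      simp only [z1, mul_assoc, Units.inv_mul, Units.mul_inv, mul_one, Units.mul_inv_cancel_left]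
    have e2 : g.symm.conj z = (1 - x) * z1 * (1 + x) := by
      rw [← ha, ← hb]
      ext v
      rw [symm_conj_apply', hgs, hg]
      have h3 : (b : End ℂ E) (((a⁻¹ : (End ℂ E)ˣ) : End ℂ E) v) =
          ((a⁻¹ : (End ℂ E)ˣ) : End ℂ E) ((b : End ℂ E) v) := by
        apply units_injective a
        rw [units_inv_apply, ← Module.End.mul_apply, hab, Module.End.mul_apply, units_inv_apply]
      rw [h3]
      rfl
    have e3 : y * g.symm.conj z = y * z - (2 : ℂ) • (y * (x * z1 - z1 * x)) := by
      rw [e2]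
      conv_rhs => rw [e1]
      rw [two_smul]
      noncomm_ring
    rw [e3, map_sub, map_smul, hx.2 z1 hz1, smul_zero, sub_zero]
  · rw [hg, ← hav, units_apply_inv, hbv]

/-- The spectrum is finite, so c = 1/t works for any t ≠ 0 with t and -t outside it. After
rescaling, every element of the Lie stabiliser has a Cayley transform. -/
theorem exists_scale_isUnit (x : End ℂ E) : ∃ c : ℂ, c ≠ 0 ∧ IsUnit (1 - c • x) ∧
    IsUnit (1 + c • x) := by
  have hfin := Module.End.finite_spectrum x
  have h2 : ((spectrum ℂ x ∪ (fun t => -t) '' spectrum ℂ x) ∪ {0}).Finite :=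
    (hfin.union (hfin.image _)).union (Set.finite_singleton 0)
  obtain ⟨t, ht⟩ := h2.infinite_compl.nonempty
  simp only [Set.mem_compl_iff, Set.mem_union, Set.mem_singleton_iff, not_or] at ht
  obtain ⟨⟨h3, h4⟩, h5⟩ := ht
  refine ⟨t⁻¹, inv_ne_zero h5, ?_, ?_⟩
  · rw [spectrum.notMem_iff] at h3
    have : (1 - t⁻¹ • x : End ℂ E) = t⁻¹ • (algebraMap ℂ (End ℂ E) t - x) := by
      rw [smul_sub, Algebra.algebraMap_eq_smul_one, smul_smul, inv_mul_cancel₀ h5, one_smul]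
    rw [this]
    exact h3.smul (Units.mk0 t⁻¹ (inv_ne_zero h5))
  · have h6 : -t ∉ spectrum ℂ x := fun h => h4 ⟨-t, h, neg_neg t⟩
    rw [spectrum.notMem_iff] at h6
    have : (1 + t⁻¹ • x : End ℂ E) = (-t⁻¹) • (algebraMap ℂ (End ℂ E) (-t) - x) := by
      rw [smul_sub, Algebra.algebraMap_eq_smul_one, smul_smul, neg_mul_neg, inv_mul_cancel₀ h5,
        one_smul, neg_smul, sub_neg_eq_add]
    rw [this]
    exact h6.smul (Units.mk0 (-t⁻¹) (neg_ne_zero.2 (inv_ne_zero h5)))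

/-- A subspace stable under the stabiliser is stable under the infinitesimal stabiliser. -/
theorem lieStab_stable {y x : End ℂ E} (hx : x ∈ lieStab B V y) {W : Submodule ℂ E}
    (hW : ∀ g ∈ grpStab B V y, ∀ v ∈ W, g v ∈ W) : ∀ v ∈ W, x v ∈ W := by
  obtain ⟨c, hc, h1, h2⟩ := exists_scale_isUnit x
  obtain ⟨g, hg, hgv⟩ := exists_cayley ((lieStab B V y).smul_mem c hx) h1 h2
  have hgv' : ∀ v, g (v - c • x v) = v + c • x v := hgv
  -- As f sends v - cxv to 2v, it is invertible. It maps W into itself, hence onto itself, so v -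
  -- cxv, and with it xv, lies in W whenever v does.
  let f : End ℂ E := 1 + (g : End ℂ E)
  have hf : ∀ v, f (v - c • x v) = (2 : ℂ) • v := fun v => by
    change (v - c • x v) + g (v - c • x v) = _
    rw [hgv', two_smul]; abel
  have hinj : Function.Injective f := by
    refine LinearMap.injective_iff_surjective.2 fun v => ?_
    refine ⟨(2 : ℂ)⁻¹ • v - c • x ((2 : ℂ)⁻¹ • v), ?_⟩
    rw [hf, smul_smul, mul_inv_cancel₀ two_ne_zero, one_smul]
  intro v hv
  have h3 : v - c • x v ∈ W :=
    mem_of_apply_mem hinj (fun w hw => add_mem hw (hW g hg w hw)) (by rw [hf]; exact W.smul_mem _ hv)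
  have h4 : c • x v ∈ W := by
    have := sub_mem hv h3
    rwa [sub_sub_cancel] at this
  have := W.smul_mem c⁻¹ h4
  rwa [smul_smul, inv_mul_cancel₀ hc, one_smul] at this

/-- If the stabiliser acts on a subspace by involutions, the infinitesimal stabiliser kills it. -/
theorem lieStab_apply_eq_zero {y x : End ℂ E} (hx : x ∈ lieStab B V y) {W : Submodule ℂ E}
    (hW : ∀ g ∈ grpStab B V y, ∀ v ∈ W, g v ∈ W)
    (hW2 : ∀ g ∈ grpStab B V y, ∀ v ∈ W, g (g v) = v) : ∀ v ∈ W, x v = 0 := by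
  obtain ⟨c, hc, h1, h2⟩ := exists_scale_isUnit x
  obtain ⟨g, hg, hgv⟩ := exists_cayley ((lieStab B V y).smul_mem c hx) h1 h2
  have hgv' : ∀ v, g (v - c • x v) = v + c • x v := hgv
  have hst := lieStab_stable hx hW
  -- The involution g exchanges v - cxv and v + cxv, so it fixes their sum 2v.
  have fixed : ∀ v ∈ W, g v = v := by
    intro v hv
    have h4 := hW2 g hg _ (sub_mem hv (W.smul_mem c (hst v hv)))
    rw [hgv'] at h4
    have h6 : g ((2 : ℂ) • v) = (2 : ℂ) • v := by
      have : (2 : ℂ) • v = (v - c • x v) + (v + c • x v) := by rw [two_smul]; abel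
      rw [this, map_add, h4, hgv', add_comm]
    rw [map_smul] at h6
    exact smul_right_injective E (two_ne_zero (α := ℂ)) h6
  intro v hv
  have h1 := hgv' v
  rw [fixed _ (sub_mem hv (W.smul_mem c (hst v hv))), sub_eq_add_neg, add_right_inj] at h1
  have h2 : (2 : ℂ) • (c • x v) = 0 := by rw [two_smul]; nth_rewrite 1 [← h1]; exact neg_add_cancel _
  exact (smul_eq_zero.1 ((smul_eq_zero.1 h2).resolve_left two_ne_zero)).resolve_left hc

end Cayley


/-! ### Elements forbidden by reductivity -/

section Normal

variable {E : Type*} [AddCommGroup E] [Module ℂ E] [FiniteDimensional ℂ E] {ι : Type*}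
  {B : BilinForm ℂ E} {V : ι → Submodule ℂ E}

theorem smul_two_cancel {v w : E} (h : (2 : ℂ) • v = (2 : ℂ) • w) : v = w :=
  smul_right_injective E (two_ne_zero (α := ℂ)) h

theorem unip_iff {g : E ≃ₗ[ℂ] E} {x a : End ℂ E} (ha : IsUnit a) (hx : IsNilpotent x)
    (hc : Commute x a) (h : ((g : End ℂ E) - 1) * a = x) : Unip g := by
  obtain ⟨u, rfl⟩ := ha
  have : (g : End ℂ E) - 1 = x * (u⁻¹ : (End ℂ E)ˣ) := by
    rw [← h, mul_assoc, Units.mul_inv, mul_one]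
  rw [Unip, this]
  exact (hc.units_inv_right).isNilpotent_mul_right hx

/-- A nilpotent element of the infinitesimal stabiliser gives a unipotent Cayley transform. -/
theorem exists_cayley_unip {y x : End ℂ E} (hx : x ∈ lieStab B V y) (hn : IsNilpotent x) :
    ∃ g ∈ grpStab B V y, Unip g ∧ ∀ v, g (v - x v) = v + x v := by
  have hu : IsUnit (1 - x) := hn.isUnit_one_sub
  obtain ⟨g, hg, h⟩ := exists_cayley hx hu hn.isUnit_one_add
  refine ⟨g, hg, unip_iff (x := (2 : ℂ) • x) hu (hn.smul _) ?_ ?_, h⟩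
  · exact ((Commute.one_right x).sub_right (Commute.refl x)).smul_left _
  · ext v
    change g (v - x v) - (v - x v) = (2 : ℂ) • x v
    rw [h, two_smul]; abel

/-- The exponential of an element with vanishing cube. -/
theorem exists_exp {y T : End ℂ E} (hT : T ∈ lieStab B V y) (h3 : ∀ v, T (T (T v)) = 0) :
    ∃ g ∈ grpStab B V y, Unip g ∧ ∀ v, g v = v + T v + (2⁻¹ : ℂ) • T (T v) := by
  have hn : IsNilpotent ((2⁻¹ : ℂ) • T) :=
    IsNilpotent.smul ⟨3, by ext v; simp [pow_succ, h3]⟩ _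
  obtain ⟨g, hg, hu, h⟩ := exists_cayley_unip ((lieStab B V y).smul_mem (2⁻¹ : ℂ) hT) hn
  refine ⟨g, hg, hu, fun v => ?_⟩
  -- The argument is (1 - T/2)⁻¹v, the Neumann series stopping because T³ = 0. Applying 1 + T/2 to
  -- it gives the exponential series.
  have h1 := h (v + (2⁻¹ : ℂ) • T v + (4⁻¹ : ℂ) • T (T v))
  have e2 : ((2⁻¹ : ℂ) • T) (v + (2⁻¹ : ℂ) • T v + (4⁻¹ : ℂ) • T (T v)) =
      (2⁻¹ : ℂ) • T v + (2⁻¹ * 2⁻¹ : ℂ) • T (T v) := by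
    simp only [LinearMap.smul_apply, map_add, map_smul, h3, smul_zero, add_zero, smul_add,
      smul_smul]
  have e1 : v + (2⁻¹ : ℂ) • T v + (4⁻¹ : ℂ) • T (T v) -
      ((2⁻¹ : ℂ) • T v + (2⁻¹ * 2⁻¹ : ℂ) • T (T v)) = v := by
    rw [show (2⁻¹ * 2⁻¹ : ℂ) = 4⁻¹ by norm_num]; abel
  rw [e2, e1] at h1
  rw [h1]
  module

/-- For a form of reductive type, an element of the stabiliser lowering the filtration
`0 ⊂ U ⊂ U^⊥ ⊂ E` attached to an invariant isotropic subspace `U` vanishes. -/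
theorem OrthReductive.eq_zero_of_lowering (D : Datum B V) {y : End ℂ E}
    (hR : OrthReductive B V y) {U : Submodule ℂ E}
    (hst : ∀ g ∈ grpStab B V y, ∀ u ∈ U, g u ∈ U) {x : End ℂ E} (hx : x ∈ lieStab B V y)
    (h0 : ∀ u ∈ U, x u = 0) (h1 : ∀ w, (∀ u ∈ U, B u w = 0) → x w ∈ U) : x = 0 := by
  have hinv : ∀ h ∈ grpStab B V y, ∀ w, (∀ u ∈ U, B u w = 0) → ∀ u ∈ U, B u (h⁻¹ w) = 0 := by
    intro h hh w hw u hu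
    rw [← hh.1.1, show h (h⁻¹ w) = w from h.apply_symm_apply w]
    exact hw _ (hst h hh u hu)
  -- N consists of the stabiliser elements acting trivially on U and on U^⊥/U. Being isometries,
  -- they then satisfy (g - 1)E ⊆ U^⊥ and so (g - 1)³ = 0. N is normal because U is invariant, and
  -- it contains the Cayley transform of x.
  let N : Subgroup (E ≃ₗ[ℂ] E) :=
    { carrier := {g | g ∈ grpStab B V y ∧ (∀ u ∈ U, g u = u) ∧
        ∀ w, (∀ u ∈ U, B u w = 0) → g w - w ∈ U}
      one_mem' := ⟨one_mem _, fun _ _ => rfl, fun w _ => by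
        rw [show (1 : E ≃ₗ[ℂ] E) w = w from rfl, sub_self]; exact zero_mem _⟩
      mul_mem' := by
        rintro g h ⟨hg, hg1, hg2⟩ ⟨hh, hh1, hh2⟩
        refine ⟨mul_mem hg hh, fun u hu => ?_, fun w hw => ?_⟩
        · change g (h u) = u
          rw [hh1 u hu, hg1 u hu]
        · change g (h w) - w ∈ U
          have : g (h w) - w = (g (h w - w)) + (g w - w) := by rw [map_sub]; abel
          rw [this, hg1 _ (hh2 w hw)]
          exact add_mem (hh2 w hw) (hg2 w hw)
      inv_mem' := by
        rintro g ⟨hg, hg1, hg2⟩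
        have h3 : ∀ u ∈ U, g⁻¹ u = u := fun u hu => by
          change g.symm u = u
          rw [LinearEquiv.symm_apply_eq, hg1 u hu]
        refine ⟨inv_mem hg, h3, fun w hw => ?_⟩
        have h4 := h3 _ (hg2 w hw)
        rw [map_sub, show g⁻¹ (g w) = w from g.symm_apply_apply w] at h4
        have : g⁻¹ w - w = -(g w - w) := by rw [← h4]; abel
        rw [this]
        exact neg_mem (hg2 w hw) }
  have hN : N = ⊥ := by
    refine hR N (fun g hg => hg.1) ?_ ?_
    · rintro h hh g ⟨hg, hg1, hg2⟩
      have hU' : ∀ u ∈ U, h⁻¹ u ∈ U := hst _ (inv_mem hh)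
      refine ⟨mul_mem (mul_mem hh hg) (inv_mem hh), fun u hu => ?_, fun w hw => ?_⟩
      · change h (g (h⁻¹ u)) = u
        rw [hg1 _ (hU' u hu)]; exact h.apply_symm_apply u
      · change h (g (h⁻¹ w)) - w ∈ U
        have : h (g (h⁻¹ w)) - w = h (g (h⁻¹ w) - h⁻¹ w) := by
          rw [map_sub, show h (h⁻¹ w) = w from h.apply_symm_apply w]
        rw [this]
        exact hst h hh _ (hg2 _ (hinv h hh w hw))
    · rintro g ⟨hg, hg1, hg2⟩
      refine ⟨3, ?_⟩
      ext w
      have e : ∀ v, ((g : End ℂ E) - 1) v = g v - v := fun v => rfl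
      have h4 : ∀ u ∈ U, B u (g w - w) = 0 := fun u hu => by
        have := hg.1.1 u w
        rw [hg1 u hu] at this
        rw [map_sub, this, sub_self]
      rw [pow_succ, pow_succ, pow_one, Module.End.mul_apply, Module.End.mul_apply, e w, e, e,
        hg1 _ (hg2 _ h4), sub_self]
      rfl
  have hx2 : ∀ w, ∀ u ∈ U, B u (x w) = 0 := fun w u hu => by
    have := hx.1.1 u w
    rw [h0 u hu, map_zero, LinearMap.zero_apply] at this
    exact neg_eq_zero.1 this.symm
  have hn : IsNilpotent x := ⟨3, by ext w; simp [pow_succ, h0 _ (h1 _ (hx2 w))]⟩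
  obtain ⟨g, hg, -, hgv⟩ := exists_cayley_unip hx hn
  have hgN : g ∈ N := by
    refine ⟨hg, fun u hu => ?_, fun w hw => ?_⟩
    · have := hgv u
      rwa [h0 u hu, sub_zero, add_zero] at this
    · have := hgv (w + x w)
      rw [map_add, h0 _ (h1 w hw), add_zero, add_sub_cancel_right] at this
      rw [this, show w + x w + x w - w = x w + x w by abel]
      exact add_mem (h1 w hw) (h1 w hw)
  rw [hN, Subgroup.mem_bot] at hgN
  ext v
  have := hgv v
  rw [hgN, LinearEquiv.coe_one, id, sub_eq_add_neg, add_right_inj] at this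
  apply smul_two_cancel
  rw [two_smul]; nth_rewrite 1 [← this]; simp

/-- For a form of reductive type, a nilpotent element of the stabiliser commuting with the group
stabiliser vanishes. -/
theorem OrthReductive.eq_zero_of_central {y : End ℂ E}
    (hR : OrthReductive B V y) {x : End ℂ E} (hx : x ∈ lieStab B V y) (hn : IsNilpotent x)
    (hc : ∀ g ∈ grpStab B V y, ∀ v, g (x v) = x (g v)) : x = 0 := by
  -- N consists of the unipotent elements in the centre of the group stabiliser. Commutation makes
  -- their products unipotent.
  let N : Subgroup (E ≃ₗ[ℂ] E) :=
    { carrier := {g | g ∈ grpStab B V y ∧ (∀ h ∈ grpStab B V y, h * g = g * h) ∧ Unip g}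
      one_mem' := ⟨one_mem _, fun h _ => by rw [mul_one, one_mul], by
        refine ⟨1, ?_⟩; rw [pow_one]; exact sub_self _⟩
      mul_mem' := by
        rintro g h ⟨hg, hg1, hg2⟩ ⟨hh, hh1, hh2⟩
        refine ⟨mul_mem hg hh, fun k hk => ?_, ?_⟩
        · rw [← mul_assoc, hg1 k hk, mul_assoc, hh1 k hk, mul_assoc]
        · have hgh : Commute (g : End ℂ E) (h : End ℂ E) := by
            have := hh1 g hg
            exact congrArg (fun k : E ≃ₗ[ℂ] E => (k : End ℂ E)) this
          have e : ((g * h : E ≃ₗ[ℂ] E) : End ℂ E) - 1 =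
              ((g : End ℂ E) - 1) * (h : End ℂ E) + ((h : End ℂ E) - 1) := by
            rw [sub_mul, one_mul, sub_add_sub_cancel]; rfl
          rw [Unip, e]
          have c1 : Commute ((g : End ℂ E) - 1) (h : End ℂ E) :=
            hgh.sub_left (Commute.one_left _)
          refine Commute.isNilpotent_add ?_ (c1.isNilpotent_mul_right hg2) hh2
          exact (c1.mul_left (Commute.refl _)).sub_right (Commute.one_right _)
      inv_mem' := by
        rintro g ⟨hg, hg1, hg2⟩
        refine ⟨inv_mem hg, fun h hh => ?_, ?_⟩
        · rw [eq_inv_mul_iff_mul_eq, ← mul_assoc, ← hg1 h hh, mul_inv_cancel_right]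
        · have e0 : (g : End ℂ E) * ((g⁻¹ : E ≃ₗ[ℂ] E) : End ℂ E) = 1 := by
            ext v; exact g.apply_symm_apply v
          have e1 : ((g⁻¹ : E ≃ₗ[ℂ] E) : End ℂ E) * (g : End ℂ E) = 1 := by
            ext v; exact g.symm_apply_apply v
          have e : ((g⁻¹ : E ≃ₗ[ℂ] E) : End ℂ E) - 1 =
              -(((g : End ℂ E) - 1) * ((g⁻¹ : E ≃ₗ[ℂ] E) : End ℂ E)) := by
            rw [sub_mul, e0, one_mul, neg_sub]
          rw [Unip, e]
          refine (Commute.isNilpotent_mul_right ?_ hg2).neg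
          exact Commute.sub_left (e0.trans e1.symm) (Commute.one_left _) }
  have hN : N = ⊥ := by
    refine hR N (fun g hg => hg.1) ?_ (fun g hg => hg.2.2)
    intro h hh g hg
    rw [hg.2.1 h hh, mul_inv_cancel_right]
    exact hg
  obtain ⟨g, hg, hgu, hgv⟩ := exists_cayley_unip hx hn
  have hgN : g ∈ N := by
    refine ⟨hg, fun h hh => ?_, hgu⟩
    obtain ⟨a, ha⟩ := hn.isUnit_one_sub
    ext w
    obtain ⟨v, rfl⟩ : ∃ v, v - x v = w := ⟨_, by
      have := units_inv_apply a w
      rw [ha] at this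
      exact this⟩
    change h (g (v - x v)) = g (h (v - x v))
    rw [hgv, map_add, hc h hh, map_sub, hc h hh, hgv]
  rw [hN, Subgroup.mem_bot] at hgN
  ext v
  have := hgv v
  rw [hgN, LinearEquiv.coe_one, id, sub_eq_add_neg, add_right_inj] at this
  apply smul_two_cancel
  rw [two_smul]; nth_rewrite 1 [← this]; simp

/-- Write d(t) = c(t)l. The product of the linear forms c and B(l, ·) vanishes on M and the second
one is nonzero, so the first is zero; evaluating at t, t₀ and t + t₀ makes this explicit. -/
theorem eq_zero_of_mem_span_of_orth {d : End ℂ E} {M : Submodule ℂ E} {l t₀ : E}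
    (hd : ∀ t ∈ M, d t ∈ Submodule.span ℂ {l}) (ho : ∀ t ∈ M, B (d t) t = 0)
    (ht₀ : t₀ ∈ M) (hl : B l t₀ ≠ 0) : ∀ t ∈ M, d t = 0 := by
  intro t ht
  obtain ⟨c, hc⟩ := Submodule.mem_span_singleton.1 (hd t ht)
  obtain ⟨c₀, hc₀⟩ := Submodule.mem_span_singleton.1 (hd t₀ ht₀)
  have h1 := ho t ht
  have h2 := ho t₀ ht₀
  have h3 := ho _ (add_mem ht ht₀)
  rw [show d (t + t₀) = c • l + c₀ • l by rw [map_add, hc, hc₀]] at h3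
  rw [← hc] at h1 ⊢
  rw [← hc₀] at h2
  simp only [map_add, map_smul, LinearMap.add_apply, LinearMap.smul_apply, smul_eq_mul] at h1 h2 h3
  have h4 : c₀ = 0 := (mul_eq_zero.1 h2).resolve_right hl
  subst h4
  have h5 : c * B l t₀ = 0 := by linear_combination h3 - h1
  rw [(mul_eq_zero.1 h5).resolve_right hl, zero_smul]

/-- An isometry that is congruent to a sign modulo an isotropic line is this sign. -/
theorem eq_smul_of_sub_mem_span (hs : ∀ v w, B v w = B w v) {g : E ≃ₗ[ℂ] E}
    (hg : ∀ v w, B (g v) (g w) = B v w) {ε : ℂ} (hε : ε * ε = 1) {M : Submodule ℂ E} {l t₀ : E}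
    (hd : ∀ t ∈ M, g t - ε • t ∈ Submodule.span ℂ {l}) (hl : B l l = 0)
    (ht₀ : t₀ ∈ M) (hlt : B l t₀ ≠ 0) : ∀ t ∈ M, g t = ε • t := by
  -- Applied to g - ε. If gt = εt + cl with l isotropic, then B(gt, gt) = B(t, t) reads 2εc B(l, t)
  -- = 0, which is the required orthogonality.
  have key := eq_zero_of_mem_span_of_orth (B := B) (d := (g : End ℂ E) - ε • 1) hd
    (fun t ht => ?_) ht₀ hlt
  · intro t ht; exact sub_eq_zero.1 (key t ht)
  · obtain ⟨c, hc⟩ := Submodule.mem_span_singleton.1 (hd t ht)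
    change B (g t - ε • t) t = 0
    have h1 : g t = ε • t + c • l := by rw [hc]; abel
    have h2 := hg t t
    rw [h1] at h2
    rw [← hc]
    simp only [map_add, map_smul, LinearMap.add_apply, LinearMap.smul_apply, smul_eq_mul, hl,
      hs t l] at h2 ⊢
    have h3 : 2 * ε * (c * B l t) = 0 := by linear_combination h2 - (B t t) * hε
    have hε0 : ε ≠ 0 := by rintro rfl; simp at hε
    exact (mul_eq_zero.1 h3).resolve_left (mul_ne_zero two_ne_zero hε0)

end Normal


/-! ### Orthogonal decompositions compatible with the flag: corners and gluing -/

section Splitting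

variable {E : Type*} [AddCommGroup E] [Module ℂ E] {ι : Type*}
  {B : BilinForm ℂ E} {V : ι → Submodule ℂ E} {A F : Submodule ℂ E}

theorem ext_of_isCompl {M : Type*} [AddCommGroup M] [Module ℂ M] (hc : IsCompl A F)
    {f g : E →ₗ[ℂ] M} (h1 : ∀ a ∈ A, f a = g a)
    (h2 : ∀ a ∈ F, f a = g a) : f = g := by
  ext v
  obtain ⟨a, ha, b, hb, rfl⟩ := Submodule.mem_sup.1 (hc.sup_eq_top ▸ Submodule.mem_top (x := v))
  rw [map_add, map_add, h1 a ha, h2 b hb]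

/-- The compression of an endomorphism to the summand `A` of `E = A ⊕ F`. -/
noncomputable def corner (hc : IsCompl A F) (y : End ℂ E) : End ℂ A :=
  A.projectionOnto F hc ∘ₗ y ∘ₗ A.subtype

/-- The extension by zero of an endomorphism of the summand `A` of `E = A ⊕ F`. -/
noncomputable def extendZero (hc : IsCompl A F) (x : End ℂ A) : End ℂ E :=
  A.subtype ∘ₗ x ∘ₗ A.projectionOnto F hc

theorem extendZero_left (hc : IsCompl A F) (x : End ℂ A) (a : A) :
    extendZero hc x a = x a := by
  simp [extendZero]

theorem extendZero_left' (hc : IsCompl A F) (x : End ℂ A) {a : E} (ha : a ∈ A) :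
    extendZero hc x a = x ⟨a, ha⟩ := extendZero_left hc x ⟨a, ha⟩

theorem extendZero_right (hc : IsCompl A F) (x : End ℂ A) {a : E} (ha : a ∈ F) :
    extendZero hc x a = 0 := by
  simp [extendZero, Submodule.projectionOnto_apply_of_mem_right hc ha]

theorem extendZero_mem (hc : IsCompl A F) (x : End ℂ A) (v : E) : extendZero hc x v ∈ A :=
  Submodule.coe_mem _

theorem corner_apply_of_mem (hc : IsCompl A F) {y : End ℂ E} {a : A} (h : y a ∈ A) :
    (corner hc y a : E) = y a := by
  change ((A.projectionOnto F hc (y a) : A) : E) = _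
  rw [Submodule.projectionOnto_apply_of_mem_left hc h]

theorem corner_apply_of_mem_right (hc : IsCompl A F) {y : End ℂ E} {a : A} (h : y a ∈ F) :
    corner hc y a = 0 :=
  Submodule.projectionOnto_apply_of_mem_right hc h

theorem sub_corner_mem (hc : IsCompl A F) (y : End ℂ E) (a : A) :
    y a - corner hc y a ∈ F := by
  rw [← Submodule.projectionOnto_apply_eq_zero_iff hc, map_sub]
  change _ - A.projectionOnto F hc ((A.projectionOnto F hc (y a) : A) : E) = 0
  rw [Submodule.projectionOnto_apply_left, sub_self]

theorem corner_extendZero (hc : IsCompl A F) (x : End ℂ A) : corner hc (extendZero hc x) = x := by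
  ext a
  rw [corner_apply_of_mem hc (extendZero_mem hc x a), extendZero_left]

/-- Cyclicity of the trace, with the extension by zero factored through the summand. It identifies
the form induced on the subalgebra of A with the trace form of the corner of `y`. -/
theorem trace_mul_extendZero [FiniteDimensional ℂ E] (hc : IsCompl A F) (y : End ℂ E)
    (x : End ℂ A) :
    LinearMap.trace ℂ E (y * extendZero hc x) = LinearMap.trace ℂ A (corner hc y * x) := by
  have h : y * extendZero hc x = (y ∘ₗ A.subtype) ∘ₗ (x ∘ₗ A.projectionOnto F hc) := rfl
  rw [h, LinearMap.trace_comp_comm']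
  have h2 : (x ∘ₗ A.projectionOnto F hc) ∘ₗ (y ∘ₗ A.subtype) = x * corner hc y := rfl
  rw [h2, LinearMap.trace_mul_comm]

/-- The family of subspaces induced on a subspace. -/
abbrev flagOn (V : ι → Submodule ℂ E) (A : Submodule ℂ E) : ι → Submodule ℂ A :=
  fun i => (V i).comap A.subtype

variable (B V) in
/-- An orthogonal decomposition of `E` compatible with the flag. -/
structure OrthDecomp (A F : Submodule ℂ E) : Prop where
  compl : IsCompl A F
  orth : ∀ a ∈ A, ∀ f ∈ F, B a f = 0
  flag : ∀ i, ∀ v ∈ V i, ∃ a ∈ A, ∃ f ∈ F, a ∈ V i ∧ f ∈ V i ∧ a + f = v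

variable (B V) in
/-- An orthogonal decomposition of `E` compatible with the flag and with the form `tr (y ·)`
and its stabiliser. -/
structure Splits (y : End ℂ E) (A F : Submodule ℂ E) : Prop extends OrthDecomp B V A F where
  trace : ∀ z, Par B V z → (∀ a ∈ A, z a ∈ F) → (∀ f ∈ F, z f ∈ A) →
    LinearMap.trace ℂ E (y * z) = 0
  left : ∀ g ∈ grpStab B V y, ∀ a ∈ A, g a ∈ A
  right : ∀ g ∈ grpStab B V y, ∀ a ∈ F, g a ∈ F

theorem OrthDecomp.symm (D : Datum B V) (h : OrthDecomp B V A F) : OrthDecomp B V F A :=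
  ⟨h.compl.symm, fun a ha f hf => by rw [D.symm]; exact h.orth f hf a ha, fun i v hv => by
    obtain ⟨a, ha, f, hf, ha', hf', rfl⟩ := h.flag i v hv
    exact ⟨f, hf, a, ha, hf', ha', add_comm _ _⟩⟩

theorem Splits.symm {y : End ℂ E} (D : Datum B V) (h : Splits B V y A F) : Splits B V y F A :=
  ⟨h.toOrthDecomp.symm D, fun z hz h1 h2 => h.trace z hz h2 h1, h.right, h.left⟩

theorem mem_of_orth [FiniteDimensional ℂ E] (D : Datum B V) (h : OrthDecomp B V A F) {v : E}
    (hv : ∀ a ∈ A, B a v = 0) : v ∈ F := by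
  obtain ⟨a, ha, f, hf, rfl⟩ :=
    Submodule.mem_sup.1 (h.compl.sup_eq_top ▸ Submodule.mem_top (x := v))
  have : a = 0 := D.nondeg a fun w => by
    obtain ⟨a', ha', f', hf', rfl⟩ :=
      Submodule.mem_sup.1 (h.compl.sup_eq_top ▸ Submodule.mem_top (x := w))
    have h1 := hv a' ha'
    rw [map_add, h.orth a' ha' f hf, add_zero] at h1
    rw [map_add, h.orth a ha f' hf', add_zero, D.symm, h1]
  rw [this, zero_add]
  exact hf

theorem OrthDecomp.right_stable [FiniteDimensional ℂ E] (D : Datum B V) (h : OrthDecomp B V A F)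
    {y : End ℂ E} (hl : ∀ g ∈ grpStab B V y, ∀ a ∈ A, g a ∈ A) :
    ∀ g ∈ grpStab B V y, ∀ a ∈ F, g a ∈ F := by
  intro g hg a ha
  refine mem_of_orth D h fun b hb => ?_
  rw [← (inv_mem hg).1.1]
  rw [show g⁻¹ (g a) = a from g.symm_apply_apply a]
  exact h.orth _ (hl _ (inv_mem hg) b hb) a ha

theorem OrthDecomp.datum (D : Datum B V) (h : OrthDecomp B V A F) :
    Datum (B.restrict A) (flagOn V A) where
  symm v w := D.symm v w
  nondeg v hv := by
    refine Subtype.ext (D.nondeg v fun w => ?_)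
    obtain ⟨a', ha', f', hf', rfl⟩ :=
      Submodule.mem_sup.1 (h.compl.sup_eq_top ▸ Submodule.mem_top (x := w))
    rw [map_add, h.orth v v.2 f' hf', add_zero]
    exact hv ⟨a', ha'⟩
  isotropic i v hv w hw := D.isotropic i v hv w hw

section Decomp
variable (D : Datum B V) (h : OrthDecomp B V A F)
include D h

theorem OrthDecomp.left_mem {i : ι} {a f : E} (ha : a ∈ A) (hf : f ∈ F) (hv : a + f ∈ V i) :
    a ∈ V i ∧ f ∈ V i := by
  obtain ⟨a', ha', f', hf', h1, h2, h3⟩ := h.flag i _ hv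
  have e : a' - a = f - f' := by
    rw [sub_eq_sub_iff_add_eq_add, h3, add_comm]
  have e0 : a' - a = 0 := by
    have := Submodule.disjoint_def.1 h.compl.disjoint _ (sub_mem ha' ha)
    exact this (e ▸ sub_mem hf hf')
  rw [← sub_eq_zero.1 e0, sub_eq_zero.1 (e ▸ e0 : f - f' = 0)]
  exact ⟨h1, h2⟩

theorem OrthDecomp.corner_isSkew {x : End ℂ E} (hx : IsSkew B x) :
    IsSkew (B.restrict A) (corner h.compl x) := by
  intro v w
  have h1 := h.orth w w.2 _ (sub_corner_mem h.compl x v)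
  have h2 := h.orth v v.2 _ (sub_corner_mem h.compl x w)
  rw [map_sub, sub_eq_zero] at h1 h2
  change B (corner h.compl x v) w = -B v (corner h.compl x w)
  rw [← h2, D.symm, ← h1, D.symm, hx]

theorem OrthDecomp.corner_par {x : End ℂ E} (hx : Par B V x) :
    Par (B.restrict A) (flagOn V A) (corner h.compl x) := by
  refine ⟨h.corner_isSkew D hx.1, fun i v hv => ?_⟩
  have h1 : x v = corner h.compl x v + (x v - corner h.compl x v) := by abel
  have h2 := hx.2 i v hv
  rw [h1] at h2
  exact (h.left_mem D (Submodule.coe_mem _) (sub_corner_mem h.compl x v) h2).1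

theorem OrthDecomp.extendZero_par {x : End ℂ A} (hx : Par (B.restrict A) (flagOn V A) x) :
    Par B V (extendZero h.compl x) := by
  refine ⟨fun v w => ?_, fun i v hv => ?_⟩
  · obtain ⟨a, ha, f, hf, rfl⟩ :=
      Submodule.mem_sup.1 (h.compl.sup_eq_top ▸ Submodule.mem_top (x := v))
    obtain ⟨a', ha', f', hf', rfl⟩ :=
      Submodule.mem_sup.1 (h.compl.sup_eq_top ▸ Submodule.mem_top (x := w))
    have e : ∀ b (hb : b ∈ A), ∀ c ∈ F, extendZero h.compl x (b + c) = x ⟨b, hb⟩ :=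
      fun b hb c hc => by
        rw [map_add, extendZero_right _ _ hc, add_zero, extendZero_left' _ _ hb]
    rw [e a ha f hf, e a' ha' f' hf', map_add, LinearMap.map_add₂,
      h.orth _ (Submodule.coe_mem _) f' hf', D.symm f, h.orth _ (Submodule.coe_mem _) f hf,
      add_zero, add_zero]
    exact hx.1 ⟨a, ha⟩ ⟨a', ha'⟩
  · obtain ⟨a, ha, f, hf, h1, h2, rfl⟩ := h.flag i v hv
    rw [map_add, extendZero_right _ _ hf, add_zero, extendZero_left' _ _ ha]
    exact hx.2 i ⟨a, ha⟩ h1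

omit D in
theorem OrthDecomp.decompose (z : End ℂ E) : ∃ s : End ℂ E,
    (∀ a ∈ A, s a ∈ F) ∧ (∀ f ∈ F, s f ∈ A) ∧
    z = extendZero h.compl (corner h.compl z) +
      extendZero h.compl.symm (corner h.compl.symm z) + s := by
  refine ⟨z - (extendZero h.compl (corner h.compl z) +
      extendZero h.compl.symm (corner h.compl.symm z)), fun a ha => ?_, fun a ha => ?_, by abel⟩
  · change z a - (extendZero h.compl (corner h.compl z) a +
      extendZero h.compl.symm (corner h.compl.symm z) a) ∈ F
    rw [extendZero_right _ _ ha, extendZero_left' _ _ ha, add_zero]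
    exact sub_corner_mem h.compl z ⟨a, ha⟩
  · change z a - (extendZero h.compl (corner h.compl z) a +
      extendZero h.compl.symm (corner h.compl.symm z) a) ∈ A
    rw [extendZero_right _ _ ha, extendZero_left' _ _ ha, zero_add]
    exact sub_corner_mem h.compl.symm z ⟨a, ha⟩

/-- Compatibility with the flag makes both diagonal corners preserve the induced flags, so the
off-diagonal remainder also belongs to the parabolic subalgebra. -/
theorem OrthDecomp.decompose_par {z : End ℂ E} (hz : Par B V z) : ∃ s : End ℂ E, Par B V s ∧
    (∀ a ∈ A, s a ∈ F) ∧ (∀ f ∈ F, s f ∈ A) ∧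
    z = extendZero h.compl (corner h.compl z) +
      extendZero h.compl.symm (corner h.compl.symm z) + s := by
  obtain ⟨s, h1, h2, h3⟩ := h.decompose z
  refine ⟨s, ?_, h1, h2, h3⟩
  have : s = z - (extendZero h.compl (corner h.compl z) +
      extendZero h.compl.symm (corner h.compl.symm z)) := by
    nth_rewrite 1 [h3]; abel
  rw [this]
  exact hz.sub ((h.extendZero_par D (h.corner_par D hz)).add
    ((h.symm D).extendZero_par D ((h.symm D).corner_par D hz)))

end Decomp

/-- The automorphism `g ⊕ g'` of `E = A ⊕ F`. -/
noncomputable def glue (hc : IsCompl A F) (g : A ≃ₗ[ℂ] A) (g' : F ≃ₗ[ℂ] F) : E ≃ₗ[ℂ] E :=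
  (Submodule.prodEquivOfIsCompl A F hc).symm ≪≫ₗ (g.prodCongr g') ≪≫ₗ
    Submodule.prodEquivOfIsCompl A F hc

theorem glue_left (hc : IsCompl A F) (g : A ≃ₗ[ℂ] A) (g' : F ≃ₗ[ℂ] F) (a : A) :
    glue hc g g' a = g a := by
  simp [glue]

theorem glue_right (hc : IsCompl A F) (g : A ≃ₗ[ℂ] A) (g' : F ≃ₗ[ℂ] F) (a : F) :
    glue hc g g' a = g' a := by
  simp [glue]

theorem glue_left' (hc : IsCompl A F) (g : A ≃ₗ[ℂ] A) (g' : F ≃ₗ[ℂ] F) {a : E} (ha : a ∈ A) :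
    glue hc g g' a = g ⟨a, ha⟩ := glue_left hc g g' ⟨a, ha⟩

theorem glue_right' (hc : IsCompl A F) (g : A ≃ₗ[ℂ] A) (g' : F ≃ₗ[ℂ] F) {a : E} (ha : a ∈ F) :
    glue hc g g' a = g' ⟨a, ha⟩ := glue_right hc g g' ⟨a, ha⟩

theorem equiv_ext_of_isCompl (hc : IsCompl A F) {f g : E ≃ₗ[ℂ] E} (h1 : ∀ a : A, f a = g a)
    (h2 : ∀ a : F, f a = g a) : f = g :=
  LinearEquiv.toLinearMap_injective
    (ext_of_isCompl hc (fun a ha => h1 ⟨a, ha⟩) (fun a ha => h2 ⟨a, ha⟩))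

theorem glue_mul (hc : IsCompl A F) (g h : A ≃ₗ[ℂ] A) (g' h' : F ≃ₗ[ℂ] F) :
    glue hc (g * h) (g' * h') = glue hc g g' * glue hc h h' := by
  apply equiv_ext_of_isCompl hc <;> intro a
  · change _ = glue hc g g' (glue hc h h' a)
    rw [glue_left, glue_left, glue_left]; rfl
  · change _ = glue hc g g' (glue hc h h' a)
    rw [glue_right, glue_right, glue_right]; rfl

theorem glue_one (hc : IsCompl A F) : glue hc (1 : A ≃ₗ[ℂ] A) (1 : F ≃ₗ[ℂ] F) = 1 := by
  apply equiv_ext_of_isCompl hc <;> intro a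
  · rw [glue_left]; rfl
  · rw [glue_right]; rfl

/-- `glue` as a homomorphism. -/
noncomputable def glueHom (hc : IsCompl A F) : (A ≃ₗ[ℂ] A) × (F ≃ₗ[ℂ] F) →* (E ≃ₗ[ℂ] E) where
  toFun g := glue hc g.1 g.2
  map_one' := glue_one hc
  map_mul' _ _ := glue_mul hc _ _ _ _

theorem glue_inv (hc : IsCompl A F) (g : A ≃ₗ[ℂ] A) (g' : F ≃ₗ[ℂ] F) :
    (glue hc g g')⁻¹ = glue hc g⁻¹ g'⁻¹ :=
  (map_inv (glueHom hc) (g, g')).symm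

theorem glue_injective (hc : IsCompl A F) {g h : A ≃ₗ[ℂ] A} {g' h' : F ≃ₗ[ℂ] F}
    (e : glue hc g g' = glue hc h h') : g = h ∧ g' = h' := by
  constructor <;> ext a
  · rw [← glue_left hc g g', e, glue_left]
  · rw [← glue_right hc g g', e, glue_right]

theorem glue_sub_smul (hc : IsCompl A F) (g : A ≃ₗ[ℂ] A) (g' : F ≃ₗ[ℂ] F) (c : ℂ) :
    (glue hc g g' : End ℂ E) - c • 1 = extendZero hc ((g : End ℂ A) - c • 1) +
      extendZero hc.symm ((g' : End ℂ F) - c • 1) := by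
  apply ext_of_isCompl hc <;> intro a ha
  · change glue hc g g' a - c • a = extendZero hc ((g : End ℂ A) - c • 1) a +
      extendZero hc.symm ((g' : End ℂ F) - c • 1) a
    rw [glue_left' hc _ _ ha, extendZero_right _ _ ha, extendZero_left' _ _ ha, add_zero]; rfl
  · change glue hc g g' a - c • a = extendZero hc ((g : End ℂ A) - c • 1) a +
      extendZero hc.symm ((g' : End ℂ F) - c • 1) a
    rw [glue_right' hc _ _ ha, extendZero_right _ _ ha, extendZero_left' _ _ ha, zero_add]; rfl

theorem extendZero_mul (hc : IsCompl A F) (x z : End ℂ A) :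
    extendZero hc (x * z) = extendZero hc x * extendZero hc z := by
  apply ext_of_isCompl hc <;> intro a ha <;>
    simp [extendZero_right _ _ ha, extendZero_left' _ _ ha, extendZero_left]

theorem extendZero_mul_symm (hc : IsCompl A F) (x : End ℂ A) (z : End ℂ F) :
    extendZero hc x * extendZero hc.symm z = 0 := by
  ext a
  exact extendZero_right hc _ (extendZero_mem hc.symm z a)

theorem extendZero_mul_symm' (hc : IsCompl A F) (x : End ℂ A) (z : End ℂ F) :
    extendZero hc.symm z * extendZero hc x = 0 := extendZero_mul_symm hc.symm z x

theorem extendZero_pow (hc : IsCompl A F) (x : End ℂ A) (z : End ℂ F) (n : ℕ) :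
    (extendZero hc x + extendZero hc.symm z) ^ (n + 1) =
      extendZero hc (x ^ (n + 1)) + extendZero hc.symm (z ^ (n + 1)) := by
  induction n with
  | zero => simp
  | succ n ih =>
    rw [pow_succ, ih, mul_add, add_mul, add_mul, extendZero_mul_symm, extendZero_mul_symm',
      ← extendZero_mul, ← extendZero_mul, ← pow_succ, ← pow_succ, add_zero, zero_add]

theorem extendZero_zero (hc : IsCompl A F) : extendZero hc 0 = 0 := by
  ext a; rfl

theorem extendZero_add (hc : IsCompl A F) (x z : End ℂ A) :
    extendZero hc (x + z) = extendZero hc x + extendZero hc z := by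
  ext a; simp [extendZero]

theorem extendZero_sub (hc : IsCompl A F) (x z : End ℂ A) :
    extendZero hc (x - z) = extendZero hc x - extendZero hc z := by
  ext a; simp [extendZero]

theorem isNilpotent_extendZero_iff (hc : IsCompl A F) (x : End ℂ A) (z : End ℂ F) :
    IsNilpotent (extendZero hc x + extendZero hc.symm z) ↔ IsNilpotent x ∧ IsNilpotent z := by
  constructor
  · rintro ⟨n, hn⟩
    have h1 : extendZero hc (x ^ (n + 1)) + extendZero hc.symm (z ^ (n + 1)) = 0 := by
      rw [← extendZero_pow, pow_succ, hn, zero_mul]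
    constructor <;> refine ⟨n + 1, ?_⟩ <;> ext a <;> have h2 := LinearMap.congr_fun h1 (a : E)
    · rw [LinearMap.add_apply, extendZero_left, extendZero_right _ _ a.2, add_zero] at h2
      rw [h2]; rfl
    · rw [LinearMap.add_apply, extendZero_left, extendZero_right _ _ a.2, zero_add] at h2
      rw [h2]; rfl
  · rintro ⟨⟨n, hn⟩, ⟨m, hm⟩⟩
    refine ⟨n + m + 1, ?_⟩
    rw [extendZero_pow, add_assoc n, pow_add, hn, zero_mul, show n + (m + 1) = m + (n + 1) by ring,
      pow_add, hm, zero_mul, extendZero_zero, extendZero_zero, add_zero]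

/-- The scalar is kept general so that c = 1 and c = -1 cover the two alternatives of `SignUnip`. -/
theorem isNilpotent_glue_iff (hc : IsCompl A F) (g : A ≃ₗ[ℂ] A) (g' : F ≃ₗ[ℂ] F) (c : ℂ) :
    IsNilpotent ((glue hc g g' : End ℂ E) - c • 1) ↔
      IsNilpotent ((g : End ℂ A) - c • 1) ∧ IsNilpotent ((g' : End ℂ F) - c • 1) := by
  rw [glue_sub_smul, isNilpotent_extendZero_iff]

theorem unip_glue_iff (hc : IsCompl A F) (g : A ≃ₗ[ℂ] A) (g' : F ≃ₗ[ℂ] F) :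
    Unip (glue hc g g') ↔ Unip g ∧ Unip g' := by
  have := isNilpotent_glue_iff hc g g' 1
  simp only [one_smul] at this
  exact this

theorem unip_one {W : Type*} [AddCommGroup W] [Module ℂ W] : Unip (1 : W ≃ₗ[ℂ] W) :=
  ⟨1, by rw [pow_one]; exact sub_self _⟩

theorem SignUnip.of_glue (hc : IsCompl A F) {g : A ≃ₗ[ℂ] A} {g' : F ≃ₗ[ℂ] F}
    (h : SignUnip (glue hc g g')) : SignUnip g := by
  rcases h with h | h
  · have := isNilpotent_glue_iff hc g g' 1
    simp only [one_smul] at this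
    exact Or.inl (this.1 h).1
  · have := isNilpotent_glue_iff hc g g' (-1)
    have e : ∀ {W : Type _} [AddCommGroup W] [Module ℂ W] (f : End ℂ W), f - (-1 : ℂ) • 1 = f + 1 :=
      fun f => by rw [neg_smul, one_smul, sub_neg_eq_add]
    rw [e, e, e] at this
    exact Or.inr (this.1 h).1

end Splitting


/-! ### Stabilisers, nilpotent type and reductivity under a splitting -/

section SplittingStabilizers

variable {E : Type*} [AddCommGroup E] [Module ℂ E] [FiniteDimensional ℂ E] {ι : Type*}
  {B : BilinForm ℂ E} {V : ι → Submodule ℂ E} {A F : Submodule ℂ E} {y : End ℂ E}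

/-- The group stabiliser preserves both summands, hence so does the Lie stabiliser by
`lieStab_stable`: its elements are block diagonal. -/
theorem Splits.eq_add_extendZero (h : Splits B V y A F) {x : End ℂ E} (hx : x ∈ lieStab B V y) :
    x = extendZero h.compl (corner h.compl x) +
      extendZero h.compl.symm (corner h.compl.symm x) := by
  apply ext_of_isCompl h.compl <;> intro a ha
  · rw [LinearMap.add_apply, extendZero_right _ _ ha, add_zero, extendZero_left' _ _ ha,
      corner_apply_of_mem _ (lieStab_stable hx h.left a ha)]
  · rw [LinearMap.add_apply, extendZero_right _ _ ha, zero_add, extendZero_left' _ _ ha,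
      corner_apply_of_mem _ (lieStab_stable hx h.right a ha)]

theorem Splits.corner_mem_lieStab (D : Datum B V) (h : Splits B V y A F) {x : End ℂ E}
    (hx : x ∈ lieStab B V y) :
    corner h.compl x ∈ lieStab (B.restrict A) (flagOn V A) (corner h.compl y) := by
  refine ⟨h.corner_par D hx.1, fun z hz => ?_⟩
  rw [← trace_mul_extendZero]
  have := hx.2 _ (h.extendZero_par D hz)
  convert this using 3
  have e := h.eq_add_extendZero hx
  conv_rhs => rw [e]
  rw [add_mul, mul_add, extendZero_mul_symm, extendZero_mul_symm', add_zero, add_zero,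
    ← extendZero_mul, ← extendZero_mul, ← extendZero_sub]

/-- The commutator of an element supported on A with an off-diagonal one is off-diagonal, where the
form vanishes by the field `trace`. Only the A-corner of the test element matters. -/
theorem Splits.extendZero_mem_lieStab (D : Datum B V) (h : Splits B V y A F) {x : End ℂ A}
    (hx : x ∈ lieStab (B.restrict A) (flagOn V A) (corner h.compl y)) :
    extendZero h.compl x ∈ lieStab B V y := by
  have hP := h.extendZero_par D hx.1
  refine ⟨hP, fun z hz => ?_⟩
  obtain ⟨s, hs, h1, h2, h3⟩ := h.decompose_par D hz
  have e : extendZero h.compl x * z - z * extendZero h.compl x =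
      extendZero h.compl (x * corner h.compl z - corner h.compl z * x) +
      (extendZero h.compl x * s - s * extendZero h.compl x) := by
    conv_lhs => rw [h3]
    rw [mul_add, mul_add, add_mul, add_mul, extendZero_mul_symm, extendZero_mul_symm', add_zero,
      add_zero, ← extendZero_mul, ← extendZero_mul, extendZero_sub]
    abel
  rw [e, mul_add, map_add, trace_mul_extendZero, hx.2 _ (h.corner_par D hz), zero_add]
  refine h.trace _ (hP.comm hs) (fun a ha => ?_) (fun a ha => ?_)
  · change extendZero h.compl x (s a) - s (extendZero h.compl x a) ∈ F
    rw [extendZero_right _ _ (h1 a ha), zero_sub]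
    exact neg_mem (h1 _ (extendZero_mem _ _ _))
  · change extendZero h.compl x (s a) - s (extendZero h.compl x a) ∈ A
    rw [extendZero_right _ _ ha, map_zero, sub_zero]
    exact extendZero_mem _ _ _

theorem corner_add (hc : IsCompl A F) (x z : End ℂ E) :
    corner hc (x + z) = corner hc x + corner hc z := by
  ext a; simp [corner]

theorem corner_extendZero_symm (hc : IsCompl A F) (x : End ℂ A) :
    corner hc.symm (extendZero hc x) = 0 := by
  ext a
  rw [corner_apply_of_mem_right hc.symm (extendZero_mem hc x a)]; rfl

/-- The stabiliser of a form compatible with an orthogonal decomposition is a product. -/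
theorem Splits.nonempty_equiv (D : Datum B V) (h : Splits B V y A F) :
    Nonempty (lieStab B V y ≃ₗ⁅ℂ⁆
      lieStab (B.restrict A) (flagOn V A) (corner h.compl y) ×
      lieStab (B.restrict F) (flagOn V F) (corner h.compl.symm y)) := by
  have hb := fun x => (h.symm D).corner_mem_lieStab D (x := x)
  have hb' := fun x => (h.symm D).extendZero_mem_lieStab D (x := x)
  let f : (lieStab (B.restrict A) (flagOn V A) (corner h.compl y) ×
      lieStab (B.restrict F) (flagOn V F) (corner h.compl.symm y)) →ₗ⁅ℂ⁆ lieStab B V y :=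
    { toFun := fun x => ⟨extendZero h.compl x.1 + extendZero h.compl.symm x.2,
        add_mem (h.extendZero_mem_lieStab D x.1.2) (hb' _ x.2.2)⟩
      map_add' := fun x z => Subtype.ext (by
        change extendZero h.compl (x.1.1 + z.1.1) + extendZero h.compl.symm (x.2.1 + z.2.1) =
          (extendZero h.compl x.1 + extendZero h.compl.symm x.2) +
          (extendZero h.compl z.1 + extendZero h.compl.symm z.2)
        rw [extendZero_add, extendZero_add]; abel)
      map_smul' := fun c x => Subtype.ext (by
        change extendZero h.compl (c • x.1.1) + extendZero h.compl.symm (c • x.2.1) =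
          c • (extendZero h.compl x.1 + extendZero h.compl.symm x.2)
        ext a; simp [extendZero])
      map_lie' := by
        intro x z
        apply Subtype.ext
        change extendZero h.compl (x.1.1 * z.1.1 - z.1.1 * x.1.1) +
            extendZero h.compl.symm (x.2.1 * z.2.1 - z.2.1 * x.2.1) =
          (extendZero h.compl x.1 + extendZero h.compl.symm x.2) *
          (extendZero h.compl z.1 + extendZero h.compl.symm z.2) -
          (extendZero h.compl z.1 + extendZero h.compl.symm z.2) *
          (extendZero h.compl x.1 + extendZero h.compl.symm x.2)
        simp only [mul_add, add_mul, extendZero_mul_symm, extendZero_mul_symm', extendZero_sub,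
          extendZero_mul]
        abel }
  have key : ∀ x, f x = 0 → x = 0 := by
    intro x hx
    have hx' : extendZero h.compl x.1.1 + extendZero h.compl.symm x.2.1 = 0 :=
      congrArg Subtype.val hx
    have h1 := congrArg (corner h.compl) hx'
    have h2 := congrArg (corner h.compl.symm) hx'
    have e0 : ∀ {A F : Submodule ℂ E} (hc : IsCompl A F), corner hc 0 = 0 := fun hc => by
      ext a; simp [corner]
    rw [corner_add, corner_extendZero, corner_extendZero_symm h.compl.symm, add_zero, e0] at h1
    rw [corner_add, corner_extendZero, corner_extendZero_symm h.compl, zero_add, e0] at h2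
    exact Prod.ext (Subtype.ext h1) (Subtype.ext h2)
  have hf : Function.Bijective f := by
    refine ⟨fun x z e => ?_, fun x => ?_⟩
    · have := key (x - z) (by rw [map_sub, e, sub_self])
      exact sub_eq_zero.1 this
    · exact ⟨(⟨_, h.corner_mem_lieStab D x.2⟩, ⟨_, hb _ x.2⟩),
        Subtype.ext (h.eq_add_extendZero x.2).symm⟩
  exact ⟨(LieEquiv.ofBijective f hf).symm⟩

theorem Splits.nilType_corner (D : Datum B V) (h : Splits B V y A F) (hN : NilType B V y) :
    NilType (B.restrict A) (flagOn V A) (corner h.compl y) := fun x hx => by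
  rw [← trace_mul_extendZero]
  exact hN _ (h.extendZero_mem_lieStab D hx)

theorem Splits.nilType (D : Datum B V) (h : Splits B V y A F)
    (h1 : NilType (B.restrict A) (flagOn V A) (corner h.compl y))
    (h2 : NilType (B.restrict F) (flagOn V F) (corner h.compl.symm y)) : NilType B V y := by
  intro x hx
  rw [h.eq_add_extendZero hx, mul_add, map_add, trace_mul_extendZero, trace_mul_extendZero,
    h1 _ (h.corner_mem_lieStab D hx), h2 _ ((h.symm D).corner_mem_lieStab D hx), add_zero]

theorem conj_extendZero (hc : IsCompl A F) (g : A ≃ₗ[ℂ] A) (g' : F ≃ₗ[ℂ] F) (z : End ℂ A) :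
    (glue hc g g').symm.conj (extendZero hc z) = extendZero hc (g.symm.conj z) := by
  have hi : (glue hc g g').symm = glue hc g⁻¹ g'⁻¹ := glue_inv hc g g'
  apply ext_of_isCompl hc <;> intro a ha
  · rw [symm_conj_apply', glue_left' _ _ _ ha, extendZero_left, hi, glue_left,
      extendZero_left' _ _ ha]
    rfl
  · rw [symm_conj_apply', glue_right' _ _ _ ha, extendZero_right _ _ (Submodule.coe_mem _),
      map_zero, extendZero_right _ _ ha]

theorem glue_symm (hc : IsCompl A F) (g : A ≃ₗ[ℂ] A) (g' : F ≃ₗ[ℂ] F) :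
    glue hc g g' = glue hc.symm g' g := by
  apply equiv_ext_of_isCompl hc <;> intro a
  · rw [glue_left, glue_right]
  · rw [glue_right, glue_left]

theorem conj_extendZero_symm (hc : IsCompl A F) (g : A ≃ₗ[ℂ] A) (g' : F ≃ₗ[ℂ] F) (z : End ℂ F) :
    (glue hc g g').symm.conj (extendZero hc.symm z) = extendZero hc.symm (g'.symm.conj z) := by
  rw [glue_symm, conj_extendZero]

theorem OrthDecomp.glue_isFlagIsometry (D : Datum B V) (h : OrthDecomp B V A F)
    {g : A ≃ₗ[ℂ] A} {g' : F ≃ₗ[ℂ] F} (hg : IsFlagIsometry (B.restrict A) (flagOn V A) g)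
    (hg' : IsFlagIsometry (B.restrict F) (flagOn V F) g') :
    IsFlagIsometry B V (glue h.compl g g') := by
  have e : ∀ a (ha : a ∈ A) f (hf : f ∈ F),
      glue h.compl g g' (a + f) = g ⟨a, ha⟩ + g' ⟨f, hf⟩ := fun a ha f hf => by
    rw [map_add, glue_left' _ _ _ ha, glue_right' _ _ _ hf]
  refine ⟨fun v w => ?_, fun i v => ?_⟩
  · obtain ⟨a, ha, f, hf, rfl⟩ :=
      Submodule.mem_sup.1 (h.compl.sup_eq_top ▸ Submodule.mem_top (x := v))
    obtain ⟨a', ha', f', hf', rfl⟩ :=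
      Submodule.mem_sup.1 (h.compl.sup_eq_top ▸ Submodule.mem_top (x := w))
    have h1 : B (g ⟨a, ha⟩) (g ⟨a', ha'⟩) = B a a' := hg.1 _ _
    have h2 : B (g' ⟨f, hf⟩) (g' ⟨f', hf'⟩) = B f f' := hg'.1 _ _
    rw [e a ha f hf, e a' ha' f' hf', map_add, LinearMap.map_add₂, LinearMap.map_add₂, h1, h2,
      h.orth _ (Submodule.coe_mem _) _ (Submodule.coe_mem _), D.symm (g' _),
      h.orth _ (Submodule.coe_mem _) _ (Submodule.coe_mem _), map_add, LinearMap.map_add₂,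
      LinearMap.map_add₂, h.orth a ha f' hf', D.symm f a', h.orth a' ha' f hf]
  · obtain ⟨a, ha, f, hf, rfl⟩ :=
      Submodule.mem_sup.1 (h.compl.sup_eq_top ▸ Submodule.mem_top (x := v))
    rw [e a ha f hf]
    constructor <;> intro hv
    · obtain ⟨h1, h2⟩ := h.left_mem D (Submodule.coe_mem _) (Submodule.coe_mem _) hv
      exact add_mem ((hg.2 i ⟨a, ha⟩).1 h1) ((hg'.2 i ⟨f, hf⟩).1 h2)
    · obtain ⟨h1, h2⟩ := h.left_mem D ha hf hv
      exact add_mem ((hg.2 i ⟨a, ha⟩).2 h1) ((hg'.2 i ⟨f, hf⟩).2 h2)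

theorem Splits.glue_mem (D : Datum B V) (h : Splits B V y A F)
    {g : A ≃ₗ[ℂ] A} {g' : F ≃ₗ[ℂ] F}
    (hg : g ∈ grpStab (B.restrict A) (flagOn V A) (corner h.compl y))
    (hg' : g' ∈ grpStab (B.restrict F) (flagOn V F) (corner h.compl.symm y)) :
    glue h.compl g g' ∈ grpStab B V y := by
  have hI := h.glue_isFlagIsometry D hg.1 hg'.1
  refine ⟨hI, fun z hz => ?_⟩
  obtain ⟨s, hs, h1, h2, h3⟩ := h.decompose_par D hz
  have hi : (glue h.compl g g').symm = glue h.compl g⁻¹ g'⁻¹ := glue_inv _ g g'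
  have h4 : LinearMap.trace ℂ E (y * (glue h.compl g g').symm.conj s) = 0 := by
    refine h.trace _ (hI.symm.conj hs) (fun a ha => ?_) (fun a ha => ?_)
    · rw [symm_conj_apply', glue_left' _ _ _ ha, hi,
        glue_right' _ _ _ (h1 _ (Submodule.coe_mem _))]
      exact Submodule.coe_mem _
    · rw [symm_conj_apply', glue_right' _ _ _ ha, hi,
        glue_left' _ _ _ (h2 _ (Submodule.coe_mem _))]
      exact Submodule.coe_mem _
  conv_lhs => rw [h3]
  conv_rhs => rw [h3]
  rw [map_add, map_add, conj_extendZero, conj_extendZero_symm, mul_add, mul_add, mul_add, mul_add,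
    map_add, map_add, map_add, map_add, h4, h.trace s hs h1 h2, trace_mul_extendZero,
    trace_mul_extendZero, trace_mul_extendZero, trace_mul_extendZero,
    hg.2 _ (h.corner_par D hz), hg'.2 _ ((h.symm D).corner_par D hz)]

theorem exists_restrict {g : E ≃ₗ[ℂ] E} (h1 : ∀ a ∈ A, g a ∈ A) (h2 : ∀ a ∈ A, g.symm a ∈ A) :
    ∃ g' : A ≃ₗ[ℂ] A, ∀ a : A, (g' a : E) = g a :=
  ⟨LinearEquiv.ofLinearMap ((g : E →ₗ[ℂ] E).restrict h1) ((g.symm : E →ₗ[ℂ] E).restrict h2)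
    (by ext a; exact g.apply_symm_apply a) (by ext a; exact g.symm_apply_apply a), fun a => rfl⟩

theorem Splits.exists_eq_glue (D : Datum B V) (h : Splits B V y A F) {k : E ≃ₗ[ℂ] E}
    (hk : k ∈ grpStab B V y) :
    ∃ g ∈ grpStab (B.restrict A) (flagOn V A) (corner h.compl y),
    ∃ g' ∈ grpStab (B.restrict F) (flagOn V F) (corner h.compl.symm y),
      k = glue h.compl g g' := by
  obtain ⟨g, hg⟩ := exists_restrict (h.left k hk) (h.left _ (inv_mem hk))
  obtain ⟨g', hg'⟩ := exists_restrict (h.right k hk) (h.right _ (inv_mem hk))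
  have hkg : k = glue h.compl g g' := by
    apply equiv_ext_of_isCompl h.compl <;> intro a
    · rw [glue_left, hg]
    · rw [glue_right, hg']
  refine ⟨g, ⟨⟨fun v w => ?_, fun i v => ?_⟩, fun z hz => ?_⟩,
    g', ⟨⟨fun v w => ?_, fun i v => ?_⟩, fun z hz => ?_⟩, hkg⟩
  · change B (g v) (g w) = B v w
    rw [hg, hg, hk.1.1]
  · change (g v : E) ∈ V i ↔ (v : E) ∈ V i
    rw [hg, hk.1.2]
  · have := hk.2 _ (h.extendZero_par D hz)
    rwa [hkg, conj_extendZero, trace_mul_extendZero, trace_mul_extendZero] at this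
  · change B (g' v) (g' w) = B v w
    rw [hg', hg', hk.1.1]
  · change (g' v : E) ∈ V i ↔ (v : E) ∈ V i
    rw [hg', hk.1.2]
  · have := hk.2 _ ((h.symm D).extendZero_par D hz)
    rwa [hkg, conj_extendZero_symm, trace_mul_extendZero, trace_mul_extendZero] at this

/-- The group stabiliser is the product of the stabilisers of the corners. A normal unipotent
subgroup of one factor, extended by the identity, is therefore normal and unipotent in the whole. -/
theorem Splits.orthReductive_corner (D : Datum B V) (h : Splits B V y A F)
    (hR : OrthReductive B V y) :
    OrthReductive (B.restrict A) (flagOn V A) (corner h.compl y) := by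
  intro N hN hnorm hu
  have hmap := hR ((N.prod ⊥).map (glueHom h.compl)) ?_ ?_ ?_
  · rw [eq_bot_iff]
    intro g hg
    have h1 : glue h.compl g 1 ∈ (N.prod ⊥).map (glueHom h.compl) :=
      ⟨(g, 1), ⟨hg, Subgroup.mem_bot.2 rfl⟩, rfl⟩
    rw [hmap, Subgroup.mem_bot, ← glue_one h.compl] at h1
    exact Subgroup.mem_bot.2 (glue_injective _ h1).1
  · rintro _ ⟨⟨g, g'⟩, ⟨hg, hg'⟩, rfl⟩
    obtain rfl : g' = 1 := Subgroup.mem_bot.1 hg'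
    exact h.glue_mem D (hN hg) (one_mem _)
  · rintro k hk _ ⟨⟨g, g'⟩, ⟨hg, hg'⟩, rfl⟩
    obtain rfl : g' = 1 := Subgroup.mem_bot.1 hg'
    obtain ⟨m, hm, m', hm', rfl⟩ := h.exists_eq_glue D hk
    refine ⟨(m * g * m⁻¹, 1), ⟨hnorm m hm g hg, one_mem _⟩, ?_⟩
    change glue h.compl (m * g * m⁻¹) 1 = glue h.compl m m' * glue h.compl g 1 *
      (glue h.compl m m')⁻¹
    rw [glue_inv, ← glue_mul, ← glue_mul, mul_one, mul_inv_cancel]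
  · rintro _ ⟨⟨g, g'⟩, ⟨hg, hg'⟩, rfl⟩
    obtain rfl : g' = 1 := Subgroup.mem_bot.1 hg'
    exact (unip_glue_iff _ _ _).2 ⟨hu g hg, unip_one⟩

/-- Commutators need only be tested against elements trivial on the other summand. Being unipotent
up to sign on E, they are so on each summand, which is why this notion of rigidity passes to
products. -/
theorem Splits.rigidUnip (D : Datum B V) (h : Splits B V y A F)
    (h1 : RigidUnip (B.restrict A) (flagOn V A) (corner h.compl y))
    (h2 : RigidUnip (B.restrict F) (flagOn V F) (corner h.compl.symm y)) : RigidUnip B V y := by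
  intro k hk hku hc
  obtain ⟨g, hg, g', hg', rfl⟩ := h.exists_eq_glue D hk
  rw [unip_glue_iff] at hku
  have e1 : g = 1 := by
    refine h1 g hg hku.1 fun m hm hmu => ?_
    have := hc _ (h.glue_mem D hm (one_mem _)) ((unip_glue_iff _ _ _).2 ⟨hmu, unip_one⟩)
    rw [glue_inv, glue_inv, ← glue_mul, ← glue_mul, ← glue_mul] at this
    exact this.of_glue
  have e2 : g' = 1 := by
    refine h2 g' hg' hku.2 fun m hm hmu => ?_
    have := hc _ (h.glue_mem D (one_mem _) hm) ((unip_glue_iff _ _ _).2 ⟨unip_one, hmu⟩)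
    rw [glue_inv, glue_inv, ← glue_mul, ← glue_mul, ← glue_mul, glue_symm] at this
    exact this.of_glue
  rw [e1, e2, glue_one]

end SplittingStabilizers


/-! ### Criteria for a splitting, sign summands, and the radical on a flag member -/

section SplittingCriteria

variable {E : Type*} [AddCommGroup E] [Module ℂ E] [FiniteDimensional ℂ E] {ι : Type*}
  {B : BilinForm ℂ E} {V : ι → Submodule ℂ E} {A F : Submodule ℂ E} {y : End ℂ E}

theorem trace_eq_zero_of_isNilpotent {W : Type*} [AddCommGroup W] [Module ℂ W]
    [FiniteDimensional ℂ W] {f : End ℂ W} (hf : IsNilpotent f) : LinearMap.trace ℂ W f = 0 :=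
  (LinearMap.isNilpotent_trace_of_isNilpotent hf).eq_zero

theorem trace_eq_corner_add_corner (hc : IsCompl A F) (f : End ℂ E) :
    LinearMap.trace ℂ E f = LinearMap.trace ℂ A (corner hc f) +
      LinearMap.trace ℂ F (corner hc.symm f) := by
  have h1 := trace_mul_extendZero hc f 1
  have h2 := trace_mul_extendZero hc.symm f 1
  rw [mul_one] at h1 h2
  rw [← h1, ← h2, ← map_add, ← mul_add]
  congr 1
  have : extendZero hc 1 + extendZero hc.symm 1 = 1 := by
    apply ext_of_isCompl hc <;> intro a ha
    · rw [LinearMap.add_apply, extendZero_left' _ _ ha, extendZero_right _ _ ha, add_zero]; rfl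
    · rw [LinearMap.add_apply, extendZero_left' _ _ ha, extendZero_right _ _ ha, zero_add]; rfl
  rw [this, mul_one]

theorem OrthDecomp.form_corner (h : OrthDecomp B V A F) (hs : ∀ v w, B v w = B w v) (f : End ℂ E)
    (a b : A) : B (corner h.compl f a) b = B (f a) b := by
  have h1 := h.orth b b.2 _ (sub_corner_mem h.compl f a)
  rw [hs, map_sub, LinearMap.sub_apply, sub_eq_zero] at h1
  exact h1.symm

/-- The trace of `y z`, for `z` exchanging `A` and `F`, vanishes as soon as the compression
of `y z` to `A` is nilpotent. -/
theorem OrthDecomp.trace_swap_eq_zero (D : Datum B V) (h : OrthDecomp B V A F) (hy : IsSkew B y)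
    {z : End ℂ E} (hz : IsSkew B z) (h1 : ∀ a ∈ A, z a ∈ F) (h2 : ∀ f ∈ F, z f ∈ A)
    (hn : IsNilpotent (corner h.compl (y * z))) : LinearMap.trace ℂ E (y * z) = 0 := by
  have DA := h.datum D
  rw [trace_eq_corner_add_corner h.compl, trace_eq_zero_of_isNilpotent hn, zero_add]
  -- The F-part of the trace of yz is the trace of n, the composite of the A → F block of y with z.
  -- With respect to B the map n is adjoint to the A-corner of yz, so it is nilpotent as well.
  let n : End ℂ A := (A.projectionOnto F h.compl ∘ₗ z ∘ₗ F.subtype) ∘ₗ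
    (F.projectionOnto A h.compl.symm ∘ₗ y ∘ₗ A.subtype)
  have e : LinearMap.trace ℂ F (corner h.compl.symm (y * z)) = LinearMap.trace ℂ A n := by
    rw [LinearMap.trace_comp_comm']
    congr 1
    ext f
    change (F.projectionOnto A h.compl.symm (y (z f)) : E) =
      (F.projectionOnto A h.compl.symm (y (A.projectionOnto F h.compl (z f))) : E)
    rw [Submodule.projectionOnto_apply_of_mem_left h.compl (h2 f f.2)]
  rw [e]
  apply trace_eq_zero_of_isNilpotent
  have adj : ∀ a b : A, B (n a) b = B a (corner h.compl (y * z) b) := fun a b => by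
    have e1 : (n a : E) = z (F.projectionOnto A h.compl.symm (y a)) :=
      by
        change ((A.projectionOnto F h.compl (z (F.projectionOnto A h.compl.symm (y a))) : A) : E)
          = _
        rw [Submodule.projectionOnto_apply_of_mem_left h.compl (h2 _ (Submodule.coe_mem _))]
    rw [e1, hz, D.symm a, h.form_corner D.symm]
    have e2 : B (F.projectionOnto A h.compl.symm (y a)) (z b) = B (y a) (z b) := by
      have := h.orth _ ((Submodule.projectionOnto_apply_eq_zero_iff h.compl.symm
        (x := y a - F.projectionOnto A h.compl.symm (y a))).1 (by
          rw [map_sub, Submodule.projectionOnto_apply_left, sub_self])) _ (h1 b b.2)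
      rw [map_sub, LinearMap.sub_apply, sub_eq_zero] at this
      exact this.symm
    rw [e2, hy a (z b), neg_neg, D.symm]
    rfl
  obtain ⟨k, hk⟩ := hn
  refine ⟨k, ?_⟩
  have adjk : ∀ j, ∀ a b : A, B ((n ^ j) a) b = B a ((corner h.compl (y * z) ^ j) b) := by
    intro j
    induction j with
    | zero => intro a b; simp
    | succ j ih =>
      intro a b
      rw [pow_succ, Module.End.mul_apply, ih, adj, ← Module.End.mul_apply, ← pow_succ']
  ext a
  have : (n ^ k) a = 0 := DA.nondeg _ fun b => by
    change B ((n ^ k) a) b = 0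
    rw [adjk, hk, LinearMap.zero_apply, Submodule.coe_zero, map_zero]
  rw [this]; rfl

/-- A splitting criterion, for a summand with a Lagrangian subspace `L`. -/
theorem OrthDecomp.splits_of_lagrangian (D : Datum B V) (h : OrthDecomp B V A F)
    (hy : IsSkew B y) (hst : ∀ g ∈ grpStab B V y, ∀ a ∈ A, g a ∈ A) {L : Submodule ℂ E}
    (hLA : L ≤ A) (hyL : ∀ l ∈ L, y l ∈ A) (hL : ∀ a ∈ A, (∀ l ∈ L, B l a = 0) → a ∈ L)
    (ha : ∀ z, Par B V z → (∀ a ∈ A, z a ∈ F) → (∀ f ∈ F, z f ∈ A) →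
      ∀ l ∈ L, ∀ a ∈ A, B (y (z l)) a = 0) : Splits B V y A F where
  toOrthDecomp := h
  left := hst
  right := h.right_stable D hst
  trace z hz h1 h2 := by
    refine h.trace_swap_eq_zero D hy hz.1 h1 h2 ⟨2, ?_⟩
    have DA := h.datum D
    ext a
    rw [pow_two, Module.End.mul_apply]
    -- For a in A, za lies in F and yL in A, so y(za) is orthogonal to L: the corner of yz maps A
    -- into L. By hypothesis it kills L, so its square is zero.
    have hm : ((corner h.compl (y * z) a : A) : E) ∈ L := by
      refine hL _ (Submodule.coe_mem _) fun l hl => ?_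
      rw [D.symm]
      refine (h.form_corner D.symm (y * z) a ⟨l, hLA hl⟩).trans ?_
      change B (y (z a)) l = 0
      rw [hy, D.symm, h.orth _ (hyL l hl) _ (h1 a a.2), neg_zero]
    have : corner h.compl (y * z) (corner h.compl (y * z) a) = 0 := DA.nondeg _ fun b => by
      refine (h.form_corner D.symm _ _ _).trans ?_
      exact ha z hz h1 h2 _ hm b b.2
    rw [this]; rfl

/-- If the stabiliser acts on the second summand by signs, this summand does not contribute. -/
theorem Splits.of_sign (D : Datum B V) (h : Splits B V y A F)
    (hsg : ∀ g ∈ grpStab B V y, (∀ f ∈ F, g f = f) ∨ (∀ f ∈ F, g f = -f)) :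
    (∀ x ∈ lieStab (B.restrict F) (flagOn V F) (corner h.compl.symm y), x = 0) ∧
      RigidUnip (B.restrict F) (flagOn V F) (corner h.compl.symm y) := by
  constructor
  · intro x hx
    have h1 := lieStab_apply_eq_zero ((h.symm D).extendZero_mem_lieStab D hx) h.right
      (fun g hg v hv => by rcases hsg g hg with h3 | h3 <;> rw [h3 v hv]
                           · rw [h3 v hv]
                           · rw [map_neg, h3 v hv, neg_neg])
    ext f
    rw [← extendZero_left h.compl.symm, h1 f f.2]; rfl
  · intro g hg hu _
    have h1 := h.glue_mem D (one_mem _) hg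
    rcases hsg _ h1 with h2 | h2
    · ext f
      rw [← glue_right h.compl 1 g, h2 f f.2]; rfl
    -- A unipotent map equal to -1 on F forces F = 0.
    · have h3 : (g : End ℂ F) - 1 = (-2 : ℂ) • 1 := by
        ext f
        change (g f : E) - f = (-2 : ℂ) • (f : E)
        rw [← glue_right h.compl 1 g, h2 f f.2]; module
      obtain ⟨k, hk⟩ := hu
      rw [h3, smul_pow, one_pow] at hk
      ext f
      have h4 := congrArg Subtype.val (LinearMap.congr_fun hk f)
      have h5 : (f : E) = 0 :=
        (smul_eq_zero.1 (h4 : ((-2 : ℂ) ^ k) • (f : E) = 0)).resolve_left (by simp)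
      obtain rfl : f = 0 := Subtype.ext h5
      rw [map_zero, map_zero]

theorem Splits.nonempty_equiv_left (D : Datum B V) (h : Splits B V y A F)
    (hsg : ∀ g ∈ grpStab B V y, (∀ f ∈ F, g f = f) ∨ (∀ f ∈ F, g f = -f)) :
    Nonempty (lieStab B V y ≃ₗ⁅ℂ⁆
      lieStab (B.restrict A) (flagOn V A) (corner h.compl y)) := by
  obtain ⟨e⟩ := h.nonempty_equiv D
  have h0 := (h.of_sign D hsg).1
  let f : (lieStab (B.restrict A) (flagOn V A) (corner h.compl y) ×
      lieStab (B.restrict F) (flagOn V F) (corner h.compl.symm y)) →ₗ⁅ℂ⁆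
      lieStab (B.restrict A) (flagOn V A) (corner h.compl y) :=
    { LinearMap.fst ℂ _ _ with map_lie' := rfl }
  have hf : Function.Bijective f := by
    refine ⟨fun x z hxz => Prod.ext hxz (Subtype.ext ?_), fun x => ⟨(x, 0), rfl⟩⟩
    rw [h0 _ x.2.2, h0 _ z.2.2]
  exact ⟨e.trans (LieEquiv.ofBijective f hf)⟩

theorem Splits.rigidUnip_left (D : Datum B V) (h : Splits B V y A F)
    (hsg : ∀ g ∈ grpStab B V y, (∀ f ∈ F, g f = f) ∨ (∀ f ∈ F, g f = -f))
    (h1 : RigidUnip (B.restrict A) (flagOn V A) (corner h.compl y)) : RigidUnip B V y :=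
  h.rigidUnip D h1 (h.of_sign D hsg).2

theorem Splits.nilType_left (D : Datum B V) (h : Splits B V y A F)
    (hsg : ∀ g ∈ grpStab B V y, (∀ f ∈ F, g f = f) ∨ (∀ f ∈ F, g f = -f))
    (h1 : NilType (B.restrict A) (flagOn V A) (corner h.compl y)) : NilType B V y :=
  h.nilType D h1 fun x hx => by rw [(h.of_sign D hsg).1 x hx, mul_zero, map_zero]

/-- If g lies in a normal unipotent subgroup, so does every commutator g(kg⁻¹k⁻¹); rigidity then
applies to g. -/
theorem RigidUnip.orthReductive (h : RigidUnip B V y) : OrthReductive B V y := by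
  intro N hN hnorm hu
  rw [eq_bot_iff]
  intro g hg
  refine Subgroup.mem_bot.2 (h g (hN hg) (hu g hg) fun k hk _ => Or.inl ?_)
  have : g * k * g⁻¹ * k⁻¹ = g * (k * g⁻¹ * k⁻¹) := by simp only [mul_assoc]
  rw [this]
  exact hu _ (mul_mem hg (hnorm k hk _ (inv_mem hg)))

/-- The kernel of the form on a member of the flag is at most a line. -/
theorem OrthReductive.kernel_le_one (D : Datum B V) (hR : OrthReductive B V y) (hy : IsSkew B y)
    {j : ι} (hj : ∀ i, V i ≤ V j ∨ V j ≤ V i) {k₁ k₂ : E} (h1 : k₁ ∈ V j) (h2 : k₂ ∈ V j)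
    (hk1 : ∀ v ∈ V j, B (y k₁) v = 0) (hk2 : ∀ v ∈ V j, B (y k₂) v = 0) (h0 : k₂ ≠ 0) :
    ∃ c : ℂ, k₁ = c • k₂ := by
  -- Both vectors lie in the radical on V_j, so k₁ ∧ k₂ stabilises the form. It kills V_j and has
  -- image in V_j, so reductivity makes it zero and the vectors are proportional.
  have hx : wedge B k₁ k₂ ∈ lieStab B V y := by
    refine ⟨par_wedge D.symm fun i => ?_, fun z hz => ?_⟩
    · rcases hj i with h | h
      · exact ⟨fun w hw => D.isotropic j _ h1 _ (h hw),
          Or.inr fun w hw => D.isotropic j _ h2 _ (h hw)⟩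
      · exact ⟨fun w hw => D.isotropic i _ (h h1) _ hw, Or.inl (h h1)⟩
    · rw [trace_lie_wedge D.symm hy hz.1, hk1 _ (hz.2 j _ h2), D.symm, hk2 _ (hz.2 j _ h1)]
      ring
  have h3 := hR.eq_zero_of_lowering D (U := V j) (fun g hg u hu => (hg.1.2 j u).2 hu) hx
    (fun u hu => by
      rw [wedge_apply, D.isotropic j _ h2 _ hu, D.isotropic j _ h1 _ hu, zero_smul, zero_smul,
        sub_zero])
    (fun w hw => by
      rw [wedge_apply]
      exact sub_mem (Submodule.smul_mem _ _ h1) (Submodule.smul_mem _ _ h2))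
  obtain ⟨w, hw⟩ : ∃ w, B k₂ w ≠ 0 := by
    by_contra! h
    exact h0 (D.nondeg _ h)
  have h4 := LinearMap.congr_fun h3 w
  rw [wedge_apply, LinearMap.zero_apply, sub_eq_zero] at h4
  refine ⟨(B k₂ w)⁻¹ * B k₁ w, ?_⟩
  rw [mul_smul, ← h4, smul_smul, inv_mul_cancel₀ hw, one_smul]

end SplittingCriteria


/-! ### Symplectic and orthonormal bases, matrix models, and a trace criterion for nilpotency -/

section Bases

variable {W : Type*} [AddCommGroup W] [Module ℂ W]

/-- A family of orthogonal hyperbolic pairs for an alternating form, spanning a complement of the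
radical. -/
structure HypFamily (w : BilinForm ℂ W) (m : ℕ) (p q : Fin m → W) : Prop where
  pq : ∀ i j, w (p i) (q j) = if i = j then 1 else 0
  pp : ∀ i j, w (p i) (p j) = 0
  qq : ∀ i j, w (q i) (q j) = 0

variable [FiniteDimensional ℂ W]

/-- Induction on the dimension: choose a hyperbolic pair in U and pass to its orthogonal inside U.
The last clause says that only the radical is left over. -/
theorem exists_hypFamily_on {w : BilinForm ℂ W} (hw : ∀ u v, w u v = -w v u) (U : Submodule ℂ W) :
    ∃ (m : ℕ) (p q : Fin m → W), HypFamily w m p q ∧ (∀ i, p i ∈ U ∧ q i ∈ U) ∧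
      ∀ v ∈ U, (∀ i, w v (p i) = 0 ∧ w v (q i) = 0) → ∀ u ∈ U, w v u = 0 := by
  have hw0 : ∀ u, w u u = 0 := fun u => by
    have := hw u u
    linear_combination this / 2
  induction hd : finrank ℂ U using Nat.strong_induction_on generalizing U with
  | _ d ih =>
  by_cases h0 : ∀ v ∈ U, ∀ u ∈ U, w v u = 0
  · exact ⟨0, Fin.elim0, Fin.elim0, ⟨fun i => i.elim0, fun i => i.elim0, fun i => i.elim0⟩,
      fun i => i.elim0, fun v hv _ => h0 v hv⟩
  push Not at h0
  obtain ⟨p₀, hp₀, q₁, hq₁, hpq⟩ := h0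
  obtain ⟨q₀, hq₀, h1⟩ : ∃ q₀ ∈ U, w p₀ q₀ = 1 :=
    ⟨(w p₀ q₁)⁻¹ • q₁, U.smul_mem _ hq₁, by rw [map_smul, smul_eq_mul, inv_mul_cancel₀ hpq]⟩
  let U' : Submodule ℂ W := U ⊓ (LinearMap.ker (w p₀) ⊓ LinearMap.ker (w q₀))
  have hU' : ∀ {v}, v ∈ U' ↔ v ∈ U ∧ w p₀ v = 0 ∧ w q₀ v = 0 := by
    intro v; rfl
  have hlt : finrank ℂ U' < d := by
    rw [← hd]
    refine Submodule.finrank_lt_finrank_of_lt (lt_of_le_of_ne inf_le_left fun h => ?_)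
    have : q₀ ∈ U' := by rw [h]; exact hq₀
    rw [(hU'.1 this).2.1] at h1
    exact zero_ne_one h1
  obtain ⟨m, p, q, hf, hm, hr⟩ := ih _ hlt U' rfl
  have hpm := fun i => hU'.1 (hm i).1
  have hqm := fun i => hU'.1 (hm i).2
  refine ⟨m + 1, Fin.cons p₀ p, Fin.cons q₀ q, ⟨?_, ?_, ?_⟩, ?_, ?_⟩
  · intro i j
    refine Fin.cases ?_ (fun i => ?_) i <;> refine Fin.cases ?_ (fun j => ?_) j
    · simpa using h1
    · simpa [(Fin.succ_ne_zero j).symm] using (hqm j).2.1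
    · simpa [hw (p i) q₀] using (hpm i).2.2
    · simpa using hf.pq i j
  · intro i j
    refine Fin.cases ?_ (fun i => ?_) i <;> refine Fin.cases ?_ (fun j => ?_) j
    · simpa using hw0 p₀
    · simpa using (hpm j).2.1
    · simpa [hw (p i) p₀] using (hpm i).2.1
    · simpa using hf.pp i j
  · intro i j
    refine Fin.cases ?_ (fun i => ?_) i <;> refine Fin.cases ?_ (fun j => ?_) j
    · simpa using hw0 q₀
    · simpa using (hqm j).2.2
    · simpa [hw (q i) q₀] using (hqm i).2.2
    · simpa using hf.qq i j
  · intro i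
    refine Fin.cases ?_ (fun i => ?_) i
    · exact ⟨hp₀, hq₀⟩
    · exact ⟨(hpm i).1, (hqm i).1⟩
  · intro v hv hvp u hu
    have h2 := hvp 0
    simp only [Fin.cons_zero] at h2
    have hv' : v ∈ U' := hU'.2 ⟨hv, by rw [hw, h2.1, neg_zero], by rw [hw, h2.2, neg_zero]⟩
    have h3 := hr v hv' fun i => by simpa using hvp i.succ
    have h4 : u - w u q₀ • p₀ + w u p₀ • q₀ ∈ U' := by
      refine hU'.2 ⟨add_mem (sub_mem hu (U.smul_mem _ hp₀)) (U.smul_mem _ hq₀), ?_, ?_⟩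
      · simp [hw0, h1, hw u p₀]
      · simp [hw0, hw q₀ p₀, h1, hw u q₀]
    have h5 := h3 _ h4
    simpa [h2.1, h2.2] using h5

theorem exists_hypFamily {w : BilinForm ℂ W} (hw : ∀ u v, w u v = -w v u) :
    ∃ (m : ℕ) (p q : Fin m → W), HypFamily w m p q ∧
      ∀ v, (∀ i, w v (p i) = 0 ∧ w v (q i) = 0) → ∀ u, w v u = 0 := by
  obtain ⟨m, p, q, h, -, h2⟩ := exists_hypFamily_on hw ⊤
  exact ⟨m, p, q, h, fun v hv u => h2 v trivial hv u trivial⟩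

/-- Coordinates with respect to a hyperbolic family. -/
noncomputable def HypFamily.coord {w : BilinForm ℂ W} {m : ℕ} {p q : Fin m → W}
    (_h : HypFamily w m p q) : W →ₗ[ℂ] (Fin m ⊕ Fin m → ℂ) :=
  LinearMap.pi (Sum.elim (fun i => w (p i)) (fun i => w.flip (q i)))

theorem HypFamily.coord_apply_sum {w : BilinForm ℂ W} (hw : ∀ u v, w u v = -w v u) {m : ℕ}
    {p q : Fin m → W} (h : HypFamily w m p q) (c : Fin m ⊕ Fin m → ℂ) :
    h.coord (∑ i, c (Sum.inl i) • q i + ∑ i, c (Sum.inr i) • p i) = c := by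
  ext (i | i)
  · simp [HypFamily.coord, h.pq, h.pp]
  · simp [HypFamily.coord, h.pq, h.qq]

/-- Dimension formula for an alternating form. -/
theorem exists_finrank_eq {w : BilinForm ℂ W} (hw : ∀ u v, w u v = -w v u) :
    ∃ m, finrank ℂ W = 2 * m + finrank ℂ (LinearMap.ker w) := by
  obtain ⟨m, p, q, h, hr⟩ := exists_hypFamily hw
  refine ⟨m, ?_⟩
  have h1 : LinearMap.ker h.coord = LinearMap.ker w := by
    ext v
    rw [LinearMap.mem_ker, LinearMap.mem_ker]
    constructor
    · intro hv
      have h2 := fun i => congrFun hv i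
      ext u
      refine hr v (fun i => ⟨?_, h2 (Sum.inr i)⟩) u
      rw [hw, show w (p i) v = 0 from h2 (Sum.inl i), neg_zero]
    · intro hv
      ext (i | i)
      · change w (p i) v = 0
        rw [hw, hv, LinearMap.zero_apply, neg_zero]
      · change w v (q i) = 0
        rw [hv, LinearMap.zero_apply]
  have h2 := LinearMap.finrank_range_add_finrank_ker h.coord
  have h3 : LinearMap.range h.coord = ⊤ :=
    LinearMap.range_eq_top.2 fun c => ⟨_, h.coord_apply_sum hw c⟩
  rw [h1, h3, finrank_top, Module.finrank_fintype_fun_eq_card, Fintype.card_sum, Fintype.card_fin]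
    at h2
  omega

theorem finrank_even_of_alternating {w : BilinForm ℂ W} (hw : ∀ u v, w u v = -w v u)
    (hn : ∀ v, (∀ u, w v u = 0) → v = 0) : Even (finrank ℂ W) := by
  obtain ⟨m, hm⟩ := exists_finrank_eq hw
  have : LinearMap.ker w = ⊥ := by
    rw [LinearMap.ker_eq_bot']
    exact fun v hv => hn v fun u => by rw [hv]; rfl
  rw [this, finrank_bot] at hm
  exact ⟨m, by omega⟩

theorem nonempty_skew_equiv_matrix {n : Type*} [Fintype n] [DecidableEq n] (w : BilinForm ℂ W)
    (b : Basis n ℂ W) : Nonempty (skewAdjointLieSubalgebra w ≃ₗ⁅ℂ⁆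
      skewAdjointMatricesLieSubalgebra (Matrix.of fun i j => w (b i) (b j))) := by
  let e : End ℂ W ≃ₗ⁅ℂ⁆ Matrix n n ℂ := (LinearMap.toMatrixAlgEquiv b).toLieEquiv
  refine ⟨LieEquiv.ofSubalgebras _ _ e ?_⟩
  have hJ : Matrix.toLinearMap₂ b b (Matrix.of fun i j => w (b i) (b j)) = w := by
    have : (Matrix.of fun i j => w (b i) (b j)) = LinearMap.toMatrix₂ b b w := by
      ext i j; rw [LinearMap.toMatrix₂_apply]; rfl
    rw [this]
    exact Matrix.toLinearMap₂_toMatrix₂ b b w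
  have key : ∀ M : Matrix n n ℂ,
      M ∈ skewAdjointMatricesLieSubalgebra (Matrix.of fun i j => w (b i) (b j)) ↔
        Matrix.toLin b b M ∈ skewAdjointLieSubalgebra w := by
    intro M
    rw [mem_skewAdjointMatricesLieSubalgebra, mem_skewAdjointMatricesSubmodule]
    change _ ↔ Matrix.toLin b b M ∈ LinearMap.skewAdjointSubmodule w
    rw [LinearMap.mem_skewAdjointSubmodule, Matrix.IsSkewAdjoint, LinearMap.IsSkewAdjoint,
      ← isAdjointPair_toLinearMap₂ b b, hJ, map_neg]
    rfl
  ext M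
  rw [key]
  constructor
  · rintro ⟨x, hx, rfl⟩
    change Matrix.toLin b b (LinearMap.toMatrix b b x) ∈ _
    rwa [Matrix.toLin_toMatrix]
  · intro h
    exact ⟨_, h, LinearMap.toMatrix_toLin b b M⟩

theorem nonempty_skew_equiv_spAlg {w : BilinForm ℂ W} (hw : ∀ u v, w u v = -w v u)
    (hn : ∀ v, (∀ u, w v u = 0) → v = 0) :
    Nonempty (skewAdjointLieSubalgebra w ≃ₗ⁅ℂ⁆ spAlg (finrank ℂ W)) := by
  obtain ⟨m, p, q, h, hr⟩ := exists_hypFamily hw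
  let φ : W ≃ₗ[ℂ] (Fin m ⊕ Fin m → ℂ) := LinearEquiv.ofBijective h.coord
    ⟨(injective_iff_map_eq_zero _).2 fun v hv => hn v (hr v fun i => ⟨by
        rw [hw, show w (p i) v = 0 from congrFun hv (Sum.inl i), neg_zero],
        congrFun hv (Sum.inr i)⟩),
      fun c => ⟨_, h.coord_apply_sum hw c⟩⟩
  -- The vectors q come before the vectors p, so that the Gram matrix is J and not -J.
  let b : Basis (Fin m ⊕ Fin m) ℂ W := Basis.ofEquivFun φ
  have hφ : ∀ c, φ.symm c = ∑ i, c (Sum.inl i) • q i + ∑ i, c (Sum.inr i) • p i := fun c => by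
    rw [LinearEquiv.symm_apply_eq]
    exact (h.coord_apply_sum hw c).symm
  have hbl : ∀ i, b (Sum.inl i) = q i := fun i => by
    rw [Basis.coe_ofEquivFun]
    refine (hφ _).trans ?_
    simp [Pi.single_apply, Sum.inl.injEq]
  have hbr : ∀ i, b (Sum.inr i) = p i := fun i => by
    rw [Basis.coe_ofEquivFun]
    refine (hφ _).trans ?_
    simp [Pi.single_apply, Sum.inr.injEq]
  have hm : finrank ℂ W / 2 = m := by
    rw [finrank_eq_card_basis b, Fintype.card_sum, Fintype.card_fin]; omega
  obtain ⟨e⟩ := nonempty_skew_equiv_matrix w b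
  have hJ : (Matrix.of fun i j => w (b i) (b j)) = Matrix.J (Fin m) ℂ := by
    ext (i | i) (j | j)
    · simp [Matrix.J, hbl, h.qq]
    · simp [Matrix.J, hbl, hbr, hw (q i) (p j), h.pq, Matrix.one_apply, eq_comm]
    · simp [Matrix.J, hbl, hbr, h.pq, Matrix.one_apply]
    · simp [Matrix.J, hbr, h.pp]
  rw [hJ] at e
  subst hm
  exact ⟨e⟩

theorem nonempty_skew_equiv_soAlg {w : BilinForm ℂ W} (hw : ∀ u v, w u v = w v u)
    (hn : ∀ v, (∀ u, w v u = 0) → v = 0) :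
    Nonempty (skewAdjointLieSubalgebra w ≃ₗ⁅ℂ⁆ soAlg (finrank ℂ W)) := by
  obtain ⟨b, hb⟩ := LinearMap.BilinForm.exists_orthogonal_basis (B := w) ⟨hw⟩
  have hb' : ∀ i j, i ≠ j → w (b i) (b j) = 0 := fun i j hij => hb hij
  have h0 : ∀ i, w (b i) (b i) ≠ 0 := fun i hi => b.ne_zero i (hn _ fun u => by
    rw [← b.sum_repr u, map_sum]
    refine Finset.sum_eq_zero fun j _ => ?_
    by_cases hij : i = j
    · subst hij; simp [hi]
    · simp [hb' i j hij])
  -- Square roots of the diagonal entries, used to rescale the orthogonal basis to an orthonormal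
  -- one.
  choose c hc using fun i => IsAlgClosed.exists_pow_nat_eq (w (b i) (b i)) (n := 2) two_pos
  have hc0 : ∀ i, c i ≠ 0 := fun i hi => h0 i (by rw [← hc, hi]; simp)
  let b' := b.unitsSMul fun i => Units.mk0 (c i)⁻¹ (inv_ne_zero (hc0 i))
  obtain ⟨e⟩ := nonempty_skew_equiv_matrix w b'
  have hJ : (Matrix.of fun i j => w (b' i) (b' j)) = 1 := by
    ext i j
    simp only [b', Matrix.of_apply, Basis.unitsSMul_apply, Units.smul_mk0, map_smul,
      LinearMap.smul_apply, smul_eq_mul]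
    by_cases hij : i = j
    · subst hij
      rw [Matrix.one_apply_eq, ← hc i]
      field_simp [hc0 i]
    · rw [hb' i j hij, Matrix.one_apply_ne hij, mul_zero, mul_zero]
  rw [hJ] at e
  exact ⟨e⟩

/-- An endomorphism all of whose powers have trace zero is nilpotent. -/
theorem isNilpotent_of_trace_pow {T : End ℂ W}
    (h : ∀ k, LinearMap.trace ℂ W (T ^ (k + 1)) = 0) : IsNilpotent T := by
  -- Write the minimal polynomial as X^k m with m prime to X, and take a Bézout relation aX^{k+1} +
  -- bm = 1. Then e = a(T)T^{k+1} is an idempotent of trace zero, hence zero in characteristic 0. So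
  -- m(T) is invertible and T^k = 0.
  obtain ⟨m, hm, hd⟩ := Polynomial.exists_eq_pow_rootMultiplicity_mul_and_not_dvd
    (minpoly ℂ T) (minpoly.ne_zero (Algebra.IsIntegral.isIntegral T)) 0
  set k := Polynomial.rootMultiplicity 0 (minpoly ℂ T)
  rw [Polynomial.C_0, sub_zero] at hm hd
  have hcop : IsCoprime (Polynomial.X ^ (k + 1)) m :=
    ((Polynomial.prime_X.irreducible.coprime_iff_not_dvd).2 hd).pow_left
  obtain ⟨a, b, hab⟩ := hcop
  have h0 : T ^ k * Polynomial.aeval T m = 0 := by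
    have := minpoly.aeval ℂ T
    rwa [hm, map_mul, map_pow, Polynomial.aeval_X] at this
  have hsum : Polynomial.aeval T (a * Polynomial.X ^ (k + 1)) +
      Polynomial.aeval T b * Polynomial.aeval T m = 1 := by
    rw [← map_mul, ← map_add, hab, map_one]
  have htr : LinearMap.trace ℂ W (Polynomial.aeval T (a * Polynomial.X ^ (k + 1))) = 0 := by
    rw [map_mul, map_pow, Polynomial.aeval_X, Polynomial.aeval_eq_sum_range, Finset.sum_mul, map_sum]
    refine Finset.sum_eq_zero fun i _ => ?_
    rw [smul_mul_assoc, ← pow_add, map_smul, ← add_assoc, h, smul_zero]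
  set e := Polynomial.aeval T (a * Polynomial.X ^ (k + 1)) with he
  have hbm : Polynomial.aeval T b * Polynomial.aeval T m = 1 - e := by rw [← hsum]; abel
  have hid : IsIdempotentElem e := by
    have : e * (1 - e) = 0 := by
      rw [← hbm, he, ← map_mul, ← map_mul, show a * Polynomial.X ^ (k + 1) * (b * m) =
        (a * b * Polynomial.X) * (Polynomial.X ^ k * m) by ring, map_mul, map_mul (Polynomial.aeval T)
        (Polynomial.X ^ k), map_pow, Polynomial.aeval_X, h0, mul_zero]
    rw [mul_sub, mul_one, sub_eq_zero] at this
    exact this.symm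
  have he0 : e = 0 := (LinearMap.IsIdempotentElem.trace_eq_zero_iff hid).1 htr
  rw [he0, sub_zero] at hbm
  refine ⟨k, ?_⟩
  calc T ^ k = T ^ k * (Polynomial.aeval T m * Polynomial.aeval T b) := by
        rw [← map_mul, mul_comm m, map_mul, hbm, mul_one]
    _ = 0 := by rw [← mul_assoc, h0, zero_mul]

end Bases


/-! ### The trivial flag: uniqueness, and trace conditions implied by rigidity -/

section Orthogonal

variable {E : Type*} [AddCommGroup E] [Module ℂ E] [FiniteDimensional ℂ E] {ι : Type*}
  {B : BilinForm ℂ E} {V : ι → Submodule ℂ E} {y : End ℂ E}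

/-- All forms on the parabolic subalgebra that are of reductive and nilpotent type have
stabiliser `M`, and there is a form of nilpotent type satisfying a strong reductivity condition. -/
def Target (B : BilinForm ℂ E) (V : ι → Submodule ℂ E) (M : Type*) [LieRing M] [LieAlgebra ℂ M] :
    Prop :=
  (∀ y, IsSkew B y → OrthReductive B V y → NilType B V y →
    Nonempty (lieStab B V y ≃ₗ⁅ℂ⁆ M)) ∧
  ∃ y, IsSkew B y ∧ NilType B V y ∧ RigidUnip B V y

theorem unip_eigenvalue {g : E ≃ₗ[ℂ] E} (hg : Unip g) {u : E} {c : ℂ} (hu : g u = c • u)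
    (h0 : u ≠ 0) : c = 1 := by
  obtain ⟨k, hk⟩ := hg
  have h : ∀ j, (((g : End ℂ E) - 1) ^ j) u = (c - 1) ^ j • u := by
    intro j
    induction j with
    | zero => simp
    | succ j ih =>
      rw [pow_succ', Module.End.mul_apply, ih, map_smul]
      change _ • (g u - u) = _
      rw [hu, pow_succ, mul_smul, sub_smul, one_smul]
  have := h k
  rw [hk, LinearMap.zero_apply] at this
  exact sub_eq_zero.1 (IsReduced.eq_zero _ ⟨k, (smul_eq_zero.1 this.symm).resolve_right h0⟩)

theorem trace_of_unip {g : E ≃ₗ[ℂ] E} (hg : Unip g) :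
    LinearMap.trace ℂ E (g : End ℂ E) = finrank ℂ E := by
  have := trace_eq_zero_of_isNilpotent hg
  rwa [map_sub, LinearMap.trace_one, sub_eq_zero] at this

theorem trace_of_signUnip {g : E ≃ₗ[ℂ] E} (hg : SignUnip g) :
    LinearMap.trace ℂ E (g : End ℂ E) = finrank ℂ E ∨
      LinearMap.trace ℂ E (g : End ℂ E) = -finrank ℂ E := by
  rcases hg with h | h
  · exact Or.inl (trace_of_unip h)
  · right
    have := trace_eq_zero_of_isNilpotent h
    rwa [map_add, LinearMap.trace_one, add_eq_zero_iff_eq_neg] at this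

/-- If p denotes the non-constant part, p(p + 2N) vanishes at every point, so one factor is zero and
p is constant. -/
theorem coeff_eq_zero_of_two_values {N a₁ a₂ a₃ a₄ : ℂ}
    (h : ∀ c : ℂ, N + a₁ * c + a₂ * c ^ 2 + a₃ * c ^ 3 + a₄ * c ^ 4 = N ∨
      N + a₁ * c + a₂ * c ^ 2 + a₃ * c ^ 3 + a₄ * c ^ 4 = -N) : a₂ = 0 ∧ a₄ = 0 := by
  let p : Polynomial ℂ := Polynomial.C a₁ * Polynomial.X + Polynomial.C a₂ * Polynomial.X ^ 2 +
    Polynomial.C a₃ * Polynomial.X ^ 3 + Polynomial.C a₄ * Polynomial.X ^ 4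
  have hp : p * (p + Polynomial.C (2 * N)) = 0 := by
    apply Polynomial.funext
    intro c
    simp only [p, Polynomial.eval_mul, Polynomial.eval_add, Polynomial.eval_C, Polynomial.eval_X,
      Polynomial.eval_pow, Polynomial.eval_zero]
    rcases h c with h | h
    · have h5 : a₁ * c + a₂ * c ^ 2 + a₃ * c ^ 3 + a₄ * c ^ 4 = 0 := by linear_combination h
      rw [h5, zero_mul]
    · have h5 : a₁ * c + a₂ * c ^ 2 + a₃ * c ^ 3 + a₄ * c ^ 4 + 2 * N = 0 := by
        linear_combination h
      rw [h5, mul_zero]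
  have key : ∃ b, p = Polynomial.C b := by
    rcases mul_eq_zero.1 hp with h | h
    · exact ⟨0, by rw [h, map_zero]⟩
    · exact ⟨-(2 * N), by rw [map_neg]; exact eq_neg_of_add_eq_zero_left h⟩
  obtain ⟨b, hb⟩ := key
  have h2 := congrArg (fun p => Polynomial.coeff p 2) hb
  have h4 := congrArg (fun p => Polynomial.coeff p 4) hb
  simp [p, Polynomial.coeff_C, Polynomial.coeff_X] at h2 h4
  exact ⟨h2, h4⟩

theorem exists_exp_inv {T : End ℂ E} (hT : T ∈ lieStab B V y) (h3 : ∀ v, T (T (T v)) = 0) :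
    ∃ g ∈ grpStab B V y, Unip g ∧ (g : End ℂ E) = 1 + T + (2⁻¹ : ℂ) • (T * T) ∧
      ((g⁻¹ : E ≃ₗ[ℂ] E) : End ℂ E) = 1 - T + (2⁻¹ : ℂ) • (T * T) := by
  obtain ⟨g, hg, hu, h⟩ := exists_exp hT h3
  refine ⟨g, hg, hu, by ext v; exact h v, ?_⟩
  ext v
  change g.symm v = v - T v + (2⁻¹ : ℂ) • T (T v)
  rw [LinearEquiv.symm_apply_eq, h]
  simp only [map_add, map_sub, map_smul, h3, smul_zero, map_zero]
  module

/-- Consequences of the rigidity hypothesis for one-parameter unipotent groups. -/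
theorem trace_conj_mul_eq_zero {T : End ℂ E} (hT : T ∈ lieStab B V y)
    (h3 : ∀ v, T (T (T v)) = 0) {g : E ≃ₗ[ℂ] E}
    (hc : ∀ h ∈ grpStab B V y, Unip h → SignUnip (g * h * g⁻¹ * h⁻¹)) :
    LinearMap.trace ℂ E (g.conj T * T) = 0 ∧
      LinearMap.trace ℂ E (g.conj T * g.conj T * (T * T)) = 0 := by
  have hn : IsNilpotent T := ⟨3, by ext v; simp [pow_succ, h3]⟩
  have hT2 : LinearMap.trace ℂ E (T * T) = 0 :=
    trace_eq_zero_of_isNilpotent ((Commute.refl T).isNilpotent_mul_right hn)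
  have e2 : g.conj T * g.conj T = g.conj (T * T) := by
    ext v; simp [conj_apply']
  have hT2' : LinearMap.trace ℂ E (g.conj T * g.conj T) = 0 := by
    rw [e2, LinearMap.trace_conj', hT2]
  -- The trace of the commutator of g with exp(cT) is a polynomial of degree at most 4 in c, with
  -- values ± dim E only. Its coefficients of c² and c⁴ are the two traces sought, up to nonzero
  -- factors.
  have key : ∀ c : ℂ, _ ∨ _ := fun c => by
    obtain ⟨h, hh, hu, h1, h2⟩ := exists_exp_inv ((lieStab B V y).smul_mem c hT) (fun v => by
      simp [h3])
    have h4 := trace_of_signUnip (hc h hh hu)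
    have e : ((g * h * g⁻¹ * h⁻¹ : E ≃ₗ[ℂ] E) : End ℂ E) =
        (1 + c • g.conj T + (c ^ 2 / 2) • (g.conj T * g.conj T)) *
          (1 - c • T + (c ^ 2 / 2) • (T * T)) := by
      have e3 : ((g * h * g⁻¹ * h⁻¹ : E ≃ₗ[ℂ] E) : End ℂ E) =
        g.conj (h : End ℂ E) * ((h⁻¹ : E ≃ₗ[ℂ] E) : End ℂ E) := rfl
      have e4 : g.conj (1 : End ℂ E) = 1 := by ext v; simp [conj_apply']
      have e5 : ∀ a : End ℂ E, (2⁻¹ : ℂ) • (c • a * c • a) = (c ^ 2 / 2) • (a * a) := fun a => by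
        rw [smul_mul_smul_comm, smul_smul]; congr 1; ring
      rw [e3, h2, h1, e5, map_add, map_add, map_smul, map_smul, e4, ← e2]
    rw [e] at h4
    have e6 : LinearMap.trace ℂ E ((1 + c • g.conj T + (c ^ 2 / 2) • (g.conj T * g.conj T)) *
          (1 - c • T + (c ^ 2 / 2) • (T * T))) = finrank ℂ E +
        (LinearMap.trace ℂ E (g.conj T) - LinearMap.trace ℂ E T) * c +
        (-LinearMap.trace ℂ E (g.conj T * T)) * c ^ 2 +
        (LinearMap.trace ℂ E (g.conj T * (T * T)) -
          LinearMap.trace ℂ E (g.conj T * g.conj T * T)) / 2 * c ^ 3 +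
        LinearMap.trace ℂ E (g.conj T * g.conj T * (T * T)) / 4 * c ^ 4 := by
      simp only [mul_add, add_mul, mul_sub, sub_mul, one_mul, mul_one, smul_mul_assoc,
        mul_smul_comm, map_add, map_sub, map_smul, smul_eq_mul, LinearMap.trace_one, hT2, hT2']
      ring
    rw [e6] at h4
    exact h4
  obtain ⟨h1, h2⟩ := coeff_eq_zero_of_two_values key
  exact ⟨neg_eq_zero.1 h1, by simpa using h2⟩

theorem isSkew_odd_pow (hy : IsSkew B y) (k : ℕ) : IsSkew B (y ^ (2 * k + 1)) := by
  induction k with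
  | zero => simpa using hy
  | succ k ih =>
    intro v w
    rw [show 2 * (k + 1) + 1 = (2 * k + 1) + 1 + 1 by ring, pow_succ', pow_succ',
      Module.End.mul_apply, Module.End.mul_apply, hy, hy, ih]
    have e : y ^ (2 * k + 1) * y * y = y * (y * y ^ (2 * k + 1)) := by
      rw [← pow_succ, ← pow_succ, pow_succ', pow_succ']
    have e' := LinearMap.congr_fun e w
    rw [Module.End.mul_apply, Module.End.mul_apply] at e'
    rw [e', neg_neg]

theorem par_iff_isSkew_of_bot (hV : ∀ i, V i = ⊥) {x : End ℂ E} : Par B V x ↔ IsSkew B x :=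
  ⟨fun h => h.1, fun h => ⟨h, fun i v hv => by
    rw [hV, Submodule.mem_bot] at hv ⊢; rw [hv, map_zero]⟩⟩

/-- The odd powers of `y` are skew and commute with `y`, so they lie in the stabiliser. Nilpotent
type then kills the traces of all positive even powers and `y` is nilpotent. It also commutes with
the group stabiliser, so reductivity applies. -/
theorem OrthReductive.eq_zero_of_bot (D : Datum B V) (hV : ∀ i, V i = ⊥) (hy : IsSkew B y)
    (hR : OrthReductive B V y) (hN : NilType B V y) : y = 0 := by
  have hmem : ∀ k, y ^ (2 * k + 1) ∈ lieStab B V y := fun k => by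
    refine ⟨(par_iff_isSkew_of_bot hV).2 (isSkew_odd_pow hy k), fun z _ => ?_⟩
    rw [mul_sub, map_sub, ← mul_assoc, ← mul_assoc, LinearMap.trace_mul_comm ℂ (y * z),
      ← mul_assoc, ← pow_succ', ← pow_succ, sub_self]
  have hn2 : IsNilpotent (y ^ 2) := isNilpotent_of_trace_pow fun k => by
    rw [← pow_mul, show 2 * (k + 1) = (2 * k + 1) + 1 by ring, pow_succ']
    exact hN _ (hmem k)
  have hn : IsNilpotent y := (IsNilpotent.pow_iff_pos two_ne_zero).1 hn2
  refine hR.eq_zero_of_central (by simpa using hmem 0) hn fun g hg v => ?_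
  have h1 : ∀ u v, B (y (g u)) (g v) = B (y u) v := fun u v =>
    grpStab_inv D.symm hy hg ((par_iff_isSkew_of_bot hV).2 (isSkew_wedge D.symm u v))
  refine (sub_eq_zero.1 (D.nondeg _ fun w => ?_)).symm
  have := h1 v (g.symm w)
  rw [g.apply_symm_apply] at this
  rw [map_sub, LinearMap.sub_apply, this, ← hg.1.1 (y v), g.apply_symm_apply, sub_self]

theorem nonempty_lieStab_zero_equiv (D : Datum B V) (hV : ∀ i, V i = ⊥) :
    Nonempty (lieStab B V 0 ≃ₗ⁅ℂ⁆ soAlg (finrank ℂ E)) := by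
  obtain ⟨e⟩ := nonempty_skew_equiv_soAlg D.symm D.nondeg
  refine ⟨(LieEquiv.ofEq _ _ (by
    ext x
    change (Par B V x ∧ _) ↔ x ∈ LinearMap.skewAdjointSubmodule B
    rw [LinearMap.mem_skewAdjointSubmodule, par_iff_isSkew_of_bot hV]
    constructor
    · exact fun h v w => (h.1 v w).trans (map_neg _ _).symm
    · exact fun h => ⟨fun v w => (h v w).trans (map_neg _ _), fun z _ => by rw [zero_mul, map_zero]⟩)).trans e⟩

end Orthogonal


/-! ### The zero form is rigid for the full orthogonal group -/

section OrthogonalRigidity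

variable {E : Type*} [AddCommGroup E] [Module ℂ E] [FiniteDimensional ℂ E] {ι : Type*}
  {B : BilinForm ℂ E} {V : ι → Submodule ℂ E} {y : End ℂ E}

theorem Datum.mem_span_of_perp (D : Datum B V) {u v : E} (h : ∀ w, B u w = 0 → B v w = 0) :
    v ∈ Submodule.span ℂ {u} :=
  D.mem_of_perp fun m hm => by
    rw [D.symm]; exact h m (hm u (Submodule.mem_span_singleton_self u))

/-- Otherwise v^⊥ would be totally isotropic, hence contained in (v^⊥)^⊥ = ℂv, which is too small in
dimension at least 3. -/
theorem Datum.exists_anisotropic (D : Datum B V) (hn : 3 ≤ finrank ℂ E) (v : E) :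
    ∃ w, B v w = 0 ∧ B w w ≠ 0 := by
  by_contra! h
  have h1 : ∀ w w', B v w = 0 → B v w' = 0 → B w w' = 0 := fun w w' hw hw' => by
    have h2 := h (w + w') (by rw [map_add, hw, hw', add_zero])
    simp only [map_add, LinearMap.add_apply, h w hw, h w' hw', D.symm w' w] at h2
    linear_combination h2 / 2
  have h2 : B.orthogonal (Submodule.span ℂ {v}) ≤ Submodule.span ℂ {v} := fun w hw =>
    D.mem_span_of_perp fun w' hw' => h1 w w' (hw v (Submodule.mem_span_singleton_self v)) hw'
  have h3 := Submodule.finrank_mono h2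
  have h4 := D.finrank_perp (Submodule.span ℂ {v})
  have h5 : finrank ℂ (Submodule.span ℂ {v}) ≤ 1 := (finrank_span_le_card {v}).trans (by simp)
  omega

/-- A unipotent isometry fixing all isotropic vectors is trivial. -/
theorem Datum.eq_one_of_isotropic (D : Datum B V) (hn : 3 ≤ finrank ℂ E) {g : E ≃ₗ[ℂ] E}
    (h : ∀ u, B u u = 0 → g u = u) : g = 1 := by
  ext v
  change g v = v
  by_cases hv : B v v = 0
  · exact h v hv
  obtain ⟨w, hvw, hw⟩ := D.exists_anisotropic hn v
  -- With this c the vectors v + cw and v - cw are isotropic, and they add up to 2v.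
  obtain ⟨c, hc⟩ := IsAlgClosed.exists_pow_nat_eq (-(B v v) / B w w) (n := 2) two_pos
  have h1 : B v v + c ^ 2 * B w w = 0 := by rw [hc]; field_simp; ring
  have hwv : B w v = 0 := by rw [D.symm, hvw]
  have h2 := h (v + c • w) (by simp [hvw, hwv]; linear_combination h1)
  have h3 := h (v - c • w) (by simp [hvw, hwv]; linear_combination h1)
  have h4 : g ((2 : ℂ) • v) = (2 : ℂ) • v := by
    have : (2 : ℂ) • v = (v + c • w) + (v - c • w) := by module
    rw [this, map_add, h2, h3]
  rw [map_smul] at h4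
  exact smul_two_cancel h4

/-- A unipotent g fixes a nonzero v, and (g - 1)E ⊆ v^⊥, a space of dimension at most one. If v is
isotropic, v^⊥ = ℂv and `eq_smul_of_sub_mem_span` applies. If not, g acts on v^⊥ by a unipotent
scalar. -/
theorem Datum.unip_eq_one_of_finrank_le_two (D : Datum B V) (hn : finrank ℂ E ≤ 2)
    {g : E ≃ₗ[ℂ] E} (hg : ∀ v w, B (g v) (g w) = B v w) (hu : Unip g) : g = 1 := by
  by_cases h0 : ∀ v : E, v = 0
  · ext v; rw [h0 v, map_zero, map_zero]
  push Not at h0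
  obtain ⟨v₀, hv₀⟩ := h0
  have hfix : ∃ v, v ≠ 0 ∧ g v = v := by
    by_contra! h
    have hinj : Function.Injective (((g : End ℂ E) - 1 : End ℂ E) : E → E) := by
      rw [injective_iff_map_eq_zero]
      intro v hv
      by_contra hv0
      exact h v hv0 (sub_eq_zero.1 hv)
    obtain ⟨k, hk⟩ := hu
    have h1 : Function.Injective ((((g : End ℂ E) - 1) ^ k : End ℂ E) : E → E) := by
      rw [Module.End.coe_pow]; exact hinj.iterate k
    rw [hk] at h1
    exact hv₀ (h1 rfl)
  obtain ⟨v, hv, hgv⟩ := hfix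
  have hperp : ∀ w, B v (g w - w) = 0 := fun w => by
    have := hg v w
    rw [hgv] at this
    rw [map_sub, this, sub_self]
  have hline : ∀ a b, B v a = 0 → B v b = 0 → a ≠ 0 → b ∈ Submodule.span ℂ {a} := by
    intro a b ha hb ha0
    have h4 := D.finrank_perp (Submodule.span ℂ {v})
    rw [finrank_span_singleton hv] at h4
    have h5 : Submodule.span ℂ {a} ≤ B.orthogonal (Submodule.span ℂ {v}) := by
      rw [Submodule.span_singleton_le_iff_mem]
      intro w hw
      obtain ⟨c, rfl⟩ := Submodule.mem_span_singleton.1 hw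
      rw [map_smul, LinearMap.smul_apply, ha, smul_zero]
    have h6 := Submodule.eq_of_le_of_finrank_le h5 (by rw [finrank_span_singleton ha0]; omega)
    rw [h6]
    intro w hw
    obtain ⟨c, rfl⟩ := Submodule.mem_span_singleton.1 hw
    rw [map_smul, LinearMap.smul_apply, hb, smul_zero]
  by_cases hvv : B v v = 0
  · obtain ⟨t₀, ht₀⟩ : ∃ t, B v t ≠ 0 := by
      by_contra! h; exact hv (D.nondeg v h)
    have := eq_smul_of_sub_mem_span (M := ⊤) D.symm hg (ε := 1) (one_mul 1)
      (fun t _ => by rw [one_smul]; exact hline v _ hvv (hperp t) hv) hvv trivial ht₀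
    ext t
    rw [this t trivial, one_smul]; rfl
  · ext t
    change g t = t
    have h1 : B v (t - (B v t / B v v) • v) = 0 := by
      rw [map_sub, map_smul, smul_eq_mul, div_mul_cancel₀ _ hvv, sub_self]
    have h2 : g (t - (B v t / B v v) • v) = t - (B v t / B v v) • v := by
      by_cases h3 : t - (B v t / B v v) • v = 0
      · rw [h3, map_zero]
      · have h4 : B v (g (t - (B v t / B v v) • v)) = 0 := by
          have := hperp (t - (B v t / B v v) • v)
          rwa [map_sub, h1, sub_zero] at this
        obtain ⟨c, hc⟩ := Submodule.mem_span_singleton.1 (hline _ _ h1 h4 h3)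
        rw [← hc, unip_eigenvalue hu hc.symm h3, one_smul]
    rw [map_sub, map_smul, hgv] at h2
    exact sub_left_inj.1 h2

theorem wedge_mul_wedge (u w : E) (hs : ∀ v w, B v w = B w v) (hu : B u u = 0) (hw : B u w = 0) :
    wedge B u w * wedge B u w = (-B w w) • (B u).smulRight u := by
  ext v
  simp [hu, hw, hs w u]
  module

/-- The zero form is rigid for the full orthogonal group. -/
theorem rigidUnip_zero (D : Datum B V) (hV : ∀ i, V i = ⊥) : RigidUnip B V 0 := by
  intro g hg hu hc
  rcases lt_or_ge (finrank ℂ E) 3 with hn | hn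
  · exact D.unip_eq_one_of_finrank_le_two (by omega) hg.1.1 hu
  -- The trace conditions for T = u ∧ w. Here T² = -B(w, w) B(u, ·)u and T³ = 0, so both traces are
  -- explicit products of values of B.
  have key : ∀ u w, B u u = 0 → B u w = 0 →
      B (g w) u * B (g u) w = B (g u) u * B (g w) w ∧ B w w * B (g u) u = 0 := by
    intro u w huu huw
    have hT : wedge B u w ∈ lieStab B V 0 := ⟨(par_iff_isSkew_of_bot hV).2
      (isSkew_wedge D.symm u w), fun z _ => by rw [zero_mul, map_zero]⟩
    have hwu : B w u = 0 := by rw [D.symm, huw]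
    have h3 : ∀ v, wedge B u w (wedge B u w (wedge B u w v)) = 0 := fun v => by
      simp [huu, huw, hwu]
    have hconj : g.conj (wedge B u w) = wedge B (g u) (g w) := by
      rw [← conj_wedge hg.1.1 u w]; ext v; simp [conj_apply']
    obtain ⟨h1, h2⟩ := trace_conj_mul_eq_zero hT h3 hc
    rw [hconj] at h1 h2
    rw [trace_mul_wedge D.symm (isSkew_wedge D.symm _ _)] at h1
    rw [wedge_mul_wedge u w D.symm huu huw, wedge_mul_wedge (g u) (g w) D.symm
      (by rw [hg.1.1, huu]) (by rw [hg.1.1, huw]), smul_mul_smul_comm, map_smul] at h2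
    have e : (B (g u)).smulRight (g u) * (B u).smulRight u = (B u).smulRight (B (g u) u • g u) := by
      ext v; simp
    rw [e, LinearMap.trace_smulRight] at h2
    simp only [wedge_apply, map_sub, map_smul, LinearMap.sub_apply, LinearMap.smul_apply,
      smul_eq_mul] at h1 h2
    refine ⟨by linear_combination h1 / 2, ?_⟩
    have h4 : (B w w * B (g u) u) ^ 2 = 0 := by
      rw [D.symm u (g u), hg.1.1 w w] at h2; linear_combination h2
    exact pow_eq_zero_iff two_ne_zero |>.1 h4
  refine D.eq_one_of_isotropic hn fun u huu => ?_
  by_cases hu0 : u = 0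
  · rw [hu0, map_zero]
  obtain ⟨w₀, hw₀, hw₀'⟩ := D.exists_anisotropic hn u
  have hgu : B (g u) u = 0 := ((mul_eq_zero.1 (key u w₀ huu hw₀).2).resolve_left hw₀')
  -- Since B(gw, u) = B(w, g⁻¹u), this says that u^⊥ is the union of its subspaces orthogonal to
  -- g⁻¹u and to gu. One of the two must be all of u^⊥, so u is an eigenvector of g, with eigenvalue
  -- 1 by unipotency.
  have hprod : ∀ w, B u w = 0 → B (g.symm u) w = 0 ∨ B (g u) w = 0 := fun w hw => by
    have := (key u w huu hw).1
    rw [hgu, zero_mul, mul_eq_zero] at this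
    refine this.imp_left fun h => ?_
    rwa [D.symm, ← hg.1.1, g.apply_symm_apply]
  have hor : (∀ w, B u w = 0 → B (g.symm u) w = 0) ∨ (∀ w, B u w = 0 → B (g u) w = 0) := by
    by_contra! h
    obtain ⟨⟨a, ha, ha'⟩, b, hb, hb'⟩ := h
    have h1 := (hprod a ha).resolve_left ha'
    have h2 := (hprod b hb).resolve_right hb'
    rcases hprod (a + b) (by rw [map_add, ha, hb, add_zero]) with h | h
    · rw [map_add, h2, add_zero] at h; exact ha' h
    · rw [map_add, h1, zero_add] at h; exact hb' h
  rcases hor with h | h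
  · obtain ⟨c, hc⟩ := Submodule.mem_span_singleton.1 (D.mem_span_of_perp h)
    have h1 : u = c • g u := by rw [← map_smul, hc, g.apply_symm_apply]
    have hc0 : c ≠ 0 := by rintro rfl; exact hu0 (by rw [h1, zero_smul])
    have h2 : g u = c⁻¹ • u := by
      nth_rewrite 2 [h1]; rw [smul_smul, inv_mul_cancel₀ hc0, one_smul]
    rw [h2, unip_eigenvalue hu h2 hu0, one_smul]
  · obtain ⟨c, hc⟩ := Submodule.mem_span_singleton.1 (D.mem_span_of_perp h)
    rw [← hc, unip_eigenvalue hu hc.symm hu0, one_smul]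

/-- The case of the full orthogonal algebra. -/
theorem target_of_bot (D : Datum B V) (hV : ∀ i, V i = ⊥) :
    Target B V (soAlg (finrank ℂ E)) := by
  refine ⟨fun y hy hR hN => ?_, 0, IsSkew.zero, fun x _ => by rw [zero_mul, map_zero],
    rigidUnip_zero D hV⟩
  rw [hR.eq_zero_of_bot D hV hy hN]
  exact nonempty_lieStab_zero_equiv D hV

end OrthogonalRigidity


/-! ### A single Lagrangian member: E = L ⊕ yL and the symplectic stabiliser -/

section Lagrangian

variable {E : Type*} [AddCommGroup E] [Module ℂ E] [FiniteDimensional ℂ E] {ι : Type*}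
  {B : BilinForm ℂ E} {V : ι → Submodule ℂ E} {y : End ℂ E} {L : Submodule ℂ E}

variable (B V) in
/-- A flag with one step, which is Lagrangian. -/
structure LagrangianDatum (L : Submodule ℂ E) : Prop extends Datum B V where
  flag : ∀ i, V i = ⊥ ∨ V i = L
  exists_eq : ∃ i, V i = L
  mem_of_orth : ∀ v, (∀ l ∈ L, B l v = 0) → v ∈ L

theorem LagrangianDatum.iso (D : LagrangianDatum B V L) {u v : E} (hu : u ∈ L) (hv : v ∈ L) :
    B u v = 0 := by
  obtain ⟨j, rfl⟩ := D.exists_eq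
  exact D.isotropic j u hu v hv

/-- The restriction to `L` of the form `B (y ·) ·`. -/
noncomputable def formOn (B : BilinForm ℂ E) (y : End ℂ E) (L : Submodule ℂ E) : BilinForm ℂ L :=
  LinearMap.BilinForm.restrict (B ∘ₗ y) L

theorem formOn_apply (u v : L) : formOn B y L u v = B (y u) v := rfl

theorem formOn_alt (hs : ∀ v w, B v w = B w v) (hy : IsSkew B y) (u v : L) :
    formOn B y L u v = -formOn B y L v u := by
  rw [formOn_apply, formOn_apply, hy, hs]

variable (B y L) in
/-- The alternating form attached to `y` is nondegenerate on `L`. -/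
def NondegOn : Prop := ∀ k ∈ L, (∀ v ∈ L, B (y k) v = 0) → k = 0

theorem NondegOn.formOn (h : NondegOn B y L) (v : L) (hv : ∀ u, formOn B y L v u = 0) : v = 0 :=
  Subtype.ext (h v v.2 fun u hu => hv ⟨u, hu⟩)

/-- Solve B(ys, ·) = B(v, ·) on L. The difference v - ys is orthogonal to L, hence in L. -/
theorem LagrangianDatum.exists_eq_add (D : LagrangianDatum B V L) (hy : IsSkew B y)
    (hn : NondegOn B y L) (v : E) : ∃ l l' : L, v = l + y l' := by
  obtain ⟨s, hs, h⟩ := exists_solve D.symm hy L (B v) fun k hk hk' => by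
    rw [hn k hk hk', map_zero]
  refine ⟨⟨v - y s, D.mem_of_orth _ fun l hl => ?_⟩, ⟨s, hs⟩, by simp⟩
  rw [D.symm, map_sub, LinearMap.sub_apply, h l hl, sub_self]

/-- The decomposition `E = L ⊕ y L`. -/
noncomputable def sumEquiv (D : LagrangianDatum B V L) (hy : IsSkew B y)
    (hn : NondegOn B y L) : (L × L) ≃ₗ[ℂ] E :=
  LinearEquiv.ofBijective (L.subtype.coprod (y ∘ₗ L.subtype)) (by
    constructor
    · rw [injective_iff_map_eq_zero]
      rintro ⟨l, l'⟩ h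
      have h' : (l : E) + y l' = 0 := h
      have h1 : l' = 0 := hn.formOn _ fun u => by
        rw [formOn_apply, ← neg_eq_of_add_eq_zero_right h', map_neg, LinearMap.neg_apply,
          D.iso l.2 u.2, neg_zero]
      rw [h1] at h' ⊢
      rw [Submodule.coe_zero, map_zero, add_zero] at h'
      exact Prod.ext (Subtype.ext h') rfl
    · intro v
      obtain ⟨l, l', h⟩ := D.exists_eq_add hy hn v
      exact ⟨(l, l'), h.symm⟩)

theorem sumEquiv_apply (D : LagrangianDatum B V L) (hy : IsSkew B y)
    (hn : NondegOn B y L) (l l' : L) : sumEquiv D hy hn (l, l') = l + y l' := rfl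

/-- The endomorphism `l + y l' ↦ a l + y (a l')`. -/
noncomputable def double (D : LagrangianDatum B V L) (hy : IsSkew B y)
    (hn : NondegOn B y L) (a : End ℂ L) : End ℂ E :=
  (sumEquiv D hy hn).conj (a.prodMap a)

section Double

variable (D : LagrangianDatum B V L) (hy : IsSkew B y) (hn : NondegOn B y L)

theorem double_apply (a : End ℂ L) (l l' : L) :
    double D hy hn a (l + y l') = a l + y (a l') := by
  change (sumEquiv D hy hn) ((a.prodMap a) ((sumEquiv D hy hn).symm (sumEquiv D hy hn (l, l')))) = _
  rw [LinearEquiv.symm_apply_apply]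
  rfl

theorem double_left (a : End ℂ L) (l : L) : double D hy hn a l = a l := by
  simpa using double_apply D hy hn a l 0

theorem double_right (a : End ℂ L) (l : L) : double D hy hn a (y l) = y (a l) := by
  simpa using double_apply D hy hn a 0 l

include D hn hy in
theorem eq_of_eqOn {f g : E →ₗ[ℂ] E} (h1 : ∀ l : L, f l = g l) (h2 : ∀ l : L, f (y l) = g (y l)) :
    f = g := by
  ext v
  obtain ⟨l, l', rfl⟩ := D.exists_eq_add hy hn v
  rw [map_add, map_add, h1, h2]

theorem double_mul (a b : End ℂ L) :
    double D hy hn (a * b) = double D hy hn a * double D hy hn b :=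
  eq_of_eqOn D hy hn (fun l => by simp [double_left]) (fun l => by simp [double_right])

theorem double_one : double D hy hn 1 = 1 :=
  eq_of_eqOn D hy hn (fun l => by simp [double_left]) (fun l => by simp [double_right])

theorem double_pow (a : End ℂ L) (k : ℕ) : double D hy hn (a ^ k) = double D hy hn a ^ k := by
  induction k with
  | zero => rw [pow_zero, pow_zero, double_one]
  | succ k ih => rw [pow_succ, pow_succ, double_mul, ih]

theorem double_add (a b : End ℂ L) :
    double D hy hn (a + b) = double D hy hn a + double D hy hn b :=
  eq_of_eqOn D hy hn (fun l => by simp [double_left]) (fun l => by simp [double_right])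

theorem double_sub (a b : End ℂ L) :
    double D hy hn (a - b) = double D hy hn a - double D hy hn b :=
  eq_of_eqOn D hy hn (fun l => by simp [double_left]) (fun l => by simp [double_right])

theorem double_smul (c : ℂ) (a : End ℂ L) : double D hy hn (c • a) = c • double D hy hn a :=
  eq_of_eqOn D hy hn (fun l => by simp [double_left]) (fun l => by simp [double_right])

theorem double_zero : double D hy hn 0 = 0 :=
  eq_of_eqOn D hy hn (fun l => by simp [double_left]) (fun l => by simp [double_right])

theorem trace_double (a : End ℂ L) :
    LinearMap.trace ℂ E (double D hy hn a) = 2 * LinearMap.trace ℂ L a := by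
  rw [double, LinearMap.trace_conj', LinearMap.trace_prodMap', two_mul]

include D hy in
-- For l in L every l ∧ v belongs to the parabolic subalgebra, so the infinitesimal invariance holds
-- against all v and [y, x] kills L.
theorem LagrangianDatum.lieStab_comm {x : End ℂ E} (hx : x ∈ lieStab B V y) :
    ∀ l ∈ L, x l ∈ L ∧ y (x l) = x (y l) := by
  intro l hl
  obtain ⟨j, hj⟩ := D.exists_eq
  refine ⟨hj ▸ hx.1.2 j l (hj.symm ▸ hl), sub_eq_zero.1 (D.nondeg _ fun v => ?_)⟩
  have hw : Par B V (wedge B l v) := par_wedge D.symm fun i => by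
    rcases D.flag i with h | h <;> rw [h]
    · exact ⟨fun w hw => by rw [(Submodule.mem_bot ℂ).1 hw, map_zero],
        Or.inr fun w hw => by rw [(Submodule.mem_bot ℂ).1 hw, map_zero]⟩
    · exact ⟨fun w hw => D.iso hl hw, Or.inl hl⟩
  have := lieStab_inv D.symm hy hx hw
  rw [map_sub, LinearMap.sub_apply, hx.1.1 (y l) v, sub_neg_eq_add, this]

include D hy in
theorem LagrangianDatum.grpStab_comm {g : E ≃ₗ[ℂ] E} (hg : g ∈ grpStab B V y) :
    ∀ l ∈ L, g l ∈ L ∧ g (y l) = y (g l) := by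
  intro l hl
  obtain ⟨j, hj⟩ := D.exists_eq
  refine ⟨hj ▸ (hg.1.2 j l).2 (hj.symm ▸ hl), (sub_eq_zero.1 (D.nondeg _ fun v => ?_)).symm⟩
  have hw : Par B V (wedge B l (g.symm v)) := par_wedge D.symm fun i => by
    rcases D.flag i with h | h <;> rw [h]
    · exact ⟨fun w hw => by rw [(Submodule.mem_bot ℂ).1 hw, map_zero],
        Or.inr fun w hw => by rw [(Submodule.mem_bot ℂ).1 hw, map_zero]⟩
    · exact ⟨fun w hw => D.iso hl hw, Or.inl hl⟩
  have := grpStab_inv D.symm hy hg hw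
  rw [g.apply_symm_apply] at this
  rw [map_sub, LinearMap.sub_apply, this, ← hg.1.1, g.apply_symm_apply, sub_self]

include D hy in
-- If [y, x] kills L then, being skew, it has image in L^⊥ = L. As z preserves L, the map [y, x]z
-- has square zero and hence trace zero.
theorem LagrangianDatum.mem_lieStab {x : End ℂ E} (hx : IsSkew B x)
    (h : ∀ l ∈ L, x l ∈ L ∧ y (x l) = x (y l)) : x ∈ lieStab B V y := by
  refine ⟨⟨hx, fun i v hv => ?_⟩, fun z hz => ?_⟩
  · rcases D.flag i with h1 | h1 <;> rw [h1] at hv ⊢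
    · rw [(Submodule.mem_bot ℂ).1 hv, map_zero]; exact zero_mem _
    · exact (h v hv).1
  · rw [mul_sub, map_sub, ← mul_assoc, ← mul_assoc, LinearMap.trace_mul_comm ℂ (y * z),
      ← mul_assoc, ← map_sub, ← sub_mul]
    have h1 : ∀ l ∈ L, (y * x - x * y) l = 0 := fun l hl => sub_eq_zero.2 (h l hl).2
    have h2 : ∀ v, (y * x - x * y) v ∈ L := fun v => D.mem_of_orth _ fun l hl => by
      rw [D.symm, (hy.comm hx) v l, h1 l hl, map_zero, neg_zero]
    obtain ⟨j, hj⟩ := D.exists_eq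
    refine trace_eq_zero_of_isNilpotent ⟨2, ?_⟩
    ext v
    rw [pow_two, Module.End.mul_apply, Module.End.mul_apply, Module.End.mul_apply]
    exact h1 _ (hj ▸ hz.2 j _ (hj.symm ▸ h2 _))

/-- Let ω be the alternating form on L and q(u, v) = B(yu, yv). Skewness for ω controls the pairing
of L with yL, and skewness for q the pairing of yL with itself. -/
theorem double_mem_lieStab {a : End ℂ L} (ha : IsSkew (formOn B y L) a)
    (hq : ∀ u v : L, B (y (a u)) (y v) + B (y u) (y (a v)) = 0) :
    double D hy hn a ∈ lieStab B V y := by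
  refine D.mem_lieStab hy (fun v w => ?_) fun l hl => ?_
  · obtain ⟨l, l', rfl⟩ := D.exists_eq_add hy hn v
    obtain ⟨m, m', rfl⟩ := D.exists_eq_add hy hn w
    rw [double_apply, double_apply]
    have h1 : B (y (a l')) m = -B (y l') (a m) := ha l' m
    have h2 : B (y (a m')) l = -B (y m') (a l) := ha m' l
    have h3 := hq l' m'
    simp only [map_add, LinearMap.add_apply, D.iso (a l).2 m.2, D.iso l.2 (a m).2]
    rw [D.symm (a l), D.symm l, h1]
    linear_combination h3 + h2
  · rw [double_left D hy hn a ⟨l, hl⟩, double_right D hy hn a ⟨l, hl⟩]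
    exact ⟨Submodule.coe_mem _, rfl⟩

include D hy hn in
-- If yL is isotropic the condition from q is empty. Restriction to L and doubling are then inverse
-- isomorphisms between the stabiliser and sp(ω).
theorem nonempty_equiv_of_isotropic (hq : ∀ u v : L, B (y u) (y v) = 0) :
    Nonempty (lieStab B V y ≃ₗ⁅ℂ⁆ spAlg (finrank ℂ L)) := by
  obtain ⟨e⟩ := nonempty_skew_equiv_spAlg (formOn_alt (L := L) D.symm hy) hn.formOn
  have hmem : ∀ {a : End ℂ L}, a ∈ skewAdjointLieSubalgebra (formOn B y L) ↔
      IsSkew (formOn B y L) a := by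
    intro a
    refine (LinearMap.mem_skewAdjointSubmodule (B := formOn B y L) a).trans ?_
    exact forall_congr' fun v => forall_congr' fun w => by
      rw [show (-(a : L → L)) w = -(a w) from rfl, map_neg]
  let f : skewAdjointLieSubalgebra (formOn B y L) →ₗ⁅ℂ⁆ lieStab B V y :=
    { toFun := fun a => ⟨double D hy hn a, double_mem_lieStab D hy hn (hmem.1 a.2)
        (fun u v => by rw [hq, hq, add_zero])⟩
      map_add' := fun a b => Subtype.ext (double_add D hy hn a b)
      map_smul' := fun c a => Subtype.ext (double_smul D hy hn c a)
      map_lie' := by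
        intro a b
        apply Subtype.ext
        change double D hy hn (a.1 * b.1 - b.1 * a.1) = double D hy hn a.1 * double D hy hn b.1 -
          double D hy hn b.1 * double D hy hn a.1
        rw [double_sub, double_mul, double_mul] }
  have hf : Function.Bijective f := by
    refine ⟨fun a b h => Subtype.ext ?_, fun x => ?_⟩
    · have h1 : double D hy hn a = double D hy hn b := congrArg Subtype.val h
      ext l
      rw [← double_left D hy hn, h1, double_left]
    · have hc := D.lieStab_comm hy x.2
      let a : End ℂ L := x.1.restrict fun l hl => (hc l hl).1
      have ha : ∀ l : L, (a l : E) = x.1 l := fun l => rfl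
      refine ⟨⟨a, hmem.2 fun u v => ?_⟩, Subtype.ext ?_⟩
      · change B (y (x.1 u)) v = -B (y u) (x.1 v)
        rw [(hc u u.2).2, x.2.1.1]
      · refine eq_of_eqOn D hy hn (fun l => ?_) (fun l => ?_)
        · exact double_left D hy hn a l
        · exact (double_right D hy hn a l).trans (hc l l.2).2
  exact ⟨(LieEquiv.ofBijective f hf).symm.trans e⟩

end Double
end Lagrangian


/-! ### The even Lagrangian block: yL is isotropic, and rigidity -/

section LagrangianTarget

variable {E : Type*} [AddCommGroup E] [Module ℂ E] [FiniteDimensional ℂ E] {ι : Type*}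
  {B : BilinForm ℂ E} {V : ι → Submodule ℂ E} {y : End ℂ E} {L : Submodule ℂ E}

theorem trace_prod_eq {M N : Type*} [AddCommGroup M] [Module ℂ M] [FiniteDimensional ℂ M]
    [AddCommGroup N] [Module ℂ N] [FiniteDimensional ℂ N] (f : End ℂ (M × N)) :
    LinearMap.trace ℂ (M × N) f =
      LinearMap.trace ℂ M (LinearMap.fst ℂ M N ∘ₗ f ∘ₗ LinearMap.inl ℂ M N) +
      LinearMap.trace ℂ N (LinearMap.snd ℂ M N ∘ₗ f ∘ₗ LinearMap.inr ℂ M N) := by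
  have h1 := LinearMap.trace_comp_comm' (R := ℂ) (LinearMap.fst ℂ M N) (f ∘ₗ LinearMap.inl ℂ M N)
  have h2 := LinearMap.trace_comp_comm' (R := ℂ) (LinearMap.snd ℂ M N) (f ∘ₗ LinearMap.inr ℂ M N)
  rw [← h1, ← h2, ← map_add]
  congr 1
  have h0 : ((0 : M), (0 : N)) = 0 := rfl
  ext v <;> simp [h0]

section

variable (D : LagrangianDatum B V L) (hy : IsSkew B y) (hn : NondegOn B y L)

/-- The trace of `y` against the double of an endomorphism. -/
theorem trace_mul_double {Q a : End ℂ L} (hQ : ∀ u v : L, B (y (Q u)) v = B (y u) (y v)) :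
    LinearMap.trace ℂ E (y * double D hy hn a) = -LinearMap.trace ℂ L (Q * a) := by
  let f : End ℂ (L × L) := (sumEquiv D hy hn).symm.conj (y * double D hy hn a)
  have hf : LinearMap.trace ℂ E (y * double D hy hn a) = LinearMap.trace ℂ (L × L) f :=
    (LinearMap.trace_conj' _ _).symm
  have happ : ∀ l l', f (l, l') = (sumEquiv D hy hn).symm (y (a l + y (a l'))) := fun l l' => by
    rw [← double_apply D hy hn]; rfl
  rw [hf, trace_prod_eq]
  have h1 : LinearMap.fst ℂ L L ∘ₗ f ∘ₗ LinearMap.inl ℂ L L = 0 := by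
    ext l
    change ((f (l, 0)).1 : E) = 0
    rw [happ, map_zero, Submodule.coe_zero, map_zero, add_zero]
    have : y (a l) = sumEquiv D hy hn (0, a l) := by simp [sumEquiv_apply]
    rw [this, LinearEquiv.symm_apply_apply]; rfl
  have h2 : LinearMap.snd ℂ L L ∘ₗ f ∘ₗ LinearMap.inr ℂ L L = -(Q * a) := by
    ext l
    change ((f (0, l)).2 : E) = -(Q (a l) : E)
    rw [happ, map_zero, Submodule.coe_zero, zero_add]
    -- Modulo L one has y²u = -y(Qu), so the block of `y` from yL to yL is -Q in the coordinate L.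
    -- The block from L to L is zero.
    have h3 : y (y (a l)) + y (Q (a l)) ∈ L := D.mem_of_orth _ fun u hu => by
      rw [D.symm, map_add, LinearMap.add_apply, hQ (a l) ⟨u, hu⟩, hy (y (a l))]
      ring
    have : y (y (a l)) = sumEquiv D hy hn (⟨_, h3⟩, -Q (a l)) := by
      rw [sumEquiv_apply]; simp
    rw [this, LinearEquiv.symm_apply_apply]; rfl
  rw [h1, h2, map_zero, zero_add, map_neg]

include D hy hn in
-- Define Q by ω(Qu, v) = B(yu, yv). It is skew for ω, and the doubles of its odd powers lie in the
-- stabiliser. Nilpotent type kills the traces of the positive even powers of Q, so Q is nilpotent.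
-- Its double commutes with the group stabiliser, so reductivity gives Q = 0.
theorem OrthReductive.isotropic_image (hR : OrthReductive B V y) (hN : NilType B V y) (u v : L) :
    B (y u) (y v) = 0 := by
  have hw := formOn_alt (L := L) D.symm hy
  have hnd : (formOn B y L).Nondegenerate :=
    ⟨fun v hv => hn.formOn v hv, fun v hv => hn.formOn v fun u => by rw [hw, hv, neg_zero]⟩
  let q : BilinForm ℂ L := B.compl₁₂ (y ∘ₗ L.subtype) (y ∘ₗ L.subtype)
  have hq : ∀ u v, q u v = B (y u) (y v) := fun u v => rfl
  have hqs : ∀ u v, q u v = q v u := fun u v => D.symm _ _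
  let Q : End ℂ L := ((formOn B y L).toDual hnd).symm ∘ₗ q
  have hQ : ∀ u v, formOn B y L (Q u) v = q u v := fun u v => by
    change formOn B y L (((formOn B y L).toDual hnd).symm (q u)) v = q u v
    exact LinearMap.BilinForm.apply_toDual_symm_apply (q u) v
  have hQs : IsSkew (formOn B y L) Q := fun u v => by
    rw [hQ, hqs, ← hQ, hw]
  have hmem : ∀ k, double D hy hn (Q ^ (2 * k + 1)) ∈ lieStab B V y := fun k => by
    refine double_mem_lieStab D hy hn (isSkew_odd_pow hQs k) fun u v => ?_
    rw [← hq, ← hq, ← hQ, ← hQ, ← Module.End.mul_apply, ← pow_succ', pow_succ,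
      Module.End.mul_apply, isSkew_odd_pow hQs k, neg_add_cancel]
  have hn2 : IsNilpotent (Q ^ 2) := isNilpotent_of_trace_pow fun k => by
    have := hN _ (hmem k)
    rw [trace_mul_double D hy hn (Q := Q) (fun u v => hQ u v), neg_eq_zero, ← pow_succ'] at this
    rw [← pow_mul, ← this]
    ring_nf
  obtain ⟨k, hk⟩ := (IsNilpotent.pow_iff_pos two_ne_zero).1 hn2
  have h0 : double D hy hn Q = 0 := by
    refine hR.eq_zero_of_central (by simpa using hmem 0)
      ⟨k, by rw [← double_pow, hk, double_zero]⟩ fun g hg => ?_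
    have hc := D.grpStab_comm hy hg
    have hgQ : ∀ l : L, g (Q l) = Q ⟨g l, (hc l l.2).1⟩ := fun l => by
      have h1 : (⟨g (Q l), (hc _ (Q l).2).1⟩ : L) - Q ⟨g l, (hc l l.2).1⟩ = 0 :=
        hn.formOn _ fun u => by
          have hi := D.grpStab_comm hy (inv_mem hg)
          have hu : (g (g⁻¹ (u : E)) : E) = u := g.apply_symm_apply _
          rw [map_sub, LinearMap.sub_apply, hQ, hq, formOn_apply, ← (hc _ (Q l).2).2,
            ← (hc l l.2).2, ← hu, ← (hc _ (hi u u.2).1).2, hg.1.1, hg.1.1, sub_eq_zero]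
          exact hQ l ⟨g⁻¹ (u : E), (hi u u.2).1⟩
      exact congrArg Subtype.val (sub_eq_zero.1 h1)
    have e : (g : End ℂ E) ∘ₗ double D hy hn Q = double D hy hn Q ∘ₗ (g : End ℂ E) := by
      refine eq_of_eqOn D hy hn (fun l => ?_) fun l => ?_
      · change g (double D hy hn Q l) = double D hy hn Q (g l)
        rw [double_left, hgQ]
        exact (double_left D hy hn Q ⟨g l, _⟩).symm
      · change g (double D hy hn Q (y l)) = double D hy hn Q (g (y l))
        rw [double_right, (hc l l.2).2, (hc _ (Q l).2).2, hgQ]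
        exact (double_right D hy hn Q ⟨g l, (hc l l.2).1⟩).symm
    exact fun v => LinearMap.congr_fun e v
  rw [← hq, ← hQ]
  have h1 : (Q u : E) = 0 := by rw [← double_left D hy hn, h0]; rfl
  rw [show Q u = 0 from Subtype.ext h1, map_zero, LinearMap.zero_apply]

include D hy hn in
theorem LagrangianDatum.nilType (hq : ∀ u v : L, B (y u) (y v) = 0) : NilType B V y := by
  intro x hx
  have hc := D.lieStab_comm hy hx
  let a : End ℂ L := x.restrict fun l hl => (hc l hl).1
  have hx' : x = double D hy hn a :=
    eq_of_eqOn D hy hn (fun l => (double_left D hy hn a l).symm)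
      (fun l => ((double_right D hy hn a l).trans (hc l l.2).2).symm)
  rw [hx', trace_mul_double D hy hn (Q := 0) (fun u v => by simp [hq]), zero_mul, map_zero, neg_zero]

include D hy hn in
-- Test against transvections l ↦ ω(v, l)v: the first trace condition is -2ω(gv, v)² = 0.
-- Polarising, g and g⁻¹ agree on L, so g² = 1 there, and unipotency leaves only g = 1.
theorem LagrangianDatum.rigidUnip (hq : ∀ u v : L, B (y u) (y v) = 0) : RigidUnip B V y := by
  intro g hg hu hc
  have hgc := D.grpStab_comm hy hg
  have hgc' := D.grpStab_comm hy (inv_mem hg)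
  have hgi : ∀ v, g (g⁻¹ v) = v := fun v => g.apply_symm_apply v
  have hww : ∀ u v, B (y u) v = -B (y v) u := fun u v => by rw [hy, D.symm]
  have hwg : ∀ u ∈ L, ∀ v, B (y (g u)) (g v) = B (y u) v := fun u hu v => by
    rw [← (hgc u hu).2, hg.1.1]
  have key : ∀ v ∈ L, B (y (g v)) v = 0 := by
    intro v hv
    classical
    -- Defined on all of E, with junk value outside L, so that τ(gv) can be written without carrying
    -- the membership of gv in L.
    let τ : E → End ℂ L := fun v' => (formOn B y L (if h : v' ∈ L then ⟨v', h⟩ else 0)).smulRight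
      (if h : v' ∈ L then ⟨v', h⟩ else 0)
    have hτ : ∀ v' ∈ L, ∀ l : L, (τ v' l : E) = B (y v') l • v' := fun v' hv' l => by
      simp only [τ, dif_pos hv']; rfl
    have hT : double D hy hn (τ v) ∈ lieStab B V y :=
      double_mem_lieStab D hy hn (fun l m => by
        change B (y (τ v l)) m = -B (y l) (τ v m)
        rw [hτ v hv, hτ v hv]
        simp only [map_smul, LinearMap.smul_apply, smul_eq_mul]
        rw [hww l v]; ring) (fun u v => by rw [hq, hq, add_zero])
    have hτ2 : τ v * τ v = 0 := by
      ext l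
      rw [Module.End.mul_apply, hτ v hv, hτ v hv]
      have h1 : B (y v) v = 0 := by have := hww v v; linear_combination this / 2
      simp [h1]
    have h3 : ∀ w, double D hy hn (τ v) (double D hy hn (τ v) (double D hy hn (τ v) w)) = 0 := by
      intro w
      have : double D hy hn (τ v) * double D hy hn (τ v) = 0 := by
        rw [← double_mul, hτ2, double_zero]
      exact LinearMap.congr_fun this _
    have hconj : g.conj (double D hy hn (τ v)) = double D hy hn (τ (g v)) := by
      have h5 : ∀ l : L, g (τ v ⟨g⁻¹ (l : E), (hgc' l l.2).1⟩) = τ (g v) l := fun l => by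
        rw [hτ v hv, hτ _ (hgc v hv).1, map_smul, ← hwg v hv, hgi]
      refine eq_of_eqOn D hy hn (fun l => ?_) fun l => ?_
      · change g (double D hy hn (τ v) (g⁻¹ (l : E))) = _
        rw [double_left D hy hn _ ⟨g⁻¹ (l : E), (hgc' l l.2).1⟩, h5, double_left]
      · change g (double D hy hn (τ v) (g⁻¹ (y l))) = _
        rw [(hgc' l l.2).2, double_right D hy hn _ ⟨g⁻¹ (l : E), (hgc' l l.2).1⟩,
          (hgc _ (Submodule.coe_mem _)).2, h5, double_right]
    have h4 := (trace_conj_mul_eq_zero hT h3 hc).1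
    rw [hconj, ← double_mul, trace_double] at h4
    have h6 : τ (g v) * τ v = (B (y (g v)) v) • (formOn B y L ⟨v, hv⟩).smulRight
        ⟨g v, (hgc v hv).1⟩ := by
      ext l
      rw [Module.End.mul_apply, hτ _ (hgc v hv).1, hτ v hv]
      simp [formOn_apply, smul_smul, mul_comm]
    rw [h6, map_smul, LinearMap.trace_smulRight, formOn_apply, hww v] at h4
    have h7 : B (y (g v)) v ^ 2 = 0 := by
      simp only [smul_eq_mul] at h4
      linear_combination -h4 / 2
    exact pow_eq_zero_iff two_ne_zero |>.1 h7
  have hgL : ∀ l ∈ L, g l = l := by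
    intro l hl
    have h1 : g l - g⁻¹ l = 0 := by
      refine hn _ (sub_mem (hgc l hl).1 (hgc' l hl).1) fun v hv => ?_
      have h2 := key (l + v) (add_mem hl hv)
      simp only [map_add, LinearMap.add_apply, key l hl, key v hv] at h2
      have h3 := hwg _ (hgc' l hl).1 v
      rw [hgi] at h3
      rw [map_sub, map_sub, LinearMap.sub_apply, ← h3, hww l]
      linear_combination h2
    have h2 : g (g l) = l := by rw [sub_eq_zero.1 h1, hgi]
    by_contra h3
    have h4 : g (g l - l) = (-1 : ℂ) • (g l - l) := by rw [map_sub, h2]; module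
    have := unip_eigenvalue hu h4 (sub_ne_zero.2 h3)
    norm_num at this
  have e : (g : End ℂ E) = 1 := eq_of_eqOn D hy hn (fun l => hgL l l.2) fun l => by
    change g (y l) = y l
    rw [(hgc l l.2).2, hgL l l.2]
  exact LinearEquiv.toLinearMap_injective e

end

/-- Isotropic subspaces admit isotropic duals. -/
theorem Datum.exists_dual (D : Datum B V) (hiso : ∀ u ∈ L, ∀ v ∈ L, B u v = 0) :
    ∃ σ : Dual ℂ L →ₗ[ℂ] E, (∀ f (l : L), B (σ f) l = f l) ∧ ∀ f g, B (σ f) (σ g) = 0 := by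
  let ρ : E →ₗ[ℂ] Dual ℂ L := L.subtype.dualMap ∘ₗ B
  have hρ : LinearMap.range ρ = ⊤ := LinearMap.range_eq_top.2 fun f => by
    obtain ⟨u, hu⟩ := D.exists_rep_on f
    exact ⟨u, LinearMap.ext hu⟩
  obtain ⟨τ, hτ⟩ := ρ.exists_rightInverse_of_surjective hρ
  have hτ' : ∀ f (l : L), B (τ f) l = f l := fun f l => LinearMap.congr_fun (LinearMap.congr_fun hτ f) l
  let β : Dual ℂ L →ₗ[ℂ] Dual ℂ (Dual ℂ L) := B.compl₁₂ τ τ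
  let φ : Dual ℂ L →ₗ[ℂ] L := (Module.evalEquiv ℂ L).symm ∘ₗ β
  have hφ : ∀ f g, g (φ f) = B (τ f) (τ g) := fun f g => by
    have : Module.evalEquiv ℂ L (φ f) = β f := LinearEquiv.apply_symm_apply _ _
    exact LinearMap.congr_fun this g
  -- φ(f) is the vector of L with g(φ f) = B(τf, τg). Subtracting half of it cancels the Gram matrix
  -- of τ and leaves the pairing with L unchanged.
  refine ⟨τ - (2⁻¹ : ℂ) • (L.subtype ∘ₗ φ), fun f l => ?_, fun f g => ?_⟩
  · simp [hτ', hiso]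
  · simp only [LinearMap.sub_apply, LinearMap.smul_apply, LinearMap.comp_apply, map_sub, map_smul,
      Submodule.subtype_apply, hiso _ (φ f).2 _ (φ g).2, hτ', D.symm (φ f) (τ g), hφ, smul_eq_mul,
      D.symm (τ g) (τ f)]
    ring

/-- Every alternating form is given by a skew endomorphism. -/
theorem Datum.exists_skew (D : Datum B V) (w : BilinForm ℂ E) (hw : ∀ u v, w u v = -w v u) :
    ∃ y, IsSkew B y ∧ ∀ u v, B (y u) v = w u v := by
  let y : End ℂ E := (B.toDual D.nondegenerate).symm ∘ₗ w
  have hy : ∀ u v, B (y u) v = w u v := fun u v =>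
    LinearMap.BilinForm.apply_toDual_symm_apply (hB := D.nondegenerate) (w u) v
  exact ⟨y, fun u v => by rw [hy, hw, ← hy, D.symm], hy⟩

theorem exists_symplectic_form {W : Type*} [AddCommGroup W] [Module ℂ W] [FiniteDimensional ℂ W]
    (hW : Even (finrank ℂ W)) : ∃ w : BilinForm ℂ W, (∀ u v, w u v = -w v u) ∧
      ∀ v, (∀ u, w v u = 0) → v = 0 := by
  obtain ⟨m, hm⟩ := hW
  let b : Basis (Fin m ⊕ Fin m) ℂ W := (finBasis ℂ W).reindex
    ((finCongr hm).trans finSumFinEquiv.symm)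
  let w : BilinForm ℂ W := Matrix.toLinearMap₂ b b (Matrix.J (Fin m) ℂ)
  have hb : ∀ i j, w (b i) (b j) = Matrix.J (Fin m) ℂ i j := fun i j => by
    rw [← LinearMap.toMatrix₂_apply b b w, LinearMap.toMatrix₂_toLinearMap₂]
  have halt : w = -w.flip := LinearMap.ext_basis b b fun i j => by
    change w (b i) (b j) = -w (b j) (b i)
    rw [hb, hb]
    rcases i with i | i <;> rcases j with j | j <;> simp [Matrix.J, Matrix.one_apply, eq_comm]
  refine ⟨w, fun u v => LinearMap.congr_fun₂ halt u v, fun v hv => ?_⟩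
  have key : ∀ j, w v (b j) = ∑ i, b.repr v i * Matrix.J (Fin m) ℂ i j := fun j => by
    conv_lhs => rw [← b.sum_repr v]
    simp only [map_sum, LinearMap.sum_apply, map_smul, LinearMap.smul_apply, hb, smul_eq_mul]
  have h0 : ∀ i, b.repr v i = 0 := by
    rintro (i | i)
    · have := hv (b (Sum.inr i))
      rw [key] at this
      simpa [Matrix.J, Matrix.one_apply] using this
    · have := hv (b (Sum.inl i))
      rw [key] at this
      simpa [Matrix.J, Matrix.one_apply] using this
  rw [← b.sum_repr v]
  simp only [h0, zero_smul, Finset.sum_const_zero]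

/-- Alternating forms on a Lagrangian subspace extend to skew endomorphisms. -/
theorem Datum.exists_skew_extension (D : Datum B V) (hiso : ∀ u ∈ L, ∀ v ∈ L, B u v = 0)
    (hL : ∀ v, (∀ l ∈ L, B l v = 0) → v ∈ L) (w : BilinForm ℂ L) (hw : ∀ u v, w u v = -w v u) :
    ∃ (σ : Dual ℂ L →ₗ[ℂ] E) (y : End ℂ E), IsSkew B y ∧ (∀ f (l : L), B (σ f) l = f l) ∧
      (∀ f g, B (σ f) (σ g) = 0) ∧ (∀ l : L, y l = σ (w l)) ∧ ∀ f, y (σ f) = 0 := by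
  obtain ⟨σ, h1, h2⟩ := D.exists_dual hiso
  have hdec : ∀ v, v - σ (L.subtype.dualMap (B v)) ∈ L := fun v => hL _ fun l hl => by
    have := h1 (L.subtype.dualMap (B v)) ⟨l, hl⟩
    rw [D.symm, map_sub, LinearMap.sub_apply, this, sub_eq_zero]
    rfl
  -- The projection onto L along the isotropic complement σ(L*); the form w is extended by zero
  -- along it.
  let p : E →ₗ[ℂ] L := (LinearMap.id - σ ∘ₗ L.subtype.dualMap ∘ₗ B).codRestrict L hdec
  have hp : ∀ v, (p v : E) = v - σ (L.subtype.dualMap (B v)) := fun v => rfl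
  have hpl : ∀ l : L, p l = l := fun l => Subtype.ext (by
    rw [hp, show L.subtype.dualMap (B l) = 0 from LinearMap.ext fun u => hiso l l.2 u u.2, map_zero,
      sub_zero])
  have hpσ : ∀ f, p (σ f) = 0 := fun f => Subtype.ext (by
    rw [hp, show L.subtype.dualMap (B (σ f)) = f from LinearMap.ext fun u => h1 f u, sub_self]; rfl)
  obtain ⟨y, hy, hyw⟩ := D.exists_skew (w.compl₁₂ p p) fun u v => hw _ _
  refine ⟨σ, y, hy, h1, h2, fun l => ?_, fun f => D.nondeg _ fun v => ?_⟩
  · refine sub_eq_zero.1 (D.nondeg _ fun v => ?_)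
    have hv : v = p v + σ (L.subtype.dualMap (B v)) := by rw [hp]; abel
    rw [map_sub, LinearMap.sub_apply, hyw, LinearMap.compl₁₂_apply, hpl, hv, map_add (B (σ (w l))),
      h1, h2, ← hv, add_zero, sub_self]
  · rw [hyw, LinearMap.compl₁₂_apply, hpσ, map_zero, LinearMap.zero_apply]

theorem LagrangianDatum.exists_skew (D : LagrangianDatum B V L) (hL : Even (finrank ℂ L)) :
    ∃ y, IsSkew B y ∧ NondegOn B y L ∧ ∀ u v : L, B (y u) (y v) = 0 := by
  obtain ⟨w, hw, hn⟩ := exists_symplectic_form hL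
  obtain ⟨σ, y, hy, h1, h2, h3, -⟩ := D.toDatum.exists_skew_extension
    (fun u hu v hv => D.iso hu hv) D.mem_of_orth w hw
  refine ⟨y, hy, fun k hk hk' => ?_, fun u v => by rw [h3, h3, h2]⟩
  refine congrArg Subtype.val (hn ⟨k, hk⟩ fun u => ?_)
  rw [← hk' u u.2, h3 ⟨k, hk⟩, h1]

/-- The radical has even codimension, so its dimension is even, and reductivity bounds it by one. -/
theorem OrthReductive.nondegOn (D : Datum B V) (hR : OrthReductive B V y) (hy : IsSkew B y)
    {j : ι} (hj : ∀ i, V i ≤ V j ∨ V j ≤ V i) (he : Even (finrank ℂ (V j))) :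
    NondegOn B y (V j) := by
  obtain ⟨m, hm⟩ := exists_finrank_eq (formOn_alt (L := V j) D.symm hy)
  intro k hk hk'
  by_contra h0
  have h1 : finrank ℂ (LinearMap.ker (formOn B y (V j))) = 1 := by
    refine finrank_eq_one (⟨⟨k, hk⟩, LinearMap.ext fun v => hk' v v.2⟩ :
      LinearMap.ker (formOn B y (V j))) (fun h => h0 (congrArg Subtype.val (congrArg Subtype.val h))) ?_
    rintro ⟨⟨l, hl⟩, hl'⟩
    obtain ⟨c, hc⟩ := hR.kernel_le_one D hy hj hl hk
      (fun v hv => LinearMap.congr_fun (LinearMap.mem_ker.1 hl') ⟨v, hv⟩) hk' h0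
    exact ⟨c, Subtype.ext (Subtype.ext hc.symm)⟩
  rw [h1] at hm
  obtain ⟨r, hr⟩ := he
  omega

/-- In odd dimension, the form has a one-dimensional kernel. -/
theorem OrthReductive.exists_kernel (D : Datum B V) (hR : OrthReductive B V y) (hy : IsSkew B y)
    {j : ι} (hj : ∀ i, V i ≤ V j ∨ V j ≤ V i) (ho : Odd (finrank ℂ (V j))) :
    ∃ k ∈ V j, k ≠ 0 ∧ (∀ v ∈ V j, B (y k) v = 0) ∧
      ∀ v ∈ V j, (∀ u ∈ V j, B (y v) u = 0) → ∃ c : ℂ, v = c • k := by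
  have hex : ∃ k ∈ V j, k ≠ 0 ∧ ∀ v ∈ V j, B (y k) v = 0 := by
    by_contra! h
    have := finrank_even_of_alternating (formOn_alt (L := V j) D.symm hy) fun v hv => by
      by_contra h0
      obtain ⟨u, hu, hu'⟩ := h v v.2 fun h1 => h0 (Subtype.ext h1)
      exact hu' (hv ⟨u, hu⟩)
    exact (Nat.not_even_iff_odd.2 ho) this
  obtain ⟨k, hk, hk0, hk'⟩ := hex
  exact ⟨k, hk, hk0, hk', fun v hv hv' => hR.kernel_le_one D hy hj hv hk hv' hk' hk0⟩

/-- The case of a flag consisting of one Lagrangian subspace of even dimension. -/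
theorem LagrangianDatum.target (D : LagrangianDatum B V L) (hL : Even (finrank ℂ L)) :
    Target B V (spAlg (finrank ℂ L)) := by
  constructor
  · intro y hy hR hN
    obtain ⟨j, rfl⟩ := D.exists_eq
    have hn := hR.nondegOn D.toDatum hy (j := j) (fun i => by
      rcases D.flag i with h | h <;> simp [h]) hL
    exact nonempty_equiv_of_isotropic D hy hn (hR.isotropic_image D hy hn hN)
  · obtain ⟨y, hy, hn, hq⟩ := D.exists_skew hL
    exact ⟨y, hy, D.nilType hy hn hq, D.rigidUnip hy hn hq⟩

end LagrangianTarget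


/-! ### Flags of given dimensions and hyperbolic summands -/

section FlagTypes

variable {E : Type*} [AddCommGroup E] [Module ℂ E] [FiniteDimensional ℂ E] {ι : Type*}
  {B : BilinForm ℂ E} {V : ι → Submodule ℂ E} {y : End ℂ E} {L A F : Submodule ℂ E} {d : ι → ℕ}

variable (B V) in
/-- A flag of isotropic subspaces of prescribed dimensions. -/
structure FlagDatum (d : ι → ℕ) : Prop extends Datum B V where
  nested : ∀ i j, V i ≤ V j ∨ V j ≤ V i
  finrank_eq : ∀ i, finrank ℂ (V i) = d i

/-- A subspace `A` with a subspace `L` that is Lagrangian in `A`. -/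
structure IsHyperbolic (B : BilinForm ℂ E) (L A : Submodule ℂ E) : Prop where
  le : L ≤ A
  iso : ∀ u ∈ L, ∀ v ∈ L, B u v = 0
  mem_of_orth : ∀ a ∈ A, (∀ l ∈ L, B l a = 0) → a ∈ L
  nondeg : ∀ a ∈ A, (∀ b ∈ A, B a b = 0) → a = 0

theorem Datum.exists_orth_proj (D : Datum B V) (hA : ∀ a ∈ A, (∀ b ∈ A, B a b = 0) → a = 0)
    (v : E) : ∃ a ∈ A, ∀ b ∈ A, B b (v - a) = 0 := by
  have h := LinearMap.BilinForm.isCompl_orthogonal_of_restrict_nondegenerate D.isRefl (W := A)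
    ⟨fun a ha => Subtype.ext (hA a a.2 fun b hb => ha ⟨b, hb⟩), fun a ha =>
      Subtype.ext (hA a a.2 fun b hb => by rw [D.symm]; exact ha ⟨b, hb⟩)⟩
  obtain ⟨a, ha, f, hf, rfl⟩ :=
    Submodule.mem_sup.1 (h.sup_eq_top ▸ Submodule.mem_top (x := v))
  exact ⟨a, ha, fun b hb => by rw [add_sub_cancel_left]; exact hf b hb⟩

theorem Datum.orthDecomp (D : Datum B V) (hA : ∀ a ∈ A, (∀ b ∈ A, B a b = 0) → a = 0)
    (hV : ∀ i, ∀ v ∈ V i, ∃ a ∈ A, a ∈ V i ∧ ∀ b ∈ A, B b (v - a) = 0) :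
    OrthDecomp B V A (B.orthogonal A) where
  compl := LinearMap.BilinForm.isCompl_orthogonal_of_restrict_nondegenerate D.isRefl
    ⟨fun a ha => Subtype.ext (hA a a.2 fun b hb => ha ⟨b, hb⟩), fun a ha =>
      Subtype.ext (hA a a.2 fun b hb => by rw [D.symm]; exact ha ⟨b, hb⟩)⟩
  orth a ha f hf := hf a ha
  flag i v hv := by
    obtain ⟨a, ha, hav, h⟩ := hV i v hv
    exact ⟨a, ha, v - a, h, hav, sub_mem hv hav, add_sub_cancel a v⟩

/-- A member containing L is isotropic, so the projections of its vectors to A are orthogonal to L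
and hence lie in L, inside the member. A member contained in A splits trivially. -/
theorem IsHyperbolic.orthDecomp (D : Datum B V) (hA : IsHyperbolic B L A)
    (hV : ∀ i, V i ≤ A ∨ L ≤ V i) : OrthDecomp B V A (B.orthogonal A) := by
  refine D.orthDecomp hA.nondeg fun i v hv => ?_
  rcases hV i with h | h
  · exact ⟨v, h hv, hv, fun b _ => by rw [sub_self, map_zero]⟩
  · obtain ⟨a, ha, ha'⟩ := D.exists_orth_proj hA.nondeg v
    refine ⟨a, ha, h (hA.mem_of_orth a ha fun l hl => ?_), ha'⟩
    have h1 := ha' l (hA.le hl)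
    rw [map_sub, D.isotropic i l (h hl) v hv, zero_sub, neg_eq_zero] at h1
    exact h1

theorem IsHyperbolic.finrank_eq (D : Datum B V) (hA : IsHyperbolic B L A) :
    finrank ℂ A = 2 * finrank ℂ L := by
  let W : Unit → Submodule ℂ A := fun _ => L.comap A.subtype
  have DA : Datum (B.restrict A) W :=
    ⟨fun v w => D.symm v w, fun v hv => Subtype.ext (hA.nondeg v v.2 fun b hb => hv ⟨b, hb⟩),
      fun _ v hv w hw => hA.iso v hv w hw⟩
  have h1 : (B.restrict A).orthogonal (W ()) = W () := by
    apply le_antisymm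
    · exact fun a ha => hA.mem_of_orth a a.2 fun l hl => ha ⟨l, hA.le hl⟩ hl
    · exact fun a ha b hb => hA.iso b hb a ha
  have h2 := DA.finrank_perp (W ())
  have h3 : finrank ℂ (W ()) = finrank ℂ L :=
    (Submodule.comapSubtypeEquivOfLe hA.le).finrank_eq
  rw [h1, h3] at h2
  omega

theorem finrank_flagOn (V : ι → Submodule ℂ E) (A : Submodule ℂ E) (i : ι) :
    finrank ℂ (flagOn V A i) = finrank ℂ (V i ⊓ A : Submodule ℂ E) := by
  rw [← Submodule.finrank_map_subtype_eq A (flagOn V A i), Submodule.map_comap_subtype, inf_comm]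

theorem OrthDecomp.finrank_add (h : OrthDecomp B V A F) (i : ι) :
    finrank ℂ (flagOn V A i) + finrank ℂ (flagOn V F i) = finrank ℂ (V i) := by
  rw [finrank_flagOn, finrank_flagOn, ← Submodule.finrank_sup_add_finrank_inf_eq]
  have h1 : (V i ⊓ A) ⊔ (V i ⊓ F) = V i := by
    refine le_antisymm (sup_le inf_le_left inf_le_left) fun v hv => ?_
    obtain ⟨a, ha, f, hf, ha', hf', rfl⟩ := h.flag i v hv
    exact Submodule.add_mem_sup ⟨ha', ha⟩ ⟨hf', hf⟩
  have h2 : (V i ⊓ A) ⊓ (V i ⊓ F) = ⊥ := by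
    rw [eq_bot_iff, ← h.compl.inf_eq_bot]
    exact le_inf (inf_le_left.trans inf_le_right) (inf_le_right.trans inf_le_right)
  rw [h1, h2, finrank_bot, add_zero]

theorem OrthDecomp.finrank_add' (h : OrthDecomp B V A F) :
    finrank ℂ A + finrank ℂ F = finrank ℂ E :=
  Submodule.finrank_add_eq_of_isCompl h.compl

/-- The flag induced on a hyperbolic summand. -/
theorem FlagDatum.left (D : FlagDatum B V d) (h : OrthDecomp B V A F) (hA : IsHyperbolic B L A)
    (hV : ∀ i, V i ≤ L ∨ L ≤ V i) :
    FlagDatum (B.restrict A) (flagOn V A) (fun i => min (d i) (finrank ℂ L)) where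
  toDatum := h.datum D.toDatum
  nested i j := (D.nested i j).imp (fun h => Submodule.comap_mono h) (fun h => Submodule.comap_mono h)
  finrank_eq i := by
    rw [finrank_flagOn, ← D.finrank_eq]
    rcases hV i with h1 | h1
    · rw [inf_eq_left.2 (h1.trans hA.le), min_eq_left (Submodule.finrank_mono h1)]
    · have : V i ⊓ A = L := le_antisymm
        (fun v hv => hA.mem_of_orth v hv.2 fun l hl => D.isotropic i l (h1 hl) v hv.1)
        (le_inf h1 hA.le)
      rw [this, min_eq_right (Submodule.finrank_mono h1)]

/-- The flag induced on the orthogonal of a hyperbolic summand. -/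
theorem FlagDatum.right (D : FlagDatum B V d) (h : OrthDecomp B V A F) (hA : IsHyperbolic B L A)
    (hV : ∀ i, V i ≤ L ∨ L ≤ V i) :
    FlagDatum (B.restrict F) (flagOn V F) (fun i => d i - finrank ℂ L) where
  toDatum := (h.symm D.toDatum).datum D.toDatum
  nested i j := (D.nested i j).imp (fun h => Submodule.comap_mono h) (fun h => Submodule.comap_mono h)
  finrank_eq i := by
    have h1 := h.finrank_add i
    rw [(D.left h hA hV).finrank_eq, D.finrank_eq] at h1
    omega

/-- Nondegeneracy on L pairs L perfectly with yL. The image yL itself need not be isotropic. -/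
theorem isHyperbolic_sup_map (hs : ∀ v w, B v w = B w v) (hy : IsSkew B y)
    (hiso : ∀ u ∈ L, ∀ v ∈ L, B u v = 0) (hn : NondegOn B y L) :
    IsHyperbolic B L (L ⊔ L.map y) where
  le := le_sup_left
  iso := hiso
  mem_of_orth a ha h := by
    obtain ⟨l, hl, _, ⟨l', hl', rfl⟩, rfl⟩ := Submodule.mem_sup.1 ha
    have : l' = 0 := hn l' hl' fun v hv => by
      have := h v hv
      rwa [map_add, hiso v hv l hl, zero_add, hs] at this
    rw [this, map_zero, add_zero]
    exact hl
  nondeg a ha h := by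
    obtain ⟨l, hl, _, ⟨l', hl', rfl⟩, rfl⟩ := Submodule.mem_sup.1 ha
    have h1 : l' = 0 := hn l' hl' fun v hv => by
      have := h v (Submodule.mem_sup_left hv)
      rwa [LinearMap.map_add₂, hiso l hl v hv, zero_add] at this
    rw [h1, map_zero, add_zero] at h ⊢
    refine hn l hl fun v hv => ?_
    have := h (y v) (Submodule.mem_sup_right ⟨v, hv, rfl⟩)
    rw [hy, this, neg_zero]

theorem Datum.exists_isHyperbolic (D : Datum B V) (hiso : ∀ u ∈ L, ∀ v ∈ L, B u v = 0) :
    ∃ A, IsHyperbolic B L A := by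
  obtain ⟨σ, h1, h2⟩ := D.exists_dual hiso
  have key : ∀ a ∈ L ⊔ LinearMap.range σ, (∀ l ∈ L, B l a = 0) → a ∈ L := by
    intro a ha h
    obtain ⟨l, hl, _, ⟨f, rfl⟩, rfl⟩ := Submodule.mem_sup.1 ha
    have : f = 0 := LinearMap.ext fun u => by
      have := h u u.2
      rwa [map_add, hiso u u.2 l hl, zero_add, D.symm, h1] at this
    rw [this, map_zero, add_zero]
    exact hl
  refine ⟨L ⊔ LinearMap.range σ, le_sup_left, hiso, key, fun a ha h => ?_⟩
  have hl := key a ha fun l hl => by rw [D.symm]; exact h l (Submodule.mem_sup_left hl)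
  refine congrArg Subtype.val ((Module.forall_dual_apply_eq_zero_iff ℂ (⟨a, hl⟩ : L)).1 fun f => ?_)
  rw [← h1, D.symm]
  exact h _ (Submodule.mem_sup_right ⟨f, rfl⟩)

theorem IsHyperbolic.exists_eq_add (hA : IsHyperbolic B L A) (hs : ∀ v w, B v w = B w v)
    (hy : IsSkew B y) (hyL : ∀ l ∈ L, y l ∈ A) (hn : NondegOn B y L) {a : E} (ha : a ∈ A) :
    ∃ l ∈ L, ∃ l' ∈ L, a = l + y l' := by
  obtain ⟨s, hs', h⟩ := exists_solve hs hy L (B a) fun k hk hk' => by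
    rw [hn k hk hk', map_zero]
  refine ⟨a - y s, hA.mem_of_orth _ (sub_mem ha (hyL s hs')) fun l hl => ?_, s, hs', by simp⟩
  rw [hs, map_sub, LinearMap.sub_apply, h l hl, sub_self]

/-- A splitting criterion for a hyperbolic summand. -/
theorem IsHyperbolic.splits (D : Datum B V) (hA : IsHyperbolic B L A) (h : OrthDecomp B V A F)
    (hy : IsSkew B y) (hyL : ∀ l ∈ L, y l ∈ A) (hn : NondegOn B y L)
    (hg : ∀ g ∈ grpStab B V y, ∀ l ∈ L, g l ∈ L ∧ g (y l) - y (g l) ∈ A)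
    (ha : ∀ z, Par B V z → (∀ a ∈ A, z a ∈ F) → ∀ l ∈ L, ∀ l' ∈ L, B (y (z l)) (y l') = 0) :
    Splits B V y A F := by
  refine h.splits_of_lagrangian D hy (fun g hgm a haA => ?_) hA.le hyL hA.mem_of_orth
    fun z hz h1 h2 l hl a haA => ?_
  · obtain ⟨l, hl, l', hl', rfl⟩ := hA.exists_eq_add D.symm hy hyL hn haA
    have e : g (l + y l') = g l + (g (y l') - y (g l')) + y (g l') := by rw [map_add]; abel
    rw [e]
    exact add_mem (add_mem (hA.le (hg g hgm l hl).1) (hg g hgm l' hl').2) (hyL _ (hg g hgm l' hl').1)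
  · obtain ⟨m, hm, m', hm', rfl⟩ := hA.exists_eq_add D.symm hy hyL hn haA
    rw [map_add, ha z hz h1 l hl m' hm', hy, D.symm, h.orth _ (hyL m hm) _ (h1 l (hA.le hl))]
    ring

end FlagTypes


/-! ### Splitting off even members, and hyperplanes of odd ones -/

section Reduction

variable {E : Type*} [AddCommGroup E] [Module ℂ E] [FiniteDimensional ℂ E] {ι : Type*}
  {B : BilinForm ℂ E} {V : ι → Submodule ℂ E} {y : End ℂ E} {L A F : Submodule ℂ E} {d : ι → ℕ}

theorem LieEquiv.nonempty_prod {L₁ L₂ M₁ M₂ : Type*} [LieRing L₁] [LieAlgebra ℂ L₁] [LieRing L₂]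
    [LieAlgebra ℂ L₂] [LieRing M₁] [LieAlgebra ℂ M₁] [LieRing M₂] [LieAlgebra ℂ M₂]
    (e₁ : L₁ ≃ₗ⁅ℂ⁆ M₁) (e₂ : L₂ ≃ₗ⁅ℂ⁆ M₂) : Nonempty ((L₁ × L₂) ≃ₗ⁅ℂ⁆ (M₁ × M₂)) :=
  ⟨{ e₁.toLinearEquiv.prodCongr e₂.toLinearEquiv with
      map_lie' := fun {x y} => Prod.ext (e₁.map_lie x.1 y.1) (e₂.map_lie x.2 y.2) }⟩

theorem Target.of_equiv {M M' : Type*} [LieRing M] [LieAlgebra ℂ M] [LieRing M'] [LieAlgebra ℂ M']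
    (h : Target B V M) (e : M ≃ₗ⁅ℂ⁆ M') : Target B V M' :=
  ⟨fun y hy hR hN => (h.1 y hy hR hN).map fun f => f.trans e, h.2⟩

theorem extendZero_isSkew (hs : ∀ v w, B v w = B w v) (h : OrthDecomp B V A F) {x : End ℂ A}
    (hx : IsSkew (B.restrict A) x) : IsSkew B (extendZero h.compl x) := by
  intro v w
  obtain ⟨a, ha, f, hf, rfl⟩ :=
    Submodule.mem_sup.1 (h.compl.sup_eq_top ▸ Submodule.mem_top (x := v))
  obtain ⟨a', ha', f', hf', rfl⟩ :=
    Submodule.mem_sup.1 (h.compl.sup_eq_top ▸ Submodule.mem_top (x := w))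
  have e : ∀ b (hb : b ∈ A), ∀ c ∈ F, extendZero h.compl x (b + c) = x ⟨b, hb⟩ :=
    fun b hb c hc => by
      rw [map_add, extendZero_right _ _ hc, add_zero, extendZero_left' _ _ hb]
  rw [e a ha f hf, e a' ha' f' hf', map_add, LinearMap.map_add₂,
    h.orth _ (Submodule.coe_mem _) f' hf', hs f, h.orth _ (Submodule.coe_mem _) f hf,
    add_zero, add_zero]
  exact hx ⟨a, ha⟩ ⟨a', ha'⟩

/-- Direct sums of skew endomorphisms. -/
theorem OrthDecomp.exists_sum (D : Datum B V) (h : OrthDecomp B V A F) {x : End ℂ A} {x' : End ℂ F}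
    (hx : IsSkew (B.restrict A) x) (hx' : IsSkew (B.restrict F) x') :
    ∃ y, IsSkew B y ∧ corner h.compl y = x ∧ corner h.compl.symm y = x' ∧
      (∀ a : A, y a = x a) ∧ ∀ f : F, y f = x' f := by
  refine ⟨extendZero h.compl x + extendZero h.compl.symm x', (extendZero_isSkew D.symm h hx).add
    (extendZero_isSkew D.symm (h.symm D) hx'), ?_, ?_, fun a => ?_, fun f => ?_⟩
  · rw [corner_add, corner_extendZero, corner_extendZero_symm h.compl.symm, add_zero]
  · rw [corner_add, corner_extendZero, corner_extendZero_symm h.compl, zero_add]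
  · rw [LinearMap.add_apply, extendZero_left, extendZero_right _ _ a.2, add_zero]
  · rw [LinearMap.add_apply, extendZero_left, extendZero_right _ _ f.2, zero_add]

section
variable {M₁ M₂ : Type*} [LieRing M₁] [LieAlgebra ℂ M₁] [LieRing M₂] [LieAlgebra ℂ M₂]

theorem Splits.nonempty_equiv_prod (D : Datum B V) (h : Splits B V y A F) (hy : IsSkew B y)
    (hR : OrthReductive B V y) (hN : NilType B V y)
    (hA : Target (B.restrict A) (flagOn V A) M₁) (hF : Target (B.restrict F) (flagOn V F) M₂) :
    Nonempty (lieStab B V y ≃ₗ⁅ℂ⁆ M₁ × M₂) := by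
  obtain ⟨e⟩ := h.nonempty_equiv D
  obtain ⟨e₁⟩ := hA.1 _ (h.corner_isSkew D hy) (h.orthReductive_corner D hR)
    (h.nilType_corner D hN)
  obtain ⟨e₂⟩ := hF.1 _ ((h.toOrthDecomp.symm D).corner_isSkew D hy)
    ((h.symm D).orthReductive_corner D hR) ((h.symm D).nilType_corner D hN)
  obtain ⟨e'⟩ := LieEquiv.nonempty_prod e₁ e₂
  exact ⟨e.trans e'⟩

/-- The block sum of rigid forms of nilpotent type on the summands is again one as soon as it
splits. Rigid forms are reductive, so reductivity of the blocks may be used to prove the splitting.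
-/
theorem OrthDecomp.exists_of_target (D : Datum B V) (h : OrthDecomp B V A F)
    (hA : Target (B.restrict A) (flagOn V A) M₁) (hF : Target (B.restrict F) (flagOn V F) M₂)
    (hs : ∀ (y : End ℂ E) (x : End ℂ A) (x' : End ℂ F), IsSkew B y →
      IsSkew (B.restrict A) x → IsSkew (B.restrict F) x' → (∀ a : A, y a = x a) →
      (∀ f : F, y f = x' f) → OrthReductive (B.restrict A) (flagOn V A) x →
      OrthReductive (B.restrict F) (flagOn V F) x' → Splits B V y A F) :
    ∃ y, IsSkew B y ∧ NilType B V y ∧ RigidUnip B V y := by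
  obtain ⟨x, hx, hxN, hxR⟩ := hA.2
  obtain ⟨x', hx', hxN', hxR'⟩ := hF.2
  obtain ⟨y, hy, rfl, rfl, h3, h4⟩ := h.exists_sum D hx hx'
  have hS := hs y _ _ hy hx hx' h3 h4 hxR.orthReductive hxR'.orthReductive
  exact ⟨y, hy, hS.nilType D hxN hxN', hS.rigidUnip D hxR hxR'⟩

end

/-- Splitting off an even-dimensional member of the flag. -/
theorem IsHyperbolic.splits_even (D : FlagDatum B V d) {j : ι} (hA : IsHyperbolic B (V j) A)
    (h : OrthDecomp B V A F) (hy : IsSkew B y) (hyL : ∀ l ∈ V j, y l ∈ A)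
    (hn : NondegOn B y (V j)) : Splits B V y A F := by
  refine hA.splits D.toDatum h hy hyL hn (fun g hg l hl => ?_) fun z hz hzA l hl l' hl' => ?_
  · have hgj : ∀ i v, g v ∈ V i ↔ v ∈ V i := hg.1.2
    -- For w orthogonal to V_j the element l ∧ g⁻¹w lies in the parabolic subalgebra. Invariance
    -- then gives B(g(yl) - y(gl), w) = 0, so this difference lies in V_j^⊥⊥ = V_j.
    refine ⟨(hgj j l).2 hl, hA.le (D.mem_of_perp fun w hw => ?_)⟩
    have h1 : ∀ v ∈ V j, B v (g.symm w) = 0 := fun v hv => by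
      rw [← hg.1.1, g.apply_symm_apply]; exact hw _ ((hgj j v).2 hv)
    have hp : Par B V (wedge B l (g.symm w)) := par_wedge D.symm fun i => by
      rcases D.nested i j with h2 | h2
      · exact ⟨fun v hv => D.isotropic j _ hl _ (h2 hv), Or.inr fun v hv => by
          rw [D.symm]; exact h1 v (h2 hv)⟩
      · exact ⟨fun v hv => D.isotropic i _ (h2 hl) _ hv, Or.inl (h2 hl)⟩
    have h2 := grpStab_inv D.symm hy hg hp
    rw [g.apply_symm_apply] at h2
    rw [D.symm, map_sub, LinearMap.sub_apply, h2, ← hg.1.1 (y l), g.apply_symm_apply, sub_self]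
  -- An off-diagonal z sends l into F, but also into V_j ⊆ A; so zl = 0.
  · have h1 : z l ∈ A := hA.le (hz.2 j l hl)
    rw [Submodule.disjoint_def.1 h.compl.disjoint _ h1 (hzA l (hA.le hl)), map_zero, map_zero,
      LinearMap.zero_apply]

/-- Splitting off a hyperplane of the first, odd-dimensional member of the flag. -/
theorem IsHyperbolic.splits_odd (D : Datum B V) {j : ι} (hV : ∀ i, V i = ⊥ ∨ V j ≤ V i)
    (hA : IsHyperbolic B L A) (h : OrthDecomp B V A F) (hy : IsSkew B y)
    (hyL : ∀ l ∈ L, y l ∈ A) (hn : NondegOn B y L) (hLj : L ≤ V j) {k : E} (hkj : k ∈ V j)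
    (hk : k ∈ F) (he : y k ∈ F) (hVj : ∀ v ∈ V j, ∃ s ∈ L, ∃ c : ℂ, v = s + c • k)
    (hee : B (y k) (y k) ≠ 0) : Splits B V y A F := by
  have hyy : ∀ v, B (y v) v = 0 := fun v => by
    have : B (y v) v = -B (y v) v := by nth_rewrite 1 [hy, D.symm]; rfl
    linear_combination this / 2
  have hker : ∀ v ∈ V j, B (y k) v = 0 := fun v hv => by
    obtain ⟨s, hs, c, rfl⟩ := hVj v hv
    rw [map_add, map_smul, hyy, smul_zero, add_zero, D.symm, h.orth s (hA.le hs) _ he]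
  have hkerL : ∀ v ∈ V j, (∀ u ∈ L, B (y v) u = 0) → ∃ c : ℂ, v = c • k := fun v hv hv' => by
    obtain ⟨s, hs, c, rfl⟩ := hVj v hv
    refine ⟨c, ?_⟩
    rw [hn s hs fun u hu => ?_, zero_add]
    have := hv' u hu
    rwa [map_add, map_add, map_smul, map_smul, LinearMap.add_apply, LinearMap.smul_apply,
      hker u (hLj hu), smul_zero, add_zero] at this
  refine hA.splits D h hy hyL hn (fun g hg l hl => ?_) fun z hz hzA l hl l' hl' => ?_
  · have hgj : ∀ i v, g v ∈ V i ↔ v ∈ V i := hg.1.2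
    have hgi : ∀ v ∈ V j, ∃ u ∈ V j, g u = v := fun v hv =>
      ⟨g.symm v, (hgj j _).1 (by rwa [g.apply_symm_apply]), g.apply_symm_apply v⟩
    -- V_j is the smallest nonzero member, so v ∧ w lies in the parabolic subalgebra for every w,
    -- and g commutes with `y` on V_j without error term.
    have hcomm : ∀ v ∈ V j, g (y v) = y (g v) := fun v hv => by
      refine (sub_eq_zero.1 (D.nondeg _ fun w => ?_)).symm
      have hp : Par B V (wedge B v (g.symm w)) := par_wedge D.symm fun i => by
        rcases hV i with h2 | h2
        · exact ⟨fun w hw => by rw [h2, Submodule.mem_bot] at hw; rw [hw, map_zero],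
            Or.inr fun w hw => by rw [h2, Submodule.mem_bot] at hw; rw [hw, map_zero]⟩
        · exact ⟨fun w hw => D.isotropic i _ (h2 hv) _ hw, Or.inl (h2 hv)⟩
      have h2 := grpStab_inv D.symm hy hg hp
      rw [g.apply_symm_apply] at h2
      rw [map_sub, LinearMap.sub_apply, h2, ← hg.1.1 (y v), g.apply_symm_apply, sub_self]
    obtain ⟨c, hc⟩ := hkerL (g k) ((hgj j k).2 hkj) fun u hu => by
      obtain ⟨u', hu', rfl⟩ := hgi u (hLj hu)
      rw [← hcomm k hkj, hg.1.1, hker u' hu']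
    have hge : g (y k) = c • y k := by rw [hcomm k hkj, hc, map_smul]
    have hc0 : c ≠ 0 := by
      rintro rfl
      have := hg.1.1 (y k) (y k)
      rw [hge, zero_smul, map_zero] at this
      exact hee this.symm
    refine ⟨?_, by rw [hcomm l (hLj hl), sub_self]; exact zero_mem _⟩
    obtain ⟨s, hs, c', hsc⟩ := hVj (g l) ((hgj j l).2 (hLj hl))
    -- L is the part of V_j whose image under `y` is orthogonal to yk. As yk is an eigenvector of g,
    -- this description is invariant, so gl has no component along k.
    have h1 : c * B (y (g l)) (y k) = 0 := by
      rw [← smul_eq_mul, ← map_smul, ← hge, ← hcomm l (hLj hl), hg.1.1,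
        h.orth _ (hyL l hl) _ he]
    have h2 := (mul_eq_zero.1 h1).resolve_left hc0
    rw [hsc, map_add, map_add, map_smul, map_smul, LinearMap.add_apply, LinearMap.smul_apply,
      h.orth _ (hyL s hs) _ he, zero_add, smul_eq_mul] at h2
    rw [hsc, (mul_eq_zero.1 h2).resolve_right hee, zero_smul, add_zero]
    exact hs
  · obtain ⟨s, hs, c, hsc⟩ := hVj (z l) (hz.2 j l (hLj hl))
    have hzl := hzA l (hA.le hl)
    have hs0 : s = 0 := by
      refine Submodule.disjoint_def.1 h.compl.disjoint _ (hA.le hs) ?_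
      have : s = z l - c • k := by rw [hsc]; abel
      rw [this]; exact sub_mem hzl (F.smul_mem c hk)
    rw [hsc, hs0, zero_add, map_smul, map_smul, LinearMap.smul_apply, D.symm,
      h.orth _ (hyL l' hl') _ he, smul_zero]

/-- For a first flag member of odd dimension that is not Lagrangian, the image of the kernel is
anisotropic. -/
theorem OrthReductive.kernel_anisotropic (D : Datum B V) (hR : OrthReductive B V y)
    (hy : IsSkew B y) {j : ι} (hV : ∀ i, V i = ⊥ ∨ V j ≤ V i)
    (hdim : 2 * finrank ℂ (V j) < finrank ℂ E) {k : E} (hkj : k ∈ V j) (hk0 : k ≠ 0)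
    (hker : ∀ v ∈ V j, B (y k) v = 0)
    (hk1 : ∀ v ∈ V j, (∀ u ∈ V j, B (y v) u = 0) → ∃ c : ℂ, v = c • k) :
    B (y k) (y k) ≠ 0 := by
  intro hee
  -- Correct w by s in V_j with B(ys, ·) = -B(yw, ·) on V_j; this is solvable because the right side
  -- vanishes at k. Then k ∧ (w + s) stabilises the form and lowers the filtration of V_j, so it is
  -- zero and w lies in V_j.
  have key : ∀ w, (∀ v ∈ V j, B v w = 0) → B w (y k) = 0 → (∀ z, Par B V z → B (y k) (z w) = 0) →
      w ∈ V j := by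
    intro w hw hwe hwz
    obtain ⟨s, hs, hs'⟩ := exists_solve D.symm hy (V j) (-(B (y w))) fun v hv hv' => by
      obtain ⟨c, rfl⟩ := hk1 v hv hv'
      rw [LinearMap.neg_apply, map_smul, hy, hwe]; simp
    have hx : wedge B k (w + s) ∈ lieStab B V y := by
      refine ⟨par_wedge D.symm fun i => ?_, fun z hz => ?_⟩
      · rcases hV i with h2 | h2
        · exact ⟨fun w hw => by rw [h2, Submodule.mem_bot] at hw; rw [hw, map_zero],
            Or.inr fun w hw => by rw [h2, Submodule.mem_bot] at hw; rw [hw, map_zero]⟩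
        · exact ⟨fun w hw => D.isotropic i _ (h2 hkj) _ hw, Or.inl (h2 hkj)⟩
      · rw [trace_lie_wedge D.symm hy hz.1, map_add z, map_add, map_add, map_add, hwz z hz,
          hker _ (hz.2 j s hs), D.symm (z k) (y s), hs' _ (hz.2 j k hkj), D.symm (z k)]
        simp
    have h3 := hR.eq_zero_of_lowering D (U := V j) (fun g hg u hu => (hg.1.2 j u).2 hu) hx
      (fun u hu => by
        rw [wedge_apply, D.isotropic j _ hkj _ hu, zero_smul, sub_zero, map_add,
          LinearMap.add_apply, D.isotropic j _ hs _ hu, D.symm, hw u hu, add_zero, zero_smul])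
      (fun u hu => by
        rw [wedge_apply, hu k hkj, zero_smul, sub_zero]
        exact Submodule.smul_mem _ _ hkj)
    obtain ⟨t, ht⟩ : ∃ t, B k t ≠ 0 := by
      by_contra! h
      exact hk0 (D.nondeg _ h)
    have h4 := LinearMap.congr_fun h3 t
    rw [wedge_apply, LinearMap.zero_apply, sub_eq_zero] at h4
    have h5 : w + s = ((B k t)⁻¹ * B (w + s) t) • k := by
      rw [mul_smul, h4, smul_smul, inv_mul_cancel₀ ht, one_smul]
    have h6 : w = ((B k t)⁻¹ * B (w + s) t) • k - s := by rw [← h5]; abel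
    rw [h6]
    exact sub_mem ((V j).smul_mem _ hkj) hs
  -- If yk were isotropic, the claim would apply first to w = yk and then to every w in V_j^⊥. So
  -- V_j^⊥ ⊆ V_j, against the dimension hypothesis.
  have he : y k ∈ V j := key (y k) (fun v hv => by rw [D.symm, hker v hv]) hee fun z hz => by
    have := hz.1 (y k) (y k)
    rw [D.symm] at this
    linear_combination this / 2
  have hle : B.orthogonal (V j) ≤ V j := fun w hw => key w hw (by
      rw [D.symm]; exact hw _ he) fun z hz => by
    have := hz.1 (y k) w
    rw [hw _ (hz.2 j _ he)] at this
    exact (neg_eq_zero.1 this.symm)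
  have h1 := Submodule.finrank_mono hle
  have h2 := D.finrank_perp (V j)
  omega

end Reduction


/-! ### Realising stabilisers by dimensions, and the two inductive splittings -/

section Composition

universe u
variable {E : Type u} [AddCommGroup E] [Module ℂ E] [FiniteDimensional ℂ E] {ι : Type*}
  {B : BilinForm ℂ E} {V : ι → Submodule ℂ E} {y : End ℂ E} {L A F : Submodule ℂ E} {n : ℕ}
  {d : ι → ℕ}

/-- Every flag of isotropic subspaces with dimensions `d` in a quadratic space of dimension `n` has
the maximal reductive stabiliser `M`. -/
def Realizes (n : ℕ) (d : ι → ℕ) (M : Type*) [LieRing M] [LieAlgebra ℂ M] : Prop :=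
  ∀ (E : Type u) [AddCommGroup E] [Module ℂ E] [FiniteDimensional ℂ E] (B : BilinForm ℂ E)
    (V : ι → Submodule ℂ E), FlagDatum B V d → finrank ℂ E = n → Target B V M

theorem FlagDatum.le_of_le (D : FlagDatum B V d) {i j : ι} (h : d i ≤ d j) : V i ≤ V j := by
  rcases D.nested i j with h1 | h1
  · exact h1
  · exact (Submodule.eq_of_le_of_finrank_le h1 (by rwa [D.finrank_eq, D.finrank_eq])).ge

theorem FlagDatum.eq_of_eq (D : FlagDatum B V d) {i j : ι} (h : d i = d j) : V i = V j :=
  le_antisymm (D.le_of_le h.le) (D.le_of_le h.ge)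

theorem FlagDatum.eq_bot (D : FlagDatum B V d) {i : ι} (h : d i = 0) : V i = ⊥ :=
  Submodule.finrank_eq_zero.1 (by rw [D.finrank_eq, h])

theorem FlagDatum.lagrangian (D : FlagDatum B V d) {m : ℕ} (hd : ∀ i, d i = 0 ∨ d i = m) {j : ι}
    (hj : d j = m) (hE : finrank ℂ E = 2 * m) : LagrangianDatum B V (V j) where
  toDatum := D.toDatum
  flag i := (hd i).imp D.eq_bot fun h => D.eq_of_eq (h.trans hj.symm)
  exists_eq := ⟨j, rfl⟩
  mem_of_orth v hv := by
    have h1 := D.finrank_perp (V j)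
    rw [D.finrank_eq, hj, hE] at h1
    have h2 : V j = B.orthogonal (V j) := Submodule.eq_of_le_of_finrank_eq
      (fun v hv w hw => D.isotropic j w hw v hv) (by rw [D.finrank_eq, hj]; omega)
    rw [h2]
    exact hv

theorem Realizes.of_bot (hd : ∀ i, d i = 0) : Realizes.{u} n d (soAlg n) := by
  intro E _ _ _ B V D hE
  subst hE
  exact target_of_bot D.toDatum fun i => D.eq_bot (hd i)

theorem Realizes.of_lagrangian {m : ℕ} (hd : ∀ i, d i = 0 ∨ d i = m) (j : ι)
    (hj : d j = m) (hm : Even m) : Realizes.{u} (2 * m) d (spAlg m) := by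
  intro E _ _ _ B V D hE
  have h := (D.lagrangian hd hj hE).target (by rwa [D.finrank_eq, hj])
  rw [D.finrank_eq, hj] at h
  exact h

theorem Realizes.of_equiv {M M' : Type*} [LieRing M] [LieAlgebra ℂ M] [LieRing M'] [LieAlgebra ℂ M']
    (h : Realizes.{u} n d M) (e : M ≃ₗ⁅ℂ⁆ M') : Realizes.{u} n d M' :=
  fun E _ _ _ B V D hE => (h E B V D hE).of_equiv e

theorem NondegOn.of_restrict (hLA : L ≤ A) {x : End ℂ A} (hyx : ∀ a : A, y a = x a)
    (hn : NondegOn (B.restrict A) x (L.comap A.subtype)) : NondegOn B y L := fun k hk hk' =>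
  congrArg Subtype.val (hn ⟨k, hLA hk⟩ hk fun v hv => by
    have := hk' v hv
    rwa [hyx ⟨k, hLA hk⟩] at this)

theorem apply_mem_of_restrict {x : End ℂ A} (hyx : ∀ a : A, y a = x a) {a : E} (ha : a ∈ A) :
    y a ∈ A := by
  rw [hyx ⟨a, ha⟩]
  exact Submodule.coe_mem _

variable {M₁ M₂ : Type*} [LieRing M₁] [LieAlgebra ℂ M₁] [LieRing M₂] [LieAlgebra ℂ M₂]

theorem exists_submodule_finrank_eq {W : Type*} [AddCommGroup W] [Module ℂ W] {m : ℕ}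
    (hm : m ≤ finrank ℂ W) : ∃ U : Submodule ℂ W, finrank ℂ U = m := by
  obtain ⟨v, hv⟩ := exists_linearIndependent_of_le_finrank hm
  exact ⟨Submodule.span ℂ (Set.range v), by rw [finrank_span_eq_card hv, Fintype.card_fin]⟩

/-- Splitting at an even-dimensional member of the flag. -/
theorem Realizes.of_even (j : ι) (hj : Even (d j))
    (h₁ : Realizes.{u} (2 * d j) (fun i => min (d i) (d j)) M₁)
    (h₂ : Realizes.{u} (n - 2 * d j) (fun i => d i - d j) M₂) : Realizes.{u} n d (M₁ × M₂) := by
  intro E _ _ _ B V D hE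
  have hVj := D.finrank_eq j
  have key : ∀ A, IsHyperbolic B (V j) A → ∃ h : OrthDecomp B V A (B.orthogonal A),
      Target (B.restrict A) (flagOn V A) M₁ ∧
      Target (B.restrict (B.orthogonal A)) (flagOn V (B.orthogonal A)) M₂ := by
    intro A hA
    have h := hA.orthDecomp D.toDatum fun i => (D.nested i j).imp (fun h => h.trans hA.le) id
    have h3 := hA.finrank_eq D.toDatum
    have h4 := h.finrank_add'
    have D₁ := D.left h hA fun i => D.nested i j
    have D₂ := D.right h hA fun i => D.nested i j
    rw [hVj] at h3 D₁ D₂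
    exact ⟨h, h₁ _ _ _ D₁ h3, h₂ _ _ _ D₂ (by omega)⟩
  constructor
  · intro y hy hR hN
    have hn := hR.nondegOn D.toDatum hy (fun i => D.nested i j) (by rwa [hVj])
    have hA := isHyperbolic_sup_map D.symm hy (D.isotropic j) hn
    obtain ⟨h, hT₁, hT₂⟩ := key _ hA
    exact (hA.splits_even D h hy (fun l hl => Submodule.mem_sup_right ⟨l, hl, rfl⟩)
      hn).nonempty_equiv_prod D.toDatum hy hR hN hT₁ hT₂
  · obtain ⟨A, hA⟩ := D.exists_isHyperbolic (D.isotropic j)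
    obtain ⟨h, hT₁, hT₂⟩ := key _ hA
    refine h.exists_of_target D.toDatum hT₁ hT₂ fun y x x' hy hx hx' hyx hyx' hR hR' => ?_
    have D₁ := D.left h hA fun i => D.nested i j
    have hn : NondegOn B y (V j) := .of_restrict hA.le hyx
      (hR.nondegOn D₁.toDatum hx (fun i => D₁.nested i j)
        (by rwa [D₁.finrank_eq, hVj, min_self]))
    exact hA.splits_even D h hy (fun l hl => apply_mem_of_restrict hyx (hA.le hl)) hn

/-- Splitting at the first member of the flag, when its dimension is odd. -/
theorem Realizes.of_odd (j : ι) {m : ℕ} (hm : Even m) (hj : d j = m + 1)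
    (hd : ∀ i, d i = 0 ∨ d j ≤ d i) (hn : 2 * d j < n)
    (h₁ : Realizes.{u} (2 * m) (fun i => min (d i) m) M₁)
    (h₂ : Realizes.{u} (n - 2 * m) (fun i => d i - m) M₂) : Realizes.{u} n d (M₁ × M₂) := by
  intro E _ _ _ B V D hE
  have hVj := (D.finrank_eq j).trans hj
  have hV : ∀ i, V i = ⊥ ∨ V j ≤ V i := fun i => (hd i).imp D.eq_bot D.le_of_le
  have hdim : 2 * finrank ℂ (V j) < finrank ℂ E := by rw [D.finrank_eq]; omega
  have key : ∀ L A, L ≤ V j → finrank ℂ L = m → IsHyperbolic B L A →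
      ∃ h : OrthDecomp B V A (B.orthogonal A), Target (B.restrict A) (flagOn V A) M₁ ∧
      Target (B.restrict (B.orthogonal A)) (flagOn V (B.orthogonal A)) M₂ ∧
      FlagDatum (B.restrict (B.orthogonal A)) (flagOn V (B.orthogonal A)) (fun i => d i - m) ∧
      FlagDatum (B.restrict A) (flagOn V A) (fun i => min (d i) m) ∧
      finrank ℂ (B.orthogonal A) = n - 2 * m := by
    intro L A hL hLm hA
    have hV' : ∀ i, V i ≤ L ∨ L ≤ V i := fun i => (hV i).imp (fun h => h.le.trans bot_le) hL.trans
    have h := hA.orthDecomp D.toDatum fun i => (hV' i).imp (fun h => h.trans hA.le) id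
    have h3 := hA.finrank_eq D.toDatum
    have h4 := h.finrank_add'
    have D₁ := D.left h hA hV'
    have D₂ := D.right h hA hV'
    rw [hLm] at h3 D₁ D₂
    exact ⟨h, h₁ _ _ _ D₁ h3, h₂ _ _ _ D₂ (by omega), D₂, D₁, by omega⟩
  constructor
  · intro y hy hR hN
    obtain ⟨k, hkj, hk0, hker, hk1⟩ := hR.exists_kernel D.toDatum hy (fun i => D.nested i j)
      (by rw [hVj]; exact hm.add_one)
    have hee := hR.kernel_anisotropic D.toDatum hy hV hdim hkj hk0 hker hk1
    -- φ does not vanish at k because yk is anisotropic, so its kernel on V_j is a hyperplane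
    -- complementary to the radical ℂk.
    let φ : E →ₗ[ℂ] ℂ := (B.flip (y k)) ∘ₗ y
    have hφ : ∀ v, φ v = B (y v) (y k) := fun v => rfl
    let L := V j ⊓ LinearMap.ker φ
    have hLj : L ≤ V j := inf_le_left
    have hL0 : ∀ l ∈ L, B (y l) (y k) = 0 := fun l hl => hl.2
    have hVL : ∀ v ∈ V j, ∃ s ∈ L, ∃ c : ℂ, v = s + c • k := fun v hv =>
      ⟨v - (φ v / φ k) • k, ⟨sub_mem hv ((V j).smul_mem _ hkj), by
        change φ _ = 0
        rw [map_sub, map_smul, smul_eq_mul, div_mul_cancel₀ _ (by exact hee : φ k ≠ 0), sub_self]⟩,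
        φ v / φ k, by rw [sub_add_cancel]⟩
    have hiso : ∀ u ∈ L, ∀ v ∈ L, B u v = 0 := fun u hu v hv =>
      D.isotropic j u (hLj hu) v (hLj hv)
    have hker' : ∀ v ∈ V j, B (y v) k = 0 := fun v hv => by
      rw [hy, D.symm, hker v hv, neg_zero]
    have hn : NondegOn B y L := fun l hl hl' => by
      obtain ⟨c, rfl⟩ := hk1 l (hLj hl) fun u hu => by
        obtain ⟨s, hs, c, rfl⟩ := hVL u hu
        rw [map_add, map_smul, hl' s hs, hker' l (hLj hl), smul_zero, add_zero]
      have h1 := hL0 _ hl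
      rw [map_smul, map_smul, LinearMap.smul_apply, smul_eq_mul] at h1
      rw [(mul_eq_zero.1 h1).resolve_right hee, zero_smul]
    have hA := isHyperbolic_sup_map D.symm hy hiso hn
    have hkF : k ∈ B.orthogonal (L ⊔ L.map y) := fun a ha => by
      obtain ⟨l, hl, _, ⟨l', hl', rfl⟩, rfl⟩ := Submodule.mem_sup.1 ha
      change B (l + y l') k = 0
      rw [LinearMap.map_add₂, D.isotropic j _ (hLj hl) _ hkj, hker' _ (hLj hl'), add_zero]
    have heF : y k ∈ B.orthogonal (L ⊔ L.map y) := fun a ha => by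
      obtain ⟨l, hl, _, ⟨l', hl', rfl⟩, rfl⟩ := Submodule.mem_sup.1 ha
      change B (l + y l') (y k) = 0
      rw [LinearMap.map_add₂, hL0 _ hl', D.symm, hker _ (hLj hl), add_zero]
    have hLm : finrank ℂ L = m := by
      have h1 : V j = L ⊔ Submodule.span ℂ {k} := by
        refine le_antisymm (fun v hv => ?_) (sup_le hLj ?_)
        · obtain ⟨s, hs, c, rfl⟩ := hVL v hv
          exact Submodule.add_mem_sup hs (Submodule.mem_span_singleton.2 ⟨c, rfl⟩)
        · rwa [Submodule.span_singleton_le_iff_mem]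
      have h2 : L ⊓ Submodule.span ℂ {k} = ⊥ := by
        rw [eq_bot_iff]
        rintro v ⟨hv, hv'⟩
        obtain ⟨c, rfl⟩ := Submodule.mem_span_singleton.1 hv'
        have h1 := hL0 _ hv
        rw [map_smul, map_smul, LinearMap.smul_apply, smul_eq_mul] at h1
        rw [(mul_eq_zero.1 h1).resolve_right hee, zero_smul]
        exact zero_mem _
      have h3 := Submodule.finrank_sup_add_finrank_inf_eq L (Submodule.span ℂ {k})
      rw [← h1, h2, finrank_bot, finrank_span_singleton hk0, hVj] at h3
      omega
    obtain ⟨h, hT₁, hT₂, -⟩ := key L _ hLj hLm hA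
    exact (hA.splits_odd D.toDatum hV h hy (fun l hl => Submodule.mem_sup_right ⟨l, hl, rfl⟩)
      hn hLj hkj hkF heF hVL hee).nonempty_equiv_prod D.toDatum hy hR hN hT₁ hT₂
  -- For existence any subspace L of dimension m in V_j will do. On the complementary summand V_j
  -- induces a line, and reductivity of the block chosen there makes the image of that line
  -- anisotropic.
  · obtain ⟨L, hL, hLm⟩ : ∃ L ≤ V j, finrank ℂ L = m := by
      obtain ⟨W, hW⟩ := exists_submodule_finrank_eq (W := V j) (m := m) (by omega)
      exact ⟨W.map (V j).subtype, Submodule.map_subtype_le _ _, by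
        rw [Submodule.finrank_map_subtype_eq]; exact hW⟩
    obtain ⟨A, hA⟩ := D.exists_isHyperbolic (L := L) fun u hu v hv =>
      D.isotropic j u (hL hu) v (hL hv)
    obtain ⟨h, hT₁, hT₂, D₂, D₁, hF⟩ := key L A hL hLm hA
    refine h.exists_of_target D.toDatum hT₁ hT₂ fun y x x' hy hx hx' hyx hyx' hR hR' => ?_
    have hflag : flagOn V A j = L.comap A.subtype := by
      symm
      refine Submodule.eq_of_le_of_finrank_eq (Submodule.comap_mono hL) ?_
      rw [D₁.finrank_eq, (Submodule.comapSubtypeEquivOfLe hA.le).finrank_eq, hLm]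
      omega
    have hn : NondegOn B y L := .of_restrict hA.le hyx (hflag ▸
      hR.nondegOn D₁.toDatum hx (fun i => D₁.nested i j)
        (by rw [D₁.finrank_eq, hj]; simpa using hm))
    have hd1 : finrank ℂ (flagOn V (B.orthogonal A) j) = 1 := by rw [D₂.finrank_eq]; omega
    obtain ⟨k, hkj, hk0, hker, hk1⟩ := hR'.exists_kernel D₂.toDatum hx'
      (fun i => D₂.nested i j) (by rw [hd1]; exact odd_one)
    have hee := hR'.kernel_anisotropic D₂.toDatum hx' (j := j)
      (fun i => (hV i).imp (fun h => by simp [flagOn, h]) fun h => Submodule.comap_mono h)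
      (by rw [hd1, hF]; omega) hkj hk0 hker hk1
    refine hA.splits_odd D.toDatum hV h hy (fun l hl => apply_mem_of_restrict hyx (hA.le hl)) hn hL
      (k := k) hkj k.2 (by rw [hyx']; exact Submodule.coe_mem _) (fun v hv => ?_) ?_
    · obtain ⟨a, ha, f, hf, hav, hfv, rfl⟩ := h.flag j v hv
      obtain ⟨c, hc⟩ := (finrank_eq_one_iff_of_nonzero' (⟨k, hkj⟩ :
        flagOn V (B.orthogonal A) j) (fun h => hk0 (congrArg Subtype.val h))).1 hd1 ⟨⟨f, hf⟩, hfv⟩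
      refine ⟨a, ?_, c, ?_⟩
      · exact (hflag.le (show (⟨a, ha⟩ : A) ∈ flagOn V A j from hav) :)
      · rw [show c • (k : E) = f from congrArg (fun z => ((z : B.orthogonal A) : E))
          (congrArg Subtype.val hc)]
    · rw [hyx']
      exact hee

end Composition


/-! ### Summands on which the stabiliser acts by signs; the isotropic line -/

section SignSummand

universe u
variable {E : Type u} [AddCommGroup E] [Module ℂ E] [FiniteDimensional ℂ E] {ι : Type*}
  {B : BilinForm ℂ E} {V : ι → Submodule ℂ E} {y : End ℂ E} {L A F T H K : Submodule ℂ E} {n : ℕ}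
  {d : ι → ℕ}

theorem IsSkew.form_self (hs : ∀ v w, B v w = B w v) (hy : IsSkew B y) (v : E) :
    B (y v) v = 0 := by
  have : B (y v) v = -B (y v) v := by nth_rewrite 1 [hy, hs]; rfl
  linear_combination this / 2

theorem OrthDecomp.eq_zero_of_mem (h : OrthDecomp B V A F) {v : E} (h1 : v ∈ A) (h2 : v ∈ F) :
    v = 0 := Submodule.disjoint_def.1 h.compl.disjoint v h1 h2

theorem OrthDecomp.exists_add (h : OrthDecomp B V A F) (v : E) : ∃ a ∈ A, ∃ f ∈ F, v = a + f := by
  obtain ⟨a, ha, f, hf, e⟩ :=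
    Submodule.mem_sup.1 (h.compl.sup_eq_top ▸ Submodule.mem_top (x := v))
  exact ⟨a, ha, f, hf, e.symm⟩

/-- Vanishing of a trace on maps exchanging two orthogonal summands, by means of a filtration
`K ⊆ H ⊆ T` of the second one. -/
theorem OrthDecomp.trace_eq_zero_of_filtration (D : Datum B V) (h : OrthDecomp B V A T)
    (hy : IsSkew B y) {z : End ℂ E} (hz : IsSkew B z) (h1 : ∀ a ∈ A, z a ∈ T)
    (h2 : ∀ t ∈ T, z t ∈ A) (hH : H ≤ T) (hK : K ≤ T)
    (hTH : ∀ t ∈ T, ∃ u ∈ H, y (z t) - u ∈ A) (hHK : ∀ t ∈ H, ∃ u ∈ K, y (z t) - u ∈ A)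
    (hK0 : ∀ t ∈ K, y (z t) ∈ A) : LinearMap.trace ℂ E (y * z) = 0 := by
  -- The T-corner of yz maps T to H, H to K and K to 0, so its cube vanishes.
  refine (h.symm D).trace_swap_eq_zero D hy hz h2 h1 ⟨3, ?_⟩
  have key : ∀ t : T, ∀ u ∈ T, y (z t) - u ∈ A →
      (corner (h.symm D).compl (y * z) t : E) = u := by
    intro t u hu hu'
    refine sub_eq_zero.1 (h.eq_zero_of_mem ?_ (sub_mem (Submodule.coe_mem _) hu))
    have h3 := sub_corner_mem (h.symm D).compl (y * z) t
    have : (corner (h.symm D).compl (y * z) t : E) - u =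
      (y (z t) - u) - ((y * z) t - corner (h.symm D).compl (y * z) t) := by
        rw [Module.End.mul_apply]; abel
    rw [this]
    exact sub_mem hu' h3
  ext t
  obtain ⟨u, hu, hu'⟩ := hTH t t.2
  have e1 := key t u (hH hu) hu'
  rw [← e1] at hu
  obtain ⟨u', hv, hv'⟩ := hHK _ hu
  have e2 := key _ u' (hK hv) hv'
  rw [← e2] at hv
  have e3 := key _ 0 (zero_mem _) (by rw [sub_zero]; exact hK0 _ hv)
  exact e3

theorem Splits.nonempty_equiv_of_sign {M : Type*} [LieRing M] [LieAlgebra ℂ M] (D : Datum B V)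
    (h : Splits B V y A T)
    (hsg : ∀ g ∈ grpStab B V y, (∀ f ∈ T, g f = f) ∨ (∀ f ∈ T, g f = -f)) (hy : IsSkew B y)
    (hR : OrthReductive B V y) (hN : NilType B V y) (hA : Target (B.restrict A) (flagOn V A) M) :
    Nonempty (lieStab B V y ≃ₗ⁅ℂ⁆ M) := by
  obtain ⟨e⟩ := h.nonempty_equiv_left D hsg
  obtain ⟨e'⟩ := hA.1 _ (h.corner_isSkew D hy) (h.orthReductive_corner D hR) (h.nilType_corner D hN)
  exact ⟨e.trans e'⟩

theorem FlagDatum.eq_span (D : FlagDatum B V d) {j : ι} (hj : d j = 1) {k : E} (hk : k ∈ V j)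
    (h0 : k ≠ 0) : V j = Submodule.span ℂ {k} := by
  symm
  refine Submodule.eq_of_le_of_finrank_eq ?_ ?_
  · rwa [Submodule.span_singleton_le_iff_mem]
  · rw [finrank_span_singleton h0, D.finrank_eq, hj]

section Line

variable {k : E}

theorem apply_eq_zero_of_span (h : OrthDecomp B V A T) {j : ι} (hj : V j = Submodule.span ℂ {k})
    (hk : k ∈ T) {z : End ℂ E} (hz : Par B V z) (h2 : ∀ t ∈ T, z t ∈ A) : z k = 0 := by
  refine h.eq_zero_of_mem (h2 k hk) ?_
  have := hz.2 j k (hj ▸ Submodule.mem_span_singleton_self k)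
  rw [hj] at this
  obtain ⟨c, hc⟩ := Submodule.mem_span_singleton.1 this
  rw [← hc]
  exact T.smul_mem c hk

/-- The action of the stabiliser on a member of the flag that is an anisotropically mapped line. -/
theorem grpStab_line (D : Datum B V) (hy : IsSkew B y)
    (hV : ∀ i, V i = ⊥ ∨ k ∈ V i) {j : ι} (hj : V j = Submodule.span ℂ {k})
    (hee : B (y k) (y k) ≠ 0) {g : E ≃ₗ[ℂ] E} (hg : g ∈ grpStab B V y) :
    ∃ ε : ℂ, ε * ε = 1 ∧ g k = ε • k ∧ g (y k) = ε • y k := by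
  have hgi : ∀ i v, g v ∈ V i ↔ v ∈ V i := hg.1.2
  have hk : g k ∈ V j := (hgi j k).2 (hj ▸ Submodule.mem_span_singleton_self k)
  rw [hj] at hk
  obtain ⟨c, hc⟩ := Submodule.mem_span_singleton.1 hk
  have he : g (y k) = y (g k) := by
    refine (sub_eq_zero.1 (D.nondeg _ fun w => ?_)).symm
    have hp : Par B V (wedge B k (g.symm w)) := par_wedge D.symm fun i => by
      rcases hV i with h2 | h2
      · exact ⟨fun w hw => by rw [h2, Submodule.mem_bot] at hw; rw [hw, map_zero],
          Or.inr fun w hw => by rw [h2, Submodule.mem_bot] at hw; rw [hw, map_zero]⟩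
      · exact ⟨fun w hw => D.isotropic i _ h2 _ hw, Or.inl h2⟩
    have h2 := grpStab_inv D.symm hy hg hp
    rw [g.apply_symm_apply] at h2
    rw [map_sub, LinearMap.sub_apply, h2, ← hg.1.1 (y k), g.apply_symm_apply, sub_self]
  rw [← hc, map_smul] at he
  refine ⟨c, ?_, hc.symm, he⟩
  have h1 := hg.1.1 (y k) (y k)
  rw [he] at h1
  simp only [map_smul, LinearMap.smul_apply, smul_eq_mul] at h1
  exact mul_right_cancel₀ hee (by rw [one_mul, mul_assoc]; exact h1)

theorem form_apply_of_eigen {g : E ≃ₗ[ℂ] E} (hg : ∀ v w, B (g v) (g w) = B v w) {ε : ℂ}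
    (hε : ε * ε = 1) {u : E} (hu : g u = ε • u) (t : E) : B u (g t) = ε * B u t := by
  rw [← hg u t, hu, map_smul, LinearMap.smul_apply, smul_eq_mul, ← mul_assoc, hε, one_mul]

theorem sign_of_eigen {g : E ≃ₗ[ℂ] E} {ε : ℂ} (hε : ε * ε = 1) (h : ∀ t ∈ T, g t = ε • t) :
    (∀ f ∈ T, g f = f) ∨ (∀ f ∈ T, g f = -f) := by
  rcases mul_self_eq_one_iff.1 hε with rfl | rfl
  · exact Or.inl fun f hf => by rw [h f hf, one_smul]
  · exact Or.inr fun f hf => by rw [h f hf, neg_smul, one_smul]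

/-- The case of a flag consisting of an isotropic line `ℂ k`: the splitting
`E = ⟨k, y k, y² k⟩^⊥ ⊕ ⟨k, y k, y² k⟩`. -/
theorem exists_splits_line (D : Datum B V) (hy : IsSkew B y)
    (hV : ∀ i, V i = ⊥ ∨ V i = Submodule.span ℂ {k}) {j : ι} (hj : V j = Submodule.span ℂ {k})
    (hee : B (y k) (y k) ≠ 0) : ∃ A T, Splits B V y A T ∧
      (∀ g ∈ grpStab B V y, (∀ f ∈ T, g f = f) ∨ (∀ f ∈ T, g f = -f)) ∧
      (∀ i, flagOn V A i = ⊥) ∧ finrank ℂ T = 3 ∧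
      (∀ a ∈ A, B k a = 0 ∧ B (y k) a = 0 ∧ B (y (y k)) a = 0) := by
  have hkk : B k k = 0 := D.isotropic j k (hj ▸ Submodule.mem_span_singleton_self k) k
    (hj ▸ Submodule.mem_span_singleton_self k)
  have hek : B (y k) k = 0 := hy.form_self D.symm k
  have hke : B k (y k) = 0 := by rw [D.symm, hek]
  have hfk : B (y (y k)) k = -B (y k) (y k) := hy _ _
  have hkf : B k (y (y k)) = -B (y k) (y k) := by rw [D.symm, hfk]
  have hfe : B (y (y k)) (y k) = 0 := hy.form_self D.symm _
  have hef : B (y k) (y (y k)) = 0 := by rw [D.symm, hfe]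
  -- In this basis the Gram matrix has ∓B(yk, yk) on the antidiagonal and only B(y²k, y²k) as a
  -- further possible entry, so it is nondegenerate.
  let T := Submodule.span ℂ {k, y k, y (y k)}
  have hmem : ∀ t, t ∈ T ↔ ∃ a b c : ℂ, a • k + b • y k + c • y (y k) = t := fun t =>
    Submodule.mem_span_triple
  have hkT : k ∈ T := Submodule.subset_span (by simp)
  have heT : y k ∈ T := Submodule.subset_span (by simp)
  have hfT : y (y k) ∈ T := Submodule.subset_span (by simp)
  have hT2 : ∀ t ∈ T, B k t = 0 → B (y k) t = 0 → t ∈ Submodule.span ℂ {k} := by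
    intro t ht h1 h2
    obtain ⟨a, b, c, rfl⟩ := (hmem t).1 ht
    simp only [map_add, map_smul, hkk, hke, hkf, hek, hef, smul_eq_mul, mul_zero, zero_add,
      add_zero] at h1 h2
    have hc : c = 0 := (mul_eq_zero.1 h1).resolve_right (neg_ne_zero.2 hee)
    have hb : b = 0 := (mul_eq_zero.1 h2).resolve_right hee
    exact Submodule.mem_span_singleton.2 ⟨a, by simp [hb, hc]⟩
  have hnd : ∀ t ∈ T, (∀ b ∈ T, B t b = 0) → t = 0 := by
    intro t ht h
    obtain ⟨a, rfl⟩ := Submodule.mem_span_singleton.1 (hT2 t ht (by rw [D.symm, h k hkT])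
      (by rw [D.symm, h _ heT]))
    have := h _ hfT
    rw [map_smul, LinearMap.smul_apply, hkf, smul_eq_mul] at this
    rw [(mul_eq_zero.1 this).resolve_right (neg_ne_zero.2 hee), zero_smul]
  have h := (D.orthDecomp hnd fun i v hv => ⟨v, by
    rcases hV i with h | h <;> rw [h] at hv
    · rw [(Submodule.mem_bot ℂ).1 hv]; exact zero_mem _
    · obtain ⟨c, rfl⟩ := Submodule.mem_span_singleton.1 hv
      exact T.smul_mem c hkT, hv, fun b _ => by rw [sub_self, map_zero]⟩).symm D
  set A := B.orthogonal T with hA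
  have hAmem : ∀ v, B k v = 0 → B (y k) v = 0 → B (y (y k)) v = 0 → v ∈ A := by
    intro v h1 h2 h3 t ht
    obtain ⟨a, b, c, rfl⟩ := (hmem t).1 ht
    change B (a • k + b • y k + c • y (y k)) v = 0
    simp [h1, h2, h3]
  have hAk : ∀ a ∈ A, B k a = 0 := fun a ha => ha k hkT
  have hAe : ∀ a ∈ A, B (y k) a = 0 := fun a ha => ha _ heT
  have hAf : ∀ a ∈ A, B (y (y k)) a = 0 := fun a ha => ha _ hfT
  have hV' : ∀ i, V i = ⊥ ∨ k ∈ V i := fun i => (hV i).imp_right fun h => by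
    rw [h]; exact Submodule.mem_span_singleton_self k
  have hpar : ∀ u v, B u k = 0 → B v k = 0 → Par B V (wedge B u v) := fun u v hu hv =>
    par_wedge D.symm fun i => by
      rcases hV i with h | h <;> rw [h]
      · exact ⟨fun w hw => by rw [(Submodule.mem_bot ℂ).1 hw, map_zero],
          Or.inr fun w hw => by rw [(Submodule.mem_bot ℂ).1 hw, map_zero]⟩
      · refine ⟨fun w hw => ?_, Or.inr fun w hw => ?_⟩ <;>
          obtain ⟨c, rfl⟩ := Submodule.mem_span_singleton.1 hw <;> simp [hu, hv]
  have hst : ∀ g ∈ grpStab B V y, ∀ a ∈ A, g a ∈ A := by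
    intro g hg a ha
    obtain ⟨ε, hε, h1, h2⟩ := grpStab_line D hy hV' hj hee hg
    refine hAmem _ ?_ ?_ ?_
    · rw [form_apply_of_eigen hg.1.1 hε h1, hAk a ha, mul_zero]
    · rw [form_apply_of_eigen hg.1.1 hε h2, hAe a ha, mul_zero]
    · have := grpStab_inv D.symm hy hg (hpar (y k) a hek (by rw [D.symm, hAk a ha]))
      rw [h2, hAf a ha, map_smul, map_smul, LinearMap.smul_apply, smul_eq_mul] at this
      refine (mul_eq_zero.1 this).resolve_left ?_
      rintro rfl
      simp at hε
  -- The T-component of ya is orthogonal to k and yk, because a is orthogonal to yk and y²k; so it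
  -- is a multiple of k. As every off-diagonal z kills k, the filtration argument applies with H = K
  -- = ℂk.
  have hyA : ∀ a ∈ A, ∃ u ∈ Submodule.span ℂ {k}, y a - u ∈ A := by
    intro a ha
    obtain ⟨a', ha', t, ht, e⟩ := h.exists_add (y a)
    have e' : t = y a - a' := by rw [e]; abel
    refine ⟨t, hT2 t ht ?_ ?_, by rw [e, add_sub_cancel_right]; exact ha'⟩
    · rw [e', map_sub, hAk a' ha', sub_zero, D.symm, hy, D.symm, hAe a ha, neg_zero]
    · rw [e', map_sub, hAe a' ha', sub_zero, D.symm, hy, D.symm, hAf a ha, neg_zero]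
  have hKT : Submodule.span ℂ {k} ≤ T := by rwa [Submodule.span_singleton_le_iff_mem]
  have hS : Splits B V y A T :=
    { toOrthDecomp := h
      left := hst
      right := h.right_stable D hst
      trace := fun z hz h1 h2 => by
        refine h.trace_eq_zero_of_filtration D hy hz.1 h1 h2 hKT hKT (fun t ht => hyA _ (h2 t ht))
          (fun t ht => hyA _ (h2 t (hKT ht))) fun t ht => ?_
        obtain ⟨c, rfl⟩ := Submodule.mem_span_singleton.1 ht
        rw [map_smul, apply_eq_zero_of_span h hj hkT hz h2, smul_zero, map_zero]
        exact zero_mem _ }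
  refine ⟨A, T, hS, fun g hg => ?_, fun i => ?_, ?_, fun a ha => ⟨hAk a ha, hAe a ha, hAf a ha⟩⟩
  · obtain ⟨ε, hε, h1, h2⟩ := grpStab_line D hy hV' hj hee hg
    refine sign_of_eigen hε (eq_smul_of_sub_mem_span D.symm hg.1.1 hε (l := k) (fun t ht => ?_)
      hkk hfT (by rw [hkf]; exact neg_ne_zero.2 hee))
    refine hT2 _ (sub_mem (hS.right g hg t ht) (T.smul_mem _ ht)) ?_ ?_
    · rw [map_sub, form_apply_of_eigen hg.1.1 hε h1, map_smul, smul_eq_mul, sub_self]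
    · rw [map_sub, form_apply_of_eigen hg.1.1 hε h2, map_smul, smul_eq_mul, sub_self]
  · rw [eq_bot_iff]
    rintro ⟨a, ha⟩ hai
    have hai' : a ∈ V i := hai
    refine (Submodule.mem_bot ℂ).2 (Subtype.ext (h.eq_zero_of_mem ha ?_))
    change a ∈ T
    rcases hV i with h | h <;> rw [h] at hai'
    · rw [(Submodule.mem_bot ℂ).1 hai']; exact zero_mem _
    · exact hKT hai'
  · have hli : LinearIndependent ℂ ![k, y k, y (y k)] := by
      rw [Fintype.linearIndependent_iff]
      intro c hc
      simp only [Fin.sum_univ_three, Matrix.cons_val] at hc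
      have h1 := congrArg (B k) hc
      have h2 := congrArg (B (y k)) hc
      have h3 := congrArg (B (y (y k))) hc
      simp only [map_add, map_smul, hkk, hke, hkf, hek, hef, hfk, hfe, smul_eq_mul, mul_zero,
        zero_add, add_zero, map_zero] at h1 h2 h3
      have hc2 := (mul_eq_zero.1 h1).resolve_right (neg_ne_zero.2 hee)
      have hc1 := (mul_eq_zero.1 h2).resolve_right hee
      rw [hc2, zero_mul, add_zero] at h3
      have hc0 := (mul_eq_zero.1 h3).resolve_right (neg_ne_zero.2 hee)
      intro i
      fin_cases i
      exacts [hc0, hc1, hc2]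
    have := finrank_span_eq_card hli
    rwa [show Set.range ![k, y k, y (y k)] = {k, y k, y (y k)} by
      rw [Matrix.range_cons, Matrix.range_cons, Matrix.range_cons, Matrix.range_empty,
        Set.union_empty, Set.singleton_union, Set.singleton_union]] at this

end Line

/-- Flags consisting of an isotropic line. -/
theorem Realizes.of_line (hd : ∀ i, d i = 0 ∨ d i = 1) (j : ι) (hj : d j = 1) (hn : 3 ≤ n) :
    Realizes.{u} n d (soAlg (n - 3)) := by
  intro E _ _ _ B V D hE
  have hV : ∀ k ∈ V j, k ≠ 0 → ∀ i, V i = ⊥ ∨ V i = Submodule.span ℂ {k} := fun k hk h0 i =>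
    (hd i).imp D.eq_bot fun h => (D.eq_of_eq (h.trans hj.symm)).trans (D.eq_span hj hk h0)
  constructor
  · intro y hy hR hN
    obtain ⟨k, hkj, hk0, hker, hk1⟩ := hR.exists_kernel D.toDatum hy (fun i => D.nested i j)
      (by rw [D.finrank_eq, hj]; exact odd_one)
    have hee := hR.kernel_anisotropic D.toDatum hy (j := j) (fun i => (hd i).imp D.eq_bot
      fun h => D.le_of_le (by omega)) (by rw [D.finrank_eq]; omega) hkj hk0 hker hk1
    obtain ⟨A, T, hS, hsg, hA, hT, -⟩ := exists_splits_line D.toDatum hy (hV k hkj hk0)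
      (D.eq_span hj hkj hk0) hee
    have h1 := hS.finrank_add'
    have h2 := target_of_bot (hS.datum D.toDatum) hA
    rw [show finrank ℂ A = n - 3 by omega] at h2
    exact hS.nonempty_equiv_of_sign D.toDatum hsg hy hR hN h2
  · obtain ⟨k, hk, h0⟩ : ∃ k ∈ V j, k ≠ 0 := Submodule.exists_mem_ne_zero_of_ne_bot fun h => by
      have := D.finrank_eq j
      rw [h, finrank_bot] at this
      omega
    obtain ⟨e, hke, hee⟩ := D.exists_anisotropic (by omega) k
    obtain ⟨w, hw⟩ : ∃ w, B k w ≠ 0 := by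
      by_contra! h
      exact h0 (D.nondeg _ h)
    -- The form y = e ∧ k', with e anisotropic and orthogonal to k and to k', while B(k, k') ≠ 0. It
    -- sends k to a nonzero multiple of e and vanishes on A, so the block on A is the zero form,
    -- which is rigid.
    let k' := w - (B e w / B e e) • e
    have hkk' : B k k' ≠ 0 := by simpa [k', hke] using hw
    have hek' : B e k' = 0 := by simp [k', hee]
    have hyk : wedge B e k' k = B k k' • e := by
      rw [wedge_apply, D.symm e k, hke, zero_smul, sub_zero, D.symm]
    have hye : wedge B e k' e = -(B e e) • k' := by
      rw [wedge_apply, D.symm k', hek']; module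
    have hy := isSkew_wedge D.symm e k'
    obtain ⟨A, T, hS, hsg, hA, hT, hA'⟩ := exists_splits_line D.toDatum hy (hV k hk h0)
      (D.eq_span hj hk h0) (by
        rw [hyk]
        simp only [map_smul, LinearMap.smul_apply, smul_eq_mul]
        exact mul_ne_zero hkk' (mul_ne_zero hkk' hee))
    have h0 : corner hS.compl (wedge B e k') = 0 := by
      ext a
      obtain ⟨-, h2, h3⟩ := hA' a a.2
      rw [hyk] at h2
      rw [hyk, map_smul, hye] at h3
      simp only [map_smul, LinearMap.smul_apply, smul_eq_mul] at h2 h3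
      have h4 := (mul_eq_zero.1 h2).resolve_left hkk'
      have h5 := (mul_eq_zero.1 ((mul_eq_zero.1 h3).resolve_left hkk')).resolve_left
        (neg_ne_zero.2 hee)
      have : wedge B e k' a = 0 := by rw [wedge_apply, h4, h5, zero_smul, zero_smul, sub_zero]
      rw [corner_apply_of_mem_right _ (by rw [this]; exact zero_mem _)]
      rfl
    refine ⟨_, hy, hS.nilType_left D.toDatum hsg ?_, hS.rigidUnip_left D.toDatum hsg ?_⟩
    · rw [h0]
      exact fun x _ => by rw [zero_mul, map_zero]
    · rw [h0]
      exact rigidUnip_zero (hS.datum D.toDatum) hA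

end SignSummand


/-! ### Symplectic parts: the flag of a line and a Lagrangian -/

section LagrangianSummand

universe u
variable {E : Type u} [AddCommGroup E] [Module ℂ E] [FiniteDimensional ℂ E] {ι : Type*}
  {B : BilinForm ℂ E} {V : ι → Submodule ℂ E} {y : End ℂ E} {L S A F T H K : Submodule ℂ E} {n : ℕ}
  {d : ι → ℕ}

theorem IsHyperbolic.orthDecomp_of_orth (D : Datum B V) (hA : IsHyperbolic B S A)
    (hV : ∀ i, S ≤ V i ∨ ∀ v ∈ V i, ∀ a ∈ A, B a v = 0) : OrthDecomp B V A (B.orthogonal A) := by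
  refine D.orthDecomp hA.nondeg fun i v hv => ?_
  rcases hV i with h | h
  · obtain ⟨a, ha, ha'⟩ := D.exists_orth_proj hA.nondeg v
    refine ⟨a, ha, h (hA.mem_of_orth a ha fun l hl => ?_), ha'⟩
    have h1 := ha' l (hA.le hl)
    rw [map_sub, D.isotropic i l (h hl) v hv, zero_sub, neg_eq_zero] at h1
    exact h1
  · exact ⟨0, zero_mem _, zero_mem _, fun b hb => by rw [sub_zero]; exact h v hv b hb⟩

theorem IsHyperbolic.lagrangianDatum (D : Datum B V) (hA : IsHyperbolic B S A)
    (hV : ∀ i, S ≤ V i ∨ ∀ v ∈ V i, ∀ a ∈ A, B a v = 0) {j : ι} (hj : S ≤ V j) :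
    LagrangianDatum (B.restrict A) (flagOn V A) (S.comap A.subtype) := by
  have key : ∀ i, S ≤ V i → flagOn V A i = S.comap A.subtype := fun i hi => le_antisymm
    (fun (a : A) ha => hA.mem_of_orth a a.2 fun l hl => D.isotropic i l (hi hl) a ha)
    (Submodule.comap_mono hi)
  exact
    { toDatum := (hA.orthDecomp_of_orth D hV).datum D
      flag := fun i => by
        rcases hV i with h | h
        · exact Or.inr (key i h)
        · refine Or.inl ((Submodule.eq_bot_iff _).2 fun a ha => Subtype.ext ?_)
          exact hA.nondeg a a.2 fun b hb => by rw [D.symm]; exact h a ha b hb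
      exists_eq := ⟨j, key j hj⟩
      mem_of_orth := fun a ha => hA.mem_of_orth a a.2 fun l hl => ha ⟨l, hA.le hl⟩ hl }

/-- A splitting criterion for a flag whose largest member is Lagrangian. -/
theorem IsHyperbolic.splits_of_lagrangian_flag (D : Datum B V) (hA : IsHyperbolic B S A)
    (h : OrthDecomp B V A T) (hy : IsSkew B y) {j : ι}
    (hL : ∀ v, (∀ l ∈ V j, B l v = 0) → v ∈ V j) (hSL : S ≤ V j)
    (hst : ∀ g ∈ grpStab B V y, ∀ a ∈ A, g a ∈ A)
    (hdec : ∀ v ∈ V j, ∃ s ∈ S, ∃ u ∈ T, y u ∈ T ∧ v = s + u) (hKT : K ≤ T)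
    (hKz : ∀ z, Par B V z → ∀ k ∈ K, z k ∈ K) (hyS : ∀ s ∈ S, ∃ u ∈ K, y s - u ∈ A) :
    Splits B V y A T where
  toOrthDecomp := h
  left := hst
  right := h.right_stable D hst
  trace z hz h1 h2 := by
    -- An off-diagonal z maps V_j ∩ T into A ∩ V_j, whose vectors are orthogonal to S and hence in
    -- S. With yS ⊆ K + A and zK = 0, the chain K, V_j ∩ T, T is the filtration required.
    have hzS : ∀ t ∈ V j ⊓ T, z t ∈ S := fun t ht =>
      hA.mem_of_orth _ (h2 t ht.2) fun l hl => D.isotropic j l (hSL hl) _ (hz.2 j t ht.1)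
    refine h.trace_eq_zero_of_filtration D hy hz.1 h1 h2 (H := V j ⊓ T) inf_le_right hKT
      (fun t ht => ?_) (fun t ht => hyS _ (hzS t ht)) fun t ht => ?_
    · obtain ⟨a, ha, u, hu, e⟩ := h.exists_add (y (z t))
      refine ⟨u, ⟨hL u fun l hl => ?_, hu⟩, by rw [e, add_sub_cancel_right]; exact ha⟩
      obtain ⟨s, hs, w, hwT, hw, rfl⟩ := hdec l hl
      have e' : u = y (z t) - a := by rw [e]; abel
      have h3 : B w a = 0 := by rw [D.symm]; exact h.orth a ha w hwT
      rw [LinearMap.map_add₂, h.orth s (hA.le hs) u hu, zero_add, e', map_sub, h3, sub_zero,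
        D.symm, hy, h.orth _ (h2 t ht) _ hw, neg_zero]
    · rw [h.eq_zero_of_mem (h2 t (hKT ht)) (hKT (hKz z hz t ht)), map_zero]
      exact zero_mem _

theorem finrank_inf_ker {W : Type*} [AddCommGroup W] [Module ℂ W] [FiniteDimensional ℂ W]
    {U : Submodule ℂ W} (φ : W →ₗ[ℂ] ℂ) {x : W} (hx : x ∈ U) (h : φ x ≠ 0) :
    finrank ℂ (U ⊓ LinearMap.ker φ : Submodule ℂ W) + 1 = finrank ℂ U := by
  have h1 := (φ.domRestrict U).finrank_range_add_finrank_ker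
  have h2 : LinearMap.range (φ.domRestrict U) = ⊤ := by
    refine LinearMap.range_eq_top.2 (LinearMap.surjective fun h0 => h ?_)
    exact LinearMap.congr_fun h0 ⟨x, hx⟩
  have h3 : LinearMap.ker (φ.domRestrict U) = (LinearMap.ker φ).comap U.subtype := rfl
  rw [h2, finrank_top, finrank_self, h3, ← Submodule.finrank_map_subtype_eq U,
    Submodule.map_comap_subtype] at h1
  omega

variable (B V y S) in
/-- `E` is the orthogonal sum of a summand on which the stabiliser acts by signs and a summand with
a flag given by the single Lagrangian subspace `S`, with a nondegenerate form on `S`. -/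
def HasSymplecticPart : Prop :=
  ∃ A T, ∃ h : Splits B V y A T,
    (∀ g ∈ grpStab B V y, (∀ f ∈ T, g f = f) ∨ (∀ f ∈ T, g f = -f)) ∧ S ≤ A ∧
    LagrangianDatum (B.restrict A) (flagOn V A) (S.comap A.subtype) ∧
    NondegOn (B.restrict A) (corner h.compl y) (S.comap A.subtype) ∧
    ∀ u v : A, (u : E) ∈ S → (v : E) ∈ S →
      B (corner h.compl y u) (corner h.compl y v) = B (y u) (y v)

theorem HasSymplecticPart.nonempty_equiv (D : Datum B V) (h : HasSymplecticPart B V y S)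
    (hy : IsSkew B y) (hR : OrthReductive B V y) (hN : NilType B V y) (he : Even (finrank ℂ S)) :
    Nonempty (lieStab B V y ≃ₗ⁅ℂ⁆ spAlg (finrank ℂ S)) := by
  obtain ⟨A, T, hS, hsg, hSA, hLD, -⟩ := h
  have e := (Submodule.comapSubtypeEquivOfLe hSA).finrank_eq
  have ht := hLD.target (by rwa [e])
  rw [e] at ht
  exact hS.nonempty_equiv_of_sign D hsg hy hR hN ht

theorem HasSymplecticPart.nilType_and_rigidUnip (D : Datum B V) (h : HasSymplecticPart B V y S)
    (hy : IsSkew B y) (hiso : ∀ u ∈ S, ∀ v ∈ S, B (y u) (y v) = 0) :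
    NilType B V y ∧ RigidUnip B V y := by
  obtain ⟨A, T, hS, hsg, hSA, hLD, hn, hq⟩ := h
  have hq' : ∀ u v : S.comap A.subtype,
      (B.restrict A) (corner hS.compl y u) (corner hS.compl y v) = 0 := fun u v =>
    (hq u v u.2 v.2).trans (hiso _ u.2 _ v.2)
  have hc := hS.corner_isSkew D hy
  exact ⟨hS.nilType_left D hsg (hLD.nilType hc hn hq'),
    hS.rigidUnip_left D hsg (hLD.rigidUnip hc hn hq')⟩

section LineLagrangian

variable {j : ι} {k : E}

/-- The line in the flag is what restricts the second factor to k^⊥. Invariance can only be tested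
against such wedges. -/
theorem par_wedge_line_lagrangian (D : Datum B V)
    (hV : ∀ i, V i = ⊥ ∨ V i = Submodule.span ℂ {k} ∨ V i = V j) (hk : k ∈ V j) {u v : E}
    (hu : u ∈ V j) (hv : B k v = 0) : Par B V (wedge B u v) :=
  par_wedge D.symm fun i => by
    rcases hV i with h | h | h <;> rw [h]
    · exact ⟨fun w hw => by rw [(Submodule.mem_bot ℂ).1 hw, map_zero],
        Or.inr fun w hw => by rw [(Submodule.mem_bot ℂ).1 hw, map_zero]⟩
    · refine ⟨fun w hw => ?_, Or.inr fun w hw => ?_⟩ <;>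
        obtain ⟨c, rfl⟩ := Submodule.mem_span_singleton.1 hw
      · rw [map_smul, D.isotropic j u hu k hk, smul_zero]
      · rw [map_smul, D.symm, hv, smul_zero]
    · exact ⟨fun w hw => D.isotropic j u hu w hw, Or.inl hu⟩

/-- Testing against v orthogonal to k determines a vector only up to k^⊥⊥ = ℂk. This is the error
term absent from the pure Lagrangian case. -/
theorem grpStab_sub_mem_line (D : Datum B V) (hy : IsSkew B y)
    (hV : ∀ i, V i = ⊥ ∨ V i = Submodule.span ℂ {k} ∨ V i = V j) (hk : k ∈ V j)
    {g : E ≃ₗ[ℂ] E} (hg : g ∈ grpStab B V y) {ε : ℂ} (hgk : g k = ε • k) {v : E} (hv : v ∈ V j) :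
    g (y v) - y (g v) ∈ Submodule.span ℂ {k} := by
  refine D.mem_span_of_perp fun w hw => ?_
  have h5 : B k (g.symm w) = 0 := by
    have : B (g k) w = 0 := by rw [hgk, map_smul, LinearMap.smul_apply, hw, smul_zero]
    rwa [← hg.1.1, g.apply_symm_apply]
  have h6 := grpStab_inv D.symm hy hg (par_wedge_line_lagrangian D hV hk hv h5)
  rw [g.apply_symm_apply] at h6
  rw [map_sub, LinearMap.sub_apply, h6, ← hg.1.1 (y v), g.apply_symm_apply, sub_self]

/-- Since yk is orthogonal to k, the wedge v ∧ yk is an admissible test element. It makes B(y²k, ·)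
on V_j an eigenvector for the stabiliser. -/
theorem grpStab_form_line (D : Datum B V) (hy : IsSkew B y)
    (hV : ∀ i, V i = ⊥ ∨ V i = Submodule.span ℂ {k} ∨ V i = V j) (hk : k ∈ V j)
    {g : E ≃ₗ[ℂ] E} (hg : g ∈ grpStab B V y) {ε : ℂ} (hε : ε * ε = 1)
    (hge : g (y k) = ε • y k) {v : E} (hv : v ∈ V j) :
    B (y (y k)) (g v) = ε * B (y (y k)) v := by
  have h := grpStab_inv D.symm hy hg (par_wedge_line_lagrangian D hV hk hv (v := y k)
    (by rw [D.symm, hy.form_self D.symm]))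
  rw [hge, map_smul, smul_eq_mul, D.symm, D.symm (y v)] at h
  rw [hy, hy _ v, ← h]
  linear_combination (B (y k) (y (g v))) * hε

/-- The case of a flag consisting of an isotropic line `ℂ k` and a Lagrangian subspace: the
complement of the summand `T` carries the symplectic part of the stabiliser. -/
theorem hasSymplecticPart_line_lagrangian (D : Datum B V) (hy : IsSkew B y) {i : ι} {h l : E}
    (hL : ∀ v, (∀ l ∈ V j, B l v = 0) → v ∈ V j)
    (hV : ∀ i, V i = ⊥ ∨ V i = Submodule.span ℂ {k} ∨ V i = V j)
    (hi : V i = Submodule.span ℂ {k}) (hk : k ∈ V j) (hee : B (y k) (y k) ≠ 0)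
    (hh : h ∈ V j) (heh : B (y k) h ≠ 0) (hl : l ∈ V j) (hyl : ∀ v ∈ V j, B (y l) v = 0)
    (hyl' : ∃ a b : ℂ, y l = a • k + b • h)
    (hker : ∀ v ∈ V j, (∀ u ∈ V j, B (y v) u = 0) → B (y (y k)) v = 0 → v = 0)
    (hfix : ∀ g ∈ grpStab B V y, ∀ ε : ℂ, ε * ε = 1 → g k = ε • k → g (y k) = ε • y k →
      g h = ε • h ∧ g l = ε • l)
    (hS : ∀ v, v ∈ S ↔ v ∈ V j ∧ B (y k) v = 0 ∧ B (y h) v = 0 ∧ B (y (y k)) v = 0)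
    (hdec : ∀ v ∈ V j, ∃ s ∈ S, ∃ a b c : ℂ, v = s + (a • k + b • h + c • l)) :
    HasSymplecticPart B V y S := by
  have hyy := hy.form_self D.symm
  have hsw : ∀ u v, B u (y v) = -B (y u) v := fun u v => by rw [hy, neg_neg]
  have hiso := D.isotropic j
  have hSj : S ≤ V j := fun s hs => ((hS s).1 hs).1
  have hylj : y l ∈ V j := hL _ fun v hv => by rw [D.symm, hyl v hv]
  have hhk : B (y h) k ≠ 0 := by rwa [hy, D.symm, neg_ne_zero]
  -- S + yS itself fails to be invariant by multiples of k. Each ys is corrected by a multiple of k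
  -- so as to be orthogonal to yh, which is possible because B(yh, k) ≠ 0.
  let A := (Submodule.span ℂ {k} ⊔ S ⊔ S.map y) ⊓ LinearMap.ker (B (y h))
  have hAmem : ∀ a, a ∈ A ↔ ∃ c : ℂ, ∃ s ∈ S, ∃ s' ∈ S, a = c • k + s + y s' ∧ B (y h) a = 0 := by
    intro a
    constructor
    · rintro ⟨ha, ha'⟩
      obtain ⟨b, hb, _, ⟨s', hs', rfl⟩, rfl⟩ := Submodule.mem_sup.1 ha
      obtain ⟨_, hc, s, hs, rfl⟩ := Submodule.mem_sup.1 hb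
      obtain ⟨c, rfl⟩ := Submodule.mem_span_singleton.1 hc
      exact ⟨c, s, hs, s', hs', rfl, ha'⟩
    · rintro ⟨c, s, hs, s', hs', rfl, h⟩
      exact ⟨Submodule.add_mem_sup (Submodule.add_mem_sup
        (Submodule.smul_mem _ _ (Submodule.mem_span_singleton_self k)) hs) ⟨s', hs', rfl⟩, h⟩
  have hSA : S ≤ A := fun s hs => (hAmem s).2 ⟨0, s, hs, 0, zero_mem _, by simp,
    ((hS s).1 hs).2.2.1⟩
  have hnS : NondegOn B y S := fun v hv hv' => by
    obtain ⟨hvj, h1, h2, h3⟩ := (hS v).1 hv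
    refine hker v hvj (fun u hu => ?_) h3
    obtain ⟨s, hs, a, b, c, rfl⟩ := hdec u hu
    have e1 : B (y v) k = 0 := by rw [hy, D.symm, h1, neg_zero]
    have e2 : B (y v) h = 0 := by rw [hy, D.symm, h2, neg_zero]
    have e3 : B (y v) l = 0 := by rw [hy, hiso v hvj _ hylj, neg_zero]
    simp [hv' s hs, e1, e2, e3]
  have hA : IsHyperbolic B S A := by
    have key : ∀ a ∈ A, (∀ l ∈ S, B l a = 0) → a ∈ S := by
      intro a ha h0
      obtain ⟨c, s, hs, s', hs', rfl, h1⟩ := (hAmem a).1 ha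
      have h2 : s' = 0 := hnS s' hs' fun u hu => by
        have := h0 u hu
        rwa [map_add, map_add, map_smul, hiso u (hSj hu) k hk, hiso u (hSj hu) s (hSj hs),
          smul_zero, zero_add, zero_add, D.symm] at this
      rw [h2, map_zero, add_zero, map_add, ((hS s).1 hs).2.2.1, add_zero, map_smul,
        smul_eq_mul] at h1
      rw [(mul_eq_zero.1 h1).resolve_right hhk, h2, zero_smul, zero_add, map_zero, add_zero]
      exact hs
    refine ⟨hSA, fun u hu v hv => hiso u (hSj hu) v (hSj hv), key, fun a ha h0 => ?_⟩
    have haS := key a ha fun l hl => by rw [D.symm]; exact h0 l (hSA hl)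
    refine hnS a haS fun v hv => ?_
    have h1 := h0 (-(B (y h) (y v) / B (y h) k) • k + 0 + y v)
      ((hAmem _).2 ⟨_, 0, zero_mem _, v, hv, rfl, by simp [hhk]⟩)
    rw [map_add, map_add, map_smul, hiso a (hSj haS) k hk, map_zero, smul_zero, add_zero, zero_add,
      hsw, neg_eq_zero] at h1
    exact h1
  have hTmem : ∀ t, (∀ a ∈ A, B a t = 0) → t ∈ B.orthogonal A := fun t ht => ht
  have horth : ∀ a ∈ A, B a k = 0 ∧ B a h = 0 ∧ B a l = 0 ∧ B a (y k) = 0 ∧ B a (y h) = 0 := by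
    intro a ha
    obtain ⟨c, s, hs, s', hs', rfl, h1⟩ := (hAmem a).1 ha
    obtain ⟨hs0, hs1, hs2, hs3⟩ := (hS s).1 hs
    obtain ⟨hs0', hs1', hs2', hs3'⟩ := (hS s').1 hs'
    have e1 : B (y s') k = 0 := by rw [hy, D.symm, hs1', neg_zero]
    have e2 : B (y s') h = 0 := by rw [hy, D.symm, hs2', neg_zero]
    have e3 : B (y s') l = 0 := by rw [hy, hiso s' hs0' _ hylj, neg_zero]
    have e4 : B (y s') (y k) = 0 := by rw [hy, D.symm, hs3', neg_zero]
    have e5 : B s (y k) = 0 := by rw [D.symm, hs1]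
    have e6 : B k (y k) = 0 := by rw [D.symm, hyy]
    refine ⟨?_, ?_, ?_, ?_, by rw [D.symm]; exact h1⟩ <;>
      simp only [map_add, map_smul, LinearMap.add_apply, LinearMap.smul_apply, e1, e2, e3, e4, e5,
        e6, hiso k hk k hk, hiso s hs0 k hk, hiso k hk h hh, hiso s hs0 h hh, hiso k hk l hl,
        hiso s hs0 l hl, smul_zero, add_zero]
  have hkT : k ∈ B.orthogonal A := fun a ha => (horth a ha).1
  have hhT : h ∈ B.orthogonal A := fun a ha => (horth a ha).2.1
  have hlT : l ∈ B.orthogonal A := fun a ha => (horth a ha).2.2.1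
  have heT : y k ∈ B.orthogonal A := fun a ha => (horth a ha).2.2.2.1
  have hyhT : y h ∈ B.orthogonal A := fun a ha => (horth a ha).2.2.2.2
  have hVA : ∀ i, S ≤ V i ∨ ∀ v ∈ V i, ∀ a ∈ A, B a v = 0 := fun i => by
    rcases hV i with h | h | h
    · exact Or.inr fun v hv a _ => by rw [h] at hv; rw [(Submodule.mem_bot ℂ).1 hv, map_zero]
    · refine Or.inr fun v hv a ha => ?_
      rw [h] at hv
      obtain ⟨c, rfl⟩ := Submodule.mem_span_singleton.1 hv
      rw [map_smul, (horth a ha).1, smul_zero]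
    · exact Or.inl (h ▸ hSj)
  have hO := hA.orthDecomp_of_orth D hVA
  set T := B.orthogonal A with hT
  have hpar : ∀ u v, u ∈ V j → B k v = 0 → Par B V (wedge B u v) := fun u v hu hv =>
    par_wedge_line_lagrangian D hV hk hu hv
  have hke : B k (y k) = 0 := by rw [D.symm, hyy]
  have hgrp : ∀ g ∈ grpStab B V y, ∃ ε : ℂ, ε * ε = 1 ∧ g k = ε • k ∧ g (y k) = ε • y k ∧
      g h = ε • h ∧ g l = ε • l ∧ (∀ v ∈ V j, g v ∈ V j) ∧
      ∀ v ∈ V j, g (y v) - y (g v) ∈ Submodule.span ℂ {k} := by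
    intro g hg
    obtain ⟨ε, hε, h1, h2⟩ := grpStab_line D hy (fun i => by
      rcases hV i with h | h | h
      · exact Or.inl h
      · exact Or.inr (h ▸ Submodule.mem_span_singleton_self k)
      · exact Or.inr (h ▸ hk)) hi hee hg
    obtain ⟨h3, h4⟩ := hfix g hg ε hε h1 h2
    refine ⟨ε, hε, h1, h2, h3, h4, fun v hv => (hg.1.2 j v).2 hv,
      fun v hv => grpStab_sub_mem_line D hy hV hk hg h1 hv⟩
  -- g(yh) - ε yh is a multiple of the isotropic k, and yh is not orthogonal to k; an isometry
  -- leaves no room for a nonzero multiple.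
  have hyhfix : ∀ g ∈ grpStab B V y, ∀ ε : ℂ, ε * ε = 1 → g h = ε • h → 
      g (y h) - y (g h) ∈ Submodule.span ℂ {k} → g (y h) = ε • y h := by
    intro g hg ε hε h1 h2
    rw [h1, map_smul] at h2
    refine eq_smul_of_sub_mem_span D.symm hg.1.1 hε (M := Submodule.span ℂ {y h}) (l := k)
      (t₀ := y h) (fun t ht => ?_) (hiso k hk k hk) (Submodule.mem_span_singleton_self _)
      (by rwa [D.symm]) _ (Submodule.mem_span_singleton_self _)
    obtain ⟨c, rfl⟩ := Submodule.mem_span_singleton.1 ht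
    rw [map_smul, smul_comm, ← smul_sub]
    exact Submodule.smul_mem _ _ h2
  have hst : ∀ g ∈ grpStab B V y, ∀ a ∈ A, g a ∈ A := by
    intro g hg a ha
    obtain ⟨ε, hε, g1, g2, g3, g4, g5, g6⟩ := hgrp g hg
    have g7 := hyhfix g hg ε hε g3 (g6 h hh)
    have hgS : ∀ s ∈ S, g s ∈ S := fun s hs => by
      obtain ⟨hs0, hs1, hs2, hs3⟩ := (hS s).1 hs
      refine (hS _).2 ⟨g5 s hs0, ?_, ?_, ?_⟩
      · rw [form_apply_of_eigen hg.1.1 hε g2, hs1, mul_zero]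
      · rw [form_apply_of_eigen hg.1.1 hε g7, hs2, mul_zero]
      · rw [grpStab_form_line D hy hV hk hg hε g2 hs0, hs3, mul_zero]
    obtain ⟨c, s, hs, s', hs', rfl, h1⟩ := (hAmem a).1 ha
    obtain ⟨c', hc'⟩ := Submodule.mem_span_singleton.1 (g6 s' (hSj hs'))
    refine (hAmem _).2 ⟨c * ε + c', g s, hgS s hs, g s', hgS s' hs', ?_, ?_⟩
    · have : g (y s') = c' • k + y (g s') := by rw [hc']; abel
      rw [map_add, map_add, map_smul, g1, this]
      module
    · rw [form_apply_of_eigen hg.1.1 hε g7, h1, mul_zero]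
  have hyS : ∀ s ∈ S, ∃ c : ℂ, y s - c • k ∈ A := fun s hs =>
    ⟨B (y h) (y s) / B (y h) k, (hAmem _).2 ⟨-(B (y h) (y s) / B (y h) k), 0, zero_mem _, s, hs,
      by module, by simp [hhk]⟩⟩
  have hKT : Submodule.span ℂ {k} ≤ T := by rwa [Submodule.span_singleton_le_iff_mem]
  have hSp : Splits B V y A T := by
    refine hA.splits_of_lagrangian_flag D hO hy hL hSj hst (fun v hv => ?_) hKT
      (fun z hz => hi ▸ hz.2 i) fun s hs => ?_
    · obtain ⟨s, hs, a, b, c, e⟩ := hdec v hv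
      obtain ⟨a', b', e'⟩ := hyl'
      refine ⟨s, hs, _, add_mem (add_mem (T.smul_mem _ hkT) (T.smul_mem _ hhT))
        (T.smul_mem _ hlT), ?_, e⟩
      rw [map_add, map_add, map_smul, map_smul, map_smul, e']
      exact add_mem (add_mem (T.smul_mem _ heT) (T.smul_mem _ hyhT))
        (T.smul_mem _ (add_mem (T.smul_mem _ hkT) (T.smul_mem _ hhT)))
    · obtain ⟨c, hc⟩ := hyS s hs
      exact ⟨c • k, Submodule.smul_mem _ _ (Submodule.mem_span_singleton_self k), hc⟩
  -- On S the corner of `y` differs from `y` by multiples of k, which is orthogonal to itself and to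
  -- yS. The values B(ys, ys') are therefore unchanged.
  have hcor : ∀ a : A, (a : E) ∈ S → ∃ c : ℂ, (corner hSp.compl y a : E) = y a - c • k := by
    intro a ha
    obtain ⟨c, hc⟩ := hyS a ha
    refine ⟨c, sub_eq_zero.1 (hSp.eq_zero_of_mem (sub_mem (Submodule.coe_mem _) hc) ?_)⟩
    have h3 := sub_corner_mem hSp.compl y a
    have : (corner hSp.compl y a : E) - (y a - c • k) = c • k - (y a - corner hSp.compl y a) := by
      abel
    rw [this]
    exact sub_mem (T.smul_mem _ hkT) h3
  refine ⟨A, T, hSp, fun g hg => ?_, hSA, hA.lagrangianDatum D hVA hSj, fun a ha h0 => ?_,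
    fun u v hu hv => ?_⟩
  · obtain ⟨ε, hε, g1, g2, g3, g4, g5, g6⟩ := hgrp g hg
    have g7 := hyhfix g hg ε hε g3 (g6 h hh)
    -- The difference is orthogonal to k, h, l and S, hence lies in V_j^⊥ ⊆ V_j and is a combination
    -- of k, h, l. Orthogonality to yk and yh removes the coefficients of h and k.
    have hd : ∀ t ∈ T, g t - ε • t ∈ Submodule.span ℂ {l} := by
      intro t ht
      have hdT : g t - ε • t ∈ T := sub_mem (hSp.right g hg t ht) (T.smul_mem _ ht)
      have hd0 : ∀ u, g u = ε • u → B u (g t - ε • t) = 0 := fun u hu => by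
        rw [map_sub, form_apply_of_eigen hg.1.1 hε hu, map_smul, smul_eq_mul, sub_self]
      have hdj : g t - ε • t ∈ V j := hL _ fun v hv => by
        obtain ⟨s, hs, a, b, c, rfl⟩ := hdec v hv
        simp only [LinearMap.map_add₂, LinearMap.map_smul₂, hd0 k g1, hd0 h g3, hd0 l g4,
          hSp.orth s (hSA hs) _ hdT, smul_zero, add_zero]
      obtain ⟨s, hs, a, b, c, e⟩ := hdec _ hdj
      have hs0 : s = 0 := by
        refine hSp.eq_zero_of_mem (hSA hs) ?_
        have : s = (g t - ε • t) - (a • k + b • h + c • l) := by rw [e]; abel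
        rw [this]
        exact sub_mem hdT (add_mem (add_mem (T.smul_mem _ hkT) (T.smul_mem _ hhT))
          (T.smul_mem _ hlT))
      have h1 := hd0 _ g2
      have h2 := hd0 _ g7
      have e1 : B (y k) l = 0 := by rw [hy, hiso k hk _ hylj, neg_zero]
      have e2 : B (y h) l = 0 := by rw [hy, hiso h hh _ hylj, neg_zero]
      rw [e, hs0] at h1 h2
      simp only [map_add, map_smul, map_zero, hyy, e1, e2, smul_eq_mul, mul_zero, add_zero,
        zero_add] at h1 h2
      rw [e, hs0, (mul_eq_zero.1 h1).resolve_right heh, (mul_eq_zero.1 h2).resolve_right hhk]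
      exact Submodule.mem_span_singleton.2 ⟨c, by simp⟩
    refine sign_of_eigen hε ?_
    by_cases hl0 : l = 0
    · intro t ht
      have := hd t ht
      rw [hl0, Submodule.span_zero_singleton, Submodule.mem_bot] at this
      exact sub_eq_zero.1 this
    · obtain ⟨t, ht, hlt⟩ : ∃ t ∈ T, B l t ≠ 0 := by
        by_contra! h0
        refine hl0 (D.nondeg _ fun w => ?_)
        obtain ⟨a, ha, t, ht, rfl⟩ := hSp.exists_add w
        rw [map_add, h0 t ht, D.symm, hSp.orth a ha l hlT, add_zero]
      exact eq_smul_of_sub_mem_span D.symm hg.1.1 hε hd (hiso l hl l hl) ht hlt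
  · refine Subtype.ext (hnS a ha fun s hs => ?_)
    have := h0 ⟨s, hSA hs⟩ hs
    rw [← this]
    exact (hSp.form_corner D.symm y a ⟨s, hSA hs⟩).symm
  · obtain ⟨c, hc⟩ := hcor u hu
    obtain ⟨c', hc'⟩ := hcor v hv
    have e1 : ∀ w ∈ S, B (y w) k = 0 := fun w hw => by
      rw [hy, D.symm, ((hS w).1 hw).2.1, neg_zero]
    rw [hc, hc']
    simp only [map_sub, map_smul, LinearMap.sub_apply, LinearMap.smul_apply, e1 u hu,
      D.symm k (y v), e1 v hv, hiso k hk k hk, smul_zero, sub_zero]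

end LineLagrangian

end LagrangianSummand


/-! ### The Lagrangian of odd dimension: the invariant decomposition -/

section LagrangianOdd

universe u
variable {E : Type u} [AddCommGroup E] [Module ℂ E] [FiniteDimensional ℂ E] {ι : Type*}
  {B : BilinForm ℂ E} {V : ι → Submodule ℂ E} {y : End ℂ E} {L S A F T H K : Submodule ℂ E} {n : ℕ}
  {d : ι → ℕ}

/-- The case of a flag consisting of a Lagrangian subspace of odd dimension. -/
theorem LagrangianDatum.hasSymplecticPart (D : LagrangianDatum B V L) (hy : IsSkew B y) {k p : E}
    (hk : k ∈ L) (hyk : y k ∈ L) (hee : B (y (y k)) (y (y k)) ≠ 0)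
    (hker : ∀ v ∈ L, (∀ u ∈ L, B (y v) u = 0) → v ∈ Submodule.span ℂ {k})
    (hp : p ∈ L) (hyp : ∀ v ∈ L, B (y p) v = B (y (y (y k))) v) (hpp : B (y p) (y p) = 0)
    (hS : ∀ v, v ∈ S ↔ v ∈ L ∧ B (y (y k)) v = 0 ∧ B (y p) v = 0 ∧ B (y p) (y v) = 0)
    (hdec : ∀ v ∈ L, ∃ s ∈ S, ∃ a b c : ℂ, v = s + (a • k + b • y k + c • p)) :
    HasSymplecticPart B V y S := by
  obtain ⟨j, hj⟩ := D.exists_eq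
  have hyy := hy.form_self D.symm
  have hsw : ∀ u v, B u (y v) = -B (y u) v := fun u v => by rw [hy, neg_neg]
  have hiso : ∀ u ∈ L, ∀ v ∈ L, B u v = 0 := fun u hu v hv => D.iso hu hv
  have hSL : S ≤ L := fun s hs => ((hS s).1 hs).1
  have hk0 : ∀ v ∈ L, B (y v) k = 0 := fun v hv => by rw [hy, hiso v hv _ hyk, neg_zero]
  have hpv : B (y p) (y k) = -B (y (y k)) (y (y k)) := by rw [hyp _ hyk, hy]
  have hpv0 : B (y p) (y k) ≠ 0 := by rw [hpv]; exact neg_ne_zero.2 hee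
  have hk00 : k ≠ 0 := by
    rintro rfl
    simp at hee
  have hnS : NondegOn B y S := fun v hv hv' => by
    obtain ⟨hvj, h1, h2, h3⟩ := (hS v).1 hv
    have e0 := hker v hvj fun u hu => by
      obtain ⟨s, hs, a, b, c, rfl⟩ := hdec u hu
      have e1 : B (y v) (y k) = 0 := by rw [hy, D.symm, h1, neg_zero]
      have e2 : B (y v) p = 0 := by rw [hy, D.symm, h2, neg_zero]
      simp [hv' s hs, e1, e2, hk0 v hvj]
    obtain ⟨c, rfl⟩ := Submodule.mem_span_singleton.1 e0
    rw [map_smul, map_smul, smul_eq_mul] at h3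
    rw [(mul_eq_zero.1 h3).resolve_right hpv0, zero_smul]
  have hA := isHyperbolic_sup_map D.symm hy (fun u hu v hv => hiso u (hSL hu) v (hSL hv)) hnS
  set A := S ⊔ S.map y with hAdef
  have hAmem : ∀ a ∈ A, ∃ s ∈ S, ∃ s' ∈ S, a = s + y s' := by
    intro a ha
    obtain ⟨s, hs, _, ⟨s', hs', rfl⟩, rfl⟩ := Submodule.mem_sup.1 ha
    exact ⟨s, hs, s', hs', rfl⟩
  have hSA : S ≤ A := le_sup_left
  have hyS : ∀ s ∈ S, y s ∈ A := fun s hs => Submodule.mem_sup_right ⟨s, hs, rfl⟩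
  have horth : ∀ a ∈ A, B a k = 0 ∧ B a (y k) = 0 ∧ B a p = 0 ∧ B a (y (y k)) = 0 ∧
      B a (y p) = 0 := by
    intro a ha
    obtain ⟨s, hs, s', hs', rfl⟩ := hAmem a ha
    obtain ⟨hs0, hs1, hs2, hs3⟩ := (hS s).1 hs
    obtain ⟨hs0', hs1', hs2', hs3'⟩ := (hS s').1 hs'
    have e1 : B (y s') (y k) = 0 := by rw [hy, D.symm, hs1', neg_zero]
    have e2 : B (y s') p = 0 := by rw [hy, D.symm, hs2', neg_zero]
    have e3 : B (y s') (y (y k)) = 0 := by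
      rw [D.symm, hsw, ← hyp s' hs0', hs2', neg_zero]
    have e4 : B (y s') (y p) = 0 := by rw [D.symm, hs3']
    have e5 : B s (y (y k)) = 0 := by rw [D.symm, hs1]
    have e6 : B s (y p) = 0 := by rw [D.symm, hs2]
    refine ⟨?_, ?_, ?_, ?_, ?_⟩ <;>
      simp only [map_add, LinearMap.add_apply, e1, e2, e3, e4, e5, e6, hk0 s' hs0',
        hiso s hs0 k hk, hiso s hs0 _ hyk, hiso s hs0 p hp, add_zero]
  have hVA : ∀ i, S ≤ V i ∨ ∀ v ∈ V i, ∀ a ∈ A, B a v = 0 := fun i => by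
    rcases D.flag i with h | h
    · exact Or.inr fun v hv a _ => by rw [h] at hv; rw [(Submodule.mem_bot ℂ).1 hv, map_zero]
    · exact Or.inl (h ▸ hSL)
  have hO := hA.orthDecomp_of_orth D.toDatum hVA
  have hkT : k ∈ B.orthogonal A := fun a ha => (horth a ha).1
  have hvT : y k ∈ B.orthogonal A := fun a ha => (horth a ha).2.1
  have hpT : p ∈ B.orthogonal A := fun a ha => (horth a ha).2.2.1
  have heT : y (y k) ∈ B.orthogonal A := fun a ha => (horth a ha).2.2.2.1
  have hypT : y p ∈ B.orthogonal A := fun a ha => (horth a ha).2.2.2.2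
  set T := B.orthogonal A with hT
  -- The stabiliser commutes with `y` on L and preserves the radical ℂk, so k, yk, y²k are
  -- eigenvectors with one common eigenvalue. It squares to 1 because y²k is anisotropic.
  have hgrp : ∀ g ∈ grpStab B V y, ∃ ε : ℂ, ε * ε = 1 ∧ g k = ε • k ∧ g (y k) = ε • y k ∧
      g (y (y k)) = ε • y (y k) ∧ g p = ε • p ∧ g (y p) = ε • y p := by
    intro g hg
    have hc := D.grpStab_comm hy hg
    have hsurj : ∀ u ∈ L, ∃ u' ∈ L, g u' = u := fun u hu =>
      ⟨g.symm u, (D.grpStab_comm hy (inv_mem hg) u hu).1, g.apply_symm_apply u⟩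
    obtain ⟨c, hck⟩ := Submodule.mem_span_singleton.1 (hker (g k) (hc k hk).1 fun u hu => by
      obtain ⟨u', hu', rfl⟩ := hsurj u hu
      rw [← (hc k hk).2, hg.1.1, hiso _ hyk _ hu'])
    have g2 : g (y k) = c • y k := by rw [(hc k hk).2, ← hck, map_smul]
    have g3 : g (y (y k)) = c • y (y k) := by rw [(hc _ hyk).2, g2, map_smul]
    have hcc : c * c = 1 := by
      have h1 := hg.1.1 (y (y k)) (y (y k))
      rw [g3] at h1
      simp only [map_smul, LinearMap.smul_apply, smul_eq_mul] at h1
      exact mul_right_cancel₀ hee (by rw [one_mul, mul_assoc]; exact h1)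
    -- p is determined by B(y³k, ·) up to the radical, so gp = cp + ak. The normalisation B(yp, yp)
    -- = 0 is preserved by g and forces a = 0.
    obtain ⟨a, ha⟩ := Submodule.mem_span_singleton.1 (hker (g p - c • p)
      (sub_mem (hc p hp).1 (L.smul_mem _ hp)) fun u hu => by
        obtain ⟨u', hu', rfl⟩ := hsurj u hu
        rw [map_sub, ← (hc p hp).2, map_smul, map_sub, map_smul, LinearMap.sub_apply,
          LinearMap.smul_apply, hg.1.1, hyp u' hu', hyp _ (hc u' hu').1, hy, hy _ (g u'),
          ← (hc u' hu').2, form_apply_of_eigen hg.1.1 hcc g3, smul_eq_mul]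
        linear_combination (B (y (y k)) (y u')) * hcc)
    have hgp : g p = c • p + a • k := by rw [ha]; abel
    have hgyp : g (y p) = c • y p + a • y k := by
      rw [(hc p hp).2, hgp, map_add, map_smul, map_smul]
    have h1 := hg.1.1 (y p) (y p)
    rw [hgyp] at h1
    simp only [map_add, map_smul, LinearMap.add_apply, LinearMap.smul_apply, smul_eq_mul, hpp,
      D.symm (y k) (y p), hiso _ hyk _ hyk] at h1
    have h2 : (c * a) * B (y p) (y k) = 0 := by linear_combination h1 / 2
    have h3 : a = 0 := (mul_eq_zero.1 ((mul_eq_zero.1 h2).resolve_right hpv0)).resolve_left (by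
      rintro rfl
      simp at hcc)
    rw [h3, zero_smul, add_zero] at hgp hgyp
    exact ⟨c, hcc, hck.symm, g2, g3, hgp, hgyp⟩
  have hst : ∀ g ∈ grpStab B V y, ∀ a ∈ A, g a ∈ A := by
    intro g hg a ha
    obtain ⟨ε, hε, g1, g2, g3, g4, g5⟩ := hgrp g hg
    have hgS : ∀ s ∈ S, g s ∈ S := fun s hs => by
      obtain ⟨hs0, hs1, hs2, hs3⟩ := (hS s).1 hs
      obtain ⟨h1, h2⟩ := D.grpStab_comm hy hg s hs0
      refine (hS _).2 ⟨h1, ?_, ?_, ?_⟩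
      · rw [form_apply_of_eigen hg.1.1 hε g3, hs1, mul_zero]
      · rw [form_apply_of_eigen hg.1.1 hε g5, hs2, mul_zero]
      · rw [← h2, form_apply_of_eigen hg.1.1 hε g5, hs3, mul_zero]
    obtain ⟨s, hs, s', hs', rfl⟩ := hAmem a ha
    rw [map_add, (D.grpStab_comm hy hg s' (hSL hs')).2]
    exact add_mem (hSA (hgS s hs)) (hyS _ (hgS s' hs'))
  have hLT : ∀ v ∈ L, (∀ l ∈ L, B l v = 0) := fun v hv l hl => hiso l hl v hv
  have hSp : Splits B V y A T := by
    refine hA.splits_of_lagrangian_flag D.toDatum hO hy (j := j) (hj ▸ D.mem_of_orth) (hj ▸ hSL)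
      hst (fun v hv => ?_) (K := ⊥) bot_le (fun z hz v hv => ?_)
      fun s hs => ⟨0, zero_mem _, by rw [sub_zero]; exact hyS s hs⟩
    · obtain ⟨s, hs, a, b, c, e⟩ := hdec v (hj ▸ hv)
      refine ⟨s, hs, _, add_mem (add_mem (T.smul_mem _ hkT) (T.smul_mem _ hvT))
        (T.smul_mem _ hpT), ?_, e⟩
      rw [map_add, map_add, map_smul, map_smul, map_smul]
      exact add_mem (add_mem (T.smul_mem _ hvT) (T.smul_mem _ heT)) (T.smul_mem _ hypT)
    · rw [(Submodule.mem_bot ℂ).1 hv, map_zero]; exact zero_mem _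
  have hcor : ∀ a : A, (a : E) ∈ S → (corner hSp.compl y a : E) = y a := fun a ha =>
    corner_apply_of_mem _ (hyS a ha)
  refine ⟨A, T, hSp, fun g hg => ?_, hSA, hA.lagrangianDatum D.toDatum hVA (hj ▸ hSL),
    fun a ha h0 => ?_, fun u v hu hv => by rw [hcor u hu, hcor v hv]⟩
  · obtain ⟨ε, hε, g1, g2, g3, g4, g5⟩ := hgrp g hg
    have hd : ∀ t ∈ T, g t - ε • t ∈ Submodule.span ℂ {k} := by
      intro t ht
      have hdT : g t - ε • t ∈ T := sub_mem (hSp.right g hg t ht) (T.smul_mem _ ht)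
      have hd0 : ∀ u, g u = ε • u → B u (g t - ε • t) = 0 := fun u hu => by
        rw [map_sub, form_apply_of_eigen hg.1.1 hε hu, map_smul, smul_eq_mul, sub_self]
      have hdj : g t - ε • t ∈ L := D.mem_of_orth _ fun v hv => by
        obtain ⟨s, hs, a, b, c, rfl⟩ := hdec v hv
        simp only [LinearMap.map_add₂, LinearMap.map_smul₂, hd0 k g1, hd0 _ g2, hd0 p g4,
          hSp.orth s (hSA hs) _ hdT, smul_zero, add_zero]
      obtain ⟨s, hs, a, b, c, e⟩ := hdec _ hdj
      have hs0 : s = 0 := by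
        refine hSp.eq_zero_of_mem (hSA hs) ?_
        have : s = (g t - ε • t) - (a • k + b • y k + c • p) := by rw [e]; abel
        rw [this]
        exact sub_mem hdT (add_mem (add_mem (T.smul_mem _ hkT) (T.smul_mem _ hvT))
          (T.smul_mem _ hpT))
      have h1 := hd0 _ g3
      have h2 := hd0 _ g5
      have e1 : B (y (y k)) p ≠ 0 := by rw [hy, D.symm]; exact neg_ne_zero.2 hpv0
      rw [e, hs0] at h1 h2
      simp only [map_add, map_smul, map_zero, hyy, hk0 _ hyk, hk0 p hp, smul_eq_mul, mul_zero,
        add_zero, zero_add] at h1 h2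
      rw [e, hs0, (mul_eq_zero.1 h1).resolve_right e1, (mul_eq_zero.1 h2).resolve_right hpv0]
      exact Submodule.mem_span_singleton.2 ⟨a, by simp⟩
    obtain ⟨t, ht, hlt⟩ : ∃ t ∈ T, B k t ≠ 0 := by
      by_contra! h0
      refine hk00 (D.nondeg _ fun w => ?_)
      obtain ⟨a, ha, t, ht, rfl⟩ := hSp.exists_add w
      rw [map_add, h0 t ht, D.symm, hSp.orth a ha k hkT, add_zero]
    exact sign_of_eigen hε (eq_smul_of_sub_mem_span D.symm hg.1.1 hε hd (hiso k hk k hk) ht hlt)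
  · refine Subtype.ext (hnS a ha fun s hs => ?_)
    have := h0 ⟨s, hSA hs⟩ hs
    rw [← this]
    exact (hSp.form_corner D.symm y a ⟨s, hSA hs⟩).symm

end LagrangianOdd


/-! ### Symplectic parts: construction and dimension -/

section SymplecticPart

universe u
variable {E : Type u} [AddCommGroup E] [Module ℂ E] [FiniteDimensional ℂ E] {ι : Type*}
  {B : BilinForm ℂ E} {V : ι → Submodule ℂ E} {y : End ℂ E} {L S A F T H K : Submodule ℂ E} {n : ℕ}
  {d : ι → ℕ}

/-- ω is nondegenerate on V_j, so no radical vector is needed (l = 0). The condition from y²k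
coincides with the one from h, which leaves two independent conditions and codimension two. -/
theorem hasSymplecticPart_line_lagrangian_even (D : Datum B V) (hy : IsSkew B y) {i j : ι}
    {k h : E} (hL : ∀ v, (∀ l ∈ V j, B l v = 0) → v ∈ V j)
    (hV : ∀ i, V i = ⊥ ∨ V i = Submodule.span ℂ {k} ∨ V i = V j)
    (hi : V i = Submodule.span ℂ {k}) (hk : k ∈ V j) (hee : B (y k) (y k) ≠ 0)
    (hn : NondegOn B y (V j)) (hh : h ∈ V j) (hyh : ∀ v ∈ V j, B (y h) v = B (y (y k)) v) :
    ∃ S, HasSymplecticPart B V y S ∧ finrank ℂ S + 2 = finrank ℂ (V j) ∧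
      ∀ v ∈ S, v ∈ V j ∧ B (y k) v = 0 ∧ B (y h) v = 0 := by
  have hyy := hy.form_self D.symm
  have hhk : B (y h) k = -B (y k) (y k) := by rw [hyh k hk, hy]
  have hhk' : B (y h) k ≠ 0 := by rw [hhk]; exact neg_ne_zero.2 hee
  have hkh : B (y k) h ≠ 0 := by rw [hy, D.symm]; exact neg_ne_zero.2 hhk'
  let S := (V j ⊓ LinearMap.ker (B (y k))) ⊓ LinearMap.ker (B (y h))
  have hdim : finrank ℂ S + 2 = finrank ℂ (V j) := by
    have h1 := finrank_inf_ker (U := V j) (B (y k)) hh hkh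
    have h2 := finrank_inf_ker (U := V j ⊓ LinearMap.ker (B (y k))) (B (y h)) (x := k)
      ⟨hk, hyy k⟩ hhk'
    change finrank ℂ S + 1 = _ at h2
    omega
  have hS : ∀ v, v ∈ S ↔ v ∈ V j ∧ B (y k) v = 0 ∧ B (y h) v = 0 := fun v => and_assoc
  refine ⟨S, ?_, hdim, fun v hv => (hS v).1 hv⟩
  refine hasSymplecticPart_line_lagrangian D hy (k := k) (l := 0) hL hV hi hk hee hh hkh
    (zero_mem _) (fun v _ => by simp) ⟨0, 0, by simp⟩ (fun v hv h0 _ => hn v hv h0)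
    (fun g hg ε hε h1 h2 => ⟨?_, by simp⟩) (fun v => ?_) (fun v hv => ?_)
  · have hgj : ∀ v, g v ∈ V j ↔ v ∈ V j := hg.1.2 j
    refine sub_eq_zero.1 (hn _ (sub_mem ((hgj h).2 hh) ((V j).smul_mem _ hh)) fun u hu => ?_)
    obtain ⟨u', rfl⟩ := g.surjective u
    have hu' := (hgj u').1 hu
    rw [map_sub, map_smul, LinearMap.map_sub₂, LinearMap.map_smul₂,
      grpStab_inv D.symm hy hg (par_wedge_line_lagrangian D hV hk hh
        (D.isotropic j k hk u' hu')), hyh u' hu', hyh _ hu,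
      grpStab_form_line D hy hV hk hg hε h2 hu', smul_eq_mul, ← mul_assoc, hε, one_mul, sub_self]
  · rw [hS]
    constructor
    · rintro ⟨h1, h2, h3⟩
      exact ⟨h1, h2, h3, by rw [← hyh v h1, h3]⟩
    · rintro ⟨h1, h2, h3, -⟩
      exact ⟨h1, h2, h3⟩
  · set b := B (y k) v / B (y k) h with hb
    set a := B (y h) (v - b • h) / B (y h) k with ha
    refine ⟨v - b • h - a • k, (hS _).2 ⟨sub_mem (sub_mem hv ((V j).smul_mem _ hh))
      ((V j).smul_mem _ hk), ?_, ?_⟩, a, b, 0, by module⟩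
    · rw [map_sub, map_sub, map_smul, map_smul, hyy k, hb, smul_eq_mul, div_mul_cancel₀ _ hkh]
      simp
    · rw [map_sub, map_smul (B (y h)) a k, ha, smul_eq_mul, div_mul_cancel₀ _ hhk', sub_self]

/-- ω has radical ℂl on V_j, and yl lies in V_j because V_j is Lagrangian. Modulo k this vector is
the required h, and the three conditions are independent, as k, h, l show. -/
theorem hasSymplecticPart_line_lagrangian_odd (D : Datum B V) (hy : IsSkew B y) {i j : ι}
    {k l : E} (hL : ∀ v, (∀ l ∈ V j, B l v = 0) → v ∈ V j)
    (hV : ∀ i, V i = ⊥ ∨ V i = Submodule.span ℂ {k} ∨ V i = V j)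
    (hi : V i = Submodule.span ℂ {k}) (hk : k ∈ V j) (hee : B (y k) (y k) ≠ 0)
    (hl : l ∈ V j) (hyl : ∀ v ∈ V j, B (y l) v = 0)
    (hker : ∀ v ∈ V j, (∀ u ∈ V j, B (y v) u = 0) → ∃ c : ℂ, v = c • l)
    (hfl : B (y (y k)) l ≠ 0) :
    ∃ S, HasSymplecticPart B V y S ∧ finrank ℂ S + 3 = finrank ℂ (V j) ∧
      ∀ v ∈ S, v ∈ V j ∧ B (y k) v = 0 ∧ B (y (y l)) v = 0 ∧ B (y (y k)) v = 0 := by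
  have hyy := hy.form_self D.symm
  have hsw : ∀ u v, B u (y v) = -B (y u) v := fun u v => by rw [hy, neg_neg]
  have hylj : y l ∈ V j := hL _ fun v hv => by rw [D.symm, hyl v hv]
  have hfk : B (y (y k)) k = -B (y k) (y k) := by rw [hy]
  have hfk0 : B (y (y k)) k ≠ 0 := by rw [hfk]; exact neg_ne_zero.2 hee
  -- Chosen so that B(y²k, h) = 0. The stabiliser moves h, up to the sign, only along k, and this
  -- normalisation then fixes it.
  set c₀ := -(B (y (y k)) (y l)) / B (y (y k)) k with hc₀
  set h := y l + c₀ • k with hh0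
  have hh : h ∈ V j := add_mem hylj ((V j).smul_mem _ hk)
  have hfh : B (y (y k)) h = 0 := by
    rw [hh0, map_add, map_smul, hc₀, smul_eq_mul, div_mul_cancel₀ _ hfk0, add_neg_cancel]
  have hkh : B (y k) h ≠ 0 := by
    rw [hh0, map_add, map_smul, hyy, smul_zero, add_zero, hsw]
    exact neg_ne_zero.2 hfl
  have hhk : B (y h) k ≠ 0 := by rw [hy, D.symm]; exact neg_ne_zero.2 hkh
  have hkl : B (y k) l = 0 := by rw [hy, D.isotropic j k hk _ hylj, neg_zero]
  have hhl : B (y h) l = 0 := by rw [hy, D.isotropic j h hh _ hylj, neg_zero]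
  let S := ((V j ⊓ LinearMap.ker (B (y k))) ⊓ LinearMap.ker (B (y h))) ⊓
    LinearMap.ker (B (y (y k)))
  have hdim : finrank ℂ S + 3 = finrank ℂ (V j) := by
    have h1 := finrank_inf_ker (U := V j) (B (y k)) hh hkh
    have h2 := finrank_inf_ker (U := V j ⊓ LinearMap.ker (B (y k))) (B (y h)) (x := k)
      ⟨hk, hyy k⟩ hhk
    have h3 := finrank_inf_ker (U := V j ⊓ LinearMap.ker (B (y k)) ⊓ LinearMap.ker (B (y h)))
      (B (y (y k))) (x := l) ⟨⟨hl, hkl⟩, hhl⟩ hfl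
    change finrank ℂ S + 1 = _ at h3
    omega
  have hS : ∀ v, v ∈ S ↔ v ∈ V j ∧ B (y k) v = 0 ∧ B (y h) v = 0 ∧ B (y (y k)) v = 0 := fun v =>
    ⟨fun ⟨⟨⟨h1, h2⟩, h3⟩, h4⟩ => ⟨h1, h2, h3, h4⟩, fun ⟨h1, h2, h3, h4⟩ => ⟨⟨⟨h1, h2⟩, h3⟩, h4⟩⟩
  refine ⟨S, ?_, hdim, fun v hv => ?_⟩
  · refine hasSymplecticPart_line_lagrangian D hy (k := k) (l := l) hL hV hi hk hee hh hkh
      hl hyl ⟨-c₀, 1, by rw [hh0]; module⟩ (fun v hv h0 h1 => ?_)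
      (fun g hg ε hε h1 h2 => ?_) hS (fun v hv => ?_)
    · obtain ⟨c, rfl⟩ := hker v hv h0
      rw [map_smul, smul_eq_mul] at h1
      rw [(mul_eq_zero.1 h1).resolve_right hfl, zero_smul]
    · have hgj : ∀ v, g v ∈ V j ↔ v ∈ V j := hg.1.2 j
      have hε0 : ε ≠ 0 := by rintro rfl; simp at hε
      have hgl : g l = ε • l := by
        obtain ⟨c, hc⟩ := hker (g l) ((hgj l).2 hl) fun u hu => by
          obtain ⟨u', rfl⟩ := g.surjective u
          have hu' := (hgj u').1 hu
          rw [grpStab_inv D.symm hy hg (par_wedge_line_lagrangian D hV hk hl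
            (D.isotropic j k hk u' hu')), hyl u' hu']
        have h3 := grpStab_form_line D hy hV hk hg hε h2 hl
        rw [hc, map_smul, smul_eq_mul] at h3
        rw [hc, mul_right_cancel₀ hfl h3]
      refine ⟨?_, hgl⟩
      have h3 := grpStab_sub_mem_line D hy hV hk hg h1 hl
      obtain ⟨a, ha⟩ := Submodule.mem_span_singleton.1 h3
      have h4 : g h = ε • h + a • k := by
        have : g (y l) = a • k + y (g l) := by rw [ha]; abel
        rw [hh0, map_add, map_smul, h1, this, hgl, map_smul]
        module
      have h5 := grpStab_form_line D hy hV hk hg hε h2 hh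
      rw [h4, map_add, map_smul, map_smul, hfh, smul_zero, zero_add, mul_zero, smul_eq_mul] at h5
      rw [h4, (mul_eq_zero.1 h5).resolve_right hfk0, zero_smul, add_zero]
    · set b := B (y k) v / B (y k) h with hb
      set a := B (y h) (v - b • h) / B (y h) k with ha
      set c := B (y (y k)) (v - b • h - a • k) / B (y (y k)) l with hc
      refine ⟨v - b • h - a • k - c • l, (hS _).2 ⟨sub_mem (sub_mem (sub_mem hv
        ((V j).smul_mem _ hh)) ((V j).smul_mem _ hk)) ((V j).smul_mem _ hl), ?_, ?_, ?_⟩,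
        a, b, c, by module⟩
      · rw [map_sub, map_sub, map_sub, map_smul, map_smul, map_smul, hyy k, hkl, hb, smul_eq_mul,
          div_mul_cancel₀ _ hkh]
        simp
      · rw [map_sub, map_sub, map_smul (B (y h)) a k, map_smul _ c, hhl, ha, smul_eq_mul,
          div_mul_cancel₀ _ hhk, sub_self, smul_zero, sub_zero]
      · rw [map_sub, map_smul _ c, hc, smul_eq_mul, div_mul_cancel₀ _ hfl, sub_self]
  · obtain ⟨h1, h2, h3, h4⟩ := (hS v).1 hv
    refine ⟨h1, h2, ?_, h4⟩
    rwa [hh0, map_add, map_smul, LinearMap.map_add₂, LinearMap.map_smul₂, h2, smul_zero,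
      add_zero] at h3

/-- The three conditions are independent on L: p, yk and k are detected by them successively, since
B(yp, yk) ≠ 0. Hence codimension three. -/
theorem LagrangianDatum.hasSymplecticPart_odd (D : LagrangianDatum B V L) (hy : IsSkew B y)
    {k p : E} (hk : k ∈ L) (hyk : y k ∈ L) (hee : B (y (y k)) (y (y k)) ≠ 0)
    (hker : ∀ v ∈ L, (∀ u ∈ L, B (y v) u = 0) → v ∈ Submodule.span ℂ {k})
    (hp : p ∈ L) (hyp : ∀ v ∈ L, B (y p) v = B (y (y (y k))) v) (hpp : B (y p) (y p) = 0) :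
    ∃ S, HasSymplecticPart B V y S ∧ finrank ℂ S + 3 = finrank ℂ L ∧
      ∀ v ∈ S, v ∈ L ∧ B (y (y k)) v = 0 ∧ B (y p) v = 0 ∧ B (y p) (y v) = 0 := by
  have hyy := hy.form_self D.symm
  have hsw : ∀ u v, B u (y v) = -B (y u) v := fun u v => by rw [hy, neg_neg]
  have hk0 : ∀ v ∈ L, B (y v) k = 0 := fun v hv => by rw [hy, D.iso hv hyk, neg_zero]
  have hpv : B (y p) (y k) = -B (y (y k)) (y (y k)) := by rw [hyp _ hyk, hy]
  have hpv0 : B (y p) (y k) ≠ 0 := by rw [hpv]; exact neg_ne_zero.2 hee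
  have hep : B (y (y k)) p ≠ 0 := by rw [hy, D.symm]; exact neg_ne_zero.2 hpv0
  let S := ((L ⊓ LinearMap.ker (B (y (y k)))) ⊓ LinearMap.ker (B (y p))) ⊓
    LinearMap.ker (B (y p) ∘ₗ y)
  have hdim : finrank ℂ S + 3 = finrank ℂ L := by
    have h1 := finrank_inf_ker (U := L) (B (y (y k))) hp hep
    have h2 := finrank_inf_ker (U := L ⊓ LinearMap.ker (B (y (y k)))) (B (y p)) (x := y k)
      ⟨hyk, hyy (y k)⟩ hpv0
    have h3 := finrank_inf_ker (U := L ⊓ LinearMap.ker (B (y (y k))) ⊓ LinearMap.ker (B (y p)))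
      (B (y p) ∘ₗ y) (x := k) ⟨⟨hk, hk0 _ hyk⟩, hk0 p hp⟩ hpv0
    change finrank ℂ S + 1 = _ at h3
    omega
  have hS : ∀ v, v ∈ S ↔ v ∈ L ∧ B (y (y k)) v = 0 ∧ B (y p) v = 0 ∧ B (y p) (y v) = 0 := fun v =>
    ⟨fun ⟨⟨⟨h1, h2⟩, h3⟩, h4⟩ => ⟨h1, h2, h3, h4⟩, fun ⟨h1, h2, h3, h4⟩ => ⟨⟨⟨h1, h2⟩, h3⟩, h4⟩⟩
  refine ⟨S, D.hasSymplecticPart hy hk hyk hee hker hp hyp hpp hS fun v hv => ?_, hdim,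
    fun v hv => (hS v).1 hv⟩
  set c := B (y (y k)) v / B (y (y k)) p with hc
  set b := B (y p) (v - c • p) / B (y p) (y k) with hb
  set a := B (y p) (y (v - c • p - b • y k)) / B (y p) (y k) with ha
  refine ⟨v - c • p - b • y k - a • k, (hS _).2 ⟨sub_mem (sub_mem (sub_mem hv
    (L.smul_mem _ hp)) (L.smul_mem _ hyk)) (L.smul_mem _ hk), ?_, ?_, ?_⟩, a, b, c, by module⟩
  · rw [map_sub, map_sub, map_sub, map_smul, map_smul, map_smul, hyy (y k), hk0 _ hyk, hc,
      smul_eq_mul, div_mul_cancel₀ _ hep]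
    simp
  · rw [map_sub, map_sub, map_smul (B (y p)) b, map_smul _ a, hk0 p hp, hb, smul_eq_mul,
      div_mul_cancel₀ _ hpv0, sub_self, smul_zero, sub_zero]
  · rw [map_sub y, map_sub (B (y p)), map_smul y a, map_smul _ a, ha, smul_eq_mul,
      div_mul_cancel₀ _ hpv0, sub_self]

section Existence

/-- Pull a symplectic form on the even-dimensional hyperplane ker κ back along the projection that
kills l. -/
theorem exists_form_with_kernel {W : Type*} [AddCommGroup W] [Module ℂ W] [FiniteDimensional ℂ W]
    (hW : Odd (finrank ℂ W)) {κ : Dual ℂ W} {l : W} (hl : κ l = 1) :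
    ∃ w : BilinForm ℂ W, (∀ u v, w u v = -w v u) ∧ w l = 0 ∧ (∀ v, w v = 0 → v = κ v • l) ∧
      ∀ v, κ v = 0 → v ≠ 0 → ∃ h, κ h = 0 ∧ w v h = 1 := by
  have hk : Even (finrank ℂ (LinearMap.ker κ)) := by
    have h1 := finrank_inf_ker (U := ⊤) κ (x := l) Submodule.mem_top (by rw [hl]; exact one_ne_zero)
    rw [finrank_top, top_inf_eq] at h1
    rw [← h1] at hW
    exact Nat.not_odd_iff_even.1 fun h2 => Nat.not_odd_iff_even.2 h2.add_one hW
  obtain ⟨w, hw, hn⟩ := exists_symplectic_form hk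
  let π : W →ₗ[ℂ] LinearMap.ker κ :=
    (LinearMap.id - κ.smulRight l).codRestrict _ fun v => by simp [hl]
  have hπ : ∀ v, (π v : W) = v - κ v • l := fun v => rfl
  have hπk : ∀ v (hv : κ v = 0), π v = ⟨v, hv⟩ := fun v hv =>
    Subtype.ext (by rw [hπ, hv, zero_smul, sub_zero])
  refine ⟨w.compl₁₂ π π, fun u v => hw _ _, LinearMap.ext fun v => ?_, fun v hv => ?_,
    fun v hv hv0 => ?_⟩
  · rw [LinearMap.compl₁₂_apply, show π l = 0 from Subtype.ext (by rw [hπ, hl]; simp), map_zero,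
      LinearMap.zero_apply, LinearMap.zero_apply]
  · have h1 : π v = 0 := hn _ fun u => by
      have := LinearMap.congr_fun hv u
      rwa [LinearMap.compl₁₂_apply, hπk u u.2] at this
    have h2 := congrArg Subtype.val h1
    rw [hπ] at h2
    exact sub_eq_zero.1 h2
  · obtain ⟨h, hh⟩ : ∃ h, w (π v) h ≠ 0 := by
      by_contra! h0
      refine hv0 ?_
      have := congrArg Subtype.val (hn _ h0)
      rwa [hπ, hv, zero_smul, sub_zero] at this
    refine ⟨(w (π v) h)⁻¹ • (h : W), by rw [map_smul, h.2, smul_zero], ?_⟩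
    rw [LinearMap.compl₁₂_apply, map_smul, hπk h h.2, map_smul, smul_eq_mul, inv_mul_cancel₀ hh]

end Existence

end SymplecticPart


/-! ### Nonvanishing forced by reductivity in the odd Lagrangian blocks -/

section Reductive

universe u
variable {E : Type u} [AddCommGroup E] [Module ℂ E] [FiniteDimensional ℂ E] {ι : Type*}
  {B : BilinForm ℂ E} {V : ι → Submodule ℂ E} {y : End ℂ E} {L S A F T H K : Submodule ℂ E} {n : ℕ}
  {d : ι → ℕ}

theorem Datum.exists_form_ne_zero (D : Datum B V) {k : E} (h0 : k ≠ 0) : ∃ t, B k t ≠ 0 := by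
  by_contra! h
  exact h0 (D.nondeg _ h)

theorem add_mem_lieStab {x x' : End ℂ E} (hx : Par B V x) (hx' : Par B V x')
    (h : ∀ z, Par B V z → LinearMap.trace ℂ E (y * (x * z - z * x)) +
      LinearMap.trace ℂ E (y * (x' * z - z * x')) = 0) : x + x' ∈ lieStab B V y := by
  refine ⟨hx.add hx', fun z hz => ?_⟩
  have : y * ((x + x') * z - z * (x + x')) =
    y * (x * z - z * x) + y * (x' * z - z * x') := by noncomm_ring
  rw [this, map_add, h z hz]

/-- If the value were zero, B(y²k, ·) would vanish on the radical, so some s in V_j would satisfy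
B(ys, ·) = -B(y²k, ·) on V_j. Then l ∧ (yk + s) + k ∧ yl stabilises the form and lowers the
filtration of ⟨k, l⟩, hence vanishes. In either position of l relative to k, this puts the
anisotropic vector yk in V_j. -/
theorem OrthReductive.form_kernel_ne_zero (D : Datum B V) (hR : OrthReductive B V y)
    (hy : IsSkew B y) {i j : ι} {k l : E} (hL : ∀ v, (∀ l ∈ V j, B l v = 0) → v ∈ V j)
    (hV : ∀ i, V i = ⊥ ∨ V i = Submodule.span ℂ {k} ∨ V i = V j)
    (hi : V i = Submodule.span ℂ {k}) (hk : k ∈ V j) (hee : B (y k) (y k) ≠ 0)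
    (hl : l ∈ V j) (hl0 : l ≠ 0) (hyl : ∀ v ∈ V j, B (y l) v = 0)
    (hker : ∀ v ∈ V j, (∀ u ∈ V j, B (y v) u = 0) → ∃ c : ℂ, v = c • l) :
    B (y (y k)) l ≠ 0 := by
  intro hfl
  have hiso := D.isotropic j
  have hyy := hy.form_self D.symm
  have hylj : y l ∈ V j := hL _ fun v hv => by rw [D.symm, hyl v hv]
  have hke : B k (y k) = 0 := by rw [D.symm, hyy]
  have hel : B (y k) l = 0 := by rw [hy, hiso k hk _ hylj, neg_zero]
  have hej : y k ∉ V j := fun h => hee (hiso _ h _ h)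
  obtain ⟨s, hs, hs'⟩ := exists_solve D.symm hy (V j) (-(B (y (y k)))) fun v hv hv' => by
    obtain ⟨c, rfl⟩ := hker v hv hv'
    rw [LinearMap.neg_apply, map_smul, hfl, smul_zero, neg_zero]
  have hx : wedge B l (y k + s) + wedge B k (y l) ∈ lieStab B V y := by
    refine add_mem_lieStab (par_wedge_line_lagrangian D hV hk hl
      (by rw [map_add, hke, hiso k hk s hs, add_zero]))
      (par_wedge_line_lagrangian D hV hk hk (hiso k hk _ hylj)) fun z hz => ?_
    have hzk := hz.2 i k (hi ▸ Submodule.mem_span_singleton_self k)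
    rw [hi] at hzk
    obtain ⟨c, hc⟩ := Submodule.mem_span_singleton.1 hzk
    rw [trace_lie_wedge D.symm hy hz.1, trace_lie_wedge D.symm hy hz.1, ← hc]
    have h1 := hs' _ (hz.2 j l hl)
    have h2 : B (y k) (z (y l)) = -B (y l) (z (y k)) := by rw [D.symm, hz.1]
    have h3 : B k (y (y l)) = 0 := by
      rw [← neg_eq_zero, ← hy, ← neg_eq_zero, ← hy, hfl]
    simp only [map_add, map_smul, LinearMap.smul_apply, LinearMap.neg_apply, smul_eq_mul,
      D.symm (z l) (y (y k)), D.symm (z l) (y s), h1, h2, h3, hyl _ (hz.2 j s hs)]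
    ring
  have hx0 := hR.eq_zero_of_lowering D (U := Submodule.span ℂ {k, l}) (fun g hg u hu => ?_) hx
    (fun u hu => ?_) (fun w hw => ?_)
  · obtain ⟨w, hkw, hlw⟩ : ∃ w, B k w = 0 ∧ B l w ≠ 0 := by
      by_contra! h
      obtain ⟨c, hc⟩ := Submodule.mem_span_singleton.1 (D.mem_span_of_perp h)
      have hc0 : c ≠ 0 := by
        rintro rfl
        rw [zero_smul] at hc
        exact hl0 hc.symm
      refine hej (hL _ fun v hv => ?_)
      have := hyl v hv
      rw [← hc, map_smul, map_smul, LinearMap.smul_apply, smul_eq_mul] at this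
      rw [D.symm, (mul_eq_zero.1 this).resolve_left hc0]
    have h1 := LinearMap.congr_fun hx0 w
    rw [LinearMap.add_apply, wedge_apply, wedge_apply, hkw, zero_smul, sub_zero,
      LinearMap.zero_apply] at h1
    refine hej ?_
    have h2 : y k = (B l w)⁻¹ • (B (y k + s) w • l + B (y l) w • k) - s := by
      have : B (y k + s) w • l + B (y l) w • k = B l w • (y k + s) := by
        rw [← sub_eq_zero, ← h1]; abel
      rw [this, smul_smul, inv_mul_cancel₀ hlw, one_smul, add_sub_cancel_right]
    rw [h2]
    exact sub_mem ((V j).smul_mem _ (add_mem ((V j).smul_mem _ hl) ((V j).smul_mem _ hk))) hs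
  · obtain ⟨a, b, rfl⟩ := Submodule.mem_span_pair.1 hu
    have hgj : ∀ v, g v ∈ V j ↔ v ∈ V j := hg.1.2 j
    have hgk := (hg.1.2 i k).2 (hi ▸ Submodule.mem_span_singleton_self k)
    rw [hi] at hgk
    obtain ⟨c, hc⟩ := Submodule.mem_span_singleton.1 hgk
    obtain ⟨c', hc'⟩ := hker (g l) ((hgj l).2 hl) fun u hu => by
      obtain ⟨u', rfl⟩ := g.surjective u
      have hu' := (hgj u').1 hu
      rw [grpStab_inv D.symm hy hg (par_wedge_line_lagrangian D hV hk hl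
        (hiso k hk u' hu')), hyl u' hu']
    rw [map_add, map_smul, map_smul, ← hc, hc']
    exact Submodule.mem_span_pair.2 ⟨a * c, b * c', by rw [mul_smul, mul_smul]⟩
  · obtain ⟨a, b, rfl⟩ := Submodule.mem_span_pair.1 hu
    have h1 : B (y l) k = 0 := hyl k hk
    simp only [LinearMap.add_apply, wedge_apply, map_add, map_smul, hyy, hel, hiso s hs k hk,
      hiso s hs l hl, hiso l hl k hk, hiso l hl l hl, hiso k hk k hk, hiso k hk l hl, h1, smul_zero,
      zero_smul, add_zero, sub_zero]
  · have h1 := hw k (Submodule.subset_span (by simp))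
    have h2 := hw l (Submodule.subset_span (by simp))
    rw [LinearMap.add_apply, wedge_apply, wedge_apply, h1, h2, zero_smul, zero_smul, sub_zero,
      sub_zero]
    exact Submodule.mem_span_pair.2 ⟨_, _, add_comm _ _⟩

theorem LagrangianDatum.par_wedge (D : LagrangianDatum B V L) {u v : E} (hu : u ∈ L) :
    Par B V (wedge B u v) :=
  SoParabolic.par_wedge D.symm fun i => by
    rcases D.flag i with h | h <;> rw [h]
    · exact ⟨fun w hw => by rw [(Submodule.mem_bot ℂ).1 hw, map_zero],
        Or.inr fun w hw => by rw [(Submodule.mem_bot ℂ).1 hw, map_zero]⟩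
    · exact ⟨fun w hw => D.iso hu hw, Or.inl hu⟩

theorem LagrangianDatum.apply_kernel (D : LagrangianDatum B V L) (hy : IsSkew B y) {k : E}
    (hk : k ∈ L) (hyk : y k ∈ L) (hker : ∀ v ∈ L, (∀ u ∈ L, B (y v) u = 0) → ∃ c : ℂ, v = c • k)
    {g : E ≃ₗ[ℂ] E} (hg : g ∈ grpStab B V y) : ∃ c : ℂ, g k = c • k ∧ g (y k) = c • y k := by
  obtain ⟨h1, h2⟩ := D.grpStab_comm hy hg k hk
  obtain ⟨c, hc⟩ := hker (g k) h1 fun u hu => by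
    have : u = g (g⁻¹ u) := (g.apply_symm_apply u).symm
    rw [← h2, this, hg.1.1, D.iso hyk (D.grpStab_comm hy (inv_mem hg) u hu).1]
  exact ⟨c, hc, by rw [h2, hc, map_smul]⟩

/-- If yk = μk, a dimension count gives w outside ℂk orthogonal to k and to (μ - y)L. Then k ∧ w is
a nonzero element of the stabiliser lowering the filtration of ℂk. -/
theorem OrthReductive.apply_kernel_notMem (D : LagrangianDatum B V L) (hR : OrthReductive B V y)
    (hy : IsSkew B y) (hdim : 3 ≤ finrank ℂ L) {k : E} (hk : k ∈ L) (hk0 : k ≠ 0)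
    (hyk : y k ∈ L)
    (hker : ∀ v ∈ L, (∀ u ∈ L, B (y v) u = 0) → ∃ c : ℂ, v = c • k) (μ : ℂ) : y k ≠ μ • k := by
  intro hμ
  let f : End ℂ E := μ • 1 - y
  let W := Submodule.span ℂ {k} ⊔ L.map f
  obtain ⟨w, hw, hwk⟩ : ∃ w ∈ B.orthogonal W, w ∉ Submodule.span ℂ {k} := by
    by_contra! h
    have h1 := Submodule.finrank_mono h
    rw [finrank_span_singleton hk0] at h1
    have h2 := D.toDatum.finrank_perp W
    have h3 : finrank ℂ W ≤ 1 + finrank ℂ L := by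
      refine (Submodule.finrank_add_le_finrank_add_finrank _ _).trans ?_
      rw [finrank_span_singleton hk0]
      exact Nat.add_le_add_left (Submodule.finrank_map_le f L) 1
    have h4 := D.toDatum.finrank_perp L
    have h5 : finrank ℂ L ≤ finrank ℂ (B.orthogonal L) :=
      Submodule.finrank_mono fun v hv w hw => D.iso hw hv
    omega
  have hkw : B k w = 0 :=
    hw k (Submodule.mem_sup_left (Submodule.mem_span_singleton_self k))
  obtain ⟨j, hj⟩ := D.exists_eq
  have hx : wedge B k w ∈ lieStab B V y := by
    refine ⟨D.par_wedge hk, fun z hz => ?_⟩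
    have hzk : z k ∈ L := hj ▸ hz.2 j k (hj.symm ▸ hk)
    have h1 : B (μ • z k - y (z k)) w = 0 := hw _ (Submodule.mem_sup_right ⟨z k, hzk, rfl⟩)
    rw [LinearMap.map_sub₂, LinearMap.map_smul₂, hy, hz.1 k] at h1
    rw [trace_lie_wedge D.symm hy hz.1, hμ, LinearMap.map_smul₂]
    linear_combination 2 * h1
  have h0 := hR.eq_zero_of_lowering D.toDatum (U := Submodule.span ℂ {k}) (fun g hg u hu => ?_) hx
    (fun u hu => ?_) (fun u hu => ?_)
  · obtain ⟨t, ht⟩ := D.toDatum.exists_form_ne_zero hk0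
    have h1 := LinearMap.congr_fun h0 t
    rw [wedge_apply, LinearMap.zero_apply, sub_eq_zero] at h1
    refine hwk (Submodule.mem_span_singleton.2 ⟨(B k t)⁻¹ * B w t, ?_⟩)
    rw [mul_smul, h1, smul_smul, inv_mul_cancel₀ ht, one_smul]
  · obtain ⟨c, rfl⟩ := Submodule.mem_span_singleton.1 hu
    obtain ⟨c', h1, -⟩ := D.apply_kernel hy hk hyk hker hg
    rw [map_smul, h1]
    exact Submodule.smul_mem _ _ (Submodule.smul_mem _ _ (Submodule.mem_span_singleton_self k))
  · obtain ⟨c, rfl⟩ := Submodule.mem_span_singleton.1 hu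
    rw [wedge_apply, map_smul, map_smul, D.iso hk hk, D.symm, hkw]
    simp
  · rw [wedge_apply, hu k (Submodule.mem_span_singleton_self k), zero_smul, sub_zero]
    exact Submodule.smul_mem _ _ (Submodule.mem_span_singleton_self k)

/-- If y²k were isotropic, some s in L would satisfy B(ys, ·) = B(y³k, y·) on L. Then yk ∧ y²k - k ∧
(y³k + s) lies in the stabiliser and lowers the filtration of ⟨k, yk⟩. Its vanishing gives y²k in L,
so yk is in the radical ℂk, which was excluded. -/
theorem OrthReductive.apply_apply_kernel_anisotropic (D : LagrangianDatum B V L)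
    (hR : OrthReductive B V y) (hy : IsSkew B y) (hdim : 3 ≤ finrank ℂ L) {k : E} (hk : k ∈ L)
    (hk0 : k ≠ 0) (hyk : y k ∈ L)
    (hker : ∀ v ∈ L, (∀ u ∈ L, B (y v) u = 0) → ∃ c : ℂ, v = c • k) :
    B (y (y k)) (y (y k)) ≠ 0 := by
  intro hee
  have hyy := hy.form_self D.symm
  have hsw : ∀ u v, B u (y v) = -B (y u) v := fun u v => by rw [hy, neg_neg]
  have hiso : ∀ u ∈ L, ∀ v ∈ L, B u v = 0 := fun u hu v hv => D.iso hu hv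
  have hnot := hR.apply_kernel_notMem D hy hdim hk hk0 hyk hker
  obtain ⟨s, hs, hs'⟩ := exists_solve D.symm hy L (B (y (y (y k))) ∘ₗ y) fun v hv hv' => by
    obtain ⟨c, rfl⟩ := hker v hv hv'
    rw [LinearMap.comp_apply, map_smul, map_smul, hy, hee, neg_zero, smul_zero]
  have hke : B (y (y k)) k = 0 := by rw [hy, hiso _ hyk _ hyk, neg_zero]
  have hkf : B (y (y (y k))) k = 0 := by rw [hy, hyy, neg_zero]
  have hvf : B (y (y (y k))) (y k) = 0 := by rw [hy, hee, neg_zero]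
  obtain ⟨j, hj⟩ := D.exists_eq
  have hx : wedge B (y k) (y (y k)) + (-1 : ℂ) • wedge B k (y (y (y k)) + s) ∈ lieStab B V y := by
    refine add_mem_lieStab (D.par_wedge hyk) ((D.par_wedge hk).smul _) fun z hz => ?_
    have hz' : ∀ v ∈ L, z v ∈ L := fun v hv => hj ▸ hz.2 j v (hj.symm ▸ hv)
    have e : y * (((-1 : ℂ) • wedge B k (y (y (y k)) + s)) * z -
        z * ((-1 : ℂ) • wedge B k (y (y (y k)) + s))) =
        (-1 : ℂ) • (y * (wedge B k (y (y (y k)) + s) * z - z * wedge B k (y (y (y k)) + s))) := by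
      simp only [smul_mul_assoc, mul_smul_comm, mul_sub, smul_sub]
    rw [e, map_smul, trace_lie_wedge D.symm hy hz.1, trace_lie_wedge D.symm hy hz.1]
    have h1 := hs' _ (hz' k hk)
    rw [LinearMap.comp_apply] at h1
    have h2 : B (y (y k)) (z (y (y k))) = 0 := by
      rw [← neg_eq_zero, ← hz.1, hz.1.form_self D.symm]
    have h3 : B (y k) (z (y (y (y k)))) = -B (z (y k)) (y (y (y k))) := by rw [hz.1, neg_neg]
    have h4 : B (z k) (y (y (y (y k)))) = -B (y (y (y k))) (y (z k)) := by rw [hsw, D.symm]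
    simp only [map_add, smul_eq_mul, h2, h3, h4, D.symm (z k) (y s), h1,
      hiso _ hyk _ (hz' s hs)]
    ring
  have hx0 := hR.eq_zero_of_lowering D.toDatum (U := Submodule.span ℂ {k, y k})
    (fun g hg u hu => ?_) hx (fun u hu => ?_) (fun w hw => ?_)
  · obtain ⟨w, hkw, hlw⟩ : ∃ w, B k w = 0 ∧ B (y k) w ≠ 0 := by
      by_contra! h
      obtain ⟨c, hc⟩ := Submodule.mem_span_singleton.1 (D.toDatum.mem_span_of_perp h)
      exact hnot c hc.symm
    have h1 := LinearMap.congr_fun hx0 w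
    rw [LinearMap.add_apply, LinearMap.smul_apply, wedge_apply, wedge_apply, hkw, zero_smul,
      sub_zero, LinearMap.zero_apply] at h1
    have h2 : y (y k) ∈ L := by
      have h3 : y (y k) = (B (y k) w)⁻¹ • (B (y (y k)) w • y k -
          B (y (y (y k)) + s) w • k) := by
        have : B (y (y k)) w • y k - B (y (y (y k)) + s) w • k = B (y k) w • y (y k) := by
          rw [← sub_eq_zero, ← h1]; module
        rw [this, smul_smul, inv_mul_cancel₀ hlw, one_smul]
      rw [h3]
      exact L.smul_mem _ (sub_mem (L.smul_mem _ hyk) (L.smul_mem _ hk))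
    obtain ⟨c, hc⟩ := hker (y k) hyk fun u hu => hiso _ h2 u hu
    exact hnot c hc
  · obtain ⟨a, b, rfl⟩ := Submodule.mem_span_pair.1 hu
    obtain ⟨c, h1, h2⟩ := D.apply_kernel hy hk hyk hker hg
    rw [map_add, map_smul, map_smul, h1, h2]
    exact Submodule.mem_span_pair.2 ⟨a * c, b * c, by rw [mul_smul, mul_smul]⟩
  · obtain ⟨a, b, rfl⟩ := Submodule.mem_span_pair.1 hu
    simp only [LinearMap.add_apply, LinearMap.smul_apply, wedge_apply, map_add, map_smul, hyy, hke,
      hkf, hvf, hiso s hs k hk, hiso s hs _ hyk, hiso _ hyk k hk, hiso _ hyk _ hyk, hiso k hk k hk,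
      hiso k hk _ hyk, smul_zero, zero_smul, add_zero, sub_zero]
  · have h1 := hw k (Submodule.subset_span (by simp))
    have h2 := hw (y k) (Submodule.subset_span (by simp))
    rw [LinearMap.add_apply, LinearMap.smul_apply, wedge_apply, wedge_apply, h1, h2, zero_smul,
      zero_smul, sub_zero, sub_zero]
    exact Submodule.mem_span_pair.2 ⟨-B (y (y (y k)) + s) w, B (y (y k)) w, by module⟩

end Reductive


/-! ### Explicit rigid forms, and the remaining blocks -/

section BlockRealizations

universe u
variable {E : Type u} [AddCommGroup E] [Module ℂ E] [FiniteDimensional ℂ E] {ι : Type*}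
  {B : BilinForm ℂ E} {V : ι → Submodule ℂ E} {y : End ℂ E} {L S A F T H K : Submodule ℂ E} {n : ℕ}
  {d : ι → ℕ}

/-- The wedge σf ∧ h is added to the standard extension. It leaves ω on L unchanged but makes yL
anisotropic in a controlled way: `y` still agrees with σ ∘ w where f vanishes. -/
theorem Datum.exists_skew_twist (D : Datum B V) (hiso : ∀ u ∈ L, ∀ v ∈ L, B u v = 0)
    (hL : ∀ v, (∀ l ∈ L, B l v = 0) → v ∈ L) (w : BilinForm ℂ L) (hw : ∀ u v, w u v = -w v u)
    (f : Dual ℂ L) (h : L) :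
    ∃ (σ : Dual ℂ L →ₗ[ℂ] E) (y : End ℂ E), IsSkew B y ∧ (∀ f (l : L), B (σ f) l = f l) ∧
      (∀ f g, B (σ f) (σ g) = 0) ∧ (∀ l : L, y l = σ (w l) - f l • (h : E)) ∧
      ∀ g, y (σ g) = g h • σ f := by
  obtain ⟨σ, y, hy, h1, h2, h3, h4⟩ := D.exists_skew_extension hiso hL w hw
  refine ⟨σ, y + wedge B (σ f) h, hy.add (isSkew_wedge D.symm _ _), h1, h2, fun l => ?_,
    fun g => ?_⟩
  · rw [LinearMap.add_apply, wedge_apply, h1, hiso h h.2 l l.2, zero_smul, h3, zero_sub,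
      sub_eq_add_neg]
  · rw [LinearMap.add_apply, wedge_apply, h2, D.symm, h1, h4, zero_smul, sub_zero, zero_add]

section LineLagrangian

variable {i j : ι} {k : E}

/-- Take h with w(k, h) = 1 and twist by f = w(·, h). Then yk = σ(w k) - h has square -2 and y²k =
-2σ(w h), so -2h represents B(y²k, ·). On the symplectic part f vanishes and `y` has isotropic
image. -/
theorem exists_rigid_line_lagrangian_even (D : Datum B V)
    (hL : ∀ v, (∀ l ∈ V j, B l v = 0) → v ∈ V j)
    (hV : ∀ i, V i = ⊥ ∨ V i = Submodule.span ℂ {k} ∨ V i = V j)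
    (hi : V i = Submodule.span ℂ {k}) (hk : k ∈ V j) (hk0 : k ≠ 0)
    (he : Even (finrank ℂ (V j))) : ∃ y, IsSkew B y ∧ NilType B V y ∧ RigidUnip B V y := by
  obtain ⟨w, hw, hn⟩ := exists_symplectic_form he
  have hww : ∀ v, w v v = 0 := fun v => by
    have := hw v v
    linear_combination this / 2
  let k' : V j := ⟨k, hk⟩
  obtain ⟨h, hh⟩ : ∃ h, w k' h = 1 := by
    obtain ⟨h, hh⟩ : ∃ h, w k' h ≠ 0 := by
      by_contra! h0
      exact hk0 (congrArg Subtype.val (hn k' h0))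
    exact ⟨(w k' h)⁻¹ • h, by rw [map_smul, smul_eq_mul, inv_mul_cancel₀ hh]⟩
  obtain ⟨σ, y, hy, h1, h2, h3, h4⟩ :=
    D.exists_skew_twist (D.isotropic j) hL w hw (-(w h)) h
  have hiso : ∀ u v : V j, B u v = 0 := fun u v => D.isotropic j u u.2 v v.2
  have hf : ∀ v, (-(w h)) v = w v h := fun v => by rw [LinearMap.neg_apply, ← hw]
  have hyuv : ∀ u v : V j, B (y u) v = w u v := fun u v => by
    rw [h3, LinearMap.map_sub₂, LinearMap.map_smul₂, h1, hiso, smul_zero, sub_zero]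
  have hyk : y k = σ (w k') - (h : E) := by
    have := h3 k'
    rwa [hf, hh, one_smul] at this
  have hyh : y h = σ (w h) := by rw [h3, hf, hww, zero_smul, sub_zero]
  have hyyk : y (y k) = (-2 : ℂ) • σ (w h) := by
    rw [hyk, map_sub, h4, hyh, hh, map_neg]; module
  have hee : B (y k) (y k) ≠ 0 := by
    rw [hyk]
    simp only [map_sub, LinearMap.sub_apply, h2, h1, hiso, D.symm h (σ _), hh]
    norm_num
  have hnd : NondegOn B y (V j) := fun v hv h0 =>
    congrArg Subtype.val (hn ⟨v, hv⟩ fun u => by rw [← hyuv]; exact h0 u u.2)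
  have hyh' : ∀ v ∈ V j, B (y ((-2 : ℂ) • h : V j)) v = B (y (y k)) v := fun v hv => by
    rw [hyyk, hyuv _ ⟨v, hv⟩, map_smul, LinearMap.smul_apply,
      LinearMap.map_smul₂, h1 _ ⟨v, hv⟩]
  obtain ⟨S, hS, -, hS'⟩ := hasSymplecticPart_line_lagrangian_even D hy (i := i)
    hL hV hi hk hee hnd (Submodule.coe_mem _) hyh'
  refine ⟨y, hy, hS.nilType_and_rigidUnip D hy fun u hu v hv => ?_⟩
  have key : ∀ s ∈ S, ∃ s' : V j, y s = σ (w s') := fun s hs => by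
    obtain ⟨a1, -, a3⟩ := hS' s hs
    refine ⟨⟨s, a1⟩, ?_⟩
    have e : B (y ((-2 : ℂ) • h : V j)) (⟨s, a1⟩ : V j) = 0 := a3
    rw [hyuv, map_smul, LinearMap.smul_apply, smul_eq_mul] at e
    have e' := (mul_eq_zero.1 e).resolve_left (by norm_num)
    rw [h3 ⟨s, a1⟩, LinearMap.neg_apply, e', neg_zero, zero_smul, sub_zero]
  obtain ⟨u', hu'⟩ := key u hu
  obtain ⟨v', hv'⟩ := key v hv
  rw [hu', hv', h2]

theorem exists_dual_pair {W : Type*} [AddCommGroup W] [Module ℂ W] [FiniteDimensional ℂ W]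
    (hW : 2 ≤ finrank ℂ W) {k : W} (hk : k ≠ 0) : ∃ (κ : Dual ℂ W) (l : W), κ k = 0 ∧ κ l = 1 := by
  obtain ⟨l, hl⟩ : ∃ l, l ∉ Submodule.span ℂ {k} := by
    by_contra! h
    have h1 := finrank_span_singleton (K := ℂ) hk
    have ht : Submodule.span ℂ {k} = ⊤ := Submodule.eq_top_iff'.2 h
    rw [ht, finrank_top] at h1
    omega
  obtain ⟨f, hf, hf'⟩ := Submodule.exists_le_ker_of_notMem hl
  have hfk : f k = 0 := hf' (Submodule.mem_span_singleton_self k)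
  exact ⟨f, (f l)⁻¹ • l, hfk, by rw [map_smul, smul_eq_mul, inv_mul_cancel₀ hf]⟩

/-- The twist κ + w(·, h), with w(k, h) = 1 and κ(h) = 0, makes yk of square -2 as before, and yl =
-h gives B(y²k, l) = 1. The conditions defining the symplectic part kill w(·, h) and κ there, so the
twist disappears on it. -/
theorem exists_rigid_line_lagrangian_odd (D : Datum B V)
    (hL : ∀ v, (∀ l ∈ V j, B l v = 0) → v ∈ V j)
    (hV : ∀ i, V i = ⊥ ∨ V i = Submodule.span ℂ {k} ∨ V i = V j)
    (hi : V i = Submodule.span ℂ {k}) (hk : k ∈ V j) (hk0 : k ≠ 0)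
    (ho : Odd (finrank ℂ (V j))) (hdim : 2 ≤ finrank ℂ (V j)) :
    ∃ y, IsSkew B y ∧ NilType B V y ∧ RigidUnip B V y := by
  let k' : V j := ⟨k, hk⟩
  have hk0' : k' ≠ 0 := fun h => hk0 (congrArg Subtype.val h)
  obtain ⟨κ, l, hκk, hκl⟩ := exists_dual_pair hdim hk0'
  obtain ⟨w, hw, hwl, hwk, hwh⟩ := exists_form_with_kernel ho hκl
  have hww : ∀ v, w v v = 0 := fun v => by
    have := hw v v
    linear_combination this / 2
  obtain ⟨h, hκh, hh⟩ := hwh k' hκk hk0'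
  obtain ⟨σ, y, hy, h1, h2, h3, h4⟩ :=
    D.exists_skew_twist (D.isotropic j) hL w hw (κ - w h) h
  have hiso : ∀ u v : V j, B u v = 0 := fun u v => D.isotropic j u u.2 v v.2
  have hf : ∀ v, (κ - w h) v = κ v + w v h := fun v => by
    rw [LinearMap.sub_apply, hw h, sub_neg_eq_add]
  have hyuv : ∀ u v : V j, B (y u) v = w u v := fun u v => by
    rw [h3, LinearMap.map_sub₂, LinearMap.map_smul₂, h1, hiso, smul_zero, sub_zero]
  have hyk : y k = σ (w k') - (h : E) := by
    have := h3 k'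
    rwa [hf, hh, hκk, zero_add, one_smul] at this
  have hyh : y h = σ (w h) := by rw [h3, hf, hww, hκh, add_zero, zero_smul, sub_zero]
  have hyl : y l = -(h : E) := by
    rw [h3, hf, hwl, hκl, map_zero, LinearMap.zero_apply, add_zero, one_smul, zero_sub]
  have hyyk : y (y k) = σ (κ - w h) - σ (w h) := by
    rw [hyk, map_sub, h4, hyh, hh, one_smul]
  have hee : B (y k) (y k) ≠ 0 := by
    rw [hyk]
    simp only [map_sub, LinearMap.sub_apply, h2, h1, hiso, D.symm h (σ _), hh]
    norm_num
  have hhl : w h l = 0 := by rw [hw, hwl, LinearMap.zero_apply, neg_zero]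
  have hyl' : ∀ v ∈ V j, B (y l) v = 0 := fun v hv => by
    rw [hyuv l ⟨v, hv⟩, hwl, LinearMap.zero_apply]
  have hker : ∀ v ∈ V j, (∀ u ∈ V j, B (y v) u = 0) → ∃ c : ℂ, v = c • (l : E) :=
    fun v hv h0 => ⟨κ ⟨v, hv⟩, congrArg Subtype.val (hwk ⟨v, hv⟩ (LinearMap.ext fun u => by
      rw [← hyuv]; exact h0 u u.2))⟩
  have hfl : B (y (y k)) l ≠ 0 := by
    rw [hyyk, LinearMap.map_sub₂, h1, h1, hf, hκl, hwl, LinearMap.zero_apply, hhl]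
    norm_num
  obtain ⟨S, hS, -, hS'⟩ := hasSymplecticPart_line_lagrangian_odd D hy (i := i) (l := (l : E))
    hL hV hi hk hee l.2 hyl' hker hfl
  refine ⟨y, hy, hS.nilType_and_rigidUnip D hy fun u hu v hv => ?_⟩
  have key : ∀ s ∈ S, ∃ s' : V j, y s = σ (w s') := fun s hs => by
    obtain ⟨a1, a2, a3, a4⟩ := hS' s hs
    refine ⟨⟨s, a1⟩, ?_⟩
    rw [hyl, map_neg, map_neg, LinearMap.neg_apply, neg_eq_zero, hyuv h ⟨s, a1⟩] at a3
    rw [hyyk, LinearMap.map_sub₂, h1 _ ⟨s, a1⟩, h1 _ ⟨s, a1⟩, a3, sub_zero] at a4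
    rw [h3 ⟨s, a1⟩, a4, zero_smul, sub_zero]
  obtain ⟨u', hu'⟩ := key u hu
  obtain ⟨v', hv'⟩ := key v hv
  rw [hu', hv', h2]

end LineLagrangian

/-- Two wedges are added to the standard extension so that k ↦ v₀ ↦ σ(w v₀) + p, a vector of square
2, while yp = σ(w p) is isotropic. As y³k = 2σ(w p), the representing vector is 2p. On the
symplectic part κ and f vanish, so its image is isotropic. -/
theorem LagrangianDatum.exists_rigid_odd (D : LagrangianDatum B V L)
    (ho : Odd (finrank ℂ L)) (hdim : 2 ≤ finrank ℂ L) :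
    ∃ y, IsSkew B y ∧ NilType B V y ∧ RigidUnip B V y := by
  have : Nontrivial L := Module.nontrivial_of_finrank_pos (R := ℂ) (by omega)
  obtain ⟨v₁, hv₁⟩ := exists_ne (0 : L)
  obtain ⟨κ, k, hκv', hκk⟩ := exists_dual_pair hdim hv₁
  obtain ⟨w, hw, hwk, hwκ, hwh⟩ := exists_form_with_kernel ho hκk
  have hww : ∀ v, w v v = 0 := fun v => by
    have := hw v v
    linear_combination this / 2
  obtain ⟨v₀, hκv, hv⟩ := hwh v₁ hκv' hv₁
  obtain ⟨p, hκp, hp⟩ := hwh v₀ hκv fun h => by simp [h] at hv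
  have hiso : ∀ u v : L, B u v = 0 := fun u v => D.iso u.2 v.2
  obtain ⟨σ, y₀, hy₀, h1, h2, h3, h4⟩ := D.toDatum.exists_skew_extension
    (fun u hu v hv => D.iso hu hv) D.mem_of_orth w hw
  let f : Dual ℂ L := -(w p)
  have hf : ∀ v, f v = w v p := fun v => by rw [hw v p]; rfl
  let y := y₀ + wedge B v₀ (σ κ) + wedge B p (σ f)
  have hy : IsSkew B y := (hy₀.add (isSkew_wedge D.symm _ _)).add (isSkew_wedge D.symm _ _)
  have hyu : ∀ u : L, y u = σ (w u) + κ u • (v₀ : E) + f u • (p : E) := fun u => by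
    simp only [y, LinearMap.add_apply, wedge_apply, h3, h1, hiso, zero_smul, sub_zero]
  have hyσ : ∀ g, y (σ g) = -(g v₀) • σ κ - g p • σ f := fun g => by
    simp only [y, LinearMap.add_apply, wedge_apply, h4, h2, zero_smul, D.symm _ (σ g), h1]
    module
  have hyuv : ∀ u v : L, B (y u) v = w u v := fun u v => by
    simp only [hyu, map_add, map_smul, LinearMap.add_apply, LinearMap.smul_apply, h1, hiso,
      smul_zero, add_zero]
  have hwkp : w k p = 0 := by rw [hwk, LinearMap.zero_apply]
  have hyk : y k = v₀ := by
    rw [hyu, hwk, map_zero, hκk, hf, hwkp, one_smul, zero_smul, add_zero, zero_add]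
  have hyv : y v₀ = σ (w v₀) + (p : E) := by
    rw [hyu, hκv, hf, hp, zero_smul, one_smul, add_zero]
  have hyp : y p = σ (w p) := by
    rw [hyu, hκp, hf, hww, zero_smul, zero_smul, add_zero, add_zero]
  have hye : y (y v₀) = (2 : ℂ) • σ (w p) := by
    rw [hyv, map_add, hyσ, hyp, hww, hp]
    simp only [f, map_neg]
    module
  have hee : B (y (y k)) (y (y k)) ≠ 0 := by
    rw [hyk, hyv]
    simp only [map_add, LinearMap.add_apply, h2, h1, hiso, D.symm p (σ _), hp]
    norm_num
  have hker : ∀ v ∈ L, (∀ u ∈ L, B (y v) u = 0) → v ∈ Submodule.span ℂ {(k : E)} := by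
    refine fun v hv h0 => Submodule.mem_span_singleton.2 ⟨κ ⟨v, hv⟩, ?_⟩
    exact (congrArg Subtype.val (hwκ ⟨v, hv⟩ (LinearMap.ext fun u => by
      rw [← hyuv]; exact h0 u u.2))).symm
  have hyp' : ∀ v ∈ L, B (y ((2 : ℂ) • p : L)) v = B (y (y (y k))) v := fun v hv => by
    rw [hyk, hye, hyuv _ ⟨v, hv⟩, map_smul, LinearMap.smul_apply,
      LinearMap.map_smul₂, h1 _ ⟨v, hv⟩]
  have hpp : B (y ((2 : ℂ) • p : L)) (y ((2 : ℂ) • p : L)) = 0 := by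
    rw [Submodule.coe_smul, map_smul, hyp]
    simp only [map_smul, LinearMap.smul_apply, h2, smul_zero]
  obtain ⟨S, hS, -, hS'⟩ := D.hasSymplecticPart_odd hy k.2
    (hyk ▸ v₀.2) hee hker (Submodule.coe_mem _) hyp' hpp
  refine ⟨y, hy, hS.nilType_and_rigidUnip D.toDatum hy fun u hu v hv => ?_⟩
  have key : ∀ s ∈ S, ∃ s' : L, y s = σ (w s') := fun s hs => by
    obtain ⟨a1, a2, a3, a4⟩ := hS' s hs
    refine ⟨⟨s, a1⟩, ?_⟩
    rw [hyuv _ ⟨s, a1⟩, map_smul, LinearMap.smul_apply, smul_eq_mul] at a3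
    have e3 := (mul_eq_zero.1 a3).resolve_left two_ne_zero
    have e4 : f ⟨s, a1⟩ = 0 := by rw [hf, hw, e3, neg_zero]
    have hwpv : w p v₀ = -1 := by rw [hw, hp]
    have e5 := hyu ⟨s, a1⟩
    rw [e4, zero_smul, add_zero] at e5
    rw [Submodule.coe_smul, map_smul, hyp, e5] at a4
    simp only [map_add, map_smul, LinearMap.smul_apply, h2, h1, hwpv, smul_eq_mul, zero_add] at a4
    have e6 : κ ⟨s, a1⟩ = 0 := by linear_combination -a4 / 2
    rw [e5, e6, zero_smul, add_zero]
  obtain ⟨u', hu'⟩ := key u hu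
  obtain ⟨v', hv'⟩ := key v hv
  rw [hu', hv', h2]

section

variable {m : ℕ}

theorem FlagDatum.line_lagrangian (D : FlagDatum B V d) (hd : ∀ i, d i = 0 ∨ d i = 1 ∨ d i = m)
    {i j : ι} (hi : d i = 1) (hj : d j = m) (hE : finrank ℂ E = 2 * m) (hm : 1 ≤ m) {k : E}
    (hk : k ∈ V i) (hk0 : k ≠ 0) : (∀ v, (∀ l ∈ V j, B l v = 0) → v ∈ V j) ∧
      (∀ i, V i = ⊥ ∨ V i = Submodule.span ℂ {k} ∨ V i = V j) ∧
      V i = Submodule.span ℂ {k} ∧ k ∈ V j := by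
  have h1 := D.eq_span hi hk hk0
  refine ⟨fun v hv => ?_, fun i' => ?_, h1, D.le_of_le (by omega) hk⟩
  · have h2 := D.finrank_perp (V j)
    rw [D.finrank_eq, hj, hE] at h2
    have h3 : V j = B.orthogonal (V j) := Submodule.eq_of_le_of_finrank_eq
      (fun v hv w hw => D.isotropic j w hw v hv) (by rw [D.finrank_eq, hj]; omega)
    rw [h3]
    exact hv
  · rcases hd i' with h | h | h
    · exact Or.inl (D.eq_bot h)
    · exact Or.inr (Or.inl (h1 ▸ D.eq_of_eq (h.trans hi.symm)))
    · exact Or.inr (Or.inr (D.eq_of_eq (h.trans hj.symm)))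

theorem FlagDatum.exists_ne_zero (D : FlagDatum B V d) {i : ι} (hi : d i ≠ 0) :
    ∃ k ∈ V i, k ≠ 0 := Submodule.exists_mem_ne_zero_of_ne_bot fun h => hi (by
  rw [← D.finrank_eq, h, finrank_bot])

theorem OrthReductive.exists_anisotropic_line (D : FlagDatum B V d)
    (hR : OrthReductive B V y) (hy : IsSkew B y) (hd : ∀ i, d i = 0 ∨ d i = 1 ∨ d i = m)
    (hE : 2 < finrank ℂ E) (hm : 1 ≤ m) {i : ι} (hi : d i = 1) :
    ∃ k ∈ V i, k ≠ 0 ∧ B (y k) (y k) ≠ 0 := by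
  obtain ⟨k, hki, hk0, hker, hk1⟩ := hR.exists_kernel D.toDatum hy (fun i' => D.nested i' i)
    (by rw [D.finrank_eq, hi]; exact odd_one)
  exact ⟨k, hki, hk0, hR.kernel_anisotropic D.toDatum hy (j := i) (fun i' => by
    rcases hd i' with h | h | h
    · exact Or.inl (D.eq_bot h)
    · exact Or.inr (D.le_of_le (by omega))
    · exact Or.inr (D.le_of_le (by omega))) (by rw [D.finrank_eq]; omega) hki hk0 hker hk1⟩

/-- Flags consisting of a line and a Lagrangian subspace of even dimension. -/
theorem Realizes.of_line_lagrangian_even (hd : ∀ i, d i = 0 ∨ d i = 1 ∨ d i = m) (i j : ι)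
    (hi : d i = 1) (hj : d j = m) (hm : Even m) (hm2 : 2 ≤ m) :
    Realizes.{u} (2 * m) d (spAlg (m - 2)) := by
  intro E _ _ _ B V D hE
  constructor
  · intro y hy hR hN
    obtain ⟨k, hki, hk0, hee⟩ := hR.exists_anisotropic_line D hy hd (by omega) (by omega) hi
    obtain ⟨hL, hV, hi', hk⟩ := D.line_lagrangian hd hi hj hE (by omega) hki hk0
    have hn := hR.nondegOn D.toDatum hy (fun i => D.nested i j) (by rwa [D.finrank_eq, hj])
    obtain ⟨h, hh, hyh⟩ := exists_solve D.symm hy (V j) (B (y (y k))) fun v hv h0 => by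
      rw [hn v hv h0, map_zero]
    obtain ⟨S, hS, hS', -⟩ := hasSymplecticPart_line_lagrangian_even D.toDatum hy hL hV hi' hk hee
      hn hh hyh
    rw [D.finrank_eq, hj] at hS'
    have hSm : finrank ℂ S = m - 2 := by omega
    have := hS.nonempty_equiv D.toDatum hy hR hN (by
      rw [hSm]
      obtain ⟨a, rfl⟩ := hm
      exact ⟨a - 1, by omega⟩)
    rwa [hSm] at this
  · obtain ⟨k, hki, hk0⟩ := D.exists_ne_zero (i := i) (by omega)
    obtain ⟨hL, hV, hi', hk⟩ := D.line_lagrangian hd hi hj hE (by omega) hki hk0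
    exact exists_rigid_line_lagrangian_even D.toDatum hL hV hi' hk hk0 (by rwa [D.finrank_eq, hj])

/-- Flags consisting of a line and a Lagrangian subspace of odd dimension. -/
theorem Realizes.of_line_lagrangian_odd (hd : ∀ i, d i = 0 ∨ d i = 1 ∨ d i = m) (i j : ι)
    (hi : d i = 1) (hj : d j = m) (hm : Odd m) (hm2 : 3 ≤ m) :
    Realizes.{u} (2 * m) d (spAlg (m - 3)) := by
  intro E _ _ _ B V D hE
  constructor
  · intro y hy hR hN
    obtain ⟨k, hki, hk0, hee⟩ := hR.exists_anisotropic_line D hy hd (by omega) (by omega) hi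
    obtain ⟨hL, hV, hi', hk⟩ := D.line_lagrangian hd hi hj hE (by omega) hki hk0
    obtain ⟨l, hl, hl0, hyl, hker⟩ := hR.exists_kernel D.toDatum hy (fun i => D.nested i j)
      (by rwa [D.finrank_eq, hj])
    have hfl := hR.form_kernel_ne_zero D.toDatum hy hL hV hi' hk hee hl hl0 hyl hker
    obtain ⟨S, hS, hS', -⟩ := hasSymplecticPart_line_lagrangian_odd D.toDatum hy hL hV hi' hk hee
      hl hyl hker hfl
    rw [D.finrank_eq, hj] at hS'
    have hSm : finrank ℂ S = m - 3 := by omega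
    have := hS.nonempty_equiv D.toDatum hy hR hN (by
      rw [hSm]
      obtain ⟨a, rfl⟩ := hm
      exact ⟨a - 1, by omega⟩)
    rwa [hSm] at this
  · obtain ⟨k, hki, hk0⟩ := D.exists_ne_zero (i := i) (by omega)
    obtain ⟨hL, hV, hi', hk⟩ := D.line_lagrangian hd hi hj hE (by omega) hki hk0
    exact exists_rigid_line_lagrangian_odd D.toDatum hL hV hi' hk hk0 (by rwa [D.finrank_eq, hj])
      (by rw [D.finrank_eq]; omega)

/-- Flags consisting of a Lagrangian subspace of odd dimension. -/
theorem Realizes.of_lagrangian_odd (hd : ∀ i, d i = 0 ∨ d i = m) (j : ι)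
    (hj : d j = m) (hm : Odd m) (hm2 : 3 ≤ m) : Realizes.{u} (2 * m) d (spAlg (m - 3)) := by
  intro E _ _ _ B V D hE
  have DL := D.lagrangian hd hj hE
  have hLm : finrank ℂ (V j) = m := by rw [D.finrank_eq, hj]
  constructor
  · intro y hy hR hN
    obtain ⟨k, hk, hk0, hyk', hker⟩ := hR.exists_kernel D.toDatum hy (fun i => D.nested i j)
      (by rwa [hLm])
    have hyk : y k ∈ V j := DL.mem_of_orth _ fun v hv => by rw [D.symm, hyk' v hv]
    have hee := hR.apply_apply_kernel_anisotropic DL hy (by omega) hk hk0 hyk hker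
    obtain ⟨p, hp, hyp⟩ := exists_solve D.symm hy (V j) (B (y (y (y k)))) fun v hv h0 => by
      obtain ⟨c, rfl⟩ := hker v hv h0
      rw [map_smul, hy, hy.form_self D.symm, neg_zero, smul_zero]
    have hpv : B (y p) (y k) ≠ 0 := by rw [hyp _ hyk, hy]; exact neg_ne_zero.2 hee
    have hk0' : ∀ v ∈ V j, B (y k) v = 0 := hyk'
    -- p is free up to multiples of k. As yk is isotropic, B(y(p + ak), y(p + ak)) is affine in a,
    -- and this is its zero.
    set a := -(B (y p) (y p)) / (2 * B (y p) (y k)) with ha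
    obtain ⟨S, hS, hS', -⟩ := DL.hasSymplecticPart_odd hy (p := p + a • k) hk hyk hee
      (fun v hv h0 => by
        obtain ⟨c, rfl⟩ := hker v hv h0
        exact Submodule.smul_mem _ _ (Submodule.mem_span_singleton_self k))
      (add_mem hp ((V j).smul_mem _ hk))
      (fun v hv => by
        rw [map_add, map_smul, LinearMap.map_add₂, LinearMap.map_smul₂, hyk' v hv, smul_zero,
          add_zero, hyp v hv])
      (by
        simp only [map_add, map_smul, LinearMap.add_apply, LinearMap.smul_apply, smul_eq_mul,
          hyk' _ hyk, D.symm (y k) (y p), ha]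
        field_simp
        ring)
    have hSm : finrank ℂ S = m - 3 := by omega
    have := hS.nonempty_equiv D.toDatum hy hR hN (by
      rw [hSm]
      obtain ⟨a, rfl⟩ := hm
      exact ⟨a - 1, by omega⟩)
    rwa [hSm] at this
  · exact DL.exists_rigid_odd (by rwa [hLm]) (by omega)

end

/-- The stabiliser of an isotropic line in a quadratic plane. -/
theorem Realizes.of_line_plane (hd : ∀ i, d i = 0 ∨ d i = 1) (j : ι) (hj : d j = 1) :
    Realizes.{u} 2 d ℂ := by
  intro E _ _ _ B V D hE
  obtain ⟨k, hkj, hk0⟩ := D.exists_ne_zero (i := j) (by omega)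
  have hjk := D.eq_span hj hkj hk0
  have DL := D.lagrangian hd hj hE
  have hkk : B k k = 0 := D.isotropic j k hkj k hkj
  have hperp : ∀ v, B k v = 0 → v ∈ Submodule.span ℂ {k} := fun v hv => hjk ▸
    DL.mem_of_orth v fun l hl => by
      rw [hjk] at hl
      obtain ⟨c, rfl⟩ := Submodule.mem_span_singleton.1 hl
      rw [map_smul, LinearMap.smul_apply, hv, smul_zero]
  obtain ⟨t, ht⟩ := D.exists_form_ne_zero hk0
  have hPar : ∀ x, Par B V x → ∃ c : ℂ, x k = c • k := fun x hx => by
    have := hx.2 j k hkj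
    rw [hjk] at this
    obtain ⟨c, hc⟩ := Submodule.mem_span_singleton.1 this
    exact ⟨c, hc.symm⟩
  -- If xk = 0 the image of x lies in k^⊥ = ℂk, and a skew map with image in this line is zero. So
  -- elements of the subalgebra are determined by their eigenvalue on k.
  have hzero : ∀ x, IsSkew B x → x k = 0 → x = 0 := fun x hx h => LinearMap.ext fun v =>
    eq_zero_of_mem_span_of_orth (B := B) (M := ⊤) (l := k) (t₀ := t) (fun v _ => hperp _ (by
      rw [← neg_eq_zero, ← hx, h, map_zero, LinearMap.zero_apply]))
      (fun v _ => hx.form_self D.symm v) Submodule.mem_top ht v Submodule.mem_top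
  -- The subalgebra is therefore abelian and every form has all of it as stabiliser.
  have hcomm : ∀ x z, Par B V x → Par B V z → x * z - z * x = 0 := fun x z hx hz => by
    refine hzero _ (hx.1.comm hz.1) ?_
    obtain ⟨c, hc⟩ := hPar x hx
    obtain ⟨c', hc'⟩ := hPar z hz
    rw [LinearMap.sub_apply, Module.End.mul_apply, Module.End.mul_apply, hc, hc', map_smul,
      map_smul, hc, hc', smul_comm, sub_self]
  have hmem : ∀ y x, Par B V x → x ∈ lieStab B V y := fun y x hx =>
    ⟨hx, fun z hz => by rw [hcomm x z hx hz, mul_zero, map_zero]⟩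
  constructor
  · intro y hy hR hN
    let φ : lieStab B V y →ₗ[ℂ] ℂ :=
      { toFun := fun x => B (x.1 k) t / B k t
        map_add' := fun x z => by simp [add_div]
        map_smul' := fun c x => by simp [mul_div_assoc] }
    have hφ : ∀ x : lieStab B V y, x.1 k = φ x • k := fun x => by
      obtain ⟨c, hc⟩ := hPar x.1 x.2.1
      change x.1 k = (B (x.1 k) t / B k t) • k
      rw [hc, map_smul, LinearMap.smul_apply, smul_eq_mul, mul_div_cancel_right₀ _ ht]
    let ψ : lieStab B V y →ₗ⁅ℂ⁆ ℂ :=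
      { φ with
        map_lie' := fun {x z} => by
          have h1 : ⁅x, z⁆ = 0 := Subtype.ext (hcomm x.1 z.1 x.2.1 z.2.1)
          change φ ⁅x, z⁆ = φ x * φ z - φ z * φ x
          rw [h1, map_zero]
          ring }
    refine ⟨LieEquiv.ofBijective ψ ⟨fun x z h => ?_, fun c => ?_⟩⟩
    · have h1 : φ (x - z) = 0 := by rw [map_sub]; exact sub_eq_zero.2 h
      have h2 := hφ (x - z)
      rw [h1, zero_smul] at h2
      exact sub_eq_zero.1 (Subtype.ext (hzero _ (x - z).2.1.1 h2))
    · have hp : Par B V (wedge B k t) := DL.par_wedge hkj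
      refine ⟨⟨(c / B k t) • wedge B k t, hmem y _ (hp.smul _)⟩, ?_⟩
      change B (((c / B k t) • wedge B k t) k) t / B k t = c
      rw [LinearMap.smul_apply, wedge_apply, hkk, zero_smul, sub_zero, D.symm t, map_smul, map_smul,
        LinearMap.smul_apply, LinearMap.smul_apply, smul_eq_mul, smul_eq_mul]
      field_simp
  · refine ⟨0, IsSkew.zero, fun x _ => by rw [zero_mul, map_zero], fun g hg hu _ => ?_⟩
    obtain ⟨c, hc⟩ := Submodule.mem_span_singleton.1 (hjk ▸ (hg.1.2 j k).2 hkj)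
    have hc1 := unip_eigenvalue hu hc.symm hk0
    rw [hc1, one_smul] at hc
    have := eq_smul_of_sub_mem_span D.symm hg.1.1 (one_mul 1) (M := ⊤) (l := k) (t₀ := t)
      (fun v _ => hperp _ ?_) hkk Submodule.mem_top ht
    · ext v
      rw [this v Submodule.mem_top, one_smul]
      rfl
    · rw [one_smul, map_sub, sub_eq_zero]
      nth_rewrite 1 [hc]
      exact hg.1.1 k v

end BlockRealizations


/-! ### Splitting the last summand off a direct sum of Lie algebras -/

section DirectSum

theorem LieEquiv.nonempty_prod_assoc (L₁ L₂ L₃ : Type*) [LieRing L₁] [LieAlgebra ℂ L₁] [LieRing L₂]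
    [LieAlgebra ℂ L₂] [LieRing L₃] [LieAlgebra ℂ L₃] :
    Nonempty ((L₁ × L₂ × L₃) ≃ₗ⁅ℂ⁆ ((L₁ × L₂) × L₃)) :=
  ⟨{ (LinearEquiv.prodAssoc ℂ L₁ L₂ L₃).symm with map_lie' := fun {x y} => rfl }⟩

theorem LieEquiv.nonempty_directSum_succ (L : ℕ → Type*) [∀ i, LieRing (L i)]
    [∀ i, LieAlgebra ℂ (L i)] (s : ℕ) :
    Nonempty ((DirectSum (Fin (s + 1)) fun i => L i) ≃ₗ⁅ℂ⁆ ((DirectSum (Fin s) fun i => L i) × L s)) := by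
  let e := (DirectSum.linearEquivFunOnFintype ℂ (Fin s) fun i => L i)
  let e' := (DirectSum.linearEquivFunOnFintype ℂ (Fin (s + 1)) fun i => L i)
  have he : ∀ f i, e.symm f i = f i := fun f i => congrFun (e.apply_symm_apply f) i
  have he' : ∀ f i, e'.symm f i = f i := fun f i => congrFun (e'.apply_symm_apply f) i
  let p : (DirectSum (Fin (s + 1)) fun i => L i) → ∀ i : Fin s, L i := fun x i => x i.castSucc
  let f : (DirectSum (Fin (s + 1)) fun i => L i) →ₗ⁅ℂ⁆ ((DirectSum (Fin s) fun i => L i) × L s) :=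
    { toFun := fun x => (e.symm (p x), x (Fin.last s))
      map_add' := fun x y => Prod.ext (map_add e.symm (p x) (p y)) rfl
      map_smul' := fun c x => Prod.ext (map_smul e.symm c (p x)) rfl
      map_lie' := fun {x y} => Prod.ext (DFinsupp.ext fun i => by
        have h1 : p ⁅x, y⁆ i = ⁅p x i, p y i⁆ := DirectSum.bracket_apply _ x y _
        have h2 := DirectSum.bracket_apply _ (e.symm (p x)) (e.symm (p y)) i
        rw [he, he] at h2
        exact ((he _ i).trans h1).trans h2.symm) (DirectSum.bracket_apply _ x y _) }
  refine ⟨LieEquiv.ofBijective f ⟨fun x y h => DFinsupp.ext fun i => ?_, fun z => ?_⟩⟩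
  · refine Fin.lastCases ?_ (fun i => ?_) i
    · exact congrArg Prod.snd h
    · exact congrFun (e.symm.injective (congrArg Prod.fst h)) i
  · refine ⟨e'.symm (Fin.lastCases z.2 fun i => z.1 i), Prod.ext (DFinsupp.ext fun i => ?_) ?_⟩
    · refine (he _ i).trans ((he' _ _).trans ?_)
      exact Fin.lastCases_castSucc ..
    · refine (he' _ _).trans ?_
      exact Fin.lastCases_last ..

end DirectSum

/-! ### The Lagrangian flag with an even total: induction on the composition -/

section Composition

universe u
variable {r n : ℕ} {a : Composition r}

theorem sizeUpTo_succ_eq (a : Composition r) {s : ℕ} (hs : s < a.length) :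
    a.sizeUpTo (s + 1) = a.sizeUpTo s + part a (s + 1) := by
  rw [a.sizeUpTo_succ hs, part, List.getD_eq_getElem _ _ hs]

theorem sizeUpTo_le_or (a : Composition r) (s i : ℕ) :
    a.sizeUpTo i ≤ a.sizeUpTo s ∨ a.sizeUpTo (s + 1) ≤ a.sizeUpTo i :=
  (le_or_gt i s).imp (fun h => a.monotone_sizeUpTo h) fun h => a.monotone_sizeUpTo h

theorem rAlg_succ (a : Composition r) (s : ℕ) :
    Nonempty ((rAlg a s × spAlg (2 * (part a (s + 1) / 2))) ≃ₗ⁅ℂ⁆ rAlg a (s + 1)) :=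
  (LieEquiv.nonempty_directSum_succ (fun i => spAlg (2 * (part a (i + 1) / 2))) s).map
    LieEquiv.symm

/-- Strong induction, splitting at the last even partial sum before the s-th. If the previous sum is
even, the cut leaves an even Lagrangian. If it is odd, the one before it is even by the parity
condition and the last two parts are odd: splitting there and at a hyperplane of the odd member
yields one symplectic algebra for each. -/
theorem realizes_rAlg (s : ℕ) (hs : s ≤ a.length) (he : Even (a.sizeUpTo s))
    (ha : ∀ i, i + 1 ≤ s → ¬ (Odd (a.sizeUpTo i) ∧ Even (part a (i + 1)))) :
    Realizes.{u} (2 * a.sizeUpTo s)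
      (fun i : Fin (a.length + 1) => min (a.sizeUpTo i) (a.sizeUpTo s)) (rAlg a s) := by
  induction s using Nat.strong_induction_on with
  | _ s ih =>
  rcases s with - | s
  · have h0 := Realizes.of_bot.{u} (n := 0)
      (d := fun i : Fin (a.length + 1) => min (a.sizeUpTo i) (a.sizeUpTo 0))
      fun i => by simp
    refine Realizes.of_equiv (by simpa using h0)
      (LieEquiv.ofBijective (0 : soAlg 0 →ₗ⁅ℂ⁆ rAlg a 0)
        ⟨fun x y _ => Subtype.ext (Subsingleton.elim _ _), fun x => ⟨0, Subsingleton.elim _ _⟩⟩)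
  · have h1 := sizeUpTo_succ_eq a (Nat.lt_of_succ_le hs)
    obtain ⟨e⟩ := rAlg_succ a s
    have ho := ha s le_rfl
    rw [Nat.odd_iff, Nat.even_iff] at ho
    have he' := he
    rw [Nat.even_iff] at he'
    rcases Nat.even_or_odd (a.sizeUpTo s) with h2 | h2
    · have h2' := h2
      rw [Nat.even_iff] at h2'
      refine Realizes.of_equiv (Realizes.of_even (⟨s, by omega⟩ : Fin (a.length + 1)) ?_ ?_ ?_) e
      · simpa [h1] using h2
      · convert ih s (by omega) (by omega) h2 fun i hi => ha i (by omega) using 1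
        · simp [h1]
        · funext i
          simp only
          omega
      · simp only
        rw [show 2 * a.sizeUpTo (s + 1) - 2 * min (a.sizeUpTo s) (a.sizeUpTo (s + 1)) =
          2 * (2 * (part a (s + 1) / 2)) by omega]
        refine Realizes.of_lagrangian (fun i => ?_) ⟨s + 1, by omega⟩ ?_ (even_two_mul _)
        · have := sizeUpTo_le_or a s i
          omega
        · simp only
          omega
    · rw [Nat.odd_iff] at h2
      rcases s with - | s
      · simp at h2
      have h3 := sizeUpTo_succ_eq a (s := s) (by omega)
      have ho' := ha s (by omega)
      rw [Nat.odd_iff, Nat.even_iff] at ho'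
      have h4 : Even (a.sizeUpTo s) := by rw [Nat.even_iff]; omega
      have h4' := h4
      rw [Nat.even_iff] at h4'
      obtain ⟨e'⟩ := rAlg_succ a s
      obtain ⟨f⟩ := LieEquiv.nonempty_prod e'
        (LieEquiv.refl : spAlg (2 * (part a (s + 1 + 1) / 2)) ≃ₗ⁅ℂ⁆ _)
      obtain ⟨g⟩ := LieEquiv.nonempty_prod_assoc (rAlg a s) (spAlg (2 * (part a (s + 1) / 2)))
        (spAlg (2 * (part a (s + 1 + 1) / 2)))
      refine Realizes.of_equiv (Realizes.of_even (⟨s, by omega⟩ : Fin (a.length + 1)) ?_ ?_ ?_)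
        ((g.trans f).trans e)
      · simp only
        rw [Nat.even_iff]
        omega
      · convert ih s (by omega) (by omega) h4 fun i hi => ha i (by omega) using 1
        · simp only; omega
        · funext i
          simp only
          omega
      · simp only
        refine Realizes.of_odd ⟨s + 1, by omega⟩ (m := 2 * (part a (s + 1) / 2)) (even_two_mul _)
          ?_ (fun i => ?_) ?_ ?_ ?_
        · simp only; omega
        · have := sizeUpTo_le_or a s i
          simp only; omega
        · simp only; omega
        · refine Realizes.of_lagrangian (fun i => ?_) ⟨s + 1, by omega⟩ ?_ (even_two_mul _)
          · have := sizeUpTo_le_or a s i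
            omega
          · simp only; omega
        · rw [show 2 * a.sizeUpTo (s + 1 + 1) - 2 * min (a.sizeUpTo s) (a.sizeUpTo (s + 1 + 1)) -
            2 * (2 * (part a (s + 1) / 2)) = 2 * (2 * (part a (s + 1 + 1) / 2) + 2) by omega]
          -- What is left is a line in a Lagrangian of dimension a_{s+2} + 1 with a_{s+2} odd. The
          -- block loses 2, giving sp of a_{s+2} - 1.
          refine Realizes.of_line_lagrangian_even (m := 2 * (part a (s + 1 + 1) / 2) + 2)
            (fun i => ?_) ⟨s + 1, by omega⟩ ⟨s + 1 + 1, by omega⟩ ?_ ?_ ?_ ?_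
          · have := sizeUpTo_le_or a s i
            have := sizeUpTo_le_or a (s + 1) i
            omega
          · simp only; omega
          · simp only; omega
          · rw [Nat.even_iff]; omega
          · omega

end Composition


/-! ### Assembling the five cases -/

section Composition

universe u
variable {r n : ℕ} {a : Composition r}

theorem Realizes.congr {ι : Type*} {n n' : ℕ} {d d' : ι → ℕ} {M : Type*} [LieRing M]
    [LieAlgebra ℂ M] (h : Realizes.{u} n d M) (hn : n = n') (hd : ∀ i, d i = d' i) :
    Realizes.{u} n' d' M := by
  obtain rfl := hn
  rwa [← funext hd]

theorem realizes_even (ha : HasStar n a) (hr : Even r) :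
    Realizes.{u} n (fun i : Fin (a.length + 1) => a.sizeUpTo i)
      (rAlg a a.length × soAlg (n - 2 * r)) := by
  have ht : truncLength n a = a.length := if_neg fun h => Nat.not_odd_iff_even.2 hr h.1
  have hl := a.sizeUpTo_length
  have h1 := realizes_rAlg (a := a) a.length le_rfl (by rwa [hl]) fun i hi => ha i (by omega)
  refine Realizes.of_even (Fin.last a.length) (by simpa using hr) h1
    ((Realizes.of_bot fun i => ?_).congr (n := n - 2 * r) (by simp) fun i => rfl)
  simpa using Nat.sub_eq_zero_of_le (a.sizeUpTo_le i)

/-- By the parity condition the sum before the last is even. Cutting there and at a hyperplane of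
the last member leaves an isotropic line in dimension n - 2r + 2, which contributes so of n - 2r -
1. -/
theorem realizes_odd (ha : HasStar n a) (hr : Odd r) (hn : 2 * r < n) :
    Realizes.{u} n (fun i : Fin (a.length + 1) => a.sizeUpTo i)
      (rAlg a (a.length - 1) × spAlg (part a a.length - 1) × soAlg (n - 2 * r - 1)) := by
  have ht : truncLength n a = a.length := if_neg fun h => hn.ne h.2
  have hl := a.sizeUpTo_length
  obtain ⟨s, hs⟩ : ∃ s, a.length = s + 1 :=
    Nat.exists_eq_succ_of_ne_zero fun h => by rw [h, a.sizeUpTo_zero] at hl; simp [← hl] at hr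
  rw [show a.length - 1 = s by omega, show part a a.length = part a (s + 1) by rw [hs]]
  have h1 := sizeUpTo_succ_eq a (s := s) (by omega)
  have hl' : a.sizeUpTo (s + 1) = r := by rw [← hs, hl]
  have h2 := ha s (by omega)
  rw [Nat.odd_iff] at hr
  rw [Nat.odd_iff, Nat.even_iff] at h2
  have h3 : Even (a.sizeUpTo s) := by rw [Nat.even_iff]; omega
  have h3' := Nat.even_iff.1 h3
  have hD : ∀ i, a.sizeUpTo i ≤ a.sizeUpTo s ∨ a.sizeUpTo i = r := fun i => by
    have := sizeUpTo_le_or a s i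
    have := a.sizeUpTo_le i
    omega
  refine Realizes.of_even (⟨s, by omega⟩ : Fin (a.length + 1)) h3
    (realizes_rAlg s (by omega) h3 fun i hi => ha i (by omega)) ?_
  have hm : Even (part a (s + 1) - 1) := by rw [Nat.even_iff]; omega
  refine Realizes.of_odd (Fin.last a.length) hm ?_ (fun i => ?_) ?_
    (Realizes.of_lagrangian (fun i => ?_) ⟨s + 1, by omega⟩ ?_ hm)
    ((Realizes.of_line (n := n - 2 * r - 1 + 3) (fun i => ?_) (Fin.last a.length) ?_ ?_).congr
      ?_ fun i => rfl)
  · simp only [Fin.val_last, hl]; omega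
  · have := hD i
    simp only [Fin.val_last, hl]; omega
  · simp only [Fin.val_last, hl]; omega
  · have := hD i
    simp only; omega
  · simp only [Fin.val_last, hl]; omega
  · have := hD i
    simp only; omega
  · simp only [Fin.val_last, hl]; omega
  · omega
  · simp only; omega

/-- The total r and the last part are odd, so the previous sum is even. Cutting there leaves a
single Lagrangian of odd dimension, the hypothesis `h`; the cases a_t = 1 and a_t ≥ 3 share this
argument. -/
theorem realizes_lagrangian_odd {M : Type*} [LieRing M] [LieAlgebra ℂ M] (ha : HasStar n a)
    (hr : Odd r) (hn : 2 * r = n) (hp : Odd (part a a.length))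
    (h : ∀ (ι : Type) (d : ι → ℕ) (j : ι), (∀ i, d i = 0 ∨ d i = part a a.length) →
      d j = part a a.length → Realizes.{u} (2 * part a a.length) d M) :
    Realizes.{u} n (fun i : Fin (a.length + 1) => a.sizeUpTo i) (rAlg a (a.length - 1) × M) := by
  have ht : truncLength n a = a.length - 1 := if_pos ⟨hr, hn⟩
  have hl := a.sizeUpTo_length
  obtain ⟨s, hs⟩ : ∃ s, a.length = s + 1 :=
    Nat.exists_eq_succ_of_ne_zero fun h => by rw [h, a.sizeUpTo_zero] at hl; simp [← hl] at hr
  rw [show part a a.length = part a (s + 1) by rw [hs]] at h hp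
  rw [show a.length - 1 = s by omega]
  have h1 := sizeUpTo_succ_eq a (s := s) (by omega)
  have hl' : a.sizeUpTo (s + 1) = r := by rw [← hs, hl]
  rw [Nat.odd_iff] at hr hp
  have h3 : Even (a.sizeUpTo s) := by rw [Nat.even_iff]; omega
  have hD : ∀ i, a.sizeUpTo i ≤ a.sizeUpTo s ∨ a.sizeUpTo i = r := fun i => by
    have := sizeUpTo_le_or a s i
    have := a.sizeUpTo_le i
    omega
  refine Realizes.of_even (⟨s, by omega⟩ : Fin (a.length + 1)) h3
    (realizes_rAlg s (by omega) h3 fun i hi => ha i (by omega))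
    ((h _ _ (Fin.last a.length) (fun i => ?_) ?_).congr ?_ fun i => rfl)
  · have := hD i
    simp only; omega
  · simp only [Fin.val_last, hl]; omega
  · simp only; omega

theorem realizes_lagrangian_one (ha : HasStar n a) (hr : Odd r) (hn : 2 * r = n)
    (hp : part a a.length = 1) :
    Realizes.{u} n (fun i : Fin (a.length + 1) => a.sizeUpTo i) (rAlg a (a.length - 1) × ℂ) := by
  refine realizes_lagrangian_odd ha hr hn (hp ▸ odd_one) fun ι d j hd hj => ?_
  rw [hp] at hd hj ⊢
  exact Realizes.of_line_plane hd j hj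

theorem realizes_lagrangian_three_le (ha : HasStar n a) (hr : Odd r) (hn : 2 * r = n)
    (hp : 1 < part a a.length) (hp' : Odd (part a a.length)) :
    Realizes.{u} n (fun i : Fin (a.length + 1) => a.sizeUpTo i)
      (rAlg a (a.length - 1) × spAlg (part a a.length - 3)) :=
  realizes_lagrangian_odd ha hr hn hp' fun ι d j hd hj => Realizes.of_lagrangian_odd hd j hj hp' (by
    rw [Nat.odd_iff] at hp'; omega)

/-- The sum before the last is odd, so there are at least two parts and the sum before that is even.
After both cuts a line in a Lagrangian of odd dimension a_t + 1 is left, whence sp of a_t - 2. -/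
theorem realizes_lagrangian_even (ha : HasStar n a) (hr : Odd r) (hn : 2 * r = n)
    (hp : Even (part a a.length)) :
    Realizes.{u} n (fun i : Fin (a.length + 1) => a.sizeUpTo i)
      (rAlg a (a.length - 2) × spAlg (part a (a.length - 1) - 1) × spAlg (part a a.length - 2)) := by
  have ht : truncLength n a = a.length - 1 := if_pos ⟨hr, hn⟩
  have hl := a.sizeUpTo_length
  obtain ⟨t, hs⟩ : ∃ s, a.length = s + 1 :=
    Nat.exists_eq_succ_of_ne_zero fun h => by rw [h, a.sizeUpTo_zero] at hl; simp [← hl] at hr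
  rw [show part a a.length = part a (t + 1) by rw [hs]] at hp
  have h1 := sizeUpTo_succ_eq a (s := t) (by omega)
  have h1' := a.sizeUpTo_strict_mono (i := t) (by omega)
  have hl' : a.sizeUpTo (t + 1) = r := by rw [← hs, hl]
  rw [Nat.even_iff] at hp
  rw [Nat.odd_iff] at hr
  obtain ⟨s, rfl⟩ : ∃ s, t = s + 1 := Nat.exists_eq_succ_of_ne_zero fun h => by
    subst h; rw [a.sizeUpTo_zero] at h1; omega
  rw [show a.length - 2 = s by omega, show a.length - 1 = s + 1 by omega,
    show part a a.length = part a (s + 1 + 1) by rw [hs]]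
  have h2 := sizeUpTo_succ_eq a (s := s) (by omega)
  have h3 := ha s (by omega)
  rw [Nat.odd_iff, Nat.even_iff] at h3
  have h4 : Even (a.sizeUpTo s) := by rw [Nat.even_iff]; omega
  have h4' := Nat.even_iff.1 h4
  have hD : ∀ i, a.sizeUpTo i ≤ a.sizeUpTo s ∨ a.sizeUpTo i = a.sizeUpTo (s + 1) ∨
      a.sizeUpTo i = r := fun i => by
    have := sizeUpTo_le_or a s i
    have := sizeUpTo_le_or a (s + 1) i
    have := a.sizeUpTo_le i
    omega
  refine Realizes.of_even (⟨s, by omega⟩ : Fin (a.length + 1)) h4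
    (realizes_rAlg s (by omega) h4 fun i hi => ha i (by omega)) ?_
  have hm : Even (part a (s + 1) - 1) := by rw [Nat.even_iff]; omega
  have hm' : Odd (part a (s + 1 + 1) + 1) := by rw [Nat.odd_iff]; omega
  refine Realizes.of_odd ⟨s + 1, by omega⟩ hm ?_ (fun i => ?_) ?_
    (Realizes.of_lagrangian (fun i => ?_) ⟨s + 1, by omega⟩ ?_ hm)
    ((Realizes.of_line_lagrangian_odd (m := part a (s + 1 + 1) + 1) (fun i => ?_)
      ⟨s + 1, by omega⟩ (Fin.last a.length) ?_ ?_ hm' ?_).congr ?_ fun i => rfl)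
  · simp only; omega
  · have := hD i
    simp only; omega
  · simp only; omega
  · have := hD i
    simp only; omega
  · simp only [Fin.val_last, hl]; omega
  · have := hD i
    simp only; omega
  · simp only; omega
  · simp only [Fin.val_last, hl]; omega
  · omega
  · simp only; omega

end Composition


/-! ### From linear forms on the parabolic subalgebra to skew endomorphisms -/

section Transfer

variable {E : Type*} [AddCommGroup E] [Module ℂ E] [FiniteDimensional ℂ E] {ι : Type*}
  {B : BilinForm ℂ E} {V : ι → Submodule ℂ E} {d : ι → ℕ} {u : E}

theorem exists_trace_rep (f : Dual ℂ (End ℂ E)) : ∃ y : End ℂ E, ∀ x, f x = LinearMap.trace ℂ E (y * x) := by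
  let T : End ℂ E →ₗ[ℂ] Dual ℂ (End ℂ E) := LinearMap.mk₂ ℂ (fun y x => LinearMap.trace ℂ E (y * x))
    (fun _ _ _ => by rw [add_mul, map_add]) (fun _ _ _ => by rw [smul_mul_assoc, map_smul])
    (fun _ _ _ => by rw [mul_add, map_add]) fun _ _ _ => by rw [mul_smul_comm, map_smul]
  have hT : Function.Injective T := by
    refine (injective_iff_map_eq_zero T).2 fun y hy => LinearMap.ext fun v => ?_
    rw [LinearMap.zero_apply, ← forall_dual_apply_eq_zero_iff ℂ]
    intro φ
    have h1 : LinearMap.trace ℂ E (y * φ.smulRight v) = 0 := LinearMap.congr_fun hy _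
    have h2 : y * φ.smulRight v = φ.smulRight (y v) := by ext w; simp
    rwa [h2, LinearMap.trace_smulRight] at h1
  obtain ⟨y, rfl⟩ := (LinearMap.injective_iff_surjective_of_finrank_eq_finrank
    Subspace.dual_finrank_eq.symm).1 hT f
  exact ⟨y, fun x => rfl⟩

theorem Datum.exists_adjoint (D : Datum B V) (y : End ℂ E) :
    ∃ z : End ℂ E, (∀ v w, B (z v) w = B v (y w)) ∧ LinearMap.trace ℂ E z = LinearMap.trace ℂ E y := by
  let e := B.toDual D.nondegenerate
  refine ⟨e.symm.conj (Dual.transpose y), fun v w => ?_, ?_⟩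
  · rw [← LinearMap.BilinForm.toDual_def D.nondegenerate]
    change e (e.symm (Dual.transpose y (e v))) w = _
    rw [e.apply_symm_apply]
    rfl
  · rw [LinearMap.trace_conj', LinearMap.trace_transpose']

/-- Represent any extension of γ by a trace and replace the endomorphism by its skew part. Skew
elements do not see the self-adjoint part, since a map and its adjoint have equal traces. -/
theorem Datum.exists_skew_rep (D : Datum B V) (γ : Dual ℂ (parabolic B V)) :
    ∃ y, IsSkew B y ∧ ∀ x : parabolic B V, γ x = LinearMap.trace ℂ E (y * x.1) := by
  obtain ⟨f, hf⟩ := LinearMap.exists_extend (p := (parabolic B V).toSubmodule) γ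
  obtain ⟨y, hy⟩ := exists_trace_rep f
  obtain ⟨z, hz, -⟩ := D.exists_adjoint y
  have hz' : ∀ v w, B v (z w) = B (y v) w := fun v w => by rw [D.symm, hz, D.symm]
  refine ⟨(2⁻¹ : ℂ) • (y - z), fun v w => ?_, fun x => ?_⟩
  · simp only [LinearMap.smul_apply, LinearMap.sub_apply, map_smul, map_sub, hz, hz', smul_eq_mul]
    ring
  · have hx : IsSkew B x.1 := (mem_parabolic_iff.1 x.2).1
    obtain ⟨t, ht, ht'⟩ := D.exists_adjoint (x.1 * y)
    have h1 : t = -(z * x.1) := by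
      ext v
      refine sub_eq_zero.1 (D.nondeg _ fun w => ?_)
      simp only [LinearMap.map_sub₂, ht, Module.End.mul_apply, LinearMap.neg_apply, map_neg, hz]
      rw [← neg_eq_iff_eq_neg.2 (hx v (y w))]
      ring
    have h2 : LinearMap.trace ℂ E (z * x.1) = -LinearMap.trace ℂ E (y * x.1) := by
      rw [LinearMap.trace_mul_comm, ← neg_eq_iff_eq_neg, LinearMap.trace_mul_comm ℂ y, ← ht', h1,
        map_neg, LinearMap.trace_mul_comm]
    have h3 : γ x = f x.1 := by rw [← hf]; rfl
    rw [h3, hy, smul_mul_assoc, map_smul, sub_mul, map_sub, h2, smul_eq_mul]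
    ring

theorem mem_coadjointStabilizer_iff {γ : Dual ℂ (parabolic B V)} {y : End ℂ E}
    (hy : ∀ x : parabolic B V, γ x = LinearMap.trace ℂ E (y * x.1)) {x : parabolic B V} :
    x ∈ coadjointStabilizer γ ↔ x.1 ∈ lieStab B V y := by
  have h : ∀ z : parabolic B V, γ ⁅x, z⁆ = LinearMap.trace ℂ E (y * (x.1 * z.1 - z.1 * x.1)) :=
    fun z => hy _
  refine ⟨fun hx => ⟨mem_parabolic_iff.1 x.2, fun z hz => ?_⟩, fun hx z => ?_⟩
  · exact (h ⟨z, mem_parabolic_iff.2 hz⟩).symm.trans (hx _)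
  · exact (h z).trans (hx.2 _ (mem_parabolic_iff.1 z.2))

theorem nonempty_coadjointStabilizer_equiv {γ : Dual ℂ (parabolic B V)} {y : End ℂ E}
    (hy : ∀ x : parabolic B V, γ x = LinearMap.trace ℂ E (y * x.1)) :
    Nonempty (coadjointStabilizer γ ≃ₗ⁅ℂ⁆ lieStab B V y) :=
  ⟨{ toFun := fun x => ⟨x.1.1, (mem_coadjointStabilizer_iff hy).1 x.2⟩
     map_add' := fun _ _ => rfl
     map_smul' := fun _ _ => rfl
     map_lie' := rfl
     invFun := fun x => ⟨⟨x.1, mem_parabolic_iff.2 x.2.1⟩, (mem_coadjointStabilizer_iff hy).2 x.2⟩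
     left_inv := fun _ => rfl
     right_inv := fun _ => rfl }⟩

theorem isNilpotentType_iff {γ : Dual ℂ (parabolic B V)} {y : End ℂ E}
    (hy : ∀ x : parabolic B V, γ x = LinearMap.trace ℂ E (y * x.1)) :
    IsNilpotentType γ ↔ NilType B V y := by
  refine ⟨fun h x hx => ?_, fun h x hx => ?_⟩
  · exact (hy ⟨x, mem_parabolic_iff.2 hx.1⟩).symm.trans
      (h ⟨x, _⟩ ((mem_coadjointStabilizer_iff hy).2 hx))
  · exact (hy x).trans (h _ ((mem_coadjointStabilizer_iff hy).1 hx))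

theorem mem_groupStabilizer_iff {γ : Dual ℂ (parabolic B V)} {y : End ℂ E}
    (hy : ∀ x : parabolic B V, γ x = LinearMap.trace ℂ E (y * x.1)) {g : parabolicGroup B V} :
    g ∈ groupStabilizer γ ↔ g.1 ∈ grpStab B V y := by
  have h : ∀ z : parabolic B V, γ (Ad B V g⁻¹ z) = LinearMap.trace ℂ E (y * g.1.symm.conj z.1) :=
    fun z => hy _
  refine ⟨fun hg => ⟨⟨g.2.1, g.2.2.2⟩, fun z hz => ?_⟩, fun hg z => ?_⟩
  · have := (h ⟨z, mem_parabolic_iff.2 hz⟩).symm.trans (hg _)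
    rwa [hy] at this
  · rw [h, hy]
    exact hg.2 _ (mem_parabolic_iff.1 z.2)

theorem Unip.det_eq_one {g : E ≃ₗ[ℂ] E} (hg : Unip g) : LinearMap.det (g : E →ₗ[ℂ] E) = 1 := by
  have h1 : IsNilpotent (1 - (g : End ℂ E)) := by
    rw [← neg_sub]; exact hg.neg
  have h2 := LinearMap.eval_charpoly (1 - (g : End ℂ E)) 1
  rw [(LinearMap.charpoly_eq_X_pow_iff _).2 (fun m => ?_)] at h2
  · simpa using h2.symm
  · obtain ⟨k, hk⟩ := h1
    exact ⟨k, by rw [hk]; rfl⟩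

/-- Conjugation is the product of left multiplication by g and right multiplication by g⁻¹, two
commuting unipotent operators. -/
theorem Unip.ad {g : parabolicGroup B V} (hg : Unip g.1) :
    IsNilpotent ((Ad B V g : End ℂ (parabolic B V)) - 1) := by
  let a : End ℂ (End ℂ E) := LinearMap.mulLeft ℂ (g.1 : End ℂ E)
  let b : End ℂ (End ℂ E) := LinearMap.mulRight ℂ (g.1.symm : End ℂ E)
  have hgs : IsNilpotent ((g.1.symm : End ℂ E) - 1) := by
    have h1 : (g.1.symm : End ℂ E) * g.1 = 1 := by ext v; simp
    have h2 : (g.1 : End ℂ E) * g.1.symm = 1 := by ext v; simp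
    have h3 : (g.1.symm : End ℂ E) - 1 = -((g.1 : End ℂ E) - 1) * g.1.symm := by
      rw [neg_sub, sub_mul, h2, one_mul]
    rw [h3]
    refine Commute.isNilpotent_mul_right ?_ hg.neg
    change _ * _ = _ * _
    simp only [neg_sub, sub_mul, mul_sub, h1, h2, one_mul, mul_one]
  have ha : IsNilpotent (a - 1) := by
    obtain ⟨k, hk⟩ := hg
    refine ⟨k, ?_⟩
    have : a - 1 = LinearMap.mulLeft ℂ ((g.1 : End ℂ E) - 1) := by
      ext x; simp [a, sub_mul]
    rw [this, LinearMap.pow_mulLeft, hk, LinearMap.mulLeft_zero_eq_zero]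
  have hb : IsNilpotent (b - 1) := by
    obtain ⟨k, hk⟩ := hgs
    refine ⟨k, ?_⟩
    have : b - 1 = LinearMap.mulRight ℂ ((g.1.symm : End ℂ E) - 1) := by
      ext x; simp [b, mul_sub]
    rw [this, LinearMap.pow_mulRight, hk, LinearMap.mulRight_zero_eq_zero]
  have hab : Commute a b := LinearMap.commute_mulLeft_right ..
  have hc : IsNilpotent (a * b - 1) := by
    have h1 : a * b - 1 = (a - 1) * b + (b - 1) := by
      rw [sub_mul, one_mul, sub_add_sub_cancel]
    rw [h1]
    have hab' : Commute (a - 1) b := hab.sub_left (Commute.one_left b)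
    have hab2 : Commute (a - 1) (b - 1) := hab'.sub_right (Commute.one_right _)
    exact Commute.isNilpotent_add
      (hab2.mul_left ((Commute.refl b).sub_right (Commute.one_right _))) (hab'.isNilpotent_mul_right ha) hb
  obtain ⟨k, hk⟩ := hc
  let c : End ℂ (parabolic B V) := (Ad B V g : End ℂ (parabolic B V)) - 1
  refine ⟨k, LinearMap.ext fun x => Subtype.ext ?_⟩
  have h : ∀ j, ((c ^ j) x).1 = ((a * b - 1) ^ j) x.1 := by
    intro j
    induction j with
    | zero => rfl
    | succ j ih =>
      rw [pow_succ', pow_succ', Module.End.mul_apply, Module.End.mul_apply, ← ih]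
      rfl
  refine (h k).trans ?_
  rw [hk]
  rfl

end Transfer


/-! ### Reductive type, the kernel of the adjoint action, and the centre -/

section Transfer

universe w
variable {E : Type w} [AddCommGroup E] [Module ℂ E] [FiniteDimensional ℂ E] {ι : Type*}
  {B : BilinForm ℂ E} {V : ι → Submodule ℂ E} {d : ι → ℕ} {u : E} {U : Submodule ℂ E}

variable (B V) in
/-- An isotropic subspace that is the smallest nonzero member of the flag. -/
structure IsMinimalMember (U : Submodule ℂ E) : Prop where
  ne_bot : U ≠ ⊥
  exists_eq : ∃ i, V i = U
  le : ∀ i, V i = ⊥ ∨ U ≤ V i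
  isotropic : ∀ u ∈ U, ∀ v ∈ U, B u v = 0

theorem FlagDatum.exists_isMinimalMember (D : FlagDatum B V d) {j : ι} (hj : d j ≠ 0) :
    ∃ U, IsMinimalMember B V U := by
  obtain ⟨i, hi, hmin⟩ := (InvImage.wf d wellFounded_lt).has_min {j | d j ≠ 0} ⟨j, hj⟩
  refine ⟨V i, fun h => hi ?_, ⟨i, rfl⟩, fun k => ?_, D.isotropic i⟩
  · rw [← D.finrank_eq, h, finrank_bot]
  · by_cases hk : d k = 0
    · exact .inl (D.eq_bot hk)
    · exact .inr (D.le_of_le (not_lt.1 (hmin k hk)))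

theorem Datum.par_wedge_of_mem (D : Datum B V) (hU : IsMinimalMember B V U) (hu : u ∈ U) (v : E) :
    Par B V (wedge B u v) := by
  refine par_wedge D.symm fun i => ?_
  rcases hU.le i with h | h
  · simp [h]
  · exact ⟨fun w hw => D.isotropic i u (h hu) w hw, .inl (h hu)⟩

theorem IsMinimalMember.exists_eigenvector (hU : IsMinimalMember B V U) {f : End ℂ E}
    (hf : ∀ v ∈ U, f v ∈ U) : ∃ u ∈ U, u ≠ 0 ∧ ∃ c : ℂ, f u = c • u := by
  have : Nontrivial U := Submodule.nontrivial_iff_ne_bot.2 hU.ne_bot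
  obtain ⟨c, hc⟩ := Module.End.exists_eigenvalue (f.restrict hf)
  obtain ⟨v, hv⟩ := hc.exists_hasEigenvector
  exact ⟨v, v.2, fun h => hv.2 (Subtype.ext h), c, congrArg Subtype.val hv.apply_eq_smul⟩

theorem Datum.exists_form_eq_one (D : Datum B V) (hu : u ≠ 0) : ∃ v, B u v = 1 := by
  obtain ⟨v, hv⟩ : ∃ v, B u v ≠ 0 := by
    by_contra! h
    exact hu (D.nondeg u h)
  exact ⟨(B u v)⁻¹ • v, by rw [map_smul, smul_eq_mul, inv_mul_cancel₀ hv]⟩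

theorem Datum.mem_span_of_wedge_eq_zero (D : Datum B V) (hu : u ≠ 0) {v : E} (h : wedge B u v = 0) :
    v ∈ Submodule.span ℂ {u} := by
  obtain ⟨w, hw⟩ := D.exists_form_eq_one hu
  have h1 := LinearMap.congr_fun h w
  rw [wedge_apply, hw, one_smul, LinearMap.zero_apply, sub_eq_zero] at h1
  exact Submodule.mem_span_singleton.2 ⟨_, h1⟩

theorem Datum.exists_orth_notMem (D : Datum B V) (hu : u ≠ 0) (hE : 3 ≤ finrank ℂ E) :
    ∃ w, B u w = 0 ∧ w ∉ Submodule.span ℂ {u} := by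
  by_contra! h
  have h1 := D.finrank_perp (Submodule.span ℂ {u})
  have h2 : finrank ℂ (B.orthogonal (Submodule.span ℂ {u})) ≤ finrank ℂ (Submodule.span ℂ {u}) :=
    Submodule.finrank_mono fun w hw => h w (hw u (Submodule.mem_span_singleton_self u))
  rw [finrank_span_singleton hu] at h1 h2
  omega

/-- If `B (w, ·)` vanishes on `u^⊥` then `w` is a multiple of `u`. -/
theorem Datum.exists_orth_form_ne_zero (D : Datum B V) {w : E}
    (hw : w ∉ Submodule.span ℂ {u}) : ∃ v, B u v = 0 ∧ B w v ≠ 0 := by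
  by_contra! h
  refine hw (D.mem_of_perp fun m hm => ?_)
  rw [D.symm]
  exact h m (hm u (Submodule.mem_span_singleton_self u))

/-- Take an eigenvector u in the smallest member; it is fixed by g. Then g commutes with every u ∧
w, and evaluating at v with B(u, v) = 1 gives gw - w in ℂu for all w. An isometry with this property
is trivial. -/
theorem Unip.eq_one_of_ad (D : FlagDatum B V d) (hU : IsMinimalMember B V U)
    {g : parabolicGroup B V} (hg : Unip g.1) (h : Ad B V g = 1) : g.1 = 1 := by
  have hgU : ∀ v ∈ U, g.1 v ∈ U := by
    obtain ⟨i, rfl⟩ := hU.exists_eq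
    exact fun v hv => (g.2.2.2 i v).2 hv
  obtain ⟨u, hu, hu0, c, hc⟩ := hU.exists_eigenvector (f := (g.1 : End ℂ E)) hgU
  have huu : B u u = 0 := hU.isotropic u hu u hu
  obtain rfl := unip_eigenvalue hg hc hu0
  have hgu : g.1 u = u := hc.trans (one_smul _ _)
  have hcomm : ∀ w v, g.1 (wedge B u w v) = wedge B u w (g.1 v) := fun w v => by
    have h1 : g.1.conj (wedge B u w) = wedge B u w := congrArg Subtype.val (LinearEquiv.congr_fun h
      ⟨_, mem_parabolic_iff.2 (D.par_wedge_of_mem hU hu w)⟩)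
    conv_rhs => rw [← h1, conj_apply', g.1.symm_apply_apply]
  obtain ⟨v, hv⟩ := D.exists_form_eq_one hu0
  have hgv : B u (g.1 v) = 1 := by
    have := g.2.1 u v
    rwa [hgu, hv] at this
  have key := eq_smul_of_sub_mem_span (l := u) (t₀ := v) (ε := 1) D.symm g.2.1 (by norm_num)
    (M := ⊤) (fun w _ => ?_) huu trivial (by rw [hv]; exact one_ne_zero)
  · exact LinearEquiv.ext fun w => (key w trivial).trans (one_smul _ _)
  · have h1 := hcomm w v
    rw [wedge_apply, wedge_apply, hv, hgv, map_sub, map_smul, hgu, one_smul] at h1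
    refine Submodule.mem_span_singleton.2 ⟨B w v - B w (g.1 v), ?_⟩
    rw [one_smul, sub_smul]
    rw [sub_eq_sub_iff_add_eq_add] at h1 ⊢
    exact h1.trans (add_comm _ _)

/-- Unipotent isometries have determinant 1, so a normal unipotent subgroup already lies in the
special orthogonal stabiliser. The adjoint action keeps it normal and unipotent and kills no
unipotent element but 1. -/
theorem orthReductive_of_isReductiveType (D : FlagDatum B V d) (hU : IsMinimalMember B V U)
    {γ : Dual ℂ (parabolic B V)} {y : End ℂ E}
    (hy : ∀ x : parabolic B V, γ x = LinearMap.trace ℂ E (y * x.1)) (h : IsReductiveType γ) :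
    OrthReductive B V y := by
  intro N hN hN' hu
  have hNP : ∀ g ∈ N, ∃ g' : parabolicGroup B V, g'.1 = g ∧ g' ∈ groupStabilizer γ := fun g hg =>
    ⟨⟨g, (hN hg).1.1, (hu g hg).det_eq_one, (hN hg).1.2⟩, rfl, (mem_groupStabilizer_iff hy).2 (hN hg)⟩
  have h0 := h ((N.comap (parabolicGroup B V).subtype).map (Ad B V)) ?_ ?_ ?_
  · refine (Subgroup.eq_bot_iff_forall _).2 fun g hg => ?_
    obtain ⟨g, rfl, hg'⟩ := hNP g hg
    refine (hu _ hg).eq_one_of_ad D hU ?_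
    rw [← Subgroup.mem_bot, ← h0]
    exact Subgroup.mem_map_of_mem _ hg
  · rintro _ ⟨g, hg, rfl⟩
    exact Subgroup.mem_map_of_mem _ ((mem_groupStabilizer_iff hy).2 (hN hg))
  · rintro _ ⟨h, hh, rfl⟩ _ ⟨g, hg, rfl⟩
    rw [← map_mul, ← map_inv, ← map_mul]
    exact Subgroup.mem_map_of_mem _ (hN' _ ((mem_groupStabilizer_iff hy).1 hh) _ hg)
  · rintro _ ⟨g, hg, rfl⟩
    exact (hu _ hg).ad

/-- An element acting unipotently on the parabolic subalgebra is unipotent up to sign. -/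
theorem signUnip_of_ad (D : FlagDatum B V d) (hU : IsMinimalMember B V U) (hE : 3 ≤ finrank ℂ E)
    {g : parabolicGroup B V} (hg : IsNilpotent ((Ad B V g : End ℂ (parabolic B V)) - 1)) :
    SignUnip g.1 := by
  have hgU : ∀ v ∈ U, g.1 v ∈ U := by
    obtain ⟨i, rfl⟩ := hU.exists_eq
    exact fun v hv => (g.2.2.2 i v).2 hv
  obtain ⟨u, hu, hu0, c, hc⟩ := hU.exists_eigenvector (f := (g.1 : End ℂ E)) hgU
  have hgu : g.1 u = c • u := hc
  have huu : B u u = 0 := hU.isotropic u hu u hu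
  -- Since gu = cu, the map Ad g - 1 sends u ∧ w to u ∧ f(w). Nilpotency of Ad g - 1 thus says that
  -- f is nilpotent modulo ℂu.
  let f : End ℂ E := c • (g.1 : End ℂ E) - 1
  have hfv : ∀ v, f v = c • g.1 v - v := fun v => rfl
  let φ : E → parabolic B V := fun w => ⟨wedge B u w, mem_parabolic_iff.2 (D.par_wedge_of_mem hU hu w)⟩
  let A : End ℂ (parabolic B V) := (Ad B V g : End ℂ (parabolic B V)) - 1
  have hA : ∀ w, A (φ w) = φ (f w) := fun w => by
    refine Subtype.ext (LinearMap.ext fun v => ?_)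
    change g.1 (wedge B u w (g.1.symm v)) - wedge B u w v = wedge B u (f w) v
    have h1 := g.2.1 u (g.1.symm v)
    have h2 := g.2.1 w (g.1.symm v)
    rw [g.1.apply_symm_apply] at h1 h2
    rw [wedge_apply, ← h1, ← h2, map_sub, map_smul, map_smul, hgu, hfv]
    simp only [wedge_apply, map_smul, LinearMap.smul_apply, LinearMap.sub_apply, map_sub,
      smul_eq_mul]
    module
  obtain ⟨k, hk⟩ := hg
  have hAk : ∀ j w, (A ^ j) (φ w) = φ ((f ^ j) w) := fun j w => by
    induction j with
    | zero => rfl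
    | succ j ih => rw [pow_succ', pow_succ', Module.End.mul_apply, Module.End.mul_apply, ih, hA]
  have hfk : ∀ w, (f ^ k) w ∈ Submodule.span ℂ {u} := fun w => by
    refine D.mem_span_of_wedge_eq_zero hu0 ?_
    have h1 : φ ((f ^ k) w) = 0 := by rw [← hAk]; exact LinearMap.congr_fun hk _
    exact congrArg Subtype.val h1
  have hc0 : c ≠ 0 := by
    rintro rfl
    rw [zero_smul] at hgu
    exact hu0 (g.1.map_eq_zero_iff.1 hgu)
  -- The last iterate of f lying outside ℂu gives w' in u^⊥ with f(w') in ℂu. For v in u^⊥ then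
  -- B(w', f v) = (c² - 1)B(w', v), and nilpotency of f modulo u forces c² = 1.
  have hcc : c * c = 1 := by
    obtain ⟨w, huw, hw⟩ := D.exists_orth_notMem hu0 hE
    have hperp : ∀ v, B u v = 0 → B u (g.1 v) = 0 := fun v hv => by
      have h1 := g.2.1 u v
      rw [hgu, LinearMap.map_smul₂, hv, smul_eq_mul] at h1
      exact (mul_eq_zero.1 h1).resolve_left hc0
    have hperp' : ∀ v, B u v = 0 → ∀ j, B u ((f ^ j) v) = 0 := fun v hv j => by
      induction j with
      | zero => exact hv
      | succ j ih =>
        rw [pow_succ', Module.End.mul_apply, hfv, map_sub, map_smul, hperp _ ih, ih, smul_zero,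
          sub_zero]
    have hex : ∃ j, (f ^ j) w ∈ Submodule.span ℂ {u} := ⟨k, hfk w⟩
    obtain ⟨w', huw', hw', hfw⟩ : ∃ w', B u w' = 0 ∧ w' ∉ Submodule.span ℂ {u} ∧
        f w' ∈ Submodule.span ℂ {u} := by
      classical
      obtain ⟨m, hm⟩ : ∃ m, Nat.find hex = m + 1 := Nat.exists_eq_succ_of_ne_zero fun h0 => hw (by
        have := Nat.find_spec hex
        rwa [h0] at this)
      refine ⟨(f ^ m) w, hperp' w huw m, Nat.find_min hex (by omega), ?_⟩
      have := Nat.find_spec hex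
      rwa [hm, pow_succ'] at this
    obtain ⟨v, huv, hwv⟩ := D.exists_orth_form_ne_zero hw'
    obtain ⟨b, hb⟩ := Submodule.mem_span_singleton.1 hfw
    have hβ : ∀ v, B u v = 0 → B w' (g.1 v) = c * B w' v := fun v hv => by
      have h1 : c • g.1 w' = w' + b • u := by rw [hb, hfv]; abel
      have h2 := congrArg (fun x => B x (g.1 v)) h1
      simp only [LinearMap.map_smul₂, LinearMap.map_add₂, g.2.1, hperp v hv, smul_eq_mul, mul_zero,
        add_zero] at h2
      exact h2.symm
    have hfo : ∀ j, B w' ((f ^ j) v) = (c * c - 1) ^ j * B w' v := by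
      intro j
      induction j with
      | zero => simp
      | succ j ih =>
        rw [pow_succ', Module.End.mul_apply, hfv, map_sub, map_smul, hβ _ (hperp' v huv j), ih,
          smul_eq_mul]
        ring
    obtain ⟨b', hb'⟩ := Submodule.mem_span_singleton.1 (hfk v)
    have h2 := hfo k
    rw [← hb', map_smul, D.symm, huw', smul_zero] at h2
    exact sub_eq_zero.1 (eq_zero_of_pow_eq_zero
      ((mul_eq_zero.1 h2.symm).resolve_right hwv))
  have hf : IsNilpotent f := by
    refine ⟨k + 1, LinearMap.ext fun w => ?_⟩
    obtain ⟨b, hb⟩ := Submodule.mem_span_singleton.1 (hfk w)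
    rw [pow_succ', Module.End.mul_apply, ← hb, map_smul, hfv, hgu, smul_smul, hcc, one_smul,
      sub_self, smul_zero, LinearMap.zero_apply]
  rcases mul_self_eq_one_iff.1 hcc with rfl | rfl
  · refine .inl ?_
    simpa [f] using hf
  · refine .inr ?_
    have : (g.1 : End ℂ E) + 1 = -f := by simp [f, add_comm]
    rw [this]
    exact hf.neg

/-- On a hyperbolic plane the parabolic subgroup acts trivially on the parabolic subalgebra. -/
theorem ad_eq_one (D : FlagDatum B V d) (hU : IsMinimalMember B V U) (hE : finrank ℂ E = 2)
    (g : parabolicGroup B V) : Ad B V g = 1 := by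
  have hgU : ∀ v ∈ U, g.1 v ∈ U := by
    obtain ⟨i, rfl⟩ := hU.exists_eq
    exact fun v hv => (g.2.2.2 i v).2 hv
  obtain ⟨u, hu, hu0, c, hc⟩ := hU.exists_eigenvector (f := (g.1 : End ℂ E)) hgU
  have hgu : g.1 u = c • u := hc
  have huu : B u u = 0 := hU.isotropic u hu u hu
  have hperp : ∀ v, B u v = 0 → v ∈ Submodule.span ℂ {u} := by
    have h1 := D.finrank_perp (Submodule.span ℂ {u})
    rw [finrank_span_singleton hu0, hE] at h1
    have h2 := Submodule.eq_of_le_of_finrank_eq (S₁ := Submodule.span ℂ {u})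
      (S₂ := B.orthogonal (Submodule.span ℂ {u})) ?_ (by rw [finrank_span_singleton hu0]; omega)
    · intro v hv
      rw [h2]
      intro w hw
      obtain ⟨b, rfl⟩ := Submodule.mem_span_singleton.1 hw
      rw [LinearMap.map_smul₂, hv, smul_zero]
    · rw [Submodule.span_singleton_le_iff_mem]
      intro w hw
      obtain ⟨b, rfl⟩ := Submodule.mem_span_singleton.1 hw
      rw [LinearMap.map_smul₂, huu, smul_zero]
  -- The vector u is an eigenvector of both x and g, so Ad g x - x is a skew map killing u. Its
  -- image lies in u^⊥ = ℂu, and so it is zero.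
  refine LinearEquiv.ext fun x => Subtype.ext (sub_eq_zero.1 ?_)
  have hx := mem_parabolic_iff.1 x.2
  have hx' := mem_parabolic_iff.1 (Ad B V g x).2
  have hs := hx'.1.sub hx.1
  obtain ⟨b, hb⟩ := Submodule.mem_span_singleton.1 (hperp (x.1 u) (by
    have := hx.1 u u
    rw [D.symm] at this
    linear_combination this / 2))
  have hc0 : c ≠ 0 := by
    rintro rfl
    rw [zero_smul] at hgu
    exact hu0 (g.1.map_eq_zero_iff.1 hgu)
  have hgs : g.1.symm u = c⁻¹ • u := by
    rw [g.1.symm_apply_eq, map_smul, hgu, smul_smul, inv_mul_cancel₀ hc0, one_smul]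
  have h0 : ((Ad B V g x).1 - x.1) u = 0 := by
    change g.1 (x.1 (g.1.symm u)) - x.1 u = 0
    rw [hgs, map_smul, map_smul, ← hb, map_smul, hgu, smul_comm, smul_smul, smul_smul,
      mul_assoc, inv_mul_cancel₀ hc0, mul_one, sub_self]
  obtain ⟨v, hv⟩ := D.exists_form_eq_one hu0
  have key := eq_zero_of_mem_span_of_orth (B := B) (d := (Ad B V g x).1 - x.1) (M := ⊤) (l := u)
    (fun t _ => hperp _ ?_) (fun t _ => ?_) (t₀ := v) trivial (by rw [hv]; exact one_ne_zero)
  · exact LinearMap.ext fun v => key v trivial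
  · rw [← neg_eq_zero, ← hs, h0, map_zero, LinearMap.zero_apply]
  · have := hs t t
    rw [D.symm] at this
    rw [D.symm]
    linear_combination this / 2

/-- An element of a normal unipotent subgroup of the image is unipotent up to sign on E, and so are
its commutators with the stabiliser. This is exactly what rigidity takes as input. In dimension 2
the adjoint action is trivial and there is nothing to prove. -/
theorem isReductiveType_of_rigidUnip (D : FlagDatum B V d) (hU : IsMinimalMember B V U)
    (hE : 2 ≤ finrank ℂ E) {γ : Dual ℂ (parabolic B V)} {y : End ℂ E}
    (hy : ∀ x : parabolic B V, γ x = LinearMap.trace ℂ E (y * x.1)) (h : RigidUnip B V y) :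
    IsReductiveType γ := by
  intro N hN hN' hu
  refine (Subgroup.eq_bot_iff_forall _).2 fun a ha => ?_
  obtain ⟨g, hg, rfl⟩ := hN ha
  rcases hE.eq_or_lt with hE | hE
  · exact ad_eq_one D hU hE.symm g
  have hgy := (mem_groupStabilizer_iff hy).1 hg
  have hcomm : ∀ h ∈ grpStab B V y, Unip h → SignUnip (g.1 * h * g.1⁻¹ * h⁻¹) := by
    intro h hh huh
    let h' : parabolicGroup B V := ⟨h, hh.1.1, huh.det_eq_one, hh.1.2⟩
    have hh' : h' ∈ groupStabilizer γ := (mem_groupStabilizer_iff hy).2 hh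
    refine signUnip_of_ad D hU hE (g := g * h' * g⁻¹ * h'⁻¹) (hu _ ?_)
    have h1 := mul_mem ha (hN' _ (Subgroup.mem_map_of_mem (Ad B V) hh') _ (inv_mem ha))
    simpa only [map_mul, map_inv, mul_assoc] using h1
  rcases signUnip_of_ad D hU hE (hu _ ha) with hgu | hgu
  · have : g = 1 := Subtype.ext (h g.1 hgy hgu hcomm)
    rw [this, map_one]
  -- If g is unipotent only up to sign, -g is unipotent, lies in the full isometry stabiliser, and
  -- has the same commutators as g; no determinant condition is needed there. Rigidity gives g = -1,
  -- which acts trivially.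
  · let s : E ≃ₗ[ℂ] E := g.1.trans (LinearEquiv.neg ℂ)
    have hsv : ∀ v, s v = -g.1 v := fun v => rfl
    have hss : ∀ v, s.symm v = -g.1.symm v := fun v => by
      rw [s.symm_apply_eq, hsv, map_neg, g.1.apply_symm_apply, neg_neg]
    have hs : s ∈ grpStab B V y := by
      refine ⟨⟨fun v w => ?_, fun i v => ?_⟩, fun z hz => ?_⟩
      · rw [hsv, hsv, LinearMap.map_neg₂, map_neg, neg_neg, hgy.1.1]
      · rw [hsv, neg_mem_iff, hgy.1.2]
      · rw [← hgy.2 z hz]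
        congr 2
        ext v
        rw [symm_conj_apply', symm_conj_apply', hsv, hss, map_neg, map_neg, neg_neg]
    have h1 := h s hs ?_ fun h' hh hu' => ?_
    · refine LinearEquiv.ext fun x => Subtype.ext (LinearMap.ext fun v => ?_)
      have h2 : ∀ v, g.1 v = -v := fun v => by rw [← neg_neg (g.1 v), ← hsv, h1]; rfl
      have h3 : g.1.symm v = -v := by rw [g.1.symm_apply_eq, h2, neg_neg]
      change g.1 (x.1 (g.1.symm v)) = x.1 v
      rw [h3, h2, map_neg, neg_neg]
    · have : (s : End ℂ E) - 1 = -((g.1 : End ℂ E) + 1) := by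
        ext v
        change -g.1 v - v = -(g.1 v + v)
        abel
      rw [Unip, this]
      exact hgu.neg
    · have : s * h' * s⁻¹ * h'⁻¹ = g.1 * h' * g.1⁻¹ * h'⁻¹ := by
        ext v
        change s (h' (s.symm (h'.symm v))) = g.1 (h' (g.1.symm (h'.symm v)))
        rw [hss, hsv, map_neg, map_neg, neg_neg]
      rw [this]
      exact hcomm h' hh hu'

/-- The centre of the parabolic subalgebra consists of semisimple endomorphisms. -/
theorem isSemisimple_of_mem_center (D : FlagDatum B V d) (hU : IsMinimalMember B V U)
    {z : parabolic B V} (hz : z ∈ LieAlgebra.center ℂ (parabolic B V)) :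
    (z : End ℂ E).IsSemisimple := by
  have hzP := mem_parabolic_iff.1 z.2
  have hzU : ∀ v ∈ U, z.1 v ∈ U := by
    obtain ⟨i, rfl⟩ := hU.exists_eq
    exact hzP.2 i
  obtain ⟨u, hu, hu0, c, hc⟩ := hU.exists_eigenvector hzU
  have huu : B u u = 0 := hU.isotropic u hu u hu
  -- [z, u ∧ w] = u ∧ (zw + cw) vanishes for central z, so z = -c modulo ℂu.
  have hspan : ∀ w, z.1 w + c • w ∈ Submodule.span ℂ {u} := fun w => by
    refine D.mem_span_of_wedge_eq_zero hu0 ?_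
    have h1 := hz ⟨_, mem_parabolic_iff.2 (D.par_wedge_of_mem hU hu w)⟩
    have h2 : wedge B u w * z.1 - z.1 * wedge B u w = 0 := congrArg Subtype.val h1
    rw [← neg_eq_zero, neg_sub, lie_wedge hzP.1, hc] at h2
    rw [← h2]
    ext v
    simp only [wedge_apply, LinearMap.add_apply, map_add, map_smul, LinearMap.smul_apply, smul_eq_mul]
    module
  by_cases hc0 : c = 0
  · obtain ⟨v, hv⟩ := D.exists_form_eq_one hu0
    have key := eq_zero_of_mem_span_of_orth (B := B) (d := z.1) (M := ⊤) (l := u)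
      (fun t _ => by simpa [hc0] using hspan t) (fun t _ => by
        have := hzP.1 t t
        rw [D.symm] at this
        rw [D.symm]
        linear_combination this / 2) (t₀ := v) trivial (by rw [hv]; exact one_ne_zero)
    have : z.1 = 0 := LinearMap.ext fun v => key v trivial
    rw [this]
    exact Module.End.isSemisimple_zero
  -- For c ≠ 0, the relation zu = cu together with z ≡ -c modulo u gives z² = c², a separable
  -- equation.
  · refine Module.End.isSemisimple_of_squarefree_aeval_eq_zero
      (p := Polynomial.X ^ 2 - Polynomial.C (c ^ 2)) ?_ ?_
    · exact (Polynomial.separable_X_pow_sub_C _ two_ne_zero (pow_ne_zero 2 hc0)).squarefree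
    · ext w
      obtain ⟨b, hb⟩ := Submodule.mem_span_singleton.1 (hspan w)
      have h1 : z.1 w = b • u - c • w := by rw [hb]; abel
      have h2 : z.1 (z.1 w) = (c * c) • w := by
        rw [h1, map_sub, map_smul, map_smul, hc, h1]
        module
      simp [pow_two, h2, mul_smul]

theorem mStarEq_of_target (D : FlagDatum B V d) {j : ι} (hj : d j ≠ 0) (hE : 2 ≤ finrank ℂ E)
    {M : Type*} [LieRing M] [LieAlgebra ℂ M] (h : Target B V M) : MStarEq B V M := by
  obtain ⟨U, hU⟩ := D.exists_isMinimalMember hj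
  obtain ⟨y, hy, hn, hr⟩ := h.2
  let γ : Dual ℂ (parabolic B V) :=
    (LinearMap.trace ℂ E ∘ₗ LinearMap.mulLeft ℂ y) ∘ₗ (parabolic B V).toSubmodule.subtype
  have hγ : ∀ x : parabolic B V, γ x = LinearMap.trace ℂ E (y * x.1) := fun x => rfl
  have hγr := isReductiveType_of_rigidUnip D hU hE hγ hr
  refine ⟨⟨⟨γ, hγr⟩, fun z hz => isSemisimple_of_mem_center D hU hz⟩,
    ⟨γ, hγr, (isNilpotentType_iff hγ).2 hn⟩, fun γ hr hn => ?_⟩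
  obtain ⟨y, hy, hγ⟩ := D.exists_skew_rep γ
  obtain ⟨e⟩ := nonempty_coadjointStabilizer_equiv hγ
  obtain ⟨f⟩ := h.1 y hy (orthReductive_of_isReductiveType D hU hγ hr)
    ((isNilpotentType_iff hγ).1 hn)
  exact ⟨e.trans f⟩

theorem Realizes.mStarEq {r n : ℕ} {a : Composition r} {V : Fin (a.length + 1) → Submodule ℂ E}
    {M : Type*} [LieRing M] [LieAlgebra ℂ M]
    (h : Realizes.{w} n (fun i : Fin (a.length + 1) => a.sizeUpTo i) M) (hB : B.Nondegenerate)
    (hB' : B.IsSymm) (hn : finrank ℂ E = n) (hr : 1 ≤ r) (hrn : r ≤ n / 2)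
    (hV : IsIsotropicFlag B a V) : MStarEq B V M := by
  have D : FlagDatum B V fun i => a.sizeUpTo i :=
    { symm := fun v w => hB'.eq v w
      nondeg := fun v hv => hB.1 v hv
      isotropic := hV.isotropic
      nested := fun i j => (le_total i j).imp (fun h => hV.mono h) fun h => hV.mono h
      finrank_eq := hV.finrank_eq }
  exact mStarEq_of_target D (j := Fin.last a.length) (by simp; omega) (by omega) (h E B V D hn)

end Transfer

end SoParabolic

/-! ### The five cases of the theorem -/

theorem theorem5p8 {E : Type*} [AddCommGroup E] [Module ℂ E] [FiniteDimensional ℂ E]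
    (B : LinearMap.BilinForm ℂ E) (hB : B.Nondegenerate) (hB' : B.IsSymm)
    (n : ℕ) (hn : Module.finrank ℂ E = n)
    (r : ℕ) (hr : 1 ≤ r) (hrn : r ≤ n / 2)
    (a : Composition r) (ha : SoParabolic.HasStar n a)
    (V : Fin (a.length + 1) → Submodule ℂ E) (hV : SoParabolic.IsIsotropicFlag B a V) :
    (Even r →
      SoParabolic.MStarEq B V
        (SoParabolic.rAlg a a.length × SoParabolic.soAlg (n - 2 * r))) ∧
    (Odd r → 2 * r < n →
      SoParabolic.MStarEq B V
        (SoParabolic.rAlg a (a.length - 1) ×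
          SoParabolic.spAlg (SoParabolic.part a a.length - 1) ×
          SoParabolic.soAlg (n - 2 * r - 1))) ∧
    (Odd r → 2 * r = n → SoParabolic.part a a.length = 1 →
      SoParabolic.MStarEq B V (SoParabolic.rAlg a (a.length - 1) × ℂ)) ∧
    (Odd r → 2 * r = n → 1 < SoParabolic.part a a.length →
      Odd (SoParabolic.part a a.length) →
      SoParabolic.MStarEq B V
        (SoParabolic.rAlg a (a.length - 1) ×
          SoParabolic.spAlg (SoParabolic.part a a.length - 3))) ∧
    (Odd r → 2 * r = n → Even (SoParabolic.part a a.length) →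
      SoParabolic.MStarEq B V
        (SoParabolic.rAlg a (a.length - 2) ×
          SoParabolic.spAlg (SoParabolic.part a (a.length - 1) - 1) ×
          SoParabolic.spAlg (SoParabolic.part a a.length - 2))) := by
  have key {M : Type} [LieRing M] [LieAlgebra ℂ M]
      (h : SoParabolic.Realizes n (fun i : Fin (a.length + 1) => a.sizeUpTo i) M) :
      SoParabolic.MStarEq B V M := h.mStarEq hB hB' hn hr hrn hV
  exact ⟨fun h => key (SoParabolic.realizes_even ha h),
    fun h h1 => key (SoParabolic.realizes_odd ha h h1),
    fun h h1 h2 => key (SoParabolic.realizes_lagrangian_one ha h h1 h2),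
    fun h h1 h2 h3 => key (SoParabolic.realizes_lagrangian_three_le ha h h1 h2 h3),
    fun h h1 h2 => key (SoParabolic.realizes_lagrangian_even ha h h1 h2)⟩
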